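/- Let $\mathbb N=\{0,1,2,\dots\}$, let $n,d\in\mathbb N$, let $u,v$ be independent indeterminates and $\mathbb A=\mathbb Z[u^{\pm1},v^{\pm1}]$, and let $\overline{\phantom{x}}$ be the involution of $\mathbb A$ (and of its fraction field) with $u\mapsto u^{-1}$, $v\mapsto v^{-1}$. **Hecke algebra.** Let $W$ be the group of permutations $g$ of $[-d,d]=\{-d,\dots,d\}$ with $g(-i)=-g(i)$, with simple reflections $s_0=(-1,1)$ and $s_i=(i,i+1)(-i,-i-1)$ for $1\le i<d$, and let $\ell$ be its length function. Let $\mathbb H$ be the Hecke algebra over $\mathbb A$ with basis $\{T_w\mid w\in W\}$, where $T_wT_{w'}=T_{ww'}$ if $\ell(ww')=\ell(w)+\ell(w')$, $(T_{s_0}+1)(T_{s_0}-u^2)=0$, and $(T_{s_i}+1)(T_{s_i}-v^2)=0$ for $1\le i<d$. For $X\subset W$ put $T_X=\sum_{w\in X}T_w$. **Schur algebra.** Let $\Lambda_{n,d}$ be the set of vectors $\lambda=(\lambda_n,\dots,\lambda_1,2\lambda_0+1,\lambda_1,\dots,\lambda_n)$ with $\lambda_i\in\mathbb N$ and $\sum_{i=0}^n\lambda_i=d$.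 For $\lambda\in\Lambda_{n,d}$ let $R^\lambda_0=[-\lambda_0,\lambda_0]$, $R^\lambda_i=[\lambda_0+\sum_{1\le j<i}\lambda_j+1,\ \lambda_0+\sum_{1\le j\le i}\lambda_j]$ and $R^\lambda_{-i}=-R^\lambda_i$ for $1\le i\le n$ (intervals of integers). Let $W_\lambda\subset W$ be the common stabilizer of the sets $R_i^\lambda$, let $x_\lambda=T_{W_\lambda}$, let $\mathcal D_\lambda=\{g\in W\mid \ell(wg)=\ell(w)+\ell(g)\ \forall w\in W_\lambda\}$, and let $\mathcal D_{\lambda\mu}=\mathcal D_\lambda\cap\mathcal D_\mu^{-1}$. The Schur algebra is $$\mathbb S^{\jmath}_{n,d}=\mathrm{End}_{\mathbb H}\Big(\bigoplus_{\lambda\in\Lambda_{n,d}}x_\lambda\mathbb H\Big)$$ (endomorphisms of right $\mathbb H$-modules). Let $\Xi_{n,d}$ be the set of matrices $A=(a_{ij})_{-n\le i,j\le n}$ with entries in $\mathbb N$ such that $\sum_{i,j}a_{ij}=2d+1$, $a_{00}$ is odd, and $a_{ij}=a_{-i,-j}$ for all $i,j$. Let $\mathrm{ro}(A),\mathrm{co}(A)\in\Lambda_{n,d}$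 be its vectors of row sums and column sums. The map $(\lambda,g,\mu)\mapsto\kappa(\lambda,g,\mu)=(|R^\lambda_i\cap gR^\mu_j|)_{ij}$, where $\lambda,\mu\in\Lambda_{n,d}$ and $g\in\mathcal D_{\lambda\mu}$, is a bijection onto $\Xi_{n,d}$, and $\lambda=\mathrm{ro}(A)$, $\mu=\mathrm{co}(A)$ if $A=\kappa(\lambda,g,\mu)$. For such $A$ let $e_A\in\mathbb S^\jmath_{n,d}$ be the element that is zero on $x_\nu\mathbb H$ for $\nu\ne\mu$ and on $x_\mu\mathbb H$ is the right $\mathbb H$-linear map to $x_\lambda\mathbb H$ with $x_\mu\mapsto T_{W_\lambda gW_\mu}$. **Standard basis.** Put $a^\natural_{00}=\frac12(a_{00}-1)$ and $a^\natural_{ij}=a_{ij}$ for $(i,j)\neq(0,0)$, let $I_{\mathfrak c}=\{(0,0)\}\sqcup(\{0\}\times[1,n])\sqcup([1,n]\times[-n,n])$, and define $$\hat\ell(A)=\tfrac12\sum_{(i,j)\in I_{\mathfrak c}}\Big(\sum_{x\le i,\,y>j}+\sum_{x\ge i,\,y<j}\Big)a^\natural_{ij}a_{xy},\qquad \hat\ell_{\mathfrak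 c}(A)=\tfrac12\Big(\sum_{x\ge0,\,y<0}+\sum_{x\le0,\,y>0}\Big)a_{xy},\qquad \hat\ell_{\mathfrak a}(A)=\hat\ell(A)-\hat\ell_{\mathfrak c}(A),$$ $$[A]=u^{-\hat\ell_{\mathfrak c}(A)}v^{-\hat\ell_{\mathfrak a}(A)}e_A .$$ **Quantum numbers.** For $a\in\mathbb Z$ and $b,t\in\mathbb N$ let $$[a]=\frac{v^{2a}-1}{v^2-1},\quad [t]!=\prod_{k=1}^t[k],\quad [2t]_{\mathfrak c}=[t]\,(u^2v^{2(t-1)}+1),\quad [t]^!_{\mathfrak c}=\prod_{k=1}^t[2k]_{\mathfrak c},\quad \begin{bmatrix}a\\b\end{bmatrix}=\prod_{i=1}^b\frac{v^{2(a-i+1)}-1}{v^{2i}-1}.$$ Let $E_{ij}$ be the matrix units, $E^\theta_{ij}=E_{ij}+E_{-i,-j}$, and let $\delta_{h,1}$ be the Kronecker delta. For $t=(t_i)_{-n\le i\le n}\in\mathbb N^{2n+1}$ put $$\check A_{t,h}=A+\sum_{l=-n}^nt_lE^\theta_{h,l}-\sum_{l=-n}^nt_lE^\theta_{h-1,l},\qquad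 \hat A_{t,h}=A-\sum_{l=-n}^nt_lE^\theta_{h,l}+\sum_{l=-n}^nt_lE^\theta_{h-1,l}.$$ **Theorem.** Let $A,B,C\in\Xi_{n,d}$, $h\in[1,n]$ and $b,c\in\mathbb N$. Below, $k$ and $l$ range over $[-n,n]$ unless stated otherwise. All matrices $\check A_{t,h}$, $\hat A_{t,h}$ that occur lie in $\Xi_{n,d}$, and all coefficients that occur lie in $\mathbb A$. (1) If $B-bE^\theta_{h,h-1}$ is diagonal and $\mathrm{co}(B)=\mathrm{ro}(A)$, then $$[B][A]=\sum_t u^{-\delta_{h,1}\sum_{l>0}t_l}\,v^{\beta(t)}\prod_{l=-n}^n\overline{\begin{bmatrix}a_{h,l}+t_l\\t_l\end{bmatrix}}\;[\check A_{t,h}],$$ where the sum is over all $t\in\mathbb N^{2n+1}$ with $\sum_it_i=b$ such that, for all $i$, $t_i\le a_{h-1,i}$ if $h>1$, and $t_i+t_{-i}\le a_{0,i}$ if $h=1$; and $$\beta(t)=\sum_{k\le l}t_la_{h,k}-\sum_{k<l}t_l(a_{h-1,k}-t_k)+\delta_{h,1}\Big(\sum_{-l<k<l}t_lt_k+\sum_{l>0}\frac{t_l(t_l+3)}2\Big).$$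 (2) Suppose $C-cE^\theta_{h-1,h}$ is diagonal and $\mathrm{co}(C)=\mathrm{ro}(A)$. The sums below are over all $t\in\mathbb N^{2n+1}$ with $\sum_it_i=c$ and $t_i\le a_{h,i}$ for all $i$. If $h\neq1$, then $$[C][A]=\sum_t v^{\beta'(t)}\prod_{l=-n}^n\overline{\begin{bmatrix}a_{h-1,l}+t_l\\t_l\end{bmatrix}}\;[\hat A_{t,h}],\qquad \beta'(t)=\sum_{k\ge l}t_la_{h-1,k}-\sum_{k>l}t_l(a_{h,k}-t_k).$$ If $h=1$, then $$[C][A]=\sum_t u^{\sum_{l\le0}t_l}\,v^{\beta''(t)}\;\overline{\left(\frac{[a^\natural_{00}+t_0]^!_{\mathfrak c}}{[a^\natural_{00}]^!_{\mathfrak c}\,[t_0]!}\prod_{l=1}^n\frac{[a_{0,l}+t_l+t_{-l}]!}{[a_{0,l}]!\,[t_l]!\,[t_{-l}]!}\right)}\;[\hat A_{t,1}],$$ $$\beta''(t)=\sum_{k\ge l}t_la_{0,k}-\sum_{k>l}t_l(a_{1,k}-t_k)+\sum_{l<k\le-l}t_lt_k+\sum_{l\le0}\frac{t_l(t_l-3)}2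 .$$ -/

import Mathlib

namespace SchurBC

/-! ### The Weyl group of type B/C -/

/-- The Weyl group of type B/C: permutations `g` of `[-d,d]` with `g (-i) = -g i`
(a permutation of `[-d,d]` is extended to `ℤ` by the identity). -/
def W (d : ℕ) : Subgroup (Equiv.Perm ℤ) where
  carrier := {g | (∀ i, g (-i) = -g i) ∧ ∀ i : ℤ, (d : ℤ) < |i| → g i = i}
  mul_mem' := by
    rintro a b ⟨ha, ha'⟩ ⟨hb, hb'⟩
    refine ⟨fun i => by simp [ha, hb], fun i hi => ?_⟩
    simp [hb' i hi, ha' i hi]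
  one_mem' := by simp
  inv_mem' := by
    rintro a ⟨ha, ha'⟩
    refine ⟨fun i => ?_, fun i hi => ?_⟩
    · rw [Equiv.Perm.inv_eq_iff_eq, ha]; simp
    · rw [Equiv.Perm.inv_eq_iff_eq, ha' i hi]

/-- `s₀ = (-1, 1)` and `sᵢ = (i, i+1)(-i, -i-1)` for `i ≥ 1`. -/
def sPerm (i : ℤ) : Equiv.Perm ℤ :=
  if i = 0 then Equiv.swap (-1) 1 else Equiv.swap i (i + 1) * Equiv.swap (-i) (-i - 1)

theorem sPerm_zero (p : ℤ) : sPerm 0 p = if p = 1 then -1 else if p = -1 then 1 else p := by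
  simp only [sPerm, if_true, Equiv.swap_apply_def]
  split_ifs <;> omega

theorem sPerm_pos {i : ℤ} (hi : 0 < i) (p : ℤ) :
    sPerm i p = if p = i then i + 1 else if p = i + 1 then i else
      if p = -i then -i - 1 else if p = -i - 1 then -i else p := by
  simp only [sPerm, if_neg hi.ne', Equiv.Perm.mul_apply, Equiv.swap_apply_def]
  split_ifs <;> omega

/-- The simple reflections `s₀, …, s_{d-1}`. -/
def s {d : ℕ} (i : Fin d) : W d :=
  ⟨sPerm (i : ℕ), by
    obtain ⟨i, hi⟩ := i
    rcases Nat.eq_zero_or_pos i with rfl | h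
    · refine ⟨fun p => ?_, fun p hp => ?_⟩ <;> simp only [Nat.cast_zero, sPerm_zero]
      · split_ifs <;> omega
      · rw [lt_abs] at hp
        split_ifs <;> omega
    · have h' : (0 : ℤ) < (i : ℤ) := by omega
      refine ⟨fun p => ?_, fun p hp => ?_⟩ <;> simp only [sPerm_pos h']
      · split_ifs <;> omega
      · rw [lt_abs] at hp
        split_ifs <;> omega⟩

theorem s_zero {d : ℕ} {i : Fin d} (h : (i : ℕ) = 0) (p : ℤ) :
    (s i).1 p = if p = 1 then -1 else if p = -1 then 1 else p := by
  simp only [s, h, Nat.cast_zero, sPerm_zero]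

theorem s_pos {d : ℕ} {i : Fin d} (h : 0 < (i : ℕ)) (p : ℤ) :
    (s i).1 p = if p = (i : ℕ) then ((i : ℕ) : ℤ) + 1 else if p = (i : ℕ) + 1 then ((i : ℕ) : ℤ) else
      if p = -((i : ℕ) : ℤ) then -((i : ℕ) : ℤ) - 1 else
        if p = -((i : ℕ) : ℤ) - 1 then -((i : ℕ) : ℤ) else p :=
  sPerm_pos (by omega) p

theorem s_mul_s {d : ℕ} (i : Fin d) : s i * s i = 1 := by
  apply Subtype.ext
  apply Equiv.ext
  intro p
  change (s i).1 ((s i).1 p) = p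
  rcases Nat.eq_zero_or_pos (i : ℕ) with h | h
  · rw [s_zero h p]
    split_ifs with h1 h2
    · rw [s_zero h]; simp [h1]
    · rw [s_zero h]; simp [h2]
    · rw [s_zero h, if_neg h1, if_neg h2]
  · simp only [s_pos h]; split_ifs <;> omega

theorem s_mul_cancel {d : ℕ} (i : Fin d) (w : W d) : s i * (s i * w) = w := by
  rw [← mul_assoc, s_mul_s, one_mul]

theorem mul_s_cancel {d : ℕ} (i : Fin d) (w : W d) : w * s i * s i = w := by
  rw [mul_assoc, s_mul_s, mul_one]

theorem s_inv {d : ℕ} (i : Fin d) : (s i)⁻¹ = s i := inv_eq_of_mul_eq_one_left (s_mul_s i)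

theorem W_neg {d : ℕ} (w : W d) (p : ℤ) : w.1 (-p) = -w.1 p := w.2.1 p

theorem W_zero {d : ℕ} (w : W d) : w.1 0 = 0 := by
  have := W_neg w 0
  simp only [neg_zero] at this
  omega

theorem W_ext {d : ℕ} {w w' : W d} (h : ∀ p, w.1 p = w'.1 p) : w = w' :=
  Subtype.ext (Equiv.ext h)

theorem W_abs {d : ℕ} (w : W d) {p : ℤ} (hp : |p| ≤ d) : |w.1 p| ≤ d := by
  by_contra h
  rw [not_le] at h
  have := w.1.injective (w.2.2 _ h)
  rw [this] at h
  omega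

instance {d : ℕ} : Finite (W d) := by
  let f : W d → (Set.Icc (-(d : ℤ)) d → Set.Icc (-(d : ℤ)) d) := fun w p =>
    ⟨w.1 p.1, Set.mem_Icc.2 (abs_le.1 (W_abs w (abs_le.2 (Set.mem_Icc.1 p.2))))⟩
  refine Finite.of_injective f fun w w' h => W_ext fun p => ?_
  by_cases hp : |p| ≤ d
  · have := congrFun h ⟨p, Set.mem_Icc.2 (abs_le.1 hp)⟩
    exact congrArg Subtype.val this
  · rw [not_le] at hp
    rw [w.2.2 p hp, w'.2.2 p hp]

noncomputable instance {d : ℕ} : Fintype (W d) := Fintype.ofFinite _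

/-- The Coxeter length: the least length of a word in the simple reflections. -/
noncomputable def len {d : ℕ} (w : W d) : ℕ :=
  sInf {k | ∃ ω : List (Fin d), ω.length = k ∧ (ω.map s).prod = w}

/-! ### Ascents -/

/-- `w` has a (right) ascent at `i`. -/
def asc {d : ℕ} (w : W d) (i : Fin d) : Prop := w.1 ((i : ℕ) : ℤ) < w.1 ((i : ℕ) + 1)

theorem asc_mul_s {d : ℕ} (w : W d) (j : Fin d) : asc (w * s j) j ↔ ¬ asc w j := by
  have e : ∀ p, (w * s j).1 p = w.1 ((s j).1 p) := fun _ => rfl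
  simp only [asc, e]
  rcases Nat.eq_zero_or_pos (j : ℕ) with h | h
  · simp only [s_zero h, h]
    have h1 : w.1 1 ≠ 0 := fun h => by
      have := w.1.injective (h.trans (W_zero w).symm); omega
    simp [W_zero, W_neg]
    omega
  · simp only [s_pos h]
    have h1 : w.1 ((j : ℕ) : ℤ) ≠ w.1 ((j : ℕ) + 1) := fun h => by
      have := w.1.injective h; omega
    simp
    omega

theorem key {d : ℕ} (w : W d) (i j : Fin d) (h : s i * w ≠ w * s j) (ha : asc w j) :
    asc (s i * w) j := by
  by_contra hb
  apply h
  have e : ∀ p, (s i * w).1 p = (s i).1 (w.1 p) := fun _ => rfl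
  simp only [asc, e] at ha hb
  apply W_ext
  intro p
  change (s i).1 (w.1 p) = w.1 ((s j).1 p)
  have inj : ∀ a b, w.1 a = w.1 b → a = b := fun a b h => w.1.injective h
  have h0 := W_zero w
  rcases Nat.eq_zero_or_pos (i : ℕ) with hi | hi <;> rcases Nat.eq_zero_or_pos (j : ℕ) with hj | hj
  · simp only [s_zero hi, s_zero hj, hj, Nat.cast_zero, zero_add, h0] at ha hb ⊢
    have h1 : w.1 1 = 1 := by split_ifs at hb <;> omega
    have h2 : w.1 (-1) = -1 := by rw [W_neg, h1]
    have h3 := inj p 1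
    have h4 := inj p (-1)
    split_ifs <;> simp_all
  · exfalso
    simp only [s_zero hi] at ha hb
    have h1 := inj (j : ℕ) 0
    have h2 := inj ((j : ℕ) + 1) 0
    have h3 := inj ((j : ℕ) + 1) (-(j : ℕ))
    rw [W_neg] at h3
    split_ifs at hb <;> omega
  · exfalso
    simp only [s_pos hi, hj, Nat.cast_zero, zero_add, h0] at ha hb
    split_ifs at hb <;> omega
  · simp only [s_pos hi, s_pos hj] at ha hb ⊢
    have h1 := inj p (j : ℕ)
    have h2 := inj p ((j : ℕ) + 1)
    have h3 := inj p (-((j : ℕ) : ℤ))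
    have h4 := inj p (-((j : ℕ) : ℤ) - 1)
    have n1 := W_neg w (j : ℕ)
    have n2 := W_neg w ((j : ℕ) + 1)
    rw [show -(((j : ℕ) : ℤ) + 1) = -((j : ℕ) : ℤ) - 1 by ring] at n2
    have hc : (w.1 ((j : ℕ) : ℤ) = (i : ℕ) ∧ w.1 ((j : ℕ) + 1) = (i : ℕ) + 1) ∨
        (w.1 ((j : ℕ) : ℤ) = -((i : ℕ) : ℤ) - 1 ∧ w.1 ((j : ℕ) + 1) = -((i : ℕ) : ℤ)) := by
      clear h1 h2 h3 h4
      split_ifs at hb <;> omega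
    by_cases p1 : p = (j : ℕ)
    · subst p1; simp only [if_true]; split_ifs <;> omega
    by_cases p2 : p = (j : ℕ) + 1
    · subst p2; rw [if_neg (by omega), if_pos rfl] ; split_ifs <;> omega
    by_cases p3 : p = -((j : ℕ) : ℤ)
    · subst p3; simp only [if_true]; split_ifs <;> omega
    by_cases p4 : p = -((j : ℕ) : ℤ) - 1
    · subst p4; simp only [if_true]; split_ifs <;> omega
    simp only [p1, p2, p3, p4, if_false]
    split_ifs <;> omega

theorem asc_s_mul {d : ℕ} (w : W d) (i j : Fin d) (h : s i * w ≠ w * s j) :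
    asc (s i * w) j ↔ asc w j := by
  refine ⟨fun ha => ?_, key w i j h⟩
  have := key (s i * w) i j (fun h' => h ?_) ha
  · rwa [s_mul_cancel] at this
  · rw [s_mul_cancel] at h'
    rw [h', mul_s_cancel, ← h']

theorem asc_inv {d : ℕ} (w : W d) (i j : Fin d) (h : s i * w = w * s j) :
    (asc w⁻¹ i ↔ asc w j) ∧ ((i : ℕ) = 0 ↔ (j : ℕ) = 0) := by
  have e : ∀ p, (s i).1 (w.1 p) = w.1 ((s j).1 p) := fun p => congrArg (fun g : W d => g.1 p) h
  have inj : ∀ a b, w.1 a = w.1 b → a = b := fun a b h => w.1.injective h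
  have iv : ∀ a b, w.1 a = b → (w⁻¹).1 b = a := by
    rintro a b rfl
    exact w.1.symm_apply_apply a
  have h0 := W_zero w
  simp only [asc]
  rcases Nat.eq_zero_or_pos (i : ℕ) with hi | hi <;> rcases Nat.eq_zero_or_pos (j : ℕ) with hj | hj
  · have e1 := e 1
    rw [s_zero hi, s_zero hj, if_pos rfl, W_neg] at e1
    simp only [hi, hj, Nat.cast_zero, zero_add, h0, W_zero, and_true]
    have h1 : w.1 1 ≠ 0 := fun h => by have := inj _ _ (h.trans h0.symm); omega
    have : w.1 1 = 1 ∨ w.1 1 = -1 := by split_ifs at e1 <;> omega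
    rcases this with h1 | h1
    · rw [h1, iv _ _ h1]
    · have := W_neg w⁻¹ (-1)
      rw [iv _ _ h1, neg_neg] at this
      rw [h1, this]
  · exfalso
    have e1 := e (j : ℕ)
    rw [s_zero hi, s_pos hj, if_pos rfl] at e1
    have h1 := inj (j : ℕ) ((j : ℕ) + 1)
    have h3 := inj ((j : ℕ) + 1) (-(j : ℕ))
    rw [W_neg] at h3
    split_ifs at e1 <;> omega
  · exfalso
    have e1 := e 1
    have h1 := inj 1 0
    rw [s_pos hi, s_zero hj, if_pos rfl, W_neg] at e1
    split_ifs at e1 <;> omega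
  · have e1 := e (j : ℕ)
    rw [s_pos hi, s_pos hj, if_pos rfl] at e1
    have h1 := inj (j : ℕ) ((j : ℕ) + 1)
    refine ⟨?_, by omega⟩
    have m1 := W_neg w⁻¹ (-((i : ℕ) : ℤ))
    have m2 := W_neg w⁻¹ (-((i : ℕ) : ℤ) - 1)
    rw [neg_neg] at m1
    rw [show -(-((i : ℕ) : ℤ) - 1) = (i : ℕ) + 1 by ring] at m2
    split_ifs at e1 with c1 c2 c3 c4
    · rw [iv _ _ c1, iv _ _ e1.symm]; omega
    · rw [iv _ _ c2, iv _ _ e1.symm]; omega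
    · have f1 := iv _ _ c3
      have f2 := iv _ _ e1.symm
      omega
    · have f1 := iv _ _ c4
      have f2 := iv _ _ e1.symm
      omega
    · omega

theorem eq_one_of_asc {d : ℕ} (w : W d) (h : ∀ j, asc w j) : w = 1 := by
  have lo : ∀ k : ℕ, k ≤ d → (k : ℤ) ≤ w.1 k := by
    intro k
    induction k with
    | zero => intro _; simp [W_zero]
    | succ k ih =>
      intro hk
      have := h ⟨k, by omega⟩
      simp only [asc] at this
      have := ih (by omega)
      push_cast
      omega
  have hi : ∀ m : ℕ, m ≤ d → w.1 ((d : ℤ) - m) ≤ (d : ℤ) - m := by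
    intro m
    induction m with
    | zero =>
      intro _
      have := W_abs w (p := d) (by simp)
      have := abs_le.1 this
      simp only [Nat.cast_zero, sub_zero]
      omega
    | succ m ih =>
      intro hm
      have h1 := h ⟨d - (m + 1), by omega⟩
      simp only [asc] at h1
      have h2 : ((d - (m + 1) : ℕ) : ℤ) = (d : ℤ) - (m + 1 : ℕ) := by omega
      rw [h2] at h1
      rw [show (d : ℤ) - (m + 1 : ℕ) + 1 = d - m by push_cast; ring] at h1
      have := ih (by omega)
      push_cast at h1 ⊢
      omega
  have pos : ∀ p : ℤ, 0 ≤ p → w.1 p = p := by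
    intro p hp
    by_cases hd : p ≤ d
    · have h1 := lo p.toNat (by omega)
      have h2 := hi (d - p.toNat) (by omega)
      rw [show ((d : ℤ) - (d - p.toNat : ℕ)) = p by omega] at h2
      rw [show ((p.toNat : ℕ) : ℤ) = p by omega] at h1
      omega
    · exact w.2.2 p (by rw [abs_of_nonneg hp]; omega)
  apply W_ext
  intro p
  change w.1 p = p
  rcases le_total 0 p with hp | hp
  · exact pos p hp
  · have := pos (-p) (by omega)
    rw [W_neg] at this
    omega

/-- An auxiliary statistic that increases when a descent is removed. -/
noncomputable def stat {d : ℕ} (w : W d) : ℤ := ∑ p ∈ Finset.Icc (1 : ℤ) d, p * w.1 p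

theorem stat_lt {d : ℕ} (w : W d) (j : Fin d) (h : ¬ asc w j) : stat w < stat (w * s j) := by
  have hjd := j.2
  have e : ∀ p, (w * s j).1 p = w.1 ((s j).1 p) := fun _ => rfl
  rw [← sub_pos, stat, stat, ← Finset.sum_sub_distrib]
  simp only [e]
  rw [asc, not_lt] at h
  rcases Nat.eq_zero_or_pos (j : ℕ) with hj | hj
  · rw [← Finset.sum_subset (s₁ := {1})]
    · simp only [hj, Nat.cast_zero, zero_add, W_zero] at h
      have h1 : w.1 1 ≠ 0 := fun h => by
        have := w.1.injective (h.trans (W_zero w).symm); omega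
      simp [s_zero hj, W_neg]
      omega
    · intro p hp
      simp at hp ⊢
      omega
    · intro p hp hp'
      simp at hp hp'
      rw [s_zero hj, if_neg hp', if_neg (by omega)]
      ring
  · have h1 : w.1 ((j : ℕ) : ℤ) ≠ w.1 ((j : ℕ) + 1) := fun h => by
      have := w.1.injective h; omega
    rw [← Finset.sum_subset (s₁ := {((j : ℕ) : ℤ), ((j : ℕ) : ℤ) + 1})]
    · rw [Finset.sum_pair (by omega)]
      simp only [s_pos hj, if_true]
      rw [if_neg (by omega)]
      nlinarith [lt_of_le_of_ne h h1.symm]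
    · intro p hp
      simp at hp ⊢
      omega
    · intro p hp hp'
      simp at hp hp'
      rw [s_pos hj, if_neg hp'.1, if_neg hp'.2, if_neg (by omega), if_neg (by omega)]
      ring

theorem exists_word {d : ℕ} (w : W d) : ∃ ω : List (Fin d), (ω.map s).prod = w := by
  by_contra hw
  obtain ⟨w', hw', hmax⟩ := Set.exists_max_image {w : W d | ¬ ∃ ω : List (Fin d), (ω.map s).prod = w}
    stat (Set.toFinite _) ⟨w, hw⟩
  by_cases h : ∀ j, asc w' j
  · exact hw' ⟨[], by simp [eq_one_of_asc w' h]⟩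
  · push Not at h
    obtain ⟨j, hj⟩ := h
    by_cases h2 : ∃ ω : List (Fin d), (ω.map s).prod = w' * s j
    · obtain ⟨ω, hω⟩ := h2
      exact hw' ⟨ω ++ [j], by simp [hω, mul_assoc, s_mul_s]⟩
    · have := hmax _ h2
      have := stat_lt w' j hj
      omega

theorem exists_reduced {d : ℕ} (w : W d) :
    ∃ ω : List (Fin d), ω.length = len w ∧ (ω.map s).prod = w := by
  obtain ⟨ω, hω⟩ := exists_word w
  exact Nat.sInf_mem (s := {k | ∃ ω : List (Fin d), ω.length = k ∧ (ω.map s).prod = w})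
    ⟨ω.length, ω, rfl, hω⟩

theorem len_le {d : ℕ} (ω : List (Fin d)) : len (ω.map s).prod ≤ ω.length :=
  Nat.sInf_le ⟨ω, rfl, rfl⟩

theorem len_one {d : ℕ} : len (1 : W d) = 0 := by simpa using len_le ([] : List (Fin d))

theorem len_eq_zero {d : ℕ} {w : W d} (h : len w = 0) : w = 1 := by
  obtain ⟨ω, h1, h2⟩ := exists_reduced w
  rw [h, List.length_eq_zero_iff] at h1
  simpa [h1] using h2.symm

theorem len_mul_le {d : ℕ} (w w' : W d) : len (w * w') ≤ len w + len w' := by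
  obtain ⟨ω, h1, h2⟩ := exists_reduced w
  obtain ⟨ω', h1', h2'⟩ := exists_reduced w'
  have := len_le (ω ++ ω')
  simpa [h1, h2, h1', h2'] using this

theorem len_s {d : ℕ} (i : Fin d) : len (s i) ≤ 1 := by simpa using len_le [i]

theorem inv_prod {d : ℕ} (ω : List (Fin d)) : (ω.reverse.map s).prod = ((ω.map s).prod)⁻¹ := by
  induction ω with
  | nil => simp
  | cons i ω ih =>
    rw [List.reverse_cons, List.map_append, List.prod_append, ih]
    simp [s_inv]

theorem len_inv {d : ℕ} (w : W d) : len w⁻¹ = len w := by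
  have : ∀ w : W d, len w⁻¹ ≤ len w := by
    intro w
    obtain ⟨ω, h1, h2⟩ := exists_reduced w
    have := len_le ω.reverse
    rwa [inv_prod, h2, List.length_reverse, h1] at this
  refine le_antisymm (this w) ?_
  simpa using this w⁻¹

theorem exchange {d : ℕ} (j : Fin d) (ω : List (Fin d)) (h : ¬ asc (ω.map s).prod j) :
    ∃ ω' : List (Fin d), ω'.length + 1 = ω.length ∧ (ω'.map s).prod = (ω.map s).prod * s j := by
  induction ω with
  | nil => exact absurd (by simp [asc]) h
  | cons i ω ih =>
    by_cases h1 : asc (ω.map s).prod j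
    · by_cases h2 : s i * (ω.map s).prod = (ω.map s).prod * s j
      · exact ⟨ω, rfl, by simp only [List.map_cons, List.prod_cons]; rw [h2, mul_s_cancel]⟩
      · exact absurd (by simpa using key _ i j h2 h1) h
    · obtain ⟨ω', e1, e2⟩ := ih h1
      exact ⟨i :: ω', by simp [e1], by simp [e2, mul_assoc]⟩

theorem len_of_not_asc {d : ℕ} (w : W d) (j : Fin d) (h : ¬ asc w j) :
    len (w * s j) + 1 = len w := by
  obtain ⟨ω, h1, h2⟩ := exists_reduced w
  obtain ⟨ω', e1, e2⟩ := exchange j ω (by rwa [h2])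
  have a := len_le ω'
  rw [e2, h2] at a
  have b := len_mul_le (w * s j) (s j)
  rw [mul_s_cancel] at b
  have := len_s j
  omega

theorem len_of_asc {d : ℕ} (w : W d) (j : Fin d) (h : asc w j) : len (w * s j) = len w + 1 := by
  have := len_of_not_asc (w * s j) j (by rwa [asc_mul_s, not_not])
  rw [mul_s_cancel] at this
  omega

theorem len_left {d : ℕ} (w : W d) (i : Fin d) : len (s i * w) = len (w⁻¹ * s i) := by
  rw [← len_inv, mul_inv_rev, s_inv]

theorem exists_not_asc {d : ℕ} (w : W d) (h : w ≠ 1) : ∃ j, ¬ asc w j := by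
  by_contra h'
  push Not at h'
  exact h (eq_one_of_asc w h')

/-! ### The ground ring -/

/-- The ground ring `𝔸 = ℤ[u^{±1}, v^{±1}]`: Laurent polynomials, with exponents in `ℤ × ℤ`. -/
def Laur : Type := AddMonoidAlgebra ℤ (ℤ × ℤ)

noncomputable instance : CommRing Laur := inferInstanceAs (CommRing (AddMonoidAlgebra ℤ (ℤ × ℤ)))

instance : IsDomain Laur := inferInstanceAs (IsDomain (AddMonoidAlgebra ℤ (ℤ × ℤ)))

/-- The monomial `u ^ a * v ^ b` of `𝔸`. -/
noncomputable def uv (a b : ℤ) : Laur :=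
  (AddMonoidAlgebra.single (a, b) 1 : AddMonoidAlgebra ℤ (ℤ × ℤ))

theorem uv_mul (a b a' b' : ℤ) : uv a b * uv a' b' = uv (a + a') (b + b') := by
  refine (AddMonoidAlgebra.single_mul_single (R := ℤ) (a, b) (a', b') 1 1).trans ?_
  simp [uv]

theorem uv_zero : uv 0 0 = 1 := rfl

/-! ### The Hecke algebra -/

/-- The parameters: `u²` for `s₀` and `v²` for the other simple reflections. -/
noncomputable def qpar {d : ℕ} (i : Fin d) : Laur := if (i : ℕ) = 0 then uv 2 0 else uv 0 2

/-- The free `𝔸`-module with basis `W`. -/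
def FreeW (d : ℕ) : Type := W d →₀ Laur

noncomputable instance (d : ℕ) : AddCommGroup (FreeW d) := inferInstanceAs (AddCommGroup (W d →₀ Laur))

noncomputable instance (d : ℕ) : Module Laur (FreeW d) := inferInstanceAs (Module Laur (W d →₀ Laur))

/-- The basis of `FreeW d` indexed by `W`. -/
noncomputable def freeB (d : ℕ) : Module.Basis (W d) Laur (FreeW d) :=
  Module.Basis.ofRepr (LinearEquiv.refl Laur (W d →₀ Laur))

open Classical in
/-- Left multiplication by `T_{sᵢ}` on the free module with basis `W`. -/
noncomputable def Lop {d : ℕ} (i : Fin d) : Module.End Laur (FreeW d) :=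
  (freeB d).constr Laur fun w : W d =>
    if asc w⁻¹ i then freeB d (s i * w)
    else (qpar i - 1) • freeB d w + qpar i • freeB d (s i * w)

open Classical in
/-- Right multiplication by `T_{sᵢ}` on the free module with basis `W`. -/
noncomputable def Rop {d : ℕ} (i : Fin d) : Module.End Laur (FreeW d) :=
  (freeB d).constr Laur fun w : W d =>
    if asc w i then freeB d (w * s i)
    else (qpar i - 1) • freeB d w + qpar i • freeB d (w * s i)

theorem Lop_asc {d : ℕ} {i : Fin d} {w : W d} (h : asc w⁻¹ i) :
    Lop i (freeB d w) = freeB d (s i * w) := by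
  rw [Lop, Module.Basis.constr_basis, if_pos h]

theorem Lop_not {d : ℕ} {i : Fin d} {w : W d} (h : ¬ asc w⁻¹ i) :
    Lop i (freeB d w) =
      (qpar i - 1) • freeB d w + qpar i • freeB d (s i * w) := by
  rw [Lop, Module.Basis.constr_basis, if_neg h]

theorem Rop_asc {d : ℕ} {i : Fin d} {w : W d} (h : asc w i) :
    Rop i (freeB d w) = freeB d (w * s i) := by
  rw [Rop, Module.Basis.constr_basis, if_pos h]

theorem Rop_not {d : ℕ} {i : Fin d} {w : W d} (h : ¬ asc w i) :
    Rop i (freeB d w) =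
      (qpar i - 1) • freeB d w + qpar i • freeB d (w * s i) := by
  rw [Rop, Module.Basis.constr_basis, if_neg h]

theorem asc_inv_s_mul {d : ℕ} (w : W d) (i : Fin d) : asc (s i * w)⁻¹ i ↔ ¬ asc w⁻¹ i := by
  rw [mul_inv_rev, s_inv, asc_mul_s]

theorem asc_inv_mul_s {d : ℕ} (w : W d) (i j : Fin d) (h : s i * w ≠ w * s j) :
    asc (w * s j)⁻¹ i ↔ asc w⁻¹ i := by
  rw [mul_inv_rev, s_inv]
  apply asc_s_mul
  intro h'
  apply h
  have := congrArg (fun x => w * x * w) h'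
  simpa [mul_assoc] using this.symm

theorem Lop_Rop {d : ℕ} (i j : Fin d) : Commute (Lop (d := d) i) (Rop j) := by
  refine (freeB d).ext fun w => ?_
  change Lop i (Rop j (freeB d w)) = Rop j (Lop i (freeB d w))
  by_cases hc : s i * w = w * s j
  · obtain ⟨ha, hq⟩ := asc_inv w i j hc
    have hq' : qpar i = qpar j := by simp only [qpar, hq]
    have h1 := asc_inv_s_mul w i
    have h2 := asc_mul_s w j
    by_cases hw : asc w j
    · rw [Rop_asc hw, Lop_asc (ha.2 hw), ← hc, Lop_not (by rw [h1, not_not, ha]; exact hw), hc,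
        Rop_not (by rw [h2, not_not]; exact hw), hq', ← hc, s_mul_cancel, hc, mul_s_cancel]
    · have hw' : ¬ asc w⁻¹ i := by rwa [ha]
      simp only [Rop_not hw, Lop_not hw', map_add, map_smul, hq', hc]
      rw [Rop_asc (h2.2 hw), ← hc, Lop_asc (h1.2 hw'), s_mul_cancel, hc, mul_s_cancel]
  · have h1 := asc_inv_mul_s w i j hc
    have h2 := asc_s_mul w i j hc
    by_cases hw : asc w j <;> by_cases hw' : asc w⁻¹ i
    · rw [Rop_asc hw, Lop_asc hw', Rop_asc (h2.2 hw), Lop_asc (h1.2 hw'), mul_assoc]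
    · rw [Rop_asc hw, Lop_not hw', map_add, map_smul, map_smul, Rop_asc hw, Rop_asc (h2.2 hw),
        Lop_not (h1.not.2 hw'), mul_assoc]
    · rw [Rop_not hw, Lop_asc hw', map_add, map_smul, map_smul, Lop_asc hw', Lop_asc (h1.2 hw'),
        Rop_not (h2.not.2 hw), mul_assoc]
    · rw [Rop_not hw, Lop_not hw']
      simp only [map_add, map_smul]
      rw [Rop_not hw, Lop_not hw', Rop_not (h2.not.2 hw), Lop_not (h1.not.2 hw'), mul_assoc]
      module

/-- The Hecke algebra of `W` over `𝔸`, realized as the algebra of operators generated by the left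
multiplications by the `T_{sᵢ}` on the free module with basis `W`.  It is free with basis
`heckeT`, and satisfies the defining relations `heckeT_mul`, `heckeT_quadratic` below. -/
def Hecke (d : ℕ) : Type := ↥(Algebra.adjoin Laur (Set.range (Lop (d := d))))

noncomputable instance (d : ℕ) : Ring (Hecke d) :=
  inferInstanceAs (Ring ↥(Algebra.adjoin Laur (Set.range (Lop (d := d)))))

noncomputable instance (d : ℕ) : Algebra Laur (Hecke d) :=
  inferInstanceAs (Algebra Laur ↥(Algebra.adjoin Laur (Set.range (Lop (d := d)))))

/-- The generator `T_{sᵢ}`. -/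
noncomputable def gen {d : ℕ} (i : Fin d) : Hecke d :=
  ⟨Lop i, Algebra.subset_adjoin ⟨i, rfl⟩⟩

theorem Hecke_comm {d : ℕ} (x : Hecke d) (j : Fin d) : Commute x.1 (Rop j) := by
  obtain ⟨x, hx⟩ := x
  induction hx using Algebra.adjoin_induction with
  | mem y hy => obtain ⟨i, rfl⟩ := hy; exact Lop_Rop i j
  | algebraMap r => exact Algebra.commutes r _
  | add y z _ _ h1 h2 => exact Commute.add_left h1 h2
  | mul y z _ _ h1 h2 => exact Commute.mul_left h1 h2

/-- Evaluation at the identity element of `W`. -/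
noncomputable def ev (d : ℕ) : Hecke d →ₗ[Laur] FreeW d where
  toFun x := x.1 (freeB d 1)
  map_add' _ _ := rfl
  map_smul' _ _ := rfl

theorem induct_len {d : ℕ} {P : W d → Prop} (h1 : P 1)
    (h : ∀ w j, asc w j → P w → P (w * s j)) (w : W d) : P w := by
  induction hn : len w generalizing w with
  | zero => rw [len_eq_zero hn]; exact h1
  | succ k ih =>
    have : w ≠ 1 := by rintro rfl; rw [len_one] at hn; omega
    obtain ⟨j, hj⟩ := exists_not_asc w this
    have hl := len_of_not_asc w j hj
    have := h (w * s j) j ((asc_mul_s w j).2 hj) (ih _ (by omega))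
    rwa [mul_s_cancel] at this

theorem induct_len' {d : ℕ} {P : W d → Prop} (h1 : P 1)
    (h : ∀ w i, asc w⁻¹ i → P w → P (s i * w)) (w : W d) : P w := by
  have := induct_len (P := fun w => P w⁻¹) (by simpa using h1)
    (fun w j hw hP => by
      rw [mul_inv_rev, s_inv]
      exact h _ _ (by simpa using hw) hP) w⁻¹
  simpa using this

theorem ev_injective (d : ℕ) : Function.Injective (ev d) := by
  rw [← LinearMap.ker_eq_bot, LinearMap.ker_eq_bot']
  intro x hx
  apply Subtype.ext
  refine (freeB d).ext fun w => ?_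
  change x.1 (freeB d w) = 0
  induction w using induct_len with
  | h1 => exact hx
  | h w j hw ih =>
    rw [← Rop_asc hw]
    have : x.1 (Rop j (freeB d w)) = Rop j (x.1 (freeB d w)) :=
      LinearMap.congr_fun (Hecke_comm x j) _
    rw [this, ih, map_zero]

theorem ev_gen_mul {d : ℕ} (i : Fin d) (x : Hecke d) : ev d (gen i * x) = Lop i (ev d x) := rfl

theorem ev_surjective (d : ℕ) : Function.Surjective (ev d) := by
  have h : ∀ w : W d, ∃ x, ev d x = freeB d w := by
    intro w
    induction w using induct_len' with
    | h1 => exact ⟨1, rfl⟩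
    | h w i hw ih =>
      obtain ⟨x, hx⟩ := ih
      exact ⟨gen i * x, by rw [ev_gen_mul, hx, Lop_asc hw]⟩
  rw [← LinearMap.range_eq_top, eq_top_iff, ← (freeB d).span_eq, Submodule.span_le]
  rintro _ ⟨w, rfl⟩
  exact h w

/-- The basis `T_w` of the Hecke algebra. -/
noncomputable def heckeT (d : ℕ) : Module.Basis (W d) Laur (Hecke d) :=
  (freeB d).map (LinearEquiv.ofBijective (ev d) ⟨ev_injective d, ev_surjective d⟩).symm

theorem ev_heckeT {d : ℕ} (w : W d) : ev d (heckeT d w) = freeB d w :=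
  (LinearEquiv.ofBijective (ev d) ⟨ev_injective d, ev_surjective d⟩).apply_symm_apply _

theorem heckeT_one {d : ℕ} : heckeT d 1 = 1 := ev_injective d (by rw [ev_heckeT]; rfl)

theorem gen_mul_of_asc {d : ℕ} {i : Fin d} {w : W d} (h : asc w⁻¹ i) :
    gen i * heckeT d w = heckeT d (s i * w) :=
  ev_injective d (by rw [ev_gen_mul, ev_heckeT, ev_heckeT, Lop_asc h])

theorem heckeT_s {d : ℕ} (i : Fin d) : heckeT d (s i) = gen i := by
  have := gen_mul_of_asc (i := i) (w := 1) (by simp [asc])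
  rw [heckeT_one, mul_one, mul_one] at this
  exact this.symm

/-- `T_w T_{w'} = T_{ww'}` if `ℓ(ww') = ℓ(w) + ℓ(w')`. -/
theorem heckeT_mul {d : ℕ} (w w' : W d) (h : len (w * w') = len w + len w') :
    heckeT d w * heckeT d w' = heckeT d (w * w') := by
  induction w using induct_len' with
  | h1 => rw [heckeT_one, one_mul, one_mul]
  | h w i hw ih =>
    have h1 : len (s i * w) = len w + 1 := by rw [len_left, len_of_asc _ _ hw, len_inv]
    have h2 := len_mul_le w w'
    have h3 := len_mul_le (s i) (w * w')
    have h4 := len_s i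
    rw [← mul_assoc] at h3
    have h5 : asc (w * w')⁻¹ i := by
      by_contra h5
      have := len_of_not_asc _ _ h5
      rw [← len_left, len_inv, ← mul_assoc] at this
      omega
    rw [← gen_mul_of_asc hw, mul_assoc, ih (by omega), gen_mul_of_asc h5, mul_assoc]

/-- `(T_{sᵢ} + 1)(T_{sᵢ} - qᵢ) = 0` with `q₀ = u²` and `qᵢ = v²` for `i ≥ 1`. -/
theorem heckeT_quadratic {d : ℕ} (i : Fin d) :
    (heckeT d (s i) + 1) * (heckeT d (s i) - algebraMap Laur (Hecke d) (qpar i)) = 0 := by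
  have h1 : asc (1 : W d)⁻¹ i := by simp [asc]
  have h2 : ¬ asc (s i)⁻¹ i := by
    have := asc_inv_s_mul 1 i
    rw [mul_one] at this
    rw [this, not_not]
    exact h1
  have h3 : gen i * heckeT d (s i) =
      (qpar i - 1) • heckeT d (s i) + qpar i • (1 : Hecke d) := by
    apply ev_injective d
    rw [ev_gen_mul, ev_heckeT, Lop_not h2, map_add, map_smul, map_smul, ev_heckeT, s_mul_s,
      ← heckeT_one, ev_heckeT]
  rw [add_mul, one_mul, mul_sub, ← Algebra.commutes, ← Algebra.smul_def, Algebra.algebraMap_eq_smul_one]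
  nth_rewrite 1 [heckeT_s]
  rw [h3]
  module

/-! ### Compositions, parabolic subgroups and coset representatives -/

/-- The set `Λ_{n,d}` of vectors `(λ_n, …, λ_1, 2λ_0+1, λ_1, …, λ_n)` with `∑_{i=0}^n λ_i = d`,
as functions on `ℤ` supported on `[-n,n]`; thus `λ_0` is `val 0 / 2`. -/
structure Ld (n d : ℕ) where
  val : ℤ → ℕ
  supp : ∀ i : ℤ, (n : ℤ) < |i| → val i = 0
  symm : ∀ i, val (-i) = val i
  odd : Odd (val 0)
  sum : val 0 / 2 + ∑ i ∈ Finset.Icc (1 : ℤ) n, val i = d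

/-- `λ_0 + ∑_{1 ≤ j ≤ i} λ_j`. -/
noncomputable def Ld.cum {n d : ℕ} (l : Ld n d) (i : ℤ) : ℤ :=
  ((l.val 0 / 2 + ∑ j ∈ Finset.Icc (1 : ℤ) i, l.val j : ℕ) : ℤ)

/-- The integer intervals `R_i`. -/
noncomputable def Ld.R {n d : ℕ} (l : Ld n d) (i : ℤ) : Finset ℤ :=
  if 0 < i then Finset.Icc (l.cum (i - 1) + 1) (l.cum i)
  else if i = 0 then Finset.Icc (-l.cum 0) (l.cum 0)
  else Finset.Icc (-l.cum (-i)) (-(l.cum (-i - 1) + 1))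

theorem Ld.cum_mono {n d : ℕ} (l : Ld n d) {i j : ℤ} (h : i ≤ j) : l.cum i ≤ l.cum j := by
  simp only [Ld.cum, Nat.cast_le]
  exact Nat.add_le_add_left
    (Finset.sum_le_sum_of_subset (Finset.Icc_subset_Icc_right h)) _

theorem Ld.cum_n {n d : ℕ} (l : Ld n d) : l.cum n = d := by
  rw [Ld.cum, l.sum]

theorem Ld.cum_nonneg {n d : ℕ} (l : Ld n d) (i : ℤ) : 0 ≤ l.cum i := by
  simp only [Ld.cum]; omega

theorem Ld.cum_le {n d : ℕ} (l : Ld n d) (i : ℤ) : l.cum i ≤ d := by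
  rcases le_total i n with h | h
  · rw [← l.cum_n]; exact l.cum_mono h
  · rw [← l.cum_n, Ld.cum, Ld.cum, ← Finset.sum_subset (Finset.Icc_subset_Icc_right h)]
    intro x hx hx'
    apply l.supp
    simp at hx hx'
    rw [abs_of_nonneg (by omega)]
    omega

theorem Ld.R_neg {n d : ℕ} (l : Ld n d) (i p : ℤ) : p ∈ l.R (-i) ↔ -p ∈ l.R i := by
  simp only [Ld.R]
  rcases lt_trichotomy i 0 with h | h | h
  · rw [if_pos (by omega), if_neg (by omega), if_neg (by omega)]
    simp; omega
  · subst h; simp; omega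
  · rw [if_neg (by omega), if_neg (by omega), if_pos h]
    simp; omega

theorem Ld.R_abs {n d : ℕ} (l : Ld n d) {i p : ℤ} (h : p ∈ l.R i) : |p| ≤ d := by
  have h0 := l.cum_nonneg
  have h1 := l.cum_le
  rw [abs_le]
  simp only [Ld.R] at h
  split_ifs at h <;> rw [Finset.mem_Icc] at h
  · have := h0 (i - 1); have := h1 i; omega
  · have := h1 0; omega
  · have := h0 (-i - 1); have := h1 (-i); omega

theorem Ld.R_Icc {n d : ℕ} (l : Ld n d) (i : ℤ) : ∃ a b, l.R i = Finset.Icc a b := by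
  simp only [Ld.R]
  split_ifs
  · exact ⟨_, _, rfl⟩
  · exact ⟨_, _, rfl⟩
  · exact ⟨_, _, rfl⟩

theorem Ld.R_cover_pos {n d : ℕ} (l : Ld n d) (p : ℤ) (hp : 0 ≤ p) (k : ℕ) (h : p ≤ l.cum k) :
    ∃ i, p ∈ l.R i := by
  induction k with
  | zero => exact ⟨0, by simp [Ld.R] at h ⊢; omega⟩
  | succ k ih =>
    by_cases h' : p ≤ l.cum k
    · exact ih h'
    · refine ⟨(k + 1 : ℕ), ?_⟩
      rw [Ld.R, if_pos (by positivity)]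
      simp at h h' ⊢
      omega

theorem Ld.R_cover {n d : ℕ} (l : Ld n d) {p : ℤ} (hp : |p| ≤ d) : ∃ i, p ∈ l.R i := by
  rw [abs_le] at hp
  rcases le_total 0 p with h | h
  · exact l.R_cover_pos p h n (by rw [l.cum_n]; omega)
  · obtain ⟨i, hi⟩ := l.R_cover_pos (-p) (by omega) n (by rw [l.cum_n]; omega)
    exact ⟨-i, by rwa [l.R_neg]⟩

theorem Ld.R_disj_pos {n d : ℕ} (l : Ld n d) {i j p : ℤ} (hi : 0 ≤ i) (hij : i < j)
    (h1 : p ∈ l.R i) (h2 : p ∈ l.R j) : False := by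
  simp only [Ld.R] at h1 h2
  have := l.cum_mono (show i ≤ j - 1 by omega)
  have := l.cum_nonneg (j - 1)
  rw [if_pos (by omega), Finset.mem_Icc] at h2
  rcases hi.eq_or_lt with rfl | hi
  · rw [if_neg (by omega), if_pos rfl, Finset.mem_Icc] at h1
    omega
  · rw [if_pos (by omega), Finset.mem_Icc] at h1
    omega

theorem Ld.R_sign {n d : ℕ} (l : Ld n d) {i p : ℤ} (h : p ∈ l.R i) :
    (0 < i → 0 < p) ∧ (i < 0 → p < 0) := by
  simp only [Ld.R] at h
  refine ⟨fun hi => ?_, fun hi => ?_⟩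
  · rw [if_pos hi, Finset.mem_Icc] at h
    have := l.cum_nonneg (i - 1); omega
  · rw [if_neg (by omega), if_neg (by omega), Finset.mem_Icc] at h
    have := l.cum_nonneg (-i - 1); omega

theorem Ld.R_disj {n d : ℕ} (l : Ld n d) {i j p : ℤ} (h1 : p ∈ l.R i) (h2 : p ∈ l.R j) :
    i = j := by
  have s1 := l.R_sign h1
  have s2 := l.R_sign h2
  have n1 : -p ∈ l.R (-i) := by rw [l.R_neg, neg_neg]; exact h1
  have n2 : -p ∈ l.R (-j) := by rw [l.R_neg, neg_neg]; exact h2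
  by_contra hne
  rcases lt_or_gt_of_ne hne with h | h
  · rcases le_or_gt 0 i with hi | hi
    · exact l.R_disj_pos hi h h1 h2
    · exact l.R_disj_pos (by omega) (by omega) n2 n1
  · rcases le_or_gt 0 j with hi | hi
    · exact l.R_disj_pos hi h h2 h1
    · exact l.R_disj_pos (by omega) (by omega) n1 n2

/-- The parabolic subgroup `W_λ`, the common stabilizer of the sets `R_i`. -/
def Ld.par {n d : ℕ} (l : Ld n d) : Subgroup (W d) where
  carrier := {w | ∀ k p, w.1 p ∈ l.R k ↔ p ∈ l.R k}
  mul_mem' := fun {a b} ha hb k p => (ha k (b.1 p)).trans (hb k p)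
  one_mem' := fun _ _ => Iff.rfl
  inv_mem' := fun {a} ha k p => by
    have := ha k ((a⁻¹).1 p)
    rw [← this]
    have e : a.1 ((a⁻¹).1 p) = p := a.1.apply_symm_apply p
    rw [e]

/-- The set of shortest right coset representatives for `W_λ \ W`. -/
def Ld.D {n d : ℕ} (l : Ld n d) : Set (W d) :=
  {g | ∀ w ∈ l.par, len (w * g) = len w + len g}

theorem Ld.s_mem {n d : ℕ} (l : Ld n d) (i : Fin d) (k : ℤ) (h1 : ((i : ℕ) : ℤ) ∈ l.R k)
    (h2 : ((i : ℕ) : ℤ) + 1 ∈ l.R k) : s i ∈ l.par := by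
  have main : ∀ k' p, p ∈ l.R k' → (s i).1 p ∈ l.R k' := by
    intro k' p hp
    have n1 : -((i : ℕ) : ℤ) ∈ l.R (-k) := by rw [l.R_neg, neg_neg]; exact h1
    have n2 : -((i : ℕ) : ℤ) - 1 ∈ l.R (-k) := by
      rw [l.R_neg, show -(-((i : ℕ) : ℤ) - 1) = (i : ℕ) + 1 by ring]; exact h2
    rcases Nat.eq_zero_or_pos (i : ℕ) with hi | hi
    · rw [s_zero hi]
      simp only [hi, Nat.cast_zero, neg_zero, zero_sub, zero_add] at h1 h2 n1 n2
      have hk := l.R_disj h1 n1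
      split_ifs with c1 c2
      · subst c1; rw [l.R_disj hp h2, hk]; exact n2
      · subst c2; rw [l.R_disj hp n2, ← hk]; exact h2
      · exact hp
    · rw [s_pos hi]
      split_ifs with c1 c2 c3 c4
      · subst c1; rw [l.R_disj hp h1]; exact h2
      · subst c2; rw [l.R_disj hp h2]; exact h1
      · subst c3; rw [l.R_disj hp n1]; exact n2
      · subst c4; rw [l.R_disj hp n2]; exact n1
      · exact hp
  intro k' p
  refine ⟨fun h => ?_, main k' p⟩
  have := main k' _ h
  have e : (s i).1 ((s i).1 p) = p := congrArg (fun g : W d => g.1 p) (s_mul_s i)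
  rwa [e] at this

/-- `y` has ascents inside all the sets `R_k`. -/
def Ld.basc {n d : ℕ} (l : Ld n d) (y : W d) : Prop :=
  ∀ (i : Fin d) (k : ℤ), ((i : ℕ) : ℤ) ∈ l.R k → ((i : ℕ) : ℤ) + 1 ∈ l.R k → asc y i

theorem Ld.basc_succ {n d : ℕ} {l : Ld n d} {y : W d} (h : l.basc y) {k p : ℤ} (h1 : p ∈ l.R k)
    (h2 : p + 1 ∈ l.R k) : y.1 p < y.1 (p + 1) := by
  rcases le_or_gt 0 p with hp | hp
  · have := abs_le.1 (l.R_abs h2)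
    have e : ((p.toNat : ℕ) : ℤ) = p := by omega
    have := h ⟨p.toNat, by omega⟩ k (by simpa only [e] using h1) (by simpa only [e] using h2)
    simpa only [asc, e] using this
  · have := abs_le.1 (l.R_abs h1)
    have e : (((-p - 1).toNat : ℕ) : ℤ) = -p - 1 := by omega
    have := h ⟨(-p - 1).toNat, by omega⟩ (-k)
      (by simp only [e]; rw [l.R_neg, show -(-p - 1) = p + 1 by ring]; exact h2)
      (by simp only [e]; rw [l.R_neg, show -(-p - 1 + 1) = p by ring]; exact h1)
    simp only [asc, e] at this
    rw [show -p - 1 = -(p + 1) by ring, show -(p + 1) + 1 = -p by ring, W_neg, W_neg] at this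
    omega

theorem Ld.basc_le {n d : ℕ} {l : Ld n d} {y : W d} (h : l.basc y) {k a b : ℤ} (h1 : a ∈ l.R k)
    (hab : a ≤ b) : b ∈ l.R k → y.1 a + (b - a) ≤ y.1 b := by
  induction b, hab using Int.leInduction with
  | base => intro _; omega
  | succ b hb ih =>
    intro h2
    have h3 : b ∈ l.R k := by
      obtain ⟨x, z, e⟩ := l.R_Icc k
      rw [e, Finset.mem_Icc] at h1 h2 ⊢
      omega
    have := ih h3
    have := Ld.basc_succ h h3 h2
    omega

theorem Ld.eq_one {n d : ℕ} {l : Ld n d} {y : W d} (hy : y ∈ l.par) (h : l.basc y) : y = 1 := by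
  apply W_ext
  intro p
  change y.1 p = p
  by_cases hp : |p| ≤ d
  · obtain ⟨k, hk⟩ := l.R_cover hp
    obtain ⟨a, b, e⟩ := l.R_Icc k
    have hk' := hk
    rw [e, Finset.mem_Icc] at hk'
    have ha : a ∈ l.R k := by rw [e, Finset.mem_Icc]; omega
    have hb : b ∈ l.R k := by rw [e, Finset.mem_Icc]; omega
    have h1 := Ld.basc_le h ha hk'.1 hk
    have h2 := Ld.basc_le h hk hk'.2 hb
    have h3 := (hy k a).2 ha
    have h4 := (hy k b).2 hb
    rw [e, Finset.mem_Icc] at h3 h4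
    omega
  · exact y.2.2 p (by omega)

theorem len_s_mul_of_asc {d : ℕ} {w : W d} {i : Fin d} (h : asc w⁻¹ i) :
    len (s i * w) = len w + 1 := by rw [len_left, len_of_asc _ _ h, len_inv]

theorem len_s_mul_of_not {d : ℕ} {w : W d} {i : Fin d} (h : ¬ asc w⁻¹ i) :
    len (s i * w) + 1 = len w := by rw [len_left, len_of_not_asc _ _ h, len_inv]

theorem Ld.mem_D {n d : ℕ} {l : Ld n d} {g : W d} (hg : l.basc g⁻¹) : g ∈ l.D := by
  intro x hx
  induction hn : len x generalizing x with
  | zero => rw [len_eq_zero hn, one_mul, zero_add]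
  | succ m ih =>
    have hx1 : x⁻¹ ≠ 1 := by
      intro h
      rw [inv_eq_one] at h
      rw [h, len_one] at hn
      omega
    have : ∃ (i : Fin d) (k : ℤ), (((i : ℕ) : ℤ) ∈ l.R k ∧ ((i : ℕ) : ℤ) + 1 ∈ l.R k) ∧
        ¬ asc x⁻¹ i := by
      by_contra hc
      push Not at hc
      exact hx1 (Ld.eq_one (l.par.inv_mem hx) fun i k h1 h2 => hc i k ⟨h1, h2⟩)
    obtain ⟨i, k, ⟨h1, h2⟩, h3⟩ := this
    have h4 := len_s_mul_of_not h3
    have h5 : s i * x ∈ l.par := l.par.mul_mem (l.s_mem i k h1 h2) hx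
    have h6 := ih (s i * x) h5 (by omega)
    have h7 : asc (s i * x)⁻¹ i := by rwa [asc_inv_s_mul]
    have h8 : asc (s i * x * g)⁻¹ i := by
      have h5' := l.par.inv_mem h5
      have a1 := (h5' k _).2 h1
      have a2 := (h5' k _).2 h2
      rw [mul_inv_rev]
      simp only [asc] at h7 ⊢
      have := Ld.basc_le hg a1 h7.le a2
      change (g⁻¹).1 _ < (g⁻¹).1 _
      omega
    have h9 := len_s_mul_of_asc h8
    rw [← mul_assoc, ← mul_assoc, s_mul_s, one_mul] at h9
    omega

theorem Ld.exists_rep {n d : ℕ} (l : Ld n d) (w : W d) : ∃ x ∈ l.par, x * w ∈ l.D := by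
  obtain ⟨x, hx, hmin⟩ := Set.exists_min_image {x : W d | x ∈ l.par} (fun x => len (x * w))
    (Set.toFinite _) ⟨1, l.par.one_mem⟩
  refine ⟨x, hx, Ld.mem_D fun i k h1 h2 => ?_⟩
  by_contra h
  have a := len_s_mul_of_not h
  have b := hmin (s i * x) (l.par.mul_mem (l.s_mem i k h1 h2) hx)
  simp only [mul_assoc] at a b
  omega

theorem Ld.D_unique {n d : ℕ} {l : Ld n d} {x g : W d} (hx : x ∈ l.par) (hg : g ∈ l.D)
    (hxg : x * g ∈ l.D) : x = 1 := by
  have a := hg x hx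
  have b := hxg x⁻¹ (l.par.inv_mem hx)
  rw [inv_mul_cancel_left] at b
  exact len_eq_zero (by omega)

/-! ### The modules `x_λ H` -/

open Classical in
/-- `T_X = ∑_{w ∈ X} T_w`. -/
noncomputable def TX {d : ℕ} (X : Set (W d)) : Hecke d := ∑ w with w ∈ X, heckeT d w

/-- `x_λ = T_{W_λ}`. -/
noncomputable def Ld.x {n d : ℕ} (l : Ld n d) : Hecke d := TX (l.par : Set (W d))

theorem TX_left {n d : ℕ} (l : Ld n d) (X : Set (W d))
    (hX : ∀ x ∈ l.par, ∀ w ∈ X, x * w ∈ X) : ∃ z, TX X = l.x * z := by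
  classical
  refine ⟨TX (X ∩ l.D), ?_⟩
  simp only [Ld.x, TX]
  rw [Finset.sum_mul_sum, ← Finset.sum_product']
  symm
  refine Finset.sum_bij (fun p _ => p.1 * p.2) ?_ ?_ ?_ ?_
  · rintro ⟨x, g⟩ h
    simp at h ⊢
    exact hX x h.1 g h.2.1
  · rintro ⟨x, g⟩ h ⟨x', g'⟩ h' e
    simp at h h' e
    have e' : x'⁻¹ * x * g = g' := by rw [mul_assoc, e, inv_mul_cancel_left]
    have := Ld.D_unique (l.par.mul_mem (l.par.inv_mem h'.1) h.1) h.2.2 (e' ▸ h'.2.2)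
    have hx : x = x' := (inv_mul_eq_one.1 this).symm
    subst hx
    simpa using e
  · intro w hw
    simp at hw
    obtain ⟨x, hx, hg⟩ := l.exists_rep w
    refine ⟨(x⁻¹, x * w), ?_, by simp⟩
    simp
    exact ⟨hx, hX x hx w hw, hg⟩
  · rintro ⟨x, g⟩ h
    simp at h
    exact heckeT_mul x g (h.2.2 x h.1)

theorem TX_right {n d : ℕ} (l : Ld n d) (X : Set (W d))
    (hX : ∀ x ∈ l.par, ∀ w ∈ X, w * x ∈ X) : ∃ y, TX X = y * l.x := by
  classical
  refine ⟨TX (X ∩ {g | g⁻¹ ∈ l.D}), ?_⟩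
  simp only [Ld.x, TX]
  rw [Finset.sum_mul_sum, ← Finset.sum_product']
  symm
  refine Finset.sum_bij (fun p _ => p.1 * p.2) ?_ ?_ ?_ ?_
  · rintro ⟨g, x⟩ h
    simp at h ⊢
    exact hX x h.2 g h.1.1
  · rintro ⟨g, x⟩ h ⟨g', x'⟩ h' e
    simp at h h' e
    have e' : x' * x⁻¹ * g⁻¹ = g'⁻¹ := by
      rw [mul_assoc, ← mul_inv_rev, e, mul_inv_rev, mul_inv_cancel_left]
    have := Ld.D_unique (l.par.mul_mem h'.2 (l.par.inv_mem h.2)) h.1.2 (e' ▸ h'.1.2)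
    have hx : x = x' := (mul_inv_eq_one.1 this).symm
    subst hx
    simpa using e
  · intro w hw
    simp at hw
    obtain ⟨x, hx, hg⟩ := l.exists_rep w⁻¹
    refine ⟨(w * x⁻¹, x), ?_, by simp⟩
    simp
    exact ⟨⟨hX _ (l.par.inv_mem hx) w hw, hg⟩, hx⟩
  · rintro ⟨g, x⟩ h
    simp at h
    refine heckeT_mul g x ?_
    have := h.1.2 x⁻¹ (l.par.inv_mem h.2)
    rw [← mul_inv_rev, len_inv, len_inv, len_inv] at this
    rw [this, add_comm]

/-- The right ideal `x_λ H`, as a right `H`-module. -/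
noncomputable def Ld.xH {n d : ℕ} (l : Ld n d) : Submodule (Hecke d)ᵐᵒᵖ (Hecke d) :=
  Submodule.span _ {l.x}

/-- The generator `x_λ` of `x_λ H`. -/
noncomputable def Ld.gen {n d : ℕ} (l : Ld n d) : l.xH :=
  ⟨l.x, Submodule.mem_span_singleton_self _⟩

theorem exists_phi {n d : ℕ} (l m : Ld n d) (X : Set (W d))
    (hl : ∀ x ∈ l.par, ∀ w ∈ X, x * w ∈ X) (hm : ∀ x ∈ m.par, ∀ w ∈ X, w * x ∈ X) :
    ∃ f : m.xH →ₗ[(Hecke d)ᵐᵒᵖ] l.xH, (f m.gen : Hecke d) = TX X := by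
  obtain ⟨z, hz⟩ := TX_left l X hl
  obtain ⟨y, hy⟩ := TX_right m X hm
  let F : Hecke d →ₗ[(Hecke d)ᵐᵒᵖ] Hecke d :=
    { toFun := fun a => y * a
      map_add' := fun a b => mul_add y a b
      map_smul' := fun c a => (mul_assoc y a c.unop).symm }
  have hF : ∀ a ∈ m.xH, F a ∈ l.xH := by
    intro a ha
    obtain ⟨c, rfl⟩ := Submodule.mem_span_singleton.1 ha
    rw [map_smul]
    apply Submodule.smul_mem
    change y * m.x ∈ l.xH
    rw [← hy, hz]
    exact Submodule.mem_span_singleton.2 ⟨MulOpposite.op z, rfl⟩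
  exact ⟨F.restrict hF, hy.symm⟩

theorem phi_unique {n d : ℕ} {l m : Ld n d} {f g : m.xH →ₗ[(Hecke d)ᵐᵒᵖ] l.xH}
    (h : f m.gen = g m.gen) : f = g := by
  apply LinearMap.ext
  rintro ⟨a, ha⟩
  obtain ⟨c, rfl⟩ := Submodule.mem_span_singleton.1 ha
  have e : (⟨c • m.x, ha⟩ : m.xH) = c • m.gen := rfl
  rw [e, map_smul, map_smul, h]

/-! ### The Schur algebra -/

/-- The right `H`-module `⨁_λ x_λ H`. -/
abbrev TensorMod (n d : ℕ) : Type := DirectSum (Ld n d) fun l => l.xH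

/-- The Schur algebra `End_H (⨁_λ x_λ H)`; the product is composition of maps. -/
abbrev Schur (n d : ℕ) : Type := Module.End (Hecke d)ᵐᵒᵖ (TensorMod n d)

/-! ### Matrices -/

/-- The set `Ξ_{n,d}` of matrices indexed by `[-n,n]` (functions on `ℤ × ℤ` that vanish elsewhere). -/
structure Xi (n d : ℕ) where
  a : ℤ → ℤ → ℕ
  supp : ∀ i j : ℤ, (n : ℤ) < |i| ∨ (n : ℤ) < |j| → a i j = 0
  symm : ∀ i j, a (-i) (-j) = a i j
  odd : Odd (a 0 0)
  sum : ∑ i ∈ Finset.Icc (-n : ℤ) n, ∑ j ∈ Finset.Icc (-n : ℤ) n, a i j = 2 * d + 1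

theorem sum_symm (n : ℕ) (f : ℤ → ℕ) (hf : ∀ i, f (-i) = f i) :
    ∑ i ∈ Finset.Icc (-n : ℤ) n, f i = f 0 + 2 * ∑ i ∈ Finset.Icc (1 : ℤ) n, f i := by
  have e : Finset.Icc (-n : ℤ) n =
      insert 0 (Finset.Icc (1 : ℤ) n ∪ (Finset.Icc (1 : ℤ) n).image Neg.neg) := by
    ext x
    simp only [Finset.mem_Icc, Finset.mem_insert, Finset.mem_union, Finset.mem_image]
    constructor
    · intro h
      rcases lt_trichotomy x 0 with h' | h' | h'
      · exact Or.inr (Or.inr ⟨-x, by omega, by omega⟩)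
      · exact Or.inl h'
      · exact Or.inr (Or.inl (by omega))
    · rintro (h | h | ⟨y, h, rfl⟩) <;> omega
  rw [e, Finset.sum_insert, Finset.sum_union, Finset.sum_image neg_injective.injOn]
  · simp only [hf]; ring
  · rw [Finset.disjoint_left]
    intro x hx hx'
    simp at hx hx'
    omega
  · simp

theorem sum_neg (n : ℕ) (f : ℤ → ℕ) :
    ∑ i ∈ Finset.Icc (-n : ℤ) n, f (-i) = ∑ i ∈ Finset.Icc (-n : ℤ) n, f i :=
  Finset.sum_nbij' Neg.neg Neg.neg (by simp; omega) (by simp; omega) (by simp) (by simp) (by simp)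

/-- The vector of row sums. -/
noncomputable def Xi.ro {n d : ℕ} (A : Xi n d) : Ld n d where
  val i := ∑ j ∈ Finset.Icc (-n : ℤ) n, A.a i j
  supp i hi := Finset.sum_eq_zero fun j _ => A.supp i j (Or.inl hi)
  symm i := by rw [← sum_neg]; simp only [A.symm]
  odd := by
    rw [sum_symm n _ fun j => by simpa using A.symm 0 j]
    exact A.odd.add_even (even_two_mul _)
  sum := by
    have h := A.sum
    have hs : ∀ i, ∑ j ∈ Finset.Icc (-n : ℤ) n, A.a (-i) j = ∑ j ∈ Finset.Icc (-n : ℤ) n, A.a i j :=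
      fun i => by rw [← sum_neg]; simp only [A.symm]
    rw [sum_symm n _ hs] at h
    omega

/-- The transposed matrix. -/
noncomputable def Xi.transpose {n d : ℕ} (A : Xi n d) : Xi n d where
  a i j := A.a j i
  supp i j h := A.supp j i h.symm
  symm i j := A.symm j i
  odd := A.odd
  sum := by rw [Finset.sum_comm, A.sum]

/-- The vector of column sums. -/
noncomputable def Xi.co {n d : ℕ} (A : Xi n d) : Ld n d := A.transpose.ro

/-- The entries of the matrix `κ(λ,g,μ) = (|R_i^λ ∩ g R_j^μ|)`. -/
noncomputable def kappa {n d : ℕ} (l : Ld n d) (g : W d) (m : Ld n d) : ℤ → ℤ → ℕ :=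
  fun i j => (l.R i ∩ (m.R j).image g.1).card

/-- The minimal length double coset representatives `D_{λμ} = D_λ ∩ D_μ⁻¹`. -/
def DD {n d : ℕ} (l m : Ld n d) : Set (W d) := {g | g ∈ l.D ∧ g⁻¹ ∈ m.D}

/-- The double coset `W_λ g W_μ`. -/
def dcoset {n d : ℕ} (l : Ld n d) (g : W d) (m : Ld n d) : Set (W d) :=
  {w | ∃ x ∈ l.par, ∃ y ∈ m.par, w = x * g * y}

/-- The double coset `W_λ g W_μ` attached to `A = κ(λ,g,μ)`, where `λ = ro(A)`, `μ = co(A)`,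
`g ∈ D_{λμ}` (there is exactly one such `g`). -/
def Xi.coset {n d : ℕ} (A : Xi n d) : Set (W d) :=
  {w | ∃ g ∈ DD A.ro A.co, kappa A.ro g A.co = A.a ∧ w ∈ dcoset A.ro g A.co}

theorem Xi.exists_phi {n d : ℕ} (A : Xi n d) :
    ∃ f : A.co.xH →ₗ[(Hecke d)ᵐᵒᵖ] A.ro.xH, (f A.co.gen : Hecke d) = TX A.coset := by
  apply SchurBC.exists_phi
  · rintro x hx w ⟨g, hg, hk, y, hy, z, hz, rfl⟩
    exact ⟨g, hg, hk, x * y, A.ro.par.mul_mem hx hy, z, hz, by simp only [mul_assoc]⟩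
  · rintro x hx w ⟨g, hg, hk, y, hy, z, hz, rfl⟩
    exact ⟨g, hg, hk, y, hy, z * x, A.co.par.mul_mem hz hx, by simp only [mul_assoc]⟩

/-- For `A = κ(λ,g,μ)`, the right `H`-linear map `φ_{λμ}^g : x_μ H → x_λ H` that sends
`x_μ` to `T_{W_λ g W_μ}`; it is unique by `phi_unique`. -/
noncomputable def Xi.phi {n d : ℕ} (A : Xi n d) : A.co.xH →ₗ[(Hecke d)ᵐᵒᵖ] A.ro.xH :=
  A.exists_phi.choose

theorem Xi.phi_gen {n d : ℕ} (A : Xi n d) : (A.phi A.co.gen : Hecke d) = TX A.coset :=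
  A.exists_phi.choose_spec

open Classical in
/-- The basis element `e_A` of the Schur algebra: `φ_{λμ}^g` on the summand `x_μ H`, and `0` on
the other summands. -/
noncomputable def Xi.e {n d : ℕ} (A : Xi n d) : Schur n d :=
  DirectSum.lof (Hecke d)ᵐᵒᵖ (Ld n d) (fun l => l.xH) A.ro ∘ₗ A.phi ∘ₗ
    DirectSum.component (Hecke d)ᵐᵒᵖ (Ld n d) (fun l => l.xH) A.co

/-- `a_{ij}^♮`, which is `(a_{00} - 1) / 2` for `(i,j) = (0,0)` and `a_{ij}` otherwise. -/
def Xi.nat {n d : ℕ} (A : Xi n d) (i j : ℤ) : ℕ :=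
  if i = 0 ∧ j = 0 then (A.a 0 0 - 1) / 2 else A.a i j

/-- The index set `I_𝔠 = {(0,0)} ⊔ ({0} × [1,n]) ⊔ ([1,n] × [-n,n])`. -/
noncomputable def Ic (n : ℕ) : Finset (ℤ × ℤ) :=
  {(0, 0)} ∪ ({0} ×ˢ Finset.Icc (1 : ℤ) n) ∪ (Finset.Icc (1 : ℤ) n ×ˢ Finset.Icc (-n : ℤ) n)

/-- The generalized length `ℓ̂(A)`. -/
noncomputable def Xi.lhat {n d : ℕ} (A : Xi n d) : ℤ :=
  ((∑ p ∈ Ic n,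
    ((∑ x ∈ Finset.Icc (-n : ℤ) n, ∑ y ∈ Finset.Icc (-n : ℤ) n,
        if x ≤ p.1 ∧ p.2 < y then A.nat p.1 p.2 * A.a x y else 0) +
      ∑ x ∈ Finset.Icc (-n : ℤ) n, ∑ y ∈ Finset.Icc (-n : ℤ) n,
        if p.1 ≤ x ∧ y < p.2 then A.nat p.1 p.2 * A.a x y else 0) : ℕ) : ℤ) / 2

/-- The truncated generalized length `ℓ̂_𝔠(A)`. -/
noncomputable def Xi.lhatc {n d : ℕ} (A : Xi n d) : ℤ :=
  (((∑ x ∈ Finset.Icc (-n : ℤ) n, ∑ y ∈ Finset.Icc (-n : ℤ) n,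
        if 0 ≤ x ∧ y < 0 then A.a x y else 0) +
      ∑ x ∈ Finset.Icc (-n : ℤ) n, ∑ y ∈ Finset.Icc (-n : ℤ) n,
        if x ≤ 0 ∧ 0 < y then A.a x y else 0 : ℕ) : ℤ) / 2

/-- The truncated generalized length `ℓ̂_𝔞(A) = ℓ̂(A) - ℓ̂_𝔠(A)`. -/
noncomputable def Xi.lhata {n d : ℕ} (A : Xi n d) : ℤ := A.lhat - A.lhatc

/-- The standard basis element `[A] = u^{-ℓ̂_𝔠(A)} v^{-ℓ̂_𝔞(A)} e_A`. -/
noncomputable def Xi.std {n d : ℕ} (A : Xi n d) : Schur n d := uv (-A.lhatc) (-A.lhata) • A.e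

/-! ### The matrices in the multiplication formulas -/

/-- The matrix `E_{kl}^θ = E_{kl} + E_{-k,-l}`. -/
def Eth (k l : ℤ) : ℤ → ℤ → ℤ := fun i j =>
  (if i = k ∧ j = l then 1 else 0) + (if i = -k ∧ j = -l then 1 else 0)

/-- `M` is a diagonal matrix. -/
def IsDiag (M : ℤ → ℤ → ℤ) : Prop := ∀ i j, i ≠ j → M i j = 0

/-- `∑_{l=-n}^n t_l E_{hl}^θ`. -/
noncomputable def rowE (n : ℕ) (h : ℤ) (t : ℤ →₀ ℕ) : ℤ → ℤ → ℤ := fun i j =>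
  ∑ l ∈ Finset.Icc (-n : ℤ) n, (t l : ℤ) * Eth h l i j

theorem rowE_eq (n : ℕ) (h : ℤ) (t : ℤ →₀ ℕ) (i j : ℤ) :
    rowE n h t i j = if j ∈ Finset.Icc (-n : ℤ) n then
      (if i = h then (t j : ℤ) else 0) + (if i = -h then (t (-j) : ℤ) else 0) else 0 := by
  have e2 : ∀ l : ℤ, (j = -l) ↔ (l = -j) := fun l => by omega
  simp only [rowE, Eth, mul_add, Finset.sum_add_distrib, ite_and, mul_ite, mul_one, mul_zero]
  by_cases hj : j ∈ Finset.Icc (-n : ℤ) n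
  · have hj' : -j ∈ Finset.Icc (-n : ℤ) n := by rw [Finset.mem_Icc] at *; omega
    rw [if_pos hj]
    congr 1
    · by_cases hi : i = h
      · simp only [hi, if_true]; rw [Finset.sum_ite_eq, if_pos hj]
      · simp [hi]
    · by_cases hi : i = -h
      · simp only [hi, if_true, e2]; rw [Finset.sum_ite_eq', if_pos hj']
      · simp [hi]
  · have hj' : -j ∉ Finset.Icc (-n : ℤ) n := by rw [Finset.mem_Icc] at *; omega
    rw [if_neg hj]
    have s1 : ∀ c : Prop, [Decidable c] → (∑ x ∈ Finset.Icc (-n : ℤ) n,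
        if c then (if j = x then (t x : ℤ) else 0) else 0) = 0 := by
      intro c _
      split_ifs
      · rw [Finset.sum_ite_eq, if_neg hj]
      · simp
    have s2 : ∀ c : Prop, [Decidable c] → (∑ x ∈ Finset.Icc (-n : ℤ) n,
        if c then (if j = -x then (t x : ℤ) else 0) else 0) = 0 := by
      intro c _
      split_ifs
      · simp only [e2]; rw [Finset.sum_ite_eq', if_neg hj']
      · simp
    rw [s1, s2, add_zero]

theorem rowE_symm (n : ℕ) (h : ℤ) (t : ℤ →₀ ℕ) (i j : ℤ) :
    rowE n h t (-i) (-j) = rowE n h t i j := by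
  have e1 : (-j ∈ Finset.Icc (-n : ℤ) n) ↔ j ∈ Finset.Icc (-n : ℤ) n := by
    simp only [Finset.mem_Icc]; omega
  have e2 : (-i = h) ↔ (i = -h) := by omega
  have e3 : (-i = -h) ↔ (i = h) := by omega
  simp only [rowE_eq, e1, e2, e3, neg_neg]
  split_ifs <;> ring

theorem rowE_supp (n : ℕ) {h : ℤ} (hh : |h| ≤ n) (t : ℤ →₀ ℕ) {i j : ℤ}
    (hij : (n : ℤ) < |i| ∨ (n : ℤ) < |j|) : rowE n h t i j = 0 := by
  rw [rowE_eq]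
  rcases hij with hi | hj
  · rw [if_neg (show i ≠ h by rintro rfl; omega),
      if_neg (show i ≠ -h by rintro rfl; rw [abs_neg] at hi; omega)]
    simp
  · rw [if_neg (by rw [Finset.mem_Icc, ← abs_le]; omega)]

theorem rowE_even (n : ℕ) (h : ℤ) (t : ℤ →₀ ℕ) : Even (rowE n h t 0 0) := by
  have e : ((0 : ℤ) = -h) ↔ ((0 : ℤ) = h) := by omega
  rw [rowE_eq, if_pos (by simp)]
  simp only [neg_zero, e]
  exact ⟨_, rfl⟩

theorem rowE_sum (n : ℕ) {h : ℤ} (hh : |h| ≤ n) (t : ℤ →₀ ℕ) :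
    ∑ i ∈ Finset.Icc (-n : ℤ) n, ∑ j ∈ Finset.Icc (-n : ℤ) n, rowE n h t i j =
      2 * ∑ l ∈ Finset.Icc (-n : ℤ) n, (t l : ℤ) := by
  have hh := abs_le.1 hh
  rw [Finset.sum_comm]
  have : ∀ j ∈ Finset.Icc (-n : ℤ) n, ∑ i ∈ Finset.Icc (-n : ℤ) n, rowE n h t i j =
      (t j : ℤ) + t (-j) := by
    intro j hj
    simp only [rowE_eq, if_pos hj, Finset.sum_add_distrib]
    rw [Finset.sum_ite_eq', Finset.sum_ite_eq', if_pos (by simp; omega), if_pos (by simp; omega)]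
  rw [Finset.sum_congr rfl this, Finset.sum_add_distrib, two_mul]
  congr 1
  have := sum_neg n t
  exact_mod_cast this

/-- A matrix of integers with the defining properties of `Ξ_{n,d}`, as an element of `Ξ_{n,d}`. -/
def Xi.ofInt {n d : ℕ} (M : ℤ → ℤ → ℤ) (h0 : ∀ i j, 0 ≤ M i j)
    (supp : ∀ i j : ℤ, (n : ℤ) < |i| ∨ (n : ℤ) < |j| → M i j = 0)
    (symm : ∀ i j, M (-i) (-j) = M i j) (odd : Odd (M 0 0))
    (sum : ∑ i ∈ Finset.Icc (-n : ℤ) n, ∑ j ∈ Finset.Icc (-n : ℤ) n, M i j = 2 * d + 1) :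
    Xi n d where
  a i j := (M i j).toNat
  supp i j h := by rw [supp i j h]; rfl
  symm i j := by rw [symm]
  odd := by
    have := h0 0 0
    rw [← Int.odd_coe_nat, Int.toNat_of_nonneg this]
    exact odd
  sum := by
    have : ∀ i j, (((M i j).toNat : ℕ) : ℤ) = M i j := fun i j => Int.toNat_of_nonneg (h0 i j)
    zify
    simp only [this]
    exact sum

/-- The index set of the first formula: `t ∈ ℕ^{[-n,n]}` with `∑ t_i = b` such that
`t_i ≤ a_{h-1,i}` if `h > 1`, and `t_i + t_{-i} ≤ a_{h-1,i}` if `h = 1`. -/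
noncomputable def Xi.checkSet {n d : ℕ} (A : Xi n d) (h : ℤ) (b : ℕ) : Finset (ℤ →₀ ℕ) :=
  {t ∈ (Finset.Icc (-n : ℤ) n).finsuppAntidiag b | ∀ i ∈ Finset.Icc (-n : ℤ) n,
    if h = 1 then t i + t (-i) ≤ A.a (h - 1) i else t i ≤ A.a (h - 1) i}

/-- The index set of the second formula: `t ∈ ℕ^{[-n,n]}` with `∑ t_i = c` such that
`t_i ≤ a_{h,i}`. -/
noncomputable def Xi.hatSet {n d : ℕ} (A : Xi n d) (h : ℤ) (c : ℕ) : Finset (ℤ →₀ ℕ) :=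
  {t ∈ (Finset.Icc (-n : ℤ) n).finsuppAntidiag c | ∀ i ∈ Finset.Icc (-n : ℤ) n, t i ≤ A.a h i}

theorem Xi.check_nonneg {n d : ℕ} (A : Xi n d) {h : ℤ} (h1 : 1 ≤ h) {b : ℕ}
    {t : ℤ →₀ ℕ} (ht : t ∈ A.checkSet h b) (i j : ℤ) :
    0 ≤ (A.a i j : ℤ) + rowE n h t i j - rowE n (h - 1) t i j := by
  have h2 := (Finset.mem_filter.1 ht).2
  rw [rowE_eq, rowE_eq]
  by_cases hj : j ∈ Finset.Icc (-n : ℤ) n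
  · rw [if_pos hj, if_pos hj]
    have hj' : -j ∈ Finset.Icc (-n : ℤ) n := by rw [Finset.mem_Icc] at *; omega
    have a1 := h2 j hj
    have a2 := h2 (-j) hj'
    have a3 := A.symm i j
    by_cases c : h = 1
    · subst c
      simp only [if_true, sub_self, neg_zero] at a1 a2 ⊢
      by_cases ci : i = 0
      · subst ci; simp; omega
      · simp only [ci, if_false]; split_ifs <;> omega
    · rw [if_neg c] at a1 a2
      by_cases ci : i = h - 1
      · subst ci; rw [if_pos rfl, if_neg (show h - 1 ≠ -(h - 1) by omega)]
        split_ifs <;> omega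
      · by_cases ci' : i = -(h - 1)
        · subst ci'; rw [neg_neg] at a3; rw [a3] at a2
          rw [if_pos rfl, if_neg ci]
          split_ifs <;> omega
        · rw [if_neg ci, if_neg ci']; split_ifs <;> omega
  · rw [if_neg hj, if_neg hj]; omega

theorem Xi.hat_nonneg {n d : ℕ} (A : Xi n d) {h : ℤ} (h1 : 1 ≤ h) {c : ℕ}
    {t : ℤ →₀ ℕ} (ht : t ∈ A.hatSet h c) (i j : ℤ) :
    0 ≤ (A.a i j : ℤ) - rowE n h t i j + rowE n (h - 1) t i j := by
  have h2 := (Finset.mem_filter.1 ht).2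
  rw [rowE_eq, rowE_eq]
  by_cases hj : j ∈ Finset.Icc (-n : ℤ) n
  · rw [if_pos hj, if_pos hj]
    have hj' : -j ∈ Finset.Icc (-n : ℤ) n := by rw [Finset.mem_Icc] at *; omega
    have a1 := h2 j hj
    have a2 := h2 (-j) hj'
    have a3 := A.symm i j
    by_cases ci : i = h
    · subst ci; rw [if_pos rfl, if_neg (show i ≠ -i by omega)]
      split_ifs <;> omega
    · by_cases ci' : i = -h
      · subst ci'; rw [neg_neg] at a3; rw [a3] at a2
        rw [if_pos rfl, if_neg ci]
        split_ifs <;> omega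
      · rw [if_neg ci, if_neg ci']; split_ifs <;> omega
  · rw [if_neg hj, if_neg hj]; omega

/-- The matrix `A + ∑_l t_l E_{hl}^θ - ∑_l t_l E_{h-1,l}^θ`. -/
noncomputable def Xi.check {n d : ℕ} (A : Xi n d) {h : ℤ} (h1 : 1 ≤ h) (hn : h ≤ n) {b : ℕ}
    (t : A.checkSet h b) : Xi n d :=
  Xi.ofInt (fun i j => (A.a i j : ℤ) + rowE n h t.1 i j - rowE n (h - 1) t.1 i j)
    (A.check_nonneg h1 t.2)
    (fun i j hij => by
      rw [A.supp i j hij, rowE_supp n (abs_le.2 (by omega)) _ hij,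
        rowE_supp n (abs_le.2 (by omega)) _ hij]
      simp)
    (fun i j => by rw [A.symm, rowE_symm, rowE_symm])
    (by
      have := (Int.odd_coe_nat _).2 A.odd
      exact (this.add_even (rowE_even n h t.1)).sub_even (rowE_even n (h - 1) t.1))
    (by
      simp only [Finset.sum_sub_distrib, Finset.sum_add_distrib]
      rw [rowE_sum n (abs_le.2 (by omega)), rowE_sum n (abs_le.2 (by omega))]
      have := A.sum
      zify at this
      rw [this]; ring)

/-- The matrix `A - ∑_l t_l E_{hl}^θ + ∑_l t_l E_{h-1,l}^θ`. -/
noncomputable def Xi.hat {n d : ℕ} (A : Xi n d) {h : ℤ} (h1 : 1 ≤ h) (hn : h ≤ n) {c : ℕ}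
    (t : A.hatSet h c) : Xi n d :=
  Xi.ofInt (fun i j => (A.a i j : ℤ) - rowE n h t.1 i j + rowE n (h - 1) t.1 i j)
    (A.hat_nonneg h1 t.2)
    (fun i j hij => by
      rw [A.supp i j hij, rowE_supp n (abs_le.2 (by omega)) _ hij,
        rowE_supp n (abs_le.2 (by omega)) _ hij]
      simp)
    (fun i j => by rw [A.symm, rowE_symm, rowE_symm])
    (by
      have := (Int.odd_coe_nat _).2 A.odd
      exact (this.sub_even (rowE_even n h t.1)).add_even (rowE_even n (h - 1) t.1))
    (by
      simp only [Finset.sum_sub_distrib, Finset.sum_add_distrib]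
      rw [rowE_sum n (abs_le.2 (by omega)), rowE_sum n (abs_le.2 (by omega))]
      have := A.sum
      zify at this
      rw [this]; ring)

/-! ### Quantum numbers -/

/-- The fraction field `ℚ(u,v)` of `𝔸`. -/
abbrev LaurK := FractionRing Laur

/-- `u` in the fraction field. -/
noncomputable def uK : LaurK := algebraMap Laur LaurK (uv 1 0)

/-- `v` in the fraction field. -/
noncomputable def vK : LaurK := algebraMap Laur LaurK (uv 0 1)

/-- The bar involution `u ↦ u⁻¹`, `v ↦ v⁻¹` of `𝔸`. -/
noncomputable def barA : Laur ≃+* Laur :=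
  (AddMonoidAlgebra.mapDomainRingEquiv ℤ (AddEquiv.neg (ℤ × ℤ)) :
    AddMonoidAlgebra ℤ (ℤ × ℤ) ≃+* AddMonoidAlgebra ℤ (ℤ × ℤ))

theorem barA_uv (a b : ℤ) : barA (uv a b) = uv (-a) (-b) := by
  refine (AddMonoidAlgebra.mapDomain_single (R := ℤ)).trans rfl

/-- The bar involution on the fraction field. -/
noncomputable def bar : LaurK ≃+* LaurK := IsFractionRing.ringEquivOfRingEquiv barA

/-- `[a] = (v^{2a} - 1) / (v² - 1)`. -/
noncomputable def qnum (a : ℤ) : LaurK := (vK ^ (2 * a) - 1) / (vK ^ 2 - 1)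

/-- `[t]! = [1][2]⋯[t]`. -/
noncomputable def qfact (t : ℕ) : LaurK := ∏ k ∈ Finset.Icc 1 t, qnum k

/-- `[2t]_𝔠 = [t] (u² v^{2(t-1)} + 1)`. -/
noncomputable def cnum (t : ℕ) : LaurK := qnum t * (uK ^ 2 * vK ^ (2 * ((t : ℤ) - 1)) + 1)

/-- `[t]_𝔠^! = [2]_𝔠 [4]_𝔠 ⋯ [2t]_𝔠`. -/
noncomputable def cfact (t : ℕ) : LaurK := ∏ k ∈ Finset.Icc 1 t, cnum k

/-- The quantum binomial `∏_{i=1}^b (v^{2(a-i+1)} - 1) / (v^{2i} - 1)`. -/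
noncomputable def qbinom (a : ℤ) (b : ℕ) : LaurK :=
  ∏ i ∈ Finset.Icc 1 b, (vK ^ (2 * (a - i + 1)) - 1) / (vK ^ (2 * i) - 1)

/-! ### The exponents -/

/-- The exponent `β(t)`. -/
noncomputable def Xi.beta {n d : ℕ} (A : Xi n d) (h : ℤ) (t : ℤ →₀ ℕ) : ℤ :=
  let I := Finset.Icc (-n : ℤ) n
  (∑ l ∈ I, ∑ k ∈ I with k ≤ l, (t l : ℤ) * A.a h k)
    - (∑ l ∈ I, ∑ k ∈ I with k < l, (t l : ℤ) * ((A.a (h - 1) k : ℤ) - t k))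
    + if h = 1 then
        (∑ l ∈ I, ∑ k ∈ I with -l < k ∧ k < l, (t l : ℤ) * t k)
          + ∑ l ∈ I with 0 < l, (t l : ℤ) * ((t l : ℤ) + 3) / 2
      else 0

/-- The exponent `β'(t)`. -/
noncomputable def Xi.beta' {n d : ℕ} (A : Xi n d) (h : ℤ) (t : ℤ →₀ ℕ) : ℤ :=
  let I := Finset.Icc (-n : ℤ) n
  (∑ l ∈ I, ∑ k ∈ I with l ≤ k, (t l : ℤ) * A.a (h - 1) k)
    - ∑ l ∈ I, ∑ k ∈ I with l < k, (t l : ℤ) * ((A.a h k : ℤ) - t k)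

/-- The exponent `β''(t)`. -/
noncomputable def Xi.beta'' {n d : ℕ} (A : Xi n d) (t : ℤ →₀ ℕ) : ℤ :=
  let I := Finset.Icc (-n : ℤ) n
  (∑ l ∈ I, ∑ k ∈ I with l ≤ k, (t l : ℤ) * A.a 0 k)
    - (∑ l ∈ I, ∑ k ∈ I with l < k, (t l : ℤ) * ((A.a 1 k : ℤ) - t k))
    + (∑ l ∈ I, ∑ k ∈ I with l < k ∧ k ≤ -l, (t l : ℤ) * t k)
    + ∑ l ∈ I with l ≤ 0, (t l : ℤ) * ((t l : ℤ) - 3) / 2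

end SchurBC

open SchurBC

/-!
Let `λ' = ro(B)`, `λ = co(B) = ro(A)` and `μ = co(A)`. Since `B` is diagonal up to the entries of
`b E_{k,m}^θ`, the blocks of `λ'` and `λ` differ only by an interval `E` of `b` elements (and `-E`)
that moves from the block `k` of `λ'` to the adjacent block `m` of `λ` (`IsStep.exists_strip`).
Hence the double coset of `B` contains `1`, and its sum factors as `T_{B} = (∑ T_w) x_λ`, where `w`
ranges over the shortest representatives of `W_{λ'} / (W_{λ'} ∩ W_λ)` (`IsStrip.TX_coset`). So `e_B e_A`
sends `x_μ` to `(∑ T_w) T_{A}`. Its coefficients are computed at the shortest representatives `x` of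
`W_{λ'} \ W`, where `T_w` acts by translation up to the weight `q_w`: the coefficient at `x` is the sum
of the `q_w` such that `w⁻¹ x` lies in the double coset of `A` (`repr_heckeT_mul`, `eq_of_repr_eq`).

The map `w ↦ S = w(E)` is a bijection from these `w` onto the subsets `S` of the block `R_k^{λ'}` with
`b` elements and `S ∩ -S = ∅` (`IsStrip.sum_reps`). The matrix of `w⁻¹ x` arises from that of `x` by
moving `t_j = |S ∩ x R_j^μ|` entries of column `j` between the rows `h` and `h - 1`
(`kappa_inv_mul`), so the summand at `t` collects the `S` of content `t`, and `q_w` becomes a count of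
inversions of `S` (`IsStrip.weight_lt`, `IsStrip.weight_gt`, `IsStrip.weight_zero`). As `x⁻¹` is
increasing on the block, it remains to sum `q` over the subsets of an interval that meet the
consecutive fibres of a monotone map in `t_j` elements. For `k > 0` this gives a power of `v` times
quantum binomial coefficients (`sum_powerset_inversions`). For `k = 0` the block is symmetric, and
removing its extreme pair `±N` yields a recursion which shows that the sum is a monomial times a
`𝔠`-binomial coefficient for the fibre over `0` and quantum trinomial coefficients for the others
(`sum_isotropic`).

For the normalization by `[A] = u^{-ℓ̂_𝔠(A)} v^{-ℓ̂_𝔞(A)} e_A`, let `M(X, Y) = ∑ X_{ij} Y_{xy}` over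
`x ≤ i`, `j < y`, a bilinear form that is symmetric on centrally symmetric matrices. Then
`2 ℓ̂_𝔞(A) = M(A, A) - 3 ℓ̂_𝔠(A)` (`Xi.lhata_eq`), so the change of the exponent from `A` to the matrix
of the summand is an explicit quadratic polynomial in `t` (`IsStep.lhata_sub`). The bar involution
turns each quantum coefficient into a monomial times itself (`gauss_eq_bar`, `isoGen_eq_bar`), and
comparing monomials gives the exponents `β`, `β'`, `β''` (`beta_eq`, `beta'_eq`, `beta''_eq`). The
coefficients lie in `𝔸` since the quantum coefficients do, by their Pascal recursions.
-/

namespace SchurBC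

open Finset

/-! ### The weights `q_w` -/

/-- The sign changes of `w`, which are counted by the simple reflection `s₀`. -/
noncomputable def signChanges {d : ℕ} (w : W d) : Finset ℤ :=
  {q ∈ Icc (1 : ℤ) d | w.1 q < 0}

/-- The inversions of `w` that are counted by the simple reflections `sᵢ` with `i ≥ 1`: one
representative `(p, q)` with `|p| < q` from each pair `{(p, q), (-q, -p)}`, where `p ≠ 0`. -/
noncomputable def inversions {d : ℕ} (w : W d) : Finset (ℤ × ℤ) :=
  {z ∈ Icc (-d : ℤ) d ×ˢ Icc (1 : ℤ) d | z.1 ≠ 0 ∧ |z.1| < z.2 ∧ w.1 z.2 < w.1 z.1}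

/-- The weight `q_w = u^{2a} v^{2b}`, where a reduced word of `w` contains `s₀` `a` times and the
other simple reflections `b` times; it is defined here by counting sign changes and inversions. -/
noncomputable def weight {d : ℕ} (w : W d) : Laur :=
  uv (2 * #(signChanges w)) (2 * #(inversions w))

theorem W_inv_apply {d : ℕ} (w : W d) (p : ℤ) : (w⁻¹).1 (w.1 p) = p := w.1.symm_apply_apply p

theorem W_apply_inv {d : ℕ} (w : W d) (p : ℤ) : w.1 ((w⁻¹).1 p) = p := w.1.apply_symm_apply p

theorem W_mul_apply {d : ℕ} (w w' : W d) (p : ℤ) : (w * w').1 p = w.1 (w'.1 p) := rfl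

theorem W_one_apply {d : ℕ} (p : ℤ) : (1 : W d).1 p = p := rfl

theorem W_inj {d : ℕ} (w : W d) {p q : ℤ} : w.1 p = w.1 q ↔ p = q := w.1.injective.eq_iff

theorem W_eq_zero {d : ℕ} (w : W d) {p : ℤ} : w.1 p = 0 ↔ p = 0 := by
  rw [← W_zero w, W_inj, W_zero]

theorem weight_one {d : ℕ} : weight (1 : W d) = 1 := by
  have h1 : signChanges (1 : W d) = ∅ := by
    refine filter_eq_empty_iff.2 fun q hq => ?_
    rw [mem_Icc] at hq
    rw [W_one_apply]
    omega
  have h2 : inversions (1 : W d) = ∅ := by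
    refine filter_eq_empty_iff.2 fun z _ => ?_
    rw [W_one_apply, W_one_apply]
    rintro ⟨_, h, h'⟩
    have := abs_lt.1 h
    omega
  rw [weight, h1, h2]; simp [uv_zero]

theorem weight_s_zero_mul {d : ℕ} {w : W d} {i : Fin d} (hi : (i : ℕ) = 0) (h : asc w⁻¹ i) :
    #(signChanges (s i * w)) = #(signChanges w) + 1 ∧
      #(inversions (s i * w)) = #(inversions w) := by
  have hd := i.2
  simp only [asc, hi, Nat.cast_zero, zero_add, W_zero] at h
  set a := (w⁻¹).1 1 with ha
  have hwa : w.1 a = 1 := W_apply_inv w 1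
  have had : a ≤ d := by
    have := W_abs w⁻¹ (p := 1) (by rw [abs_one]; omega)
    exact (abs_le.1 this).2
  have key : ∀ p, w.1 p = 1 ↔ p = a := fun p => by rw [← hwa, W_inj]
  have key' : ∀ p, w.1 p = -1 ↔ p = -a := fun p => by rw [← hwa, ← W_neg, W_inj]
  constructor
  · have : signChanges (s i * w) = insert a (signChanges w) := by
      ext q
      simp only [signChanges, mem_filter, mem_Icc, mem_insert, W_mul_apply, s_zero hi, key, key']
      by_cases h1 : q = a
      · subst h1; simp; omega
      · by_cases h2 : q = -a
        · omega
        · simp [h1, h2]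
    rw [this, card_insert_of_notMem]
    simp [signChanges, hwa]
  · congr 1
    ext ⟨p, q⟩
    simp only [inversions, mem_filter, mem_product, mem_Icc, W_mul_apply, s_zero hi]
    refine and_congr_right fun _ => and_congr_right fun hp => and_congr_right fun hpq => ?_
    have := abs_lt.1 hpq
    have h0 := W_eq_zero w (p := p)
    have h0' := W_eq_zero w (p := q)
    have h1 : w.1 p ≠ w.1 q := fun h => by rw [W_inj] at h; omega
    have h2 : w.1 p ≠ -w.1 q := fun h => by rw [← W_neg, W_inj] at h; omega
    split_ifs <;> omega

theorem weight_s_pos_mul {d : ℕ} {w : W d} {i : Fin d} (hi : 0 < (i : ℕ)) (h : asc w⁻¹ i) :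
    #(signChanges (s i * w)) = #(signChanges w) ∧
      #(inversions (s i * w)) = #(inversions w) + 1 := by
  have hd := i.2
  simp only [asc] at h
  set k : ℤ := ((i : ℕ) : ℤ) with hk
  have hk0 : 0 < k := by omega
  set a := (w⁻¹).1 k with ha
  set b := (w⁻¹).1 (k + 1) with hb
  have hwa : w.1 a = k := W_apply_inv w k
  have hwb : w.1 b = k + 1 := W_apply_inv w (k + 1)
  have hab : |a| ≤ d := W_abs w⁻¹ (by rw [abs_le]; omega)
  have hbb : |b| ≤ d := W_abs w⁻¹ (by rw [abs_le]; omega)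
  rw [abs_le] at hab hbb
  have ka : ∀ p, w.1 p = k ↔ p = a := fun p => by rw [← hwa, W_inj]
  have kb : ∀ p, w.1 p = k + 1 ↔ p = b := fun p => by rw [← hwb, W_inj]
  have ka' : ∀ p, w.1 p = -k ↔ p = -a := fun p => by rw [← hwa, ← W_neg, W_inj]
  have kb' : ∀ p, w.1 p = -k - 1 ↔ p = -b := fun p => by
    rw [show -k - 1 = -(k + 1) by ring, ← hwb, ← W_neg, W_inj]
  have e : ∀ p, (s i * w).1 p = if w.1 p = k then k + 1 else if w.1 p = k + 1 then k else
      if w.1 p = -k then -k - 1 else if w.1 p = -k - 1 then -k else w.1 p := fun p => by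
    rw [W_mul_apply, s_pos hi]
  have ha0 : a ≠ 0 := fun h => by rw [h, W_zero] at hwa; omega
  have hb0 : b ≠ 0 := fun h => by rw [h, W_zero] at hwb; omega
  have hne : a ≠ -b := fun h => by rw [h, W_neg] at hwa; omega
  constructor
  · congr 1
    ext q
    simp only [signChanges, mem_filter, mem_Icc, e]
    refine and_congr_right fun _ => ?_
    split_ifs <;> omega
  · -- the new inversion is one of `(a, b)` and `(-b, -a)`, namely the one with `|p| < q`
    have : inversions (s i * w) = insert (if |a| < b then (a, b) else (-b, -a)) (inversions w) := by
      ext ⟨p, q⟩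
      simp only [inversions, mem_filter, mem_product, mem_Icc, e, mem_insert, abs_lt]
      constructor
      · rintro ⟨h1, hp, hpq, hw⟩
        by_cases c : w.1 q < w.1 p
        · exact Or.inr ⟨h1, hp, hpq, c⟩
        · left
          have hc1 := ka p
          have hc2 := kb q
          have hc3 := ka' q
          have hc4 := kb' p
          have hne1 : w.1 p ≠ w.1 q := fun h => by rw [W_inj] at h; omega
          have : (w.1 p = k ∧ w.1 q = k + 1) ∨ (w.1 p = -k - 1 ∧ w.1 q = -k) := by
            clear ka kb ka' kb' e hc1 hc2 hc3 hc4
            split_ifs at hw <;> omega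
          rcases this with ⟨x1, x2⟩ | ⟨x1, x2⟩
          · have y1 := hc1.1 x1
            have y2 := hc2.1 x2
            rw [if_pos (by omega), y1, y2]
          · have y1 := hc4.1 x1
            have y2 := hc3.1 x2
            rw [if_neg (by omega), y1, y2]
      · rintro (h1 | ⟨h1, hp, hpq, hw⟩)
        · split_ifs at h1 with c
          · obtain ⟨rfl, rfl⟩ := Prod.mk.inj h1
            rw [hwa, hwb]
            refine ⟨by omega, ha0, c, ?_⟩
            split_ifs <;> omega
          · obtain ⟨rfl, rfl⟩ := Prod.mk.inj h1
            rw [W_neg, W_neg, hwa, hwb]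
            refine ⟨by omega, by omega, by omega, ?_⟩
            split_ifs <;> omega
        · refine ⟨h1, hp, hpq, ?_⟩
          have c1 : ¬ (w.1 q = k ∧ w.1 p = k + 1) := by rw [ka, kb]; omega
          have c2 : ¬ (w.1 q = -k - 1 ∧ w.1 p = -k) := by rw [ka', kb']; omega
          clear ka kb ka' kb' e
          split_ifs <;> omega
    rw [this, card_insert_of_notMem]
    simp only [inversions, mem_filter, not_and]
    intro _ _ _
    split_ifs
    · simp only; omega
    · simp only [W_neg]; omega

/-- `q_{sᵢ w} = qᵢ q_w` if `ℓ(sᵢ w) > ℓ(w)`. -/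
theorem weight_s_mul {d : ℕ} {w : W d} {i : Fin d} (h : asc w⁻¹ i) :
    weight (s i * w) = qpar i * weight w := by
  rcases Nat.eq_zero_or_pos (i : ℕ) with hi | hi
  · obtain ⟨e1, e2⟩ := weight_s_zero_mul hi h
    rw [weight, weight, e1, e2, qpar, if_pos hi, uv_mul]
    congr 1 <;> push_cast <;> ring
  · obtain ⟨e1, e2⟩ := weight_s_pos_mul hi h
    rw [weight, weight, e1, e2, qpar, if_neg hi.ne', uv_mul]
    congr 1 <;> push_cast <;> ring

/-! ### Coefficients with respect to the basis `T_w` -/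

theorem gen_mul_of_not_asc {d : ℕ} {i : Fin d} {w : W d} (h : ¬ asc w⁻¹ i) :
    gen i * heckeT d w = (qpar i - 1) • heckeT d w + qpar i • heckeT d (s i * w) :=
  ev_injective d (by
    rw [ev_gen_mul, ev_heckeT, Lop_not h, map_add, map_smul, map_smul, ev_heckeT, ev_heckeT])

open Classical in
theorem repr_gen_mul {d : ℕ} (i : Fin d) (z : Hecke d) (x : W d) :
    (heckeT d).repr (gen i * z) x = if asc x⁻¹ i then qpar i * (heckeT d).repr z (s i * x)
      else (heckeT d).repr z (s i * x) + (qpar i - 1) * (heckeT d).repr z x := by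
  let F : Hecke d →ₗ[Laur] Laur :=
    (Finsupp.lapply x ∘ₗ (heckeT d).repr.toLinearMap) ∘ₗ LinearMap.mulLeft Laur (gen i)
  let G : Hecke d →ₗ[Laur] Laur :=
    if asc x⁻¹ i then qpar i • (Finsupp.lapply (s i * x) ∘ₗ (heckeT d).repr.toLinearMap)
    else (Finsupp.lapply (s i * x) ∘ₗ (heckeT d).repr.toLinearMap) +
      (qpar i - 1) • (Finsupp.lapply x ∘ₗ (heckeT d).repr.toLinearMap)
  have hFG : F = G := by
    refine (heckeT d).ext fun w => ?_
    have hG : G (heckeT d w) = if asc x⁻¹ i then qpar i * (heckeT d).repr (heckeT d w) (s i * x)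
      else (heckeT d).repr (heckeT d w) (s i * x) +
        (qpar i - 1) * (heckeT d).repr (heckeT d w) x := by
      simp only [G]; split_ifs <;> rfl
    have hF : F (heckeT d w) = (heckeT d).repr (gen i * heckeT d w) x := rfl
    rw [hF, hG]
    have hsx : w = s i * x ↔ s i * w = x :=
      ⟨fun h => by rw [h, s_mul_cancel], fun h => by rw [← h, s_mul_cancel]⟩
    have hasc := asc_inv_s_mul w i
    by_cases hw : asc w⁻¹ i
    · rw [gen_mul_of_asc hw]
      simp only [Module.Basis.repr_self, Finsupp.single_apply, hsx]
      by_cases h1 : s i * w = x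
      · have h2 : w ≠ x := by
          rintro rfl
          rw [h1] at hasc
          tauto
        have h3 : ¬ asc x⁻¹ i := by rw [← h1]; tauto
        simp [h1, h2, h3]
      · by_cases h2 : w = x
        · subst h2; simp [h1, hw]
        · simp [h1, h2]
    · rw [gen_mul_of_not_asc hw]
      simp only [map_add, map_smul, Finsupp.add_apply, Finsupp.smul_apply,
        Module.Basis.repr_self, Finsupp.single_apply, hsx, smul_eq_mul]
      by_cases h1 : s i * w = x
      · have h2 : w ≠ x := by
          rintro rfl
          rw [h1] at hasc
          tauto
        have h3 : asc x⁻¹ i := by rw [← h1]; tauto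
        simp [h1, h2, h3]
      · by_cases h2 : w = x
        · subst h2; simp [h1, hw]
        · simp [h1, h2]
  have := LinearMap.congr_fun hFG z
  simp only [G] at this
  split_ifs at this ⊢ <;> exact this

/-- Left multiplication by `T_w` is adjoint to left multiplication by `T_{w⁻¹}`; hence the
coefficient of `T_x` in `T_w z` is `q_w` times that of `T_{w⁻¹x}` in `z` if lengths add. -/
theorem repr_heckeT_mul {d : ℕ} (w : W d) : ∀ (x : W d) (z : Hecke d),
    len (w⁻¹ * x) = len w + len x →
      (heckeT d).repr (heckeT d w * z) x = weight w * (heckeT d).repr z (w⁻¹ * x) := by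
  induction w using induct_len' with
  | h1 => intro x z _; simp [heckeT_one, weight_one]
  | h w i hw ih =>
    intro x z hl
    have h1 := len_s_mul_of_asc hw
    rw [mul_inv_rev, s_inv, mul_assoc] at hl ⊢
    have h2 := len_mul_le w⁻¹ (s i * x)
    rw [len_inv] at h2
    have h5 : asc x⁻¹ i := by
      by_contra h5
      have := len_s_mul_of_not h5
      omega
    have h6 := len_s_mul_of_asc h5
    rw [← gen_mul_of_asc hw, mul_assoc, repr_gen_mul, if_pos h5, ih _ _ (by omega),
      weight_s_mul hw, mul_assoc]

open Classical in
theorem repr_TX {d : ℕ} (X : Set (W d)) (x : W d) :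
    (heckeT d).repr (TX X) x = if x ∈ X then 1 else 0 := by
  rw [TX, map_sum, Finsupp.finsetSum_apply]
  simp [Finsupp.single_apply, Finset.sum_ite_eq']

theorem gen_mul_TX {d : ℕ} {i : Fin d} {X : Set (W d)} (hX : ∀ w ∈ X, s i * w ∈ X) :
    gen i * TX X = qpar i • TX X := by
  have hX' : ∀ w, s i * w ∈ X ↔ w ∈ X := fun w =>
    ⟨fun h => by have := hX _ h; rwa [s_mul_cancel] at this, hX w⟩
  apply (heckeT d).repr.injective
  ext x
  rw [repr_gen_mul, map_smul, Finsupp.smul_apply, repr_TX, repr_TX, smul_eq_mul]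
  by_cases h : x ∈ X
  · rw [if_pos h, if_pos ((hX' x).2 h)]
    split_ifs <;> ring
  · rw [if_neg h, if_neg (fun h' => h ((hX' x).1 h'))]
    split_ifs <;> ring

/-- Two elements on which `W_λ` acts by the index character agree if their coefficients agree at
the shortest representatives of `W_λ \ W`. -/
theorem eq_of_repr_eq {n d : ℕ} {l : Ld n d} {z z' : Hecke d}
    (hz : ∀ i, s i ∈ l.par → gen i * z = qpar i • z)
    (hz' : ∀ i, s i ∈ l.par → gen i * z' = qpar i • z')
    (h : ∀ x : W d, l.basc x⁻¹ → (heckeT d).repr z x = (heckeT d).repr z' x) : z = z' := by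
  have step : ∀ (z : Hecke d) (i : Fin d) (x : W d), gen i * z = qpar i • z → ¬ asc x⁻¹ i →
      (heckeT d).repr z (s i * x) = (heckeT d).repr z x := by
    intro z i x hz hx
    have := congrArg (fun y => (heckeT d).repr y x) hz
    simp only [repr_gen_mul, if_neg hx, map_smul, Finsupp.smul_apply, smul_eq_mul] at this
    linear_combination this
  apply (heckeT d).repr.injective
  ext x
  induction hn : len x using Nat.strong_induction_on generalizing x with
  | _ m ih =>
    by_cases hx : l.basc x⁻¹
    · exact h x hx
    · simp only [Ld.basc, not_forall] at hx
      obtain ⟨i, k, h1, h2, h3⟩ := hx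
      have hi := l.s_mem i k h1 h2
      have := len_s_mul_of_not h3
      rw [← step z i x (hz i hi) h3, ← step z' i x (hz' i hi) h3]
      exact ih _ (by omega) _ rfl

/-! ### Products in the Schur algebra -/

theorem Ld.mem_xH {n d : ℕ} {l : Ld n d} {z : Hecke d} (hz : z ∈ l.xH) : ∃ c, z = l.x * c := by
  obtain ⟨c, rfl⟩ := Submodule.mem_span_singleton.1 hz
  exact ⟨c.unop, rfl⟩

theorem Xi.phi_apply {n d : ℕ} (A : Xi n d) (z : A.co.xH) (c : Hecke d)
    (hz : (z : Hecke d) = A.co.x * c) : (A.phi z : Hecke d) = TX A.coset * c := by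
  have e : z = MulOpposite.op c • A.co.gen := Subtype.ext hz
  rw [e, map_smul, ← A.phi_gen]
  rfl

open Classical in
theorem Xi.e_apply {n d : ℕ} (A : Xi n d) (z : TensorMod n d) (c : Hecke d)
    (hz : (z A.co : Hecke d) = A.co.x * c) (r : Ld n d) :
    ((A.e z) r : Hecke d) = if r = A.ro then TX A.coset * c else 0 := by
  have h1 : A.e z = DirectSum.lof (Hecke d)ᵐᵒᵖ (Ld n d) (fun l => l.xH) A.ro
      (A.phi (z A.co)) := rfl
  rw [h1, DirectSum.lof_eq_of]
  split_ifs with h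
  · subst h
    rw [DirectSum.of_eq_same, A.phi_apply _ c hz]
  · rw [DirectSum.of_eq_of_ne _ _ _ h]
    rfl

theorem TensorMod_ext {n d : ℕ} {z z' : TensorMod n d}
    (h : ∀ r, (z r : Hecke d) = (z' r : Hecke d)) : z = z' :=
  DFinsupp.ext fun r => Subtype.ext (h r)

theorem coe_smul_apply {n d : ℕ} (c : Laur) (z : TensorMod n d) (r : Ld n d) :
    ((c • z) r : Hecke d) = c • (z r : Hecke d) := rfl

theorem coe_sum_apply {n d : ℕ} {ι : Type*} (s : Finset ι) (z : ι → TensorMod n d) (r : Ld n d) :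
    ((∑ i ∈ s, z i) r : Hecke d) = ∑ i ∈ s, (z i r : Hecke d) := by
  rw [DFinsupp.finsetSum_apply, Submodule.coe_sum]

/-- The product formula in the Schur algebra that results from a formula in the Hecke algebra: if
`T_Y = y x_λ` for the double coset `Y` of `B`, then `e_B e_A` is determined by `y T_X` for the
double coset `X` of `A`. -/
theorem Xi.std_mul_std {n d : ℕ} {A B : Xi n d} (hBA : B.co = A.ro) {ι : Type*} [Fintype ι]
    (A' : ι → Xi n d) (hro : ∀ t, (A' t).ro = B.ro) (hco : ∀ t, (A' t).co = A.co)
    (y : Hecke d) (hy : TX B.coset = y * A.ro.x) (c γ : ι → Laur)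
    (h : y * TX A.coset = ∑ t, c t • TX (A' t).coset)
    (hγ : ∀ t, γ t * uv (-(A' t).lhatc) (-(A' t).lhata) =
      uv (-B.lhatc) (-B.lhata) * uv (-A.lhatc) (-A.lhata) * c t) :
    B.std * A.std = ∑ t, γ t • (A' t).std := by
  classical
  refine LinearMap.ext fun z => TensorMod_ext fun r => ?_
  obtain ⟨a, ha⟩ := Ld.mem_xH (z A.co).2
  obtain ⟨k, hk⟩ := TX_left A.ro A.coset (by
    rintro x hx w ⟨g, hg, hκ, y, hy, z, hz, rfl⟩
    exact ⟨g, hg, hκ, x * y, A.ro.par.mul_mem hx hy, z, hz, by simp only [mul_assoc]⟩)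
  have h1 : ((A.std z) B.co : Hecke d) = B.co.x * (uv (-A.lhatc) (-A.lhata) • (k * a)) := by
    change ((uv (-A.lhatc) (-A.lhata) • A.e z) B.co : Hecke d) = _
    rw [coe_smul_apply, A.e_apply z a ha, hBA, if_pos rfl, hk, mul_smul_comm, mul_assoc]
  have h2 : (((B.std * A.std) z) r : Hecke d) = uv (-B.lhatc) (-B.lhata) • ((B.e (A.std z)) r : Hecke d) :=
    rfl
  rw [h2, B.e_apply _ _ h1, LinearMap.sum_apply, coe_sum_apply]
  have h3 : ∀ t, (((γ t • (A' t).std) z) r : Hecke d) =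
      if r = B.ro then (γ t * uv (-(A' t).lhatc) (-(A' t).lhata)) • (TX (A' t).coset * a) else 0 := by
    intro t
    change γ t • uv (-(A' t).lhatc) (-(A' t).lhata) • (((A' t).e z) r : Hecke d) = _
    have hz : (z (A' t).co : Hecke d) = (A' t).co.x * a := by rw [hco]; exact ha
    rw [(A' t).e_apply z a hz, hro, smul_smul]
    split_ifs
    · rfl
    · rw [smul_zero]
  simp only [h3]
  split_ifs
  · simp only [hγ, mul_smul _ (c _)]
    rw [← Finset.smul_sum]
    simp only [← smul_mul_assoc]
    rw [← Finset.sum_mul, ← h, hk, hy]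
    simp only [mul_smul_comm, smul_mul_assoc, smul_smul, mul_assoc]
    rw [mul_comm (uv (-A.lhatc) _)]
  · simp

/-! ### Double cosets and the matrices `κ(λ, g, μ)` -/

theorem kappa_eq {n d : ℕ} (l : Ld n d) (g : W d) (m : Ld n d) (i j : ℤ) :
    kappa l g m i j = #{p ∈ l.R i | (g⁻¹).1 p ∈ m.R j} := by
  rw [kappa]
  congr 1
  ext p
  simp only [mem_inter, mem_image, mem_filter]
  refine and_congr_right fun _ => ⟨?_, fun h => ⟨_, h, W_apply_inv g p⟩⟩
  rintro ⟨q, hq, rfl⟩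
  rwa [W_inv_apply]

theorem kappa_mul {n d : ℕ} {l m : Ld n d} {x y : W d} (hx : x ∈ l.par) (hy : y ∈ m.par) (g : W d) :
    kappa l (x * g * y) m = kappa l g m := by
  funext i j
  rw [kappa_eq, kappa_eq]
  have h1 : ∀ p, ((x * g * y)⁻¹).1 p ∈ m.R j ↔ (g⁻¹).1 ((x⁻¹).1 p) ∈ m.R j := fun p => by
    rw [mul_inv_rev, mul_inv_rev]
    exact (m.par.inv_mem hy) j _
  refine card_nbij' (fun p => (x⁻¹).1 p) (fun p => x.1 p) ?_ ?_ ?_ ?_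
  · intro p hp
    simp only [coe_filter, Set.mem_ofPred_eq, h1] at hp ⊢
    exact ⟨((l.par.inv_mem hx) i p).2 hp.1, hp.2⟩
  · intro p hp
    simp only [coe_filter, Set.mem_ofPred_eq, h1, W_inv_apply] at hp ⊢
    exact ⟨(hx i p).2 hp.1, hp.2⟩
  · intro p _
    exact W_apply_inv x p
  · intro p _
    exact W_inv_apply x p

theorem Ld.basc_of_mem_D {n d : ℕ} {l : Ld n d} {g : W d} (hg : g ∈ l.D) : l.basc g⁻¹ := by
  intro i k h1 h2
  by_contra h
  have a := len_s_mul_of_not h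
  have b := hg (s i) (l.s_mem i k h1 h2)
  omega

/-- The elements of smallest length in a double coset lie in `D_{λμ}`. -/
theorem exists_mem_DD {n d : ℕ} (l m : Ld n d) (w : W d) :
    ∃ x ∈ l.par, ∃ y ∈ m.par, x * w * y ∈ DD l m := by
  obtain ⟨⟨x, y⟩, ⟨hx, hy⟩, hmin⟩ := Set.exists_min_image
    {z : W d × W d | z.1 ∈ l.par ∧ z.2 ∈ m.par} (fun z => len (z.1 * w * z.2))
    (Set.toFinite _) ⟨(1, 1), l.par.one_mem, m.par.one_mem⟩
  refine ⟨x, hx, y, hy, Ld.mem_D fun i k h1 h2 => ?_, Ld.mem_D fun i k h1 h2 => ?_⟩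
  · by_contra h
    have a := len_s_mul_of_not h
    have b := hmin (s i * x, y) ⟨l.par.mul_mem (l.s_mem i k h1 h2) hx, hy⟩
    simp only [mul_assoc] at a b
    omega
  · rw [inv_inv]
    by_contra h
    have a := len_of_not_asc _ _ h
    have b := hmin (x, y * s i) ⟨hx, m.par.mul_mem hy (m.s_mem i k h1 h2)⟩
    simp only [mul_assoc] at a b
    omega

theorem Xi.mem_coset {n d : ℕ} (A : Xi n d) (w : W d) : w ∈ A.coset ↔ kappa A.ro w A.co = A.a := by
  constructor
  · rintro ⟨g, _, hk, x, hx, y, hy, rfl⟩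
    rw [kappa_mul hx hy, hk]
  · intro h
    obtain ⟨x, hx, y, hy, hg⟩ := exists_mem_DD A.ro A.co w
    refine ⟨_, hg, by rw [kappa_mul hx hy, h], x⁻¹, A.ro.par.inv_mem hx, y⁻¹, A.co.par.inv_mem hy, ?_⟩
    simp only [mul_assoc, inv_mul_cancel_left, mul_inv_cancel, mul_one]

theorem TX_coset_left {n d : ℕ} (A : Xi n d) {i : Fin d} (hi : s i ∈ A.ro.par) :
    gen i * TX A.coset = qpar i • TX A.coset := by
  refine gen_mul_TX fun w hw => ?_
  rw [A.mem_coset] at hw ⊢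
  have := kappa_mul (n := n) (l := A.ro) (m := A.co) hi A.co.par.one_mem w
  rw [mul_one] at this
  rw [this, hw]

/-- `T_X = (∑ T_g) x_λ`, where `g` ranges over the shortest representatives of `X / W_λ`. -/
theorem TX_right_eq {n d : ℕ} (l : Ld n d) (X : Set (W d)) (Y : Finset (W d))
    (hY : ∀ g, g ∈ Y → g⁻¹ ∈ l.D) (hX : ∀ w, w ∈ X ↔ ∃ g ∈ Y, ∃ x ∈ l.par, w = g * x) :
    TX X = (∑ g ∈ Y, heckeT d g) * l.x := by
  classical
  simp only [Ld.x, TX]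
  rw [Finset.sum_mul_sum, ← Finset.sum_product']
  symm
  refine Finset.sum_bij (fun p _ => p.1 * p.2) ?_ ?_ ?_ ?_
  · rintro ⟨g, x⟩ h
    simp at h ⊢
    exact (hX _).2 ⟨g, h.1, x, h.2, rfl⟩
  · rintro ⟨g, x⟩ h ⟨g', x'⟩ h' e
    simp at h h' e
    have e' : x' * x⁻¹ * g⁻¹ = g'⁻¹ := by
      rw [mul_assoc, ← mul_inv_rev, e, mul_inv_rev, mul_inv_cancel_left]
    have := Ld.D_unique (l.par.mul_mem h'.2 (l.par.inv_mem h.2)) (hY _ h.1) (e' ▸ hY _ h'.1)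
    have hx : x = x' := (mul_inv_eq_one.1 this).symm
    subst hx
    simpa using e
  · intro w hw
    simp at hw
    obtain ⟨g, hg, x, hx, rfl⟩ := (hX w).1 hw
    exact ⟨(g, x), by simpa using ⟨hg, hx⟩, rfl⟩
  · rintro ⟨g, x⟩ h
    simp at h
    refine heckeT_mul g x ?_
    have := hY _ h.1 x⁻¹ (l.par.inv_mem h.2)
    rw [← mul_inv_rev, len_inv, len_inv, len_inv] at this
    rw [this, add_comm]

/-! ### The order of the blocks -/

theorem Ld.mem_R_pos {n d : ℕ} (l : Ld n d) {i p : ℤ} (hi : 0 < i) :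
    p ∈ l.R i ↔ l.cum (i - 1) < p ∧ p ≤ l.cum i := by
  rw [Ld.R, if_pos hi, mem_Icc]; omega

theorem Ld.mem_R_zero {n d : ℕ} (l : Ld n d) {p : ℤ} :
    p ∈ l.R 0 ↔ -l.cum 0 ≤ p ∧ p ≤ l.cum 0 := by
  rw [Ld.R, if_neg (by omega), if_pos rfl, mem_Icc]

theorem Ld.R_lt_of_nonneg {n d : ℕ} (l : Ld n d) {i j p q : ℤ} (hi : 0 ≤ i) (hij : i < j)
    (hp : p ∈ l.R i) (hq : q ∈ l.R j) : p < q := by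
  rw [l.mem_R_pos (by omega)] at hq
  have := l.cum_mono (show i ≤ j - 1 by omega)
  rcases hi.eq_or_lt with rfl | hi
  · rw [l.mem_R_zero] at hp; omega
  · rw [l.mem_R_pos hi] at hp; omega

theorem Ld.R_lt {n d : ℕ} (l : Ld n d) {i j p q : ℤ} (hij : i < j)
    (hp : p ∈ l.R i) (hq : q ∈ l.R j) : p < q := by
  have n1 : -p ∈ l.R (-i) := by rwa [l.R_neg, neg_neg]
  have n2 : -q ∈ l.R (-j) := by rwa [l.R_neg, neg_neg]
  rcases le_or_gt 0 i with hi | hi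
  · exact l.R_lt_of_nonneg hi hij hp hq
  · rcases le_or_gt j 0 with hj | hj
    · have := l.R_lt_of_nonneg (by omega) (neg_lt_neg hij) n2 n1
      omega
    · have := (l.R_sign hp).2 hi
      have := (l.R_sign hq).1 hj
      omega

theorem Ld.idx_le {n d : ℕ} (l : Ld n d) {i j p q : ℤ} (hpq : p ≤ q)
    (hp : p ∈ l.R i) (hq : q ∈ l.R j) : i ≤ j := by
  by_contra h
  have := l.R_lt (not_le.1 h) hq hp
  omega

theorem Ld.R_empty {n d : ℕ} (l : Ld n d) {i p : ℤ} (hp : p ∈ l.R i) : |i| ≤ n := by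
  have key : ∀ i p, p ∈ l.R i → i ≤ n := by
    intro i p hp
    by_contra h
    rw [l.mem_R_pos (by omega)] at hp
    have h1 := l.cum_mono (show (n : ℤ) ≤ i - 1 by omega)
    have h2 := l.cum_le i
    rw [l.cum_n] at h1
    omega
  have h1 := key i p hp
  have h2 := key (-i) (-p) (by rwa [l.R_neg, neg_neg])
  rw [abs_le]; omega

theorem Ld.cum_succ {n d : ℕ} (l : Ld n d) {i : ℤ} (hi : 0 < i) :
    l.cum i = l.cum (i - 1) + l.val i := by
  have : Icc (1 : ℤ) i = insert i (Icc (1 : ℤ) (i - 1)) := by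
    ext x; simp only [mem_Icc, mem_insert]; omega
  simp only [Ld.cum]
  rw [this, sum_insert (by simp)]
  push_cast
  ring

theorem Ld.cum_zero {n d : ℕ} (l : Ld n d) : 2 * l.cum 0 + 1 = l.val 0 := by
  have h := Nat.two_mul_div_two_add_one_of_odd l.odd
  simp only [Ld.cum]
  rw [Icc_eq_empty (by omega), sum_empty, add_zero]
  exact_mod_cast h

theorem Ld.card_R {n d : ℕ} (l : Ld n d) (i : ℤ) : #(l.R i) = l.val i := by
  have hpos : ∀ i : ℤ, 0 < i → #(l.R i) = l.val i := by
    intro i hi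
    have := l.cum_succ hi
    rw [Ld.R, if_pos hi, Int.card_Icc]
    omega
  rcases lt_trichotomy i 0 with hi | rfl | hi
  · rw [← l.symm, ← hpos (-i) (by omega)]
    refine card_nbij' Neg.neg Neg.neg ?_ ?_ ?_ ?_ <;> intro p hp
    · simp only [mem_coe] at hp ⊢; rw [l.R_neg, neg_neg]; exact hp
    · simp only [mem_coe] at hp ⊢; rwa [l.R_neg] at hp
    · exact neg_neg p
    · exact neg_neg p
  · have := l.cum_zero
    rw [Ld.R, if_neg (by omega), if_pos rfl, Int.card_Icc]
    omega
  · exact hpos i hi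

theorem Ld.par_apply {n d : ℕ} {l : Ld n d} {w : W d} (h : ∀ i p, p ∈ l.R i → w.1 p ∈ l.R i) :
    w ∈ l.par := by
  intro k p
  refine ⟨fun hp => ?_, h k p⟩
  by_cases hd : |p| ≤ d
  · obtain ⟨i, hi⟩ := l.R_cover hd
    rwa [l.R_disj hp (h i p hi)]
  · rwa [w.2.2 p (by omega)] at hp

/-! ### Moving the boundary between two adjacent blocks -/

/-- The blocks of `l` and `l'` differ by `b` elements: the last `b` elements of the block `h - 1`
of `l` are the first `b` elements of the block `h` of `l'`. -/
def Cut {n d : ℕ} (l l' : Ld n d) (h : ℤ) (b : ℕ) : Prop :=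
  ∀ i, 0 ≤ i → l.cum i = l'.cum i + if i = h - 1 then (b : ℤ) else 0

/-- The elements that belong to the block `h - 1` of `l` and to the block `h` of `l'`. -/
noncomputable def strip {n d : ℕ} (l l' : Ld n d) (h : ℤ) : Finset ℤ :=
  Icc (l'.cum (h - 1) + 1) (l.cum (h - 1))

theorem Cut.card_strip {n d : ℕ} {l l' : Ld n d} {h : ℤ} {b : ℕ} (hc : Cut l l' h b) (h1 : 1 ≤ h) :
    #(strip l l' h) = b := by
  have := hc (h - 1) (by omega)
  rw [if_pos rfl] at this
  rw [strip, Int.card_Icc]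
  omega

theorem strip_pos {n d : ℕ} {l l' : Ld n d} {h : ℤ} {p : ℤ}
    (hp : p ∈ strip l l' h) : 0 < p := by
  rw [strip, mem_Icc] at hp
  have := l'.cum_nonneg (h - 1)
  omega

theorem Cut.mem_strip {n d : ℕ} {l l' : Ld n d} {h : ℤ} {b : ℕ} (hc : Cut l l' h b) (h1 : 1 ≤ h)
    (p : ℤ) : p ∈ strip l l' h ↔ p ∈ l'.R h ∧ p ∈ l.R (h - 1) := by
  have c0 := hc (h - 1) (by omega)
  have c1 := hc h (by omega)
  have m1 := l.cum_mono (show h - 1 ≤ h by omega)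
  have m2 := l'.cum_nonneg (h - 1)
  rw [if_pos rfl] at c0
  rw [if_neg (by omega)] at c1
  rw [strip, mem_Icc, l'.mem_R_pos (by omega)]
  by_cases hh : h = 1
  · subst hh
    simp only [sub_self] at *
    rw [l.mem_R_zero]
    omega
  · have c2 := hc (h - 1 - 1) (by omega)
    rw [if_neg (by omega)] at c2
    have m3 := l'.cum_mono (show h - 1 - 1 ≤ h - 1 by omega)
    rw [l.mem_R_pos (by omega)]
    omega

theorem Cut.indicator_nonneg {n d : ℕ} {l l' : Ld n d} {h : ℤ} {b : ℕ} (hc : Cut l l' h b)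
    (h1 : 1 ≤ h) (p : ℤ) {i : ℤ} (hi : 0 ≤ i) :
    (if p ∈ l.R i then (1 : ℤ) else 0) = (if p ∈ l'.R i then 1 else 0)
      + (if i = h - 1 ∧ p ∈ strip l l' h then 1 else 0)
      - (if i = h ∧ p ∈ strip l l' h then 1 else 0)
      + (if -i = h - 1 ∧ -p ∈ strip l l' h then 1 else 0)
      - (if -i = h ∧ -p ∈ strip l l' h then 1 else 0) := by
  have c0 := hc (h - 1) (by omega)
  have c1 := hc h (by omega)
  have m1 := l.cum_mono (show h - 1 ≤ h by omega)
  have m2 := l'.cum_nonneg (h - 1)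
  rw [if_pos rfl] at c0
  rw [if_neg (by omega)] at c1
  simp only [strip, mem_Icc]
  rcases hi.eq_or_lt with rfl | hi
  · have c3 := hc 0 le_rfl
    simp only [l.mem_R_zero, l'.mem_R_zero]
    by_cases hh : h = 1
    · subst hh
      simp only [sub_self, if_true, neg_zero, true_and] at *
      split_ifs <;> omega
    · rw [if_neg (by omega)] at c3
      rw [c3]
      split_ifs <;> omega
  · have c3 := hc i hi.le
    have c4 := hc (i - 1) (by omega)
    simp only [l.mem_R_pos hi, l'.mem_R_pos hi]
    by_cases hh : i = h
    · subst hh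
      rw [if_neg (by omega)] at c3
      split_ifs <;> omega
    · rw [if_neg (by omega)] at c4
      by_cases hh' : i = h - 1
      · subst hh'
        have m3 := l'.cum_mono (show h - 1 - 1 ≤ h - 1 by omega)
        split_ifs <;> omega
      · rw [if_neg hh'] at c3
        rw [c3, c4]
        split_ifs <;> omega

/-- The blocks of `l` result from those of `l'` when the strip moves from the block `h` to the block
`h - 1`, and its negative from `-h` to `-(h - 1)`; stated for indicator functions. -/
theorem Cut.indicator {n d : ℕ} {l l' : Ld n d} {h : ℤ} {b : ℕ} (hc : Cut l l' h b)
    (h1 : 1 ≤ h) (p i : ℤ) :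
    (if p ∈ l.R i then (1 : ℤ) else 0) = (if p ∈ l'.R i then 1 else 0)
      + (if i = h - 1 ∧ p ∈ strip l l' h then 1 else 0)
      - (if i = h ∧ p ∈ strip l l' h then 1 else 0)
      + (if -i = h - 1 ∧ -p ∈ strip l l' h then 1 else 0)
      - (if -i = h ∧ -p ∈ strip l l' h then 1 else 0) := by
  rcases le_total 0 i with hi | hi
  · exact hc.indicator_nonneg h1 p hi
  · have := hc.indicator_nonneg h1 (-p) (i := -i) (by omega)
    simp only [neg_neg, l.R_neg, l'.R_neg] at this
    rw [this]
    ring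

/-- A block count for `l` in terms of that for `l'`. -/
theorem Cut.card_filter {n d : ℕ} {l l' : Ld n d} {h : ℤ} {b : ℕ} (hc : Cut l l' h b)
    (h1 : 1 ≤ h) (G : ℤ → Prop) [DecidablePred G] (i : ℤ) :
    (#{p ∈ l.R i | G p} : ℤ) = #{p ∈ l'.R i | G p}
      + (if i = h - 1 then (#{p ∈ strip l l' h | G p} : ℤ) else 0)
      - (if i = h then (#{p ∈ strip l l' h | G p} : ℤ) else 0)
      + (if -i = h - 1 then (#{p ∈ strip l l' h | G (-p)} : ℤ) else 0)
      - (if -i = h then (#{p ∈ strip l l' h | G (-p)} : ℤ) else 0) := by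
  have hE : ∀ p ∈ strip l l' h, |p| ≤ d := fun p hp =>
    l'.R_abs ((hc.mem_strip h1 p).1 hp).1
  have e0 : ∀ (X : Finset ℤ), (∀ p ∈ X, |p| ≤ d) → (#{p ∈ X | G p} : ℤ) =
      ∑ p ∈ Icc (-d : ℤ) d, (if p ∈ X then 1 else 0) * (if G p then 1 else 0) := by
    intro X hX
    rw [Finset.card_filter, Nat.cast_sum]
    have : X = {p ∈ Icc (-d : ℤ) d | p ∈ X} := by
      ext p
      simp only [mem_filter, mem_Icc]
      exact ⟨fun h => ⟨abs_le.1 (hX p h), h⟩, fun h => h.2⟩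
    conv_lhs => rw [this]
    rw [sum_filter]
    refine sum_congr rfl fun p _ => ?_
    split_ifs <;> simp
  have e2 : (#{p ∈ strip l l' h | G (-p)} : ℤ) = ∑ p ∈ Icc (-d : ℤ) d,
      (if -p ∈ strip l l' h then 1 else 0) * (if G p then 1 else 0) := by
    have : #{p ∈ strip l l' h | G (-p)} = #{p ∈ (strip l l' h).image Neg.neg | G p} := by
      rw [filter_image, card_image_of_injective _ neg_injective]
    rw [this, e0]
    · refine sum_congr rfl fun p _ => ?_
      have : p ∈ (strip l l' h).image Neg.neg ↔ -p ∈ strip l l' h := by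
        simp only [mem_image]
        exact ⟨by rintro ⟨q, hq, rfl⟩; rwa [neg_neg], fun h => ⟨_, h, neg_neg p⟩⟩
      simp only [this]
    · intro p hp
      obtain ⟨q, hq, rfl⟩ := mem_image.1 hp
      rw [abs_neg]; exact hE q hq
  rw [e0 _ fun p hp => l.R_abs hp, e0 _ fun p hp => l'.R_abs hp, e0 _ hE, e2]
  simp only [hc.indicator h1, add_mul, sub_mul, sum_add_distrib, sum_sub_distrib]
  congr 1
  · congr 1
    · congr 1
      · congr 1
        split_ifs with hi <;> simp [hi]
      · split_ifs with hi <;> simp [hi]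
    · split_ifs with hi <;> simp [hi]
  · split_ifs with hi <;> simp [hi]

/-- A relation between the sizes of the blocks that yields `Cut`. -/
theorem cut_of_val {n d : ℕ} {l l' : Ld n d} {h : ℤ} {b : ℕ} (h1 : 1 ≤ h)
    (hv : ∀ i, 0 ≤ i → (l'.val i : ℤ) = l.val i + (if i = h then (b : ℤ) else 0)
      - (if i = h - 1 then (b : ℤ) else 0) - (if i = -(h - 1) then (b : ℤ) else 0)) :
    Cut l l' h b := by
  intro i hi
  induction i, hi using Int.leInduction with
  | base =>
    have a1 := l.cum_zero
    have a2 := l'.cum_zero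
    have a3 := hv 0 le_rfl
    split_ifs at a3 ⊢ <;> omega
  | succ i hi ih =>
    have a1 := l.cum_succ (show 0 < i + 1 by omega)
    have a2 := l'.cum_succ (show 0 < i + 1 by omega)
    have a3 := hv (i + 1) (by omega)
    rw [add_sub_cancel_right] at a1 a2
    split_ifs at a3 ih ⊢ <;> omega

/-! ### Coset representatives and subsets of a block -/

/-- `E` is the set of positive elements that move from the block `r` of `l'` to the block `s` of `l`:
it is the intersection of these blocks (`mem`), the blocks of `l` are determined by those of `l'` and
by `±E` (`det`), and the elements outside `±E` stay in their block (`sub`). -/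
structure IsStrip {n d : ℕ} (l l' : Ld n d) (E : Finset ℤ) (r s : ℤ) : Prop where
  mem : ∀ p, p ∈ E ↔ p ∈ l'.R r ∧ p ∈ l.R s
  pos : ∀ p ∈ E, 0 < p
  det : ∀ p q i k, p ∈ l'.R i → q ∈ l'.R i → (p ∈ E ↔ q ∈ E) → (-p ∈ E ↔ -q ∈ E) →
    p ∈ l.R k → q ∈ l.R k
  sub : ∀ p i, p ∈ l'.R i → p ∉ E → -p ∉ E → p ∈ l.R i

theorem Cut.isStrip {n d : ℕ} {l l' : Ld n d} {h : ℤ} {b : ℕ} (hc : Cut l l' h b) (h1 : 1 ≤ h) :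
    IsStrip l l' (strip l l' h) h (h - 1) where
  mem := hc.mem_strip h1
  pos _ := strip_pos
  det p q i k hp hq hE hE' hk := by
    have a := hc.indicator h1 p k
    have a' := hc.indicator h1 q k
    have hpq : p ∈ l'.R k ↔ q ∈ l'.R k :=
      ⟨fun h => l'.R_disj hp h ▸ hq, fun h => l'.R_disj hq h ▸ hp⟩
    simp only [← hE, ← hE', ← hpq] at a'
    rw [← a, if_pos hk] at a'
    by_contra hn
    rw [if_neg hn] at a'
    omega
  sub p i hp h1' h2 := by
    have a := hc.indicator h1 p i
    simp only [h1', h2, hp, and_false, if_false, if_true] at a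
    by_contra hn
    rw [if_neg hn] at a
    omega

theorem Cut.isStrip' {n d : ℕ} {l l' : Ld n d} {h : ℤ} {b : ℕ} (hc : Cut l' l h b) (h1 : 1 ≤ h) :
    IsStrip l l' (strip l' l h) (h - 1) h where
  mem p := by rw [hc.mem_strip h1, and_comm]
  pos _ := strip_pos
  det p q i k hp hq hE hE' hk := by
    have a := hc.indicator h1 p k
    have a' := hc.indicator h1 q k
    have hpq : p ∈ l'.R k ↔ q ∈ l'.R k :=
      ⟨fun h => l'.R_disj hp h ▸ hq, fun h => l'.R_disj hq h ▸ hp⟩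
    simp only [← hE, ← hE', ← hpq] at a'
    rw [if_pos hk] at a
    by_contra hn
    rw [if_neg hn] at a'
    omega
  sub p i hp h1' h2 := by
    have a := hc.indicator h1 p i
    simp only [h1', h2, hp, and_false, if_false, if_true] at a
    by_contra hn
    rw [if_neg hn] at a
    omega

open Classical in
/-- The shortest representatives of `W_{λ'} / (W_{λ'} ∩ W_λ)`. -/
noncomputable def reps {n d : ℕ} (l l' : Ld n d) : Finset (W d) := {w | w ∈ l'.par ∧ l.basc w}

theorem mem_reps {n d : ℕ} {l l' : Ld n d} {w : W d} :
    w ∈ reps l l' ↔ w ∈ l'.par ∧ l.basc w := by simp [reps]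

theorem IsStrip.mem_par {n d : ℕ} {l l' : Ld n d} {E : Finset ℤ} {r s : ℤ}
    (hE : IsStrip l l' E r s) {z : W d} (hz : z ∈ l'.par) (hzE : ∀ p, z.1 p ∈ E ↔ p ∈ E) :
    z ∈ l.par := by
  refine Ld.par_apply fun k p hp => ?_
  obtain ⟨i, hi⟩ := l'.R_cover (l.R_abs hp)
  exact hE.det p (z.1 p) i k hi ((hz i p).2 hi) (hzE p).symm (by rw [← W_neg, hzE]) hp

theorem mem_iff_of_image_eq {d : ℕ} {E : Finset ℤ} {w w' : W d}
    (h : E.image w.1 = E.image w'.1) (p : ℤ) : (w'⁻¹ * w).1 p ∈ E ↔ p ∈ E := by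
  have h1 : p ∈ E ↔ w.1 p ∈ E.image w.1 := by
    rw [mem_image]
    exact ⟨fun h => ⟨p, h, rfl⟩, by rintro ⟨q, hq, e⟩; rwa [← (W_inj w).1 e]⟩
  rw [h1, h, mem_image, W_mul_apply]
  constructor
  · intro h; exact ⟨_, h, W_apply_inv _ _⟩
  · rintro ⟨q, hq, e⟩
    rwa [← e, W_inv_apply]

/-- The coset of `w` modulo `W_{λ'} ∩ W_λ` is determined by `w(E)`. -/
theorem IsStrip.inv_mul_mem_par {n d : ℕ} {l l' : Ld n d} {E : Finset ℤ} {r s : ℤ}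
    (hE : IsStrip l l' E r s) {w w' : W d} (hw : w ∈ l'.par) (hw' : w' ∈ l'.par)
    (h : E.image w.1 = E.image w'.1) : w'⁻¹ * w ∈ l.par :=
  hE.mem_par (l'.par.mul_mem (l'.par.inv_mem hw') hw) (mem_iff_of_image_eq h)

theorem inv_mem_D {n d : ℕ} {l : Ld n d} {w : W d} (h : l.basc w) : w⁻¹ ∈ l.D :=
  Ld.mem_D (by rwa [inv_inv])

theorem IsStrip.reps_injOn {n d : ℕ} {l l' : Ld n d} {E : Finset ℤ} {r s : ℤ}
    (hE : IsStrip l l' E r s) {w w' : W d} (hw : w ∈ reps l l') (hw' : w' ∈ reps l l')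
    (h : E.image w.1 = E.image w'.1) : w = w' := by
  rw [mem_reps] at hw hw'
  have h1 := hE.inv_mul_mem_par hw.1 hw'.1 h
  have := Ld.D_unique h1 (inv_mem_D hw.2) (by simpa using inv_mem_D hw'.2)
  rw [inv_mul_eq_one] at this
  exact this.symm

/-- Every left coset of `W_{λ'} ∩ W_λ` in `W_{λ'}` has a representative in `reps`. -/
theorem IsStrip.exists_reps {n d : ℕ} {l l' : Ld n d} {E : Finset ℤ} {r t : ℤ}
    (hE : IsStrip l l' E r t) {a : W d} (ha : a ∈ l'.par) :
    ∃ w ∈ reps l l', E.image w.1 = E.image a.1 := by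
  obtain ⟨w, ⟨hw, hwE⟩, hmin⟩ := Set.exists_min_image
    {w : W d | w ∈ l'.par ∧ E.image w.1 = E.image a.1} len (Set.toFinite _) ⟨a, ha, rfl⟩
  refine ⟨w, mem_reps.2 ⟨hw, fun i k h1 h2 => ?_⟩, hwE⟩
  by_contra h
  have hlen := len_of_not_asc w i h
  obtain ⟨j, hj⟩ := l'.R_cover (l.R_abs h1)
  obtain ⟨j', hj'⟩ := l'.R_cover (l.R_abs h2)
  have hjj := l'.idx_le (by omega) hj hj'
  rcases hjj.eq_or_lt with rfl | hlt
  · -- `sᵢ` preserves the blocks of both `l` and `l'`, hence it preserves `E`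
    have s1 := l.s_mem i k h1 h2
    have s2 := l'.s_mem i j hj hj'
    have hsE : ∀ p, (s i).1 p ∈ E ↔ p ∈ E := fun p => by
      rw [hE.mem, hE.mem, s1 t p, s2 r p]
    have : E.image (w * s i).1 = E.image w.1 := by
      have h3 : E.image (s i).1 = E := by
        ext p
        rw [mem_image]
        constructor
        · rintro ⟨q, hq, rfl⟩; exact (hsE q).2 hq
        · intro hp
          refine ⟨(s i).1 p, (hsE p).2 hp, ?_⟩
          rw [← W_mul_apply, s_mul_s]; rfl
      conv_rhs => rw [← h3, image_image]
      rfl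
    have := hmin (w * s i) ⟨l'.par.mul_mem hw s2, this.trans hwE⟩
    omega
  · -- distinct blocks of `l'` cannot carry a descent of `w`
    exact h (l'.R_lt hlt ((hw j _).2 hj) ((hw j' _).2 hj'))

/-- The element of `W` that exchanges `e` with `f` and `-e` with `-f`. -/
theorem exists_swap {d : ℕ} {e f : ℤ} (he : e ≠ 0) (hf : f ≠ 0) (hef : e ≠ f)
    (hed : |e| ≤ d) (hfd : |f| ≤ d) :
    ∃ τ : W d, ∀ p, τ.1 p = if p = e then f else if p = f then e else
      if p = -e then -f else if p = -f then -e else p := by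
  rw [abs_le] at hed hfd
  let F : ℤ → ℤ := fun p => if p = e then f else if p = f then e else
      if p = -e then -f else if p = -f then -e else p
  have hF : Function.Involutive F := by
    intro p; simp only [F]; split_ifs <;> omega
  refine ⟨⟨hF.toPerm, fun p => ?_, fun p hp => ?_⟩, fun p => rfl⟩
  · simp only [Function.Involutive.coe_toPerm, F]; split_ifs <;> omega
  · simp only [Function.Involutive.coe_toPerm, F]
    rw [lt_abs] at hp
    split_ifs <;> omega

theorem swap_mem_par {n d : ℕ} {l : Ld n d} {e f r : ℤ} (he : e ∈ l.R r) (hf : f ∈ l.R r)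
    {τ : W d} (hτ : ∀ p, τ.1 p = if p = e then f else if p = f then e else
      if p = -e then -f else if p = -f then -e else p) : τ ∈ l.par := by
  have he' : -e ∈ l.R (-r) := by rwa [l.R_neg, neg_neg]
  have hf' : -f ∈ l.R (-r) := by rwa [l.R_neg, neg_neg]
  refine Ld.par_apply fun k p hp => ?_
  rw [hτ]
  split_ifs with c1 c2 c3 c4
  · subst c1; rw [l.R_disj hp he]; exact hf
  · subst c2; rw [l.R_disj hp hf]; exact he
  · subst c3; rw [l.R_disj hp he']; exact hf'
  · subst c4; rw [l.R_disj hp hf']; exact he'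
  · exact hp

/-- `W_λ` acts transitively on the subsets `S` of a block of given size with `S ∩ -S = ∅`. -/
theorem exists_par_image {n d : ℕ} {l : Ld n d} {r : ℤ} {E S : Finset ℤ} (hE : E ⊆ l.R r)
    (hE' : ∀ p ∈ E, -p ∉ E) (hS : S ⊆ l.R r) (hS' : ∀ p ∈ S, -p ∉ S) (hc : #S = #E) :
    ∃ a ∈ l.par, E.image a.1 = S := by
  induction hk : #(E \ S) generalizing S with
  | zero =>
    refine ⟨1, l.par.one_mem, ?_⟩
    rw [card_eq_zero, sdiff_eq_empty_iff_subset] at hk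
    rw [← eq_of_subset_of_card_le hk hc.le]
    exact image_id
  | succ k ih =>
    obtain ⟨e, he⟩ : (E \ S).Nonempty := by rw [← card_pos]; omega
    rw [mem_sdiff] at he
    -- replace an element `f` of `S` by `e`, where `-e` must be replaced if it belongs to `S`
    obtain ⟨f, hf, hfE, hef⟩ : ∃ f ∈ S, f ∉ E ∧ (-e ∈ S → f = -e) := by
      by_cases h : -e ∈ S
      · exact ⟨-e, h, hE' e he.1, fun _ => rfl⟩
      · have h2 : #(S \ E) = #(E \ S) := card_sdiff_comm hc
        obtain ⟨f, hf⟩ : (S \ E).Nonempty := by rw [← card_pos]; omega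
        rw [mem_sdiff] at hf
        exact ⟨f, hf.1, hf.2, fun h' => absurd h' h⟩
    have he0 : e ≠ 0 := by rintro rfl; exact hE' 0 he.1 (by simpa using he.1)
    have hf0 : f ≠ 0 := by rintro rfl; exact hS' 0 hf (by simpa using hf)
    have hne : e ≠ f := by rintro rfl; exact he.2 hf
    obtain ⟨τ, hτ⟩ := exists_swap he0 hf0 hne (l.R_abs (hE he.1)) (l.R_abs (hS hf))
    have hτ1 := swap_mem_par (hE he.1) (hS hf) hτ
    have hfS : -f ∉ S := hS' f hf
    have himg : S.image τ.1 = insert e (S.erase f) := by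
      ext p
      simp only [mem_image, mem_insert, mem_erase]
      constructor
      · rintro ⟨q, hq, rfl⟩
        rw [hτ]
        by_cases c1 : q = e
        · exact absurd (c1 ▸ hq) he.2
        rw [if_neg c1]
        by_cases c2 : q = f
        · rw [if_pos c2]; exact Or.inl rfl
        rw [if_neg c2]
        by_cases c3 : q = -e
        · exact absurd (c3.trans (hef (c3 ▸ hq)).symm) c2
        rw [if_neg c3]
        by_cases c4 : q = -f
        · exact absurd (c4 ▸ hq) hfS
        rw [if_neg c4]
        exact Or.inr ⟨c2, hq⟩
      · rintro (rfl | ⟨c2, hq⟩)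
        · refine ⟨f, hf, ?_⟩
          rw [hτ, if_neg hne.symm, if_pos rfl]
        · refine ⟨p, hq, ?_⟩
          rw [hτ, if_neg (fun h : p = e => he.2 (h ▸ hq)), if_neg c2,
            if_neg (fun h : p = -e => c2 (h.trans (hef (h ▸ hq)).symm)),
            if_neg (fun h : p = -f => hfS (h ▸ hq))]
    have g1 : S.image τ.1 ⊆ l.R r := by
      rw [himg]
      intro p hp
      rcases mem_insert.1 hp with rfl | hp
      · exact hE he.1
      · exact hS (mem_of_mem_erase hp)
    have g2 : ∀ p ∈ S.image τ.1, -p ∉ S.image τ.1 := by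
      intro p hp hp'
      rw [mem_image] at hp hp'
      obtain ⟨q, hq, rfl⟩ := hp
      obtain ⟨q', hq', e'⟩ := hp'
      rw [← W_neg, W_inj] at e'
      exact hS' q hq (e' ▸ hq')
    have g3 : #(S.image τ.1) = #E := by
      rw [card_image_of_injective _ τ.1.injective, hc]
    have g4 : #(E \ S.image τ.1) = k := by
      have : E \ S.image τ.1 = (E \ S).erase e := by
        rw [himg]
        ext p
        simp only [mem_sdiff, mem_insert, mem_erase, not_or, not_and]
        constructor
        · rintro ⟨h1, h2, h3⟩
          exact ⟨h2, h1, fun h => h3 (fun h' => hfE (h' ▸ h1)) h⟩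
        · rintro ⟨h1, h2, h3⟩
          exact ⟨h2, h1, fun _ => h3⟩
      rw [this, card_erase_of_mem (mem_sdiff.2 he), hk, Nat.add_sub_cancel]
    obtain ⟨a, ha, hab⟩ := ih g1 g2 g3 g4
    refine ⟨τ * a, l.par.mul_mem hτ1 ha, ?_⟩
    have : E.image (τ * a).1 = (E.image a.1).image τ.1 := by rw [image_image]; rfl
    rw [this, hab, image_image]
    have h2 : (τ.1 ∘ τ.1 : ℤ → ℤ) = id := by
      funext p
      simp only [Function.comp, hτ, id]
      split_ifs <;> omega
    rw [h2, image_id]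

/-- The subsets `S` of `P` of size `m` with `S ∩ -S = ∅`. -/
noncomputable def isotropic (P : Finset ℤ) (m : ℕ) : Finset (Finset ℤ) :=
  {S ∈ P.powersetCard m | ∀ p ∈ S, -p ∉ S}

theorem mem_isotropic {P S : Finset ℤ} {m : ℕ} :
    S ∈ isotropic P m ↔ (S ⊆ P ∧ #S = m) ∧ ∀ p ∈ S, -p ∉ S := by
  rw [isotropic, mem_filter, mem_powersetCard]

/-- The map `w ↦ w(E)` is a bijection from `reps` onto the subsets `S` of the block `r` of `l'` with
`|S| = |E|` and `S ∩ -S = ∅`. -/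
theorem IsStrip.sum_reps {n d : ℕ} {l l' : Ld n d} {E : Finset ℤ} {r t : ℤ}
    (hE : IsStrip l l' E r t) {M : Type*} [AddCommMonoid M] (F : Finset ℤ → M) :
    ∑ w ∈ reps l l', F (E.image w.1) = ∑ S ∈ isotropic (l'.R r) #E, F S := by
  have hEr : E ⊆ l'.R r := fun p hp => ((hE.mem p).1 hp).1
  have hEi : ∀ p ∈ E, -p ∉ E := fun p hp hp' => by
    have := hE.pos p hp
    have := hE.pos _ hp'
    omega
  refine sum_bij (fun w _ => E.image w.1) ?_ ?_ ?_ ?_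
  · intro w hw
    rw [mem_reps] at hw
    rw [mem_isotropic, card_image_of_injective _ w.1.injective]
    refine ⟨⟨?_, rfl⟩, ?_⟩
    · intro p hp
      obtain ⟨q, hq, rfl⟩ := mem_image.1 hp
      exact (hw.1 r q).2 (hEr hq)
    · intro p hp hp'
      obtain ⟨q, hq, rfl⟩ := mem_image.1 hp
      obtain ⟨q', hq', e'⟩ := mem_image.1 hp'
      rw [← W_neg, W_inj] at e'
      exact hEi q hq (e' ▸ hq')
  · intro w hw w' hw' h
    exact hE.reps_injOn hw hw' h
  · intro S hS
    rw [mem_isotropic] at hS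
    obtain ⟨a, ha, haS⟩ := exists_par_image hEr hEi hS.1.1 hS.2 hS.1.2
    obtain ⟨w, hw, hwE⟩ := hE.exists_reps ha
    exact ⟨w, hw, hwE.trans haS⟩
  · intros; rfl

/-! ### The double cosets of `B` and `C` -/

/-- A matrix whose columns `k < k'` only meet rows `i ≤ i'` belongs to the double coset of `1`. -/
theorem eq_one_of_staircase {n d : ℕ} {l l' : Ld n d} {g : W d} (hg : g ∈ DD l' l)
    (hs : ∀ i i' k k', 0 ≤ k → k < k' → 0 < kappa l' g l i k → 0 < kappa l' g l i' k' → i ≤ i') :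
    g = 1 := by
  have h1 := Ld.basc_of_mem_D hg.1
  have h2 := Ld.basc_of_mem_D hg.2
  rw [inv_inv] at h2
  have kpos : ∀ i k p, p ∈ l.R k → g.1 p ∈ l'.R i → 0 < kappa l' g l i k := by
    intro i k p hp hgp
    rw [kappa_eq, card_pos]
    exact ⟨g.1 p, mem_filter.2 ⟨hgp, by rwa [W_inv_apply]⟩⟩
  refine eq_one_of_asc g fun j => ?_
  have hj := j.2
  have c1 : |((j : ℕ) : ℤ)| ≤ d := by rw [abs_le]; omega
  have c2 : |((j : ℕ) : ℤ) + 1| ≤ d := by rw [abs_le]; omega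
  obtain ⟨k, hk⟩ := l.R_cover c1
  obtain ⟨k', hk'⟩ := l.R_cover c2
  obtain ⟨i, hi⟩ := l'.R_cover (W_abs g c1)
  obtain ⟨i', hi'⟩ := l'.R_cover (W_abs g c2)
  have hk0 : 0 ≤ k := by
    by_contra h
    have := (l.R_sign hk).2 (by omega)
    omega
  rcases (l.idx_le (by omega) hk hk').eq_or_lt with rfl | hlt
  · exact h2 j k hk hk'
  · rcases (hs i i' k k' hk0 hlt (kpos _ _ _ hk hi) (kpos _ _ _ hk' hi')).eq_or_lt with rfl | hii
    · rw [asc]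
      by_contra h
      have := Ld.basc_le h1 hi' (not_lt.1 h) hi
      rw [W_inv_apply, W_inv_apply] at this
      omega
    · exact l'.R_lt hii hi hi'

/-- The double coset of `B` is the union of the cosets `w W_λ` with `w` in `reps`. -/
theorem IsStrip.TX_coset {n d : ℕ} {B : Xi n d} {E : Finset ℤ} {r t : ℤ}
    (hE : IsStrip B.co B.ro E r t) (h1 : kappa B.ro 1 B.co = B.a)
    (hs : ∀ i i' k k', 0 ≤ k → k < k' → 0 < B.a i k → 0 < B.a i' k' → i ≤ i') :
    TX B.coset = (∑ w ∈ reps B.co B.ro, heckeT d w) * B.co.x := by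
  refine TX_right_eq _ _ _ (fun g hg => inv_mem_D (mem_reps.1 hg).2) fun w => ?_
  constructor
  · rintro ⟨g, hg, hk, x, hx, y, hy, rfl⟩
    have : g = 1 := eq_one_of_staircase hg (by rwa [hk])
    subst this
    obtain ⟨a, ha, hax⟩ := hE.exists_reps hx
    refine ⟨a, ha, a⁻¹ * x * y,
      B.co.par.mul_mem (hE.inv_mul_mem_par hx (mem_reps.1 ha).1 hax.symm) hy, ?_⟩
    simp only [mul_assoc, mul_inv_cancel_left, one_mul]
  · rintro ⟨g, hg, x, hx, rfl⟩
    have := kappa_mul (n := n) (mem_reps.1 hg).1 hx 1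
    rw [mul_one] at this
    rw [B.mem_coset, this, h1]

/-! ### The weights of the coset representatives -/

theorem Ld.basc_lt {n d : ℕ} {l : Ld n d} {w : W d} (hw : l.basc w) {k p q : ℤ} (hp : p ∈ l.R k)
    (hq : q ∈ l.R k) (hpq : p < q) : w.1 p < w.1 q := by
  have := Ld.basc_le hw hp hpq.le hq
  omega

theorem mem_image_W {d : ℕ} {E : Finset ℤ} {w : W d} {p : ℤ} : w.1 p ∈ E.image w.1 ↔ p ∈ E := by
  rw [mem_image]
  exact ⟨by rintro ⟨q, hq, e⟩; rwa [← (W_inj w).1 e], fun h => ⟨p, h, rfl⟩⟩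

/-- A representative changes the sign of a positive `q` only if `q` lies in `E` and the block of `E` is
symmetric. -/
theorem IsStrip.sign_change {n d : ℕ} {l l' : Ld n d} {E : Finset ℤ} {r t : ℤ}
    (hE : IsStrip l l' E r t) {w : W d} (hw : w ∈ reps l l') {q : ℤ} (hq : 0 < q)
    (hqd : q ≤ d) (hwq : w.1 q < 0) : r = 0 ∧ q ∈ E := by
  obtain ⟨hw1, hw2⟩ := mem_reps.1 hw
  obtain ⟨i, hi⟩ := l'.R_cover (p := q) (by rw [abs_le]; omega)
  have hi' := (hw1 i q).2 hi
  have s1 := l'.R_sign hi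
  have s2 := l'.R_sign hi'
  have hi0 : i = 0 := by omega
  subst hi0
  by_cases hqE : q ∈ E
  · exact ⟨l'.R_disj ((hE.mem q).1 hqE).1 hi, hqE⟩
  · exfalso
    have hn : -q ∉ E := fun h => by have := hE.pos _ h; omega
    have m := hE.sub q 0 hi hqE hn
    have m' : -q ∈ l.R 0 := by
      rw [show (0 : ℤ) = -0 by rfl, l.R_neg, neg_neg]; exact m
    have := Ld.basc_lt hw2 m' m (by omega)
    rw [W_neg] at this
    omega

/-- The inversions of a representative `w` lie within the block of `E`, since `w` preserves the blocks
of `l'`, and they involve `±E`, since `w` is increasing on the blocks of `l`. -/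
theorem IsStrip.mem_inversions {n d : ℕ} {l l' : Ld n d} {E : Finset ℤ} {r t : ℤ}
    (hE : IsStrip l l' E r t) {w : W d} (hw : w ∈ reps l l') {p q : ℤ}
    (h : (p, q) ∈ inversions w) :
    p ∈ l'.R r ∧ q ∈ l'.R r ∧ (q ∈ E → p ∉ E) ∧ (q ∉ E → p ∈ E ∨ -p ∈ E) := by
  obtain ⟨hw1, hw2⟩ := mem_reps.1 hw
  simp only [inversions, mem_filter, mem_product, mem_Icc, abs_lt] at h
  obtain ⟨⟨hp, hq⟩, hp0, hpq, hlt⟩ := h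
  obtain ⟨i, hi⟩ := l'.R_cover (p := q) (by rw [abs_le]; omega)
  obtain ⟨k, hk⟩ := l'.R_cover (p := p) (by rw [abs_le]; omega)
  have h1 := l'.idx_le hpq.2.le hk hi
  have h2 := l'.idx_le hlt.le ((hw1 i q).2 hi) ((hw1 k p).2 hk)
  obtain rfl : k = i := le_antisymm h1 h2
  have key : ∀ j, p ∈ l.R j → q ∈ l.R j → False := fun j hj hj' => by
    have := Ld.basc_lt hw2 hj hj' hpq.2
    omega
  have hqE' : -q ∉ E := fun h => by have := hE.pos _ h; omega
  have hor : q ∉ E → p ∈ E ∨ -p ∈ E := by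
    intro hqE
    by_contra hc
    rw [not_or] at hc
    exact key k (hE.sub p k hk hc.1 hc.2) (hE.sub q k hi hqE hqE')
  have hE2 : q ∈ E → p ∉ E := fun h h' => key t ((hE.mem p).1 h').2 ((hE.mem q).1 h).2
  have hr : k = r := by
    by_cases hqE : q ∈ E
    · exact l'.R_disj hi ((hE.mem q).1 hqE).1
    · rcases hor hqE with h | h
      · exact l'.R_disj hk ((hE.mem p).1 h).1
      · have h3 := (hE.mem _).1 h
        -- here `p < 0 < q` lie in one block, which is the block `0`
        have h4 := hE.pos _ h
        have s1 := l'.R_sign hk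
        have s2 := l'.R_sign hi
        have hk0 : k = 0 := by omega
        have h5 : -p ∈ l'.R 0 := by
          rw [show (0 : ℤ) = -0 by rfl, l'.R_neg, neg_neg, ← hk0]; exact hk
        rw [hk0]
        exact l'.R_disj h5 h3.1
  subst hr
  exact ⟨hk, hi, hE2, hor⟩

theorem signChanges_eq_empty {n d : ℕ} {l l' : Ld n d} {E : Finset ℤ} {r t : ℤ}
    (hE : IsStrip l l' E r t) (hr : 0 < r) {w : W d} (hw : w ∈ reps l l') : signChanges w = ∅ := by
  refine filter_eq_empty_iff.2 fun q hq h => ?_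
  rw [mem_Icc] at hq
  have := (hE.sign_change hw (by omega) hq.2 h).1
  omega

/-- If `E` consists of the first elements of its block, then the inversions of `w` correspond to the
pairs of an element of `S = w(E)` and a smaller element of the complement of `S`. -/
theorem IsStrip.weight_lt {n d : ℕ} {l l' : Ld n d} {E : Finset ℤ} {r t : ℤ}
    (hE : IsStrip l l' E r t) (hr : 0 < r) (ht : t < r) {w : W d} (hw : w ∈ reps l l') :
    weight w = uv 0 (2 * #{z ∈ E.image w.1 ×ˢ (l'.R r \ E.image w.1) | z.2 < z.1}) := by
  obtain ⟨hw1, hw2⟩ := mem_reps.1 hw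
  rw [weight, signChanges_eq_empty hE hr hw, card_empty, Nat.cast_zero, mul_zero]
  congr 3
  refine card_nbij' (fun z => (w.1 z.1, w.1 z.2)) (fun z => ((w⁻¹).1 z.1, (w⁻¹).1 z.2)) ?_ ?_ ?_ ?_
  · rintro ⟨p, q⟩ hz
    obtain ⟨h1, h2, h3, h4⟩ := hE.mem_inversions hw hz
    have hpE : p ∈ E ∧ q ∉ E := by
      have s1 := (l'.R_sign h1).1 hr
      by_cases hq : q ∈ E
      · -- `p` belongs to a later block of `l` than `q`
        have hp' : -p ∉ E := fun h => by have := hE.pos _ h; omega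
        have := l.R_lt ht ((hE.mem q).1 hq).2 (hE.sub p r h1 (h3 hq) hp')
        simp only [coe_filter, inversions, Set.mem_ofPred_eq, abs_lt] at hz
        omega
      · refine ⟨(h4 hq).resolve_right fun h => ?_, hq⟩
        have := hE.pos _ h
        omega
    simp only [coe_filter, inversions, Set.mem_ofPred_eq, mem_product, mem_sdiff, mem_image_W] at hz ⊢
    exact ⟨⟨hpE.1, (hw1 r q).2 h2, hpE.2⟩, hz.2.2.2⟩
  · rintro ⟨x, y⟩ hz
    obtain ⟨p, rfl⟩ : ∃ p, w.1 p = x := ⟨_, W_apply_inv w x⟩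
    obtain ⟨q, rfl⟩ : ∃ q, w.1 q = y := ⟨_, W_apply_inv w y⟩
    simp only [coe_filter, inversions, Set.mem_ofPred_eq, mem_product, mem_sdiff, mem_image_W, W_inv_apply, mem_Icc, abs_lt] at hz ⊢
    obtain ⟨⟨hp, hq, hqE⟩, hlt⟩ := hz
    have hq' := (hw1 r q).1 hq
    have p0 := hE.pos p hp
    have hqn : -q ∉ E := fun h => by
      have := hE.pos _ h
      have := (l'.R_sign hq').1 hr
      omega
    have := l.R_lt ht ((hE.mem p).1 hp).2 (hE.sub q r hq' hqE hqn)
    have := abs_le.1 (l'.R_abs hq')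
    omega
  · rintro ⟨p, q⟩ _
    simp only [W_inv_apply]
  · rintro ⟨p, q⟩ _
    simp only [W_apply_inv]

/-- If `E` consists of the last elements of its block, then the inversions of `w` correspond to the
pairs of an element of `S = w(E)` and a larger element of the complement of `S`. -/
theorem IsStrip.weight_gt {n d : ℕ} {l l' : Ld n d} {E : Finset ℤ} {r t : ℤ}
    (hE : IsStrip l l' E r t) (hr : 0 < r) (ht : r < t) {w : W d} (hw : w ∈ reps l l') :
    weight w = uv 0 (2 * #{z ∈ E.image w.1 ×ˢ (l'.R r \ E.image w.1) | z.1 < z.2}) := by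
  obtain ⟨hw1, hw2⟩ := mem_reps.1 hw
  rw [weight, signChanges_eq_empty hE hr hw, card_empty, Nat.cast_zero, mul_zero]
  congr 3
  refine card_nbij' (fun z => (w.1 z.2, w.1 z.1)) (fun z => ((w⁻¹).1 z.2, (w⁻¹).1 z.1)) ?_ ?_ ?_ ?_
  · rintro ⟨p, q⟩ hz
    obtain ⟨h1, h2, h3, h4⟩ := hE.mem_inversions hw hz
    have hpE : q ∈ E ∧ p ∉ E := by
      have s1 := (l'.R_sign h1).1 hr
      have s2 := (l'.R_sign h2).1 hr
      by_cases hq : q ∈ E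
      · exact ⟨hq, h3 hq⟩
      · have hp : p ∈ E := (h4 hq).resolve_right fun h => by
          have := hE.pos _ h
          omega
        have hq' : -q ∉ E := fun h => by have := hE.pos _ h; omega
        have := l.R_lt ht (hE.sub q r h2 hq hq') ((hE.mem p).1 hp).2
        simp only [coe_filter, inversions, Set.mem_ofPred_eq, abs_lt] at hz
        omega
    simp only [coe_filter, inversions, Set.mem_ofPred_eq, mem_product, mem_sdiff, mem_image_W] at hz ⊢
    exact ⟨⟨hpE.1, (hw1 r p).2 h1, hpE.2⟩, hz.2.2.2⟩
  · rintro ⟨x, y⟩ hz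
    obtain ⟨q, rfl⟩ : ∃ p, w.1 p = x := ⟨_, W_apply_inv w x⟩
    obtain ⟨p, rfl⟩ : ∃ q, w.1 q = y := ⟨_, W_apply_inv w y⟩
    simp only [coe_filter, inversions, Set.mem_ofPred_eq, mem_product, mem_sdiff, mem_image_W, W_inv_apply, mem_Icc, abs_lt] at hz ⊢
    obtain ⟨⟨hq, hp, hpE⟩, hlt⟩ := hz
    have hp' := (hw1 r p).1 hp
    have q0 := hE.pos q hq
    have p0 := (l'.R_sign hp').1 hr
    have hpn : -p ∉ E := fun h => by
      have := hE.pos _ h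
      omega
    have := l.R_lt ht (hE.sub p r hp' hpE hpn) ((hE.mem q).1 hq).2
    have := abs_le.1 (l'.R_abs ((hE.mem q).1 hq).1)
    omega
  · rintro ⟨p, q⟩ _
    simp only [W_inv_apply]
  · rintro ⟨p, q⟩ _
    simp only [W_apply_inv]

/-- The inversions of an isotropic subset `S` of a symmetric interval `P`: the pairs `x < y` with
`x ∈ S` and `y ∉ S`, where `y ≠ 0`, and for `y ∈ -S` only one of the pairs `(x, y)` and `(-y, -x)` is
counted. -/
noncomputable def isoInversions (P S : Finset ℤ) : Finset (ℤ × ℤ) :=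
  {z ∈ S ×ˢ (P \ S) | z.2 ≠ 0 ∧ z.1 < z.2 ∧ (-z.2 ∈ S → -z.2 < z.1)}

/-- For the symmetric block `0`, whose last elements form `E`, the sign changes of `w` correspond to the
negative elements of `S = w(E)`. -/
theorem IsStrip.weight_zero {n d : ℕ} {l l' : Ld n d} {E : Finset ℤ} {t : ℤ}
    (hE : IsStrip l l' E 0 t) (ht : 0 < t) {w : W d} (hw : w ∈ reps l l') :
    weight w = uv (2 * #{p ∈ E.image w.1 | p < 0})
      (2 * #(isoInversions (l'.R 0) (E.image w.1))) := by
  obtain ⟨hw1, hw2⟩ := mem_reps.1 hw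
  have hneg : ∀ {m : Ld n d} {p : ℤ}, p ∈ m.R 0 → -p ∈ m.R 0 := fun {m p} h => by
    rw [show (0 : ℤ) = -0 by rfl, m.R_neg, neg_neg]; exact h
  have hEd : ∀ p ∈ E, p ≤ d := fun p hp => (abs_le.1 (l'.R_abs ((hE.mem p).1 hp).1)).2
  rw [weight]
  congr 3
  · refine card_nbij' w.1 (w⁻¹).1 ?_ ?_ ?_ ?_
    · intro q hq
      simp only [coe_filter, signChanges, Set.mem_ofPred_eq, mem_Icc] at hq ⊢
      exact ⟨mem_image_W.2 (hE.sign_change hw (by omega) hq.1.2 hq.2).2, hq.2⟩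
    · intro x hx
      obtain ⟨q, rfl⟩ : ∃ p, w.1 p = x := ⟨_, W_apply_inv w x⟩
      simp only [coe_filter, signChanges, Set.mem_ofPred_eq, mem_Icc, mem_image_W,
        W_inv_apply] at hx ⊢
      have := hE.pos q hx.1
      have := hEd q hx.1
      omega
    · intro p _
      exact W_inv_apply w p
    · intro p _
      exact W_apply_inv w p
  · rw [isoInversions]
    refine card_nbij' (fun z => (w.1 z.2, w.1 z.1)) (fun z => ((w⁻¹).1 z.2, (w⁻¹).1 z.1))
      ?_ ?_ ?_ ?_
    · rintro ⟨p, q⟩ hz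
      obtain ⟨h1, h2, h3, h4⟩ := hE.mem_inversions hw hz
      simp only [coe_filter, inversions, Set.mem_ofPred_eq, mem_product, mem_sdiff, mem_image_W, mem_Icc, abs_lt, ← W_neg] at hz ⊢
      have hq : q ∈ E := by
        by_contra hq
        have hq' : -q ∉ E := fun h => by have := hE.pos _ h; omega
        have m := hE.sub q 0 h2 hq hq'
        rcases h4 hq with h | h
        · have := l.R_lt ht m ((hE.mem p).1 h).2
          omega
        · have := l.R_lt ht m ((hE.mem _).1 h).2
          omega
      refine ⟨⟨hq, (hw1 0 p).2 h1, h3 hq⟩, fun h => hz.2.1 ((W_eq_zero w).1 h), hz.2.2.2, fun h => ?_⟩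
      exact Ld.basc_lt hw2 ((hE.mem _).1 h).2 ((hE.mem q).1 hq).2 (by omega)
    · rintro ⟨x, y⟩ hz
      obtain ⟨q, rfl⟩ : ∃ p, w.1 p = x := ⟨_, W_apply_inv w x⟩
      obtain ⟨p, rfl⟩ : ∃ q, w.1 q = y := ⟨_, W_apply_inv w y⟩
      simp only [coe_filter, inversions, Set.mem_ofPred_eq, mem_product, mem_sdiff, mem_image_W, W_inv_apply, mem_Icc, abs_lt, ← W_neg] at hz ⊢
      obtain ⟨⟨hq, hp, hpE⟩, hp0, hlt, hn⟩ := hz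
      have hp' := (hw1 0 p).1 hp
      have hq' := ((hE.mem q).1 hq).2
      have q0 := hE.pos q hq
      have := abs_le.1 (l'.R_abs hp')
      have := hEd q hq
      have hpq : -q < p ∧ p < q := by
        by_cases hpn : -p ∈ E
        · have hlt' := hn hpn
          have : -p < q := by
            by_contra hc
            rcases (not_lt.1 hc).eq_or_lt with e | e
            · rw [e] at hlt'; omega
            · have := Ld.basc_lt hw2 hq' ((hE.mem _).1 hpn).2 e
              omega
          have := hE.pos _ hpn
          omega
        · have m := hE.sub p 0 hp' hpE hpn
          have := l.R_lt ht m hq'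
          have := l.R_lt ht (hneg m) hq'
          omega
      exact ⟨by omega, fun h => hp0 (by rw [h, W_zero]), hpq, hlt⟩
    · rintro ⟨p, q⟩ _
      simp only [W_inv_apply]
    · rintro ⟨p, q⟩ _
      simp only [W_apply_inv]

/-! ### Monomials and quantum numbers -/

theorem uv_injective {a b a' b' : ℤ} (h : uv a b = uv a' b') : a = a' ∧ b = b' := by
  have h' : (AddMonoidAlgebra.single (a, b) 1 : AddMonoidAlgebra ℤ (ℤ × ℤ)) =
    AddMonoidAlgebra.single (a', b') 1 := h
  have := AddMonoidAlgebra.single_left_injective (R := ℤ) one_ne_zero h'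
  exact Prod.mk.inj this

theorem uv_pow (a b : ℤ) (k : ℕ) : uv a b ^ k = uv (k * a) (k * b) := by
  induction k with
  | zero => simp [uv_zero]
  | succ k ih => rw [pow_succ, ih, uv_mul]; congr 1 <;> push_cast <;> ring

theorem uK_ne_zero : uK ≠ 0 := by
  intro h
  have h1 : algebraMap Laur LaurK (uv 1 0 * uv (-1) 0) = 0 := by
    rw [map_mul, show algebraMap Laur LaurK (uv 1 0) = uK from rfl, h, zero_mul]
  rw [uv_mul, add_neg_cancel, add_zero, uv_zero, map_one] at h1
  exact one_ne_zero h1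

theorem vK_ne_zero : vK ≠ 0 := by
  intro h
  have h1 : algebraMap Laur LaurK (uv 0 1 * uv 0 (-1)) = 0 := by
    rw [map_mul, show algebraMap Laur LaurK (uv 0 1) = vK from rfl, h, zero_mul]
  rw [uv_mul, add_neg_cancel, add_zero, uv_zero, map_one] at h1
  exact one_ne_zero h1

theorem uK_zpow (a : ℤ) : uK ^ a = algebraMap Laur LaurK (uv a 0) := by
  have key : ∀ k : ℕ, uK ^ k = algebraMap Laur LaurK (uv k 0) := fun k => by
    rw [uK, ← map_pow, uv_pow, mul_one, mul_zero]
  obtain ⟨k, rfl | rfl⟩ := a.eq_nat_or_neg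
  · rw [zpow_natCast, key]
  · rw [zpow_neg, zpow_natCast]
    refine inv_eq_of_mul_eq_one_right ?_
    rw [key, ← map_mul, uv_mul, add_neg_cancel, add_zero, uv_zero, map_one]

theorem vK_zpow (a : ℤ) : vK ^ a = algebraMap Laur LaurK (uv 0 a) := by
  have key : ∀ k : ℕ, vK ^ k = algebraMap Laur LaurK (uv 0 k) := fun k => by
    rw [vK, ← map_pow, uv_pow, mul_one, mul_zero]
  obtain ⟨k, rfl | rfl⟩ := a.eq_nat_or_neg
  · rw [zpow_natCast, key]
  · rw [zpow_neg, zpow_natCast]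
    refine inv_eq_of_mul_eq_one_right ?_
    rw [key, ← map_mul, uv_mul, add_neg_cancel, add_zero, uv_zero, map_one]

theorem algebraMap_uv (a b : ℤ) : algebraMap Laur LaurK (uv a b) = uK ^ a * vK ^ b := by
  rw [uK_zpow, vK_zpow, ← map_mul, uv_mul, add_zero, zero_add]

theorem bar_algebraMap (x : Laur) : bar (algebraMap Laur LaurK x) = algebraMap Laur LaurK (barA x) :=
  IsFractionRing.ringEquivOfRingEquiv_algebraMap barA x

theorem bar_uK : bar uK = uK⁻¹ := by
  rw [uK, bar_algebraMap, barA_uv, neg_zero, ← uK_zpow, zpow_neg_one, uK]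

theorem bar_vK : bar vK = vK⁻¹ := by
  rw [vK, bar_algebraMap, barA_uv, neg_zero, ← vK_zpow, zpow_neg_one, vK]

theorem vK_zpow_ne_one {a : ℤ} (ha : a ≠ 0) : vK ^ a ≠ 1 := by
  rw [vK_zpow, ← map_one (algebraMap Laur LaurK), ← uv_zero]
  intro h
  exact ha (uv_injective (IsFractionRing.injective Laur LaurK h)).2

theorem vK_sq_sub_one : vK ^ 2 - 1 ≠ 0 := by
  have := vK_zpow_ne_one (a := 2) (by norm_num)
  rw [sub_ne_zero]
  exact_mod_cast this

theorem qnum_zero : qnum 0 = 0 := by simp [qnum]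

theorem qnum_nat (k : ℕ) : qnum k = ((vK ^ 2) ^ k - 1) / (vK ^ 2 - 1) := by
  rw [qnum, ← pow_mul]
  norm_cast

theorem qnum_add (a b : ℕ) :
    qnum ((a + b : ℕ) : ℤ) = qnum (a : ℤ) + (vK ^ 2) ^ a * qnum (b : ℤ) := by
  rw [qnum_nat, qnum_nat, qnum_nat, pow_add]
  have := vK_sq_sub_one
  field_simp
  ring

theorem qnum_ne_zero {k : ℕ} (hk : k ≠ 0) : qnum k ≠ 0 := by
  rw [qnum]
  refine div_ne_zero (sub_ne_zero.2 (vK_zpow_ne_one (by omega))) vK_sq_sub_one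

theorem qfact_zero : qfact 0 = 1 := by simp [qfact]

theorem qfact_succ (k : ℕ) : qfact (k + 1) = qfact k * qnum ((k + 1 : ℕ) : ℤ) := by
  rw [qfact, prod_Icc_succ_top (by omega), qfact]

theorem qfact_ne_zero (k : ℕ) : qfact k ≠ 0 := by
  refine prod_ne_zero_iff.2 fun i hi => qnum_ne_zero ?_
  rw [mem_Icc] at hi
  omega

theorem cfact_zero : cfact 0 = 1 := by simp [cfact]

theorem cnum_succ (k : ℕ) : cnum (k + 1) =
    qnum ((k + 1 : ℕ) : ℤ) * (uK ^ 2 * (vK ^ 2) ^ k + 1) := by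
  rw [cnum, ← pow_mul]
  congr 3
  rw [show (2 * (((k + 1 : ℕ) : ℤ) - 1)) = ((2 * k : ℕ) : ℤ) by push_cast; ring, zpow_natCast]

theorem cfact_succ (k : ℕ) : cfact (k + 1) =
    cfact k * (qnum ((k + 1 : ℕ) : ℤ) * (uK ^ 2 * (vK ^ 2) ^ k + 1)) := by
  rw [cfact, prod_Icc_succ_top (by omega), cfact, cnum_succ]

theorem uK_sq_mul_add_one_ne_zero (k : ℕ) : uK ^ 2 * (vK ^ 2) ^ k + 1 ≠ 0 := by
  -- otherwise the square of `u² v^{2k}` would be `1`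
  intro h
  have h1 : uK ^ (4 : ℤ) * vK ^ ((4 * k : ℕ) : ℤ) = 1 := by
    rw [zpow_natCast, show (uK : LaurK) ^ (4 : ℤ) = uK ^ 4 from zpow_ofNat uK 4]
    have h2 : uK ^ 2 * (vK ^ 2) ^ k = -1 := by linear_combination h
    calc uK ^ 4 * vK ^ (4 * k) = (uK ^ 2 * (vK ^ 2) ^ k) ^ 2 := by ring
      _ = 1 := by rw [h2]; norm_num
  rw [← algebraMap_uv, ← map_one (algebraMap Laur LaurK), ← uv_zero] at h1
  have := (uv_injective (IsFractionRing.injective Laur LaurK h1)).1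
  omega

theorem cfact_ne_zero (k : ℕ) : cfact k ≠ 0 := by
  induction k with
  | zero => rw [cfact_zero]; exact one_ne_zero
  | succ k ih =>
    rw [cfact_succ]
    exact mul_ne_zero ih (mul_ne_zero (qnum_ne_zero (by omega)) (uK_sq_mul_add_one_ne_zero k))

/-- The quantum binomial coefficient `[a + t]! / ([a]! [t]!)`. -/
noncomputable def gauss (a t : ℕ) : LaurK := qfact (a + t) / (qfact a * qfact t)

theorem gauss_zero_right (a : ℕ) : gauss a 0 = 1 := by
  rw [gauss, add_zero, qfact_zero, mul_one, div_self (qfact_ne_zero a)]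

theorem gauss_zero_left (t : ℕ) : gauss 0 t = 1 := by
  rw [gauss, zero_add, qfact_zero, one_mul, div_self (qfact_ne_zero t)]

theorem gauss_succ_left (a t : ℕ) :
    gauss (a + 1) t * qnum ((a + 1 : ℕ) : ℤ) = gauss a t * qnum ((a + t + 1 : ℕ) : ℤ) := by
  have h1 := qfact_ne_zero a
  have h2 := qfact_ne_zero t
  have h3 : qnum ((a + 1 : ℕ) : ℤ) ≠ 0 := qnum_ne_zero (by omega)
  rw [gauss, gauss, show a + 1 + t = a + t + 1 by ring, qfact_succ, qfact_succ]
  field_simp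

theorem gauss_succ_right (a t : ℕ) :
    gauss a (t + 1) * qnum ((t + 1 : ℕ) : ℤ) = gauss a t * qnum ((a + t + 1 : ℕ) : ℤ) := by
  have h1 := qfact_ne_zero a
  have h2 := qfact_ne_zero t
  have h3 : qnum ((t + 1 : ℕ) : ℤ) ≠ 0 := qnum_ne_zero (by omega)
  rw [gauss, gauss, ← add_assoc, qfact_succ, qfact_succ]
  field_simp

/-- The Pascal recursion. -/
theorem gauss_succ_succ (a t : ℕ) :
    gauss (a + 1) (t + 1) = gauss a (t + 1) + (vK ^ 2) ^ (a + 1) * gauss (a + 1) t := by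
  have h : qnum ((a + 1 + (t + 1) : ℕ) : ℤ) ≠ 0 := qnum_ne_zero (by omega)
  have h1 := gauss_succ_left a (t + 1)
  have h2 := gauss_succ_right (a + 1) t
  rw [show a + (t + 1) + 1 = a + 1 + (t + 1) by ring] at h1
  rw [show a + 1 + t + 1 = a + 1 + (t + 1) by ring] at h2
  apply mul_right_cancel₀ h
  rw [add_mul, mul_assoc _ (gauss (a + 1) t), ← h1, ← h2, qnum_add]
  ring

theorem qbinom_eq (a t : ℕ) : qbinom ((a : ℤ) + t) t = gauss a t := by
  have h0 := vK_sq_sub_one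
  induction t generalizing a with
  | zero => simp [qbinom, gauss_zero_right]
  | succ t ih =>
    have h3 : qnum ((t + 1 : ℕ) : ℤ) ≠ 0 := qnum_ne_zero (by omega)
    rw [qbinom, prod_Icc_succ_top (by omega)]
    have e : ∏ i ∈ Icc 1 t, (vK ^ (2 * ((a : ℤ) + ((t + 1 : ℕ) : ℤ) - i + 1)) - 1) / (vK ^ (2 * i) - 1)
        = qbinom (((a + 1 : ℕ) : ℤ) + t) t := by
      rw [qbinom]
      refine prod_congr rfl fun i _ => ?_
      congr 4
      push_cast
      ring
    rw [e, ih (a + 1)]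
    apply mul_right_cancel₀ h3
    rw [gauss_succ_right, show a + t + 1 = (a + 1) + t by ring]
    have h5 : (vK ^ (2 * ((a : ℤ) + ((t + 1 : ℕ) : ℤ) - ((t + 1 : ℕ) : ℤ) + 1)) - 1) / (vK ^ (2 * (t + 1)) - 1) =
        qnum ((a + 1 : ℕ) : ℤ) / qnum ((t + 1 : ℕ) : ℤ) := by
      rw [qnum, qnum_nat, div_div_div_cancel_right₀ h0, ← pow_mul]
      congr 4
      push_cast
      ring
    rw [h5, mul_assoc, div_mul_cancel₀ _ h3]
    have := gauss_succ_left a t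
    rw [this, show a + 1 + t = a + t + 1 by ring]

/-! ### The generating function of the subsets of a block -/

theorem card_filter_product {R : ℤ → ℤ → Prop} [∀ a b, Decidable (R a b)] (S T : Finset ℤ) :
    #{z ∈ S ×ˢ T | R z.1 z.2} = ∑ x ∈ S, #{y ∈ T | R x y} := by
  rw [card_filter, sum_product]
  simp only [card_filter]

theorem card_filter_insert_eq {P : Finset ℤ} {f : ℤ → ℤ} {N : ℤ} (hN : N ∉ P) (j : ℤ) :
    #{p ∈ insert N P | f p = j} = #{p ∈ P | f p = j} + if j = f N then 1 else 0 := by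
  rw [filter_insert]
  by_cases h : f N = j
  · rw [if_pos h, if_pos h.symm, card_insert_of_notMem (by simp [hN])]
  · rw [if_neg h, if_neg (fun h' => h h'.symm), add_zero]

theorem card_eq_sum_content {I S : Finset ℤ} {f : ℤ → ℤ} (h : ∀ p ∈ S, f p ∈ I) :
    #S = ∑ j ∈ I, #{p ∈ S | f p = j} := card_eq_sum_card_fiberwise h

/-- The generating function, by the number of inversions, of the subsets of `P` with `t_j` elements
in the fibre of the monotone map `f` over `j`; here this fibre has `a_j + t_j` elements. -/
theorem sum_powerset_inversions (I : Finset ℤ) (f : ℤ → ℤ) (P : Finset ℤ) :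
    MonotoneOn f P → (∀ p ∈ P, f p ∈ I) → ∀ a t : ℤ → ℕ,
    (∀ j ∈ I, #{p ∈ P | f p = j} = a j + t j) →
    (∑ S ∈ P.powerset, if ∀ j ∈ I, #{p ∈ S | f p = j} = t j then
      (vK ^ 2) ^ #{z ∈ S ×ˢ (P \ S) | z.2 < z.1} else 0) =
    (vK ^ 2) ^ (∑ l ∈ I, ∑ k ∈ I with k < l, t l * a k) * ∏ l ∈ I, gauss (a l) (t l) := by
  induction P using Finset.induction_on_max with
  | empty =>
    intro _ _ a t h
    have ht : ∀ j ∈ I, a j = 0 ∧ t j = 0 := fun j hj => by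
      have := h j hj
      simp at this
      omega
    have h1 : ∑ l ∈ I, ∑ k ∈ I with k < l, t l * a k = 0 :=
      sum_eq_zero fun l hl => sum_eq_zero fun k _ => by rw [(ht l hl).2, zero_mul]
    have h2 : ∏ l ∈ I, gauss (a l) (t l) = 1 :=
      prod_eq_one fun l hl => by rw [(ht l hl).2, gauss_zero_right]
    rw [h1, h2, powerset_empty, sum_singleton, if_pos]
    · simp
    · intro j hj
      simp [(ht j hj).2]
  | insert N P hN ih =>
    intro hf hfI a t h
    have hNP : N ∉ P := fun h => lt_irrefl _ (hN N h)
    have hfI' : ∀ p ∈ P, f p ∈ I := fun p hp => hfI p (mem_insert_of_mem hp)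
    have hf' : MonotoneOn f P := hf.mono (by simp)
    have ih := ih hf' hfI'
    set l := f N with hl
    have hlI : l ∈ I := hfI N (mem_insert_self N P)
    have hc : ∀ j ∈ I, #{p ∈ P | f p = j} + (if j = l then 1 else 0) = a j + t j := fun j hj => by
      rw [← h j hj, card_filter_insert_eq hNP]
    have hmax : ∀ j ∈ I, l < j → a j = 0 ∧ t j = 0 := by
      intro j hj hlj
      have h1 := h j hj
      have h2 : #{p ∈ insert N P | f p = j} = 0 := by
        rw [card_eq_zero, filter_eq_empty_iff]
        intro p hp hpj
        have hpN : p ≤ N := by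
          rcases mem_insert.1 hp with rfl | hp
          · exact le_rfl
          · exact (hN p hp).le
        have := hf (by exact_mod_cast hp) (by simp) hpN
        omega
      omega
    have hnl : a l + t l ≠ 0 := by
      have := hc l hlI
      rw [if_pos rfl] at this
      omega
    rw [sum_powerset_insert hNP]
    have hq : qnum ((a l + t l : ℕ) : ℤ) ≠ 0 := qnum_ne_zero hnl
    apply mul_right_cancel₀ hq
    rw [add_mul]
    -- the subsets that do not contain `N`
    have claim1 : (∑ S ∈ P.powerset, if ∀ j ∈ I, #{p ∈ S | f p = j} = t j then
        (vK ^ 2) ^ #{z ∈ S ×ˢ (insert N P \ S) | z.2 < z.1} else 0) * qnum ((a l + t l : ℕ) : ℤ) =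
        (vK ^ 2) ^ (∑ l ∈ I, ∑ k ∈ I with k < l, t l * a k) *
          (∏ l ∈ I, gauss (a l) (t l)) * qnum (a l : ℤ) := by
      rcases Nat.eq_zero_or_pos (a l) with ha | ha
      · rw [ha, Nat.cast_zero, qnum_zero, mul_zero, sum_eq_zero, zero_mul]
        intro S hS
        rw [if_neg]
        intro hS'
        have h1 := hS' l hlI
        have h2 := hc l hlI
        have h3 := card_le_card (filter_subset_filter (f · = l) (mem_powerset.1 hS))
        rw [if_pos rfl] at h2
        omega
      · obtain ⟨a0, ha0⟩ : ∃ a0, a l = a0 + 1 := ⟨a l - 1, by omega⟩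
        have ih := ih (fun j => if j = l then a0 else a j) t (fun j hj => by
          have := hc j hj
          split_ifs at this ⊢ with hj'
          · subst hj'; omega
          · omega)
        have e1 : (∑ S ∈ P.powerset, if ∀ j ∈ I, #{p ∈ S | f p = j} = t j then
            (vK ^ 2) ^ #{z ∈ S ×ˢ (insert N P \ S) | z.2 < z.1} else 0) =
            ∑ S ∈ P.powerset, if ∀ j ∈ I, #{p ∈ S | f p = j} = t j then
            (vK ^ 2) ^ #{z ∈ S ×ˢ (P \ S) | z.2 < z.1} else 0 := by
          refine sum_congr rfl fun S hS => ?_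
          rw [mem_powerset] at hS
          congr 2
          rw [insert_sdiff_of_notMem _ (fun h => hNP (hS h)),
            card_filter_product (R := fun x y => y < x), card_filter_product (R := fun x y => y < x)]
          refine sum_congr rfl fun x hx => ?_
          rw [filter_insert, if_neg (not_lt.2 (hN x (hS hx)).le)]
        have e2 : ∑ l' ∈ I, ∑ k ∈ I with k < l', t l' * (if k = l then a0 else a k) =
            ∑ l' ∈ I, ∑ k ∈ I with k < l', t l' * a k := by
          refine sum_congr rfl fun l' hl' => sum_congr rfl fun k hk => ?_
          by_cases hll : l < l'
          · rw [(hmax l' hl' hll).2, zero_mul, zero_mul]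
          · rw [mem_filter] at hk
            rw [if_neg (by omega)]
        rw [e1, ih, e2, mul_assoc, mul_assoc]
        congr 1
        rw [← mul_prod_erase I _ hlI, ← mul_prod_erase I (fun j => gauss (a j) (t j)) hlI, if_pos rfl]
        have e3 : ∏ x ∈ I.erase l, gauss (if x = l then a0 else a x) (t x) =
            ∏ x ∈ I.erase l, gauss (a x) (t x) :=
          prod_congr rfl fun x hx => by rw [if_neg (ne_of_mem_erase hx)]
        have e4 := gauss_succ_left a0 (t l)
        rw [e3, ha0, show a0 + 1 + t l = a0 + t l + 1 by ring]
        linear_combination -(∏ x ∈ I.erase l, gauss (a x) (t x)) * e4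
    -- the subsets that contain `N`
    have claim2 : (∑ S ∈ P.powerset, if ∀ j ∈ I, #{p ∈ insert N S | f p = j} = t j then
        (vK ^ 2) ^ #{z ∈ insert N S ×ˢ (insert N P \ insert N S) | z.2 < z.1} else 0) *
          qnum ((a l + t l : ℕ) : ℤ) =
        (vK ^ 2) ^ (∑ l ∈ I, ∑ k ∈ I with k < l, t l * a k) *
          (∏ l ∈ I, gauss (a l) (t l)) * ((vK ^ 2) ^ a l * qnum (t l : ℤ)) := by
      rcases Nat.eq_zero_or_pos (t l) with ht | ht
      · rw [ht, Nat.cast_zero, qnum_zero, mul_zero, mul_zero, sum_eq_zero, zero_mul]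
        intro S hS
        rw [if_neg]
        intro hS'
        have h1 := hS' l hlI
        rw [card_filter_insert_eq (fun h => hNP (mem_powerset.1 hS h)), if_pos rfl] at h1
        omega
      · obtain ⟨t0, ht0⟩ : ∃ t0, t l = t0 + 1 := ⟨t l - 1, by omega⟩
        have ih := ih a (fun j => if j = l then t0 else t j) (fun j hj => by
          have := hc j hj
          split_ifs at this ⊢ with hj'
          · subst hj'; omega
          · omega)
        have e1 : (∑ S ∈ P.powerset, if ∀ j ∈ I, #{p ∈ insert N S | f p = j} = t j then
            (vK ^ 2) ^ #{z ∈ insert N S ×ˢ (insert N P \ insert N S) | z.2 < z.1} else 0) =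
            (vK ^ 2) ^ (∑ j ∈ I, a j) * ∑ S ∈ P.powerset,
            if ∀ j ∈ I, #{p ∈ S | f p = j} = if j = l then t0 else t j then
            (vK ^ 2) ^ #{z ∈ S ×ˢ (P \ S) | z.2 < z.1} else 0 := by
          rw [mul_sum]
          refine sum_congr rfl fun S hS => ?_
          rw [mem_powerset] at hS
          have hNS : N ∉ S := fun h => hNP (hS h)
          have hcond : (∀ j ∈ I, #{p ∈ insert N S | f p = j} = t j) ↔
              ∀ j ∈ I, #{p ∈ S | f p = j} = if j = l then t0 else t j := by
            refine forall₂_congr fun j hj => ?_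
            rw [card_filter_insert_eq hNS]
            split_ifs with hj'
            · subst hj'; rw [ht0] at *; omega
            · omega
          by_cases hS' : ∀ j ∈ I, #{p ∈ S | f p = j} = if j = l then t0 else t j
          · rw [if_pos (hcond.2 hS'), if_pos hS', ← pow_add]
            congr 1
            have hd : insert N P \ insert N S = P \ S := by
              ext x
              simp only [mem_sdiff, mem_insert]
              constructor
              · rintro ⟨h1, h2⟩; tauto
              · rintro ⟨h1, h2⟩
                exact ⟨Or.inr h1, by rintro (rfl | h); exacts [hNP h1, h2 h]⟩
            rw [hd, card_filter_product (R := fun x y => y < x),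
              card_filter_product (R := fun x y => y < x), sum_insert hNS]
            congr 1
            have h5 : {y ∈ P \ S | y < N} = P \ S :=
              filter_true_of_mem fun y hy => hN y (mem_sdiff.1 hy).1
            have h6 := card_sdiff_add_card_eq_card hS
            have h7 := card_eq_sum_content (S := P) hfI'
            have h8 := card_eq_sum_content (S := S) (I := I) (f := f) fun p hp => hfI' p (hS hp)
            have h9 : ∑ j ∈ I, #{p ∈ P | f p = j} = ∑ j ∈ I, a j + ∑ j ∈ I, #{p ∈ S | f p = j} := by
              rw [← sum_add_distrib]
              refine sum_congr rfl fun j hj => ?_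
              have := hc j hj
              rw [hS' j hj]
              split_ifs at this ⊢ with hj'
              · subst hj'; omega
              · omega
            rw [h5]
            omega
          · rw [if_neg (fun h => hS' (hcond.1 h)), if_neg hS', mul_zero]
        have e2 : ∑ l' ∈ I, ∑ k ∈ I with k < l', t l' * a k =
            ∑ l' ∈ I, ∑ k ∈ I with k < l', (if l' = l then t0 else t l') * a k +
              ∑ k ∈ I with k < l, a k := by
          rw [← add_sum_erase I _ hlI, ← add_sum_erase I (fun l' => ∑ k ∈ I with k < l',
            (if l' = l then t0 else t l') * a k) hlI, ht0, if_pos rfl]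
          have : ∑ x ∈ I.erase l, ∑ k ∈ I with k < x, (if x = l then t0 else t x) * a k =
              ∑ x ∈ I.erase l, ∑ k ∈ I with k < x, t x * a k :=
            sum_congr rfl fun x hx => by rw [if_neg (ne_of_mem_erase hx)]
          rw [this]
          simp only [add_mul, one_mul, sum_add_distrib]
          ring
        have e5 : ∑ j ∈ I, a j = ∑ k ∈ I with k < l, a k + a l := by
          rw [← sum_filter_add_sum_filter_not I (· < l)]
          congr 1
          rw [sum_eq_single_of_mem l (by simp [hlI])]
          intro j hj hjl
          rw [mem_filter] at hj
          exact (hmax j hj.1 (by omega)).1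
        rw [e1, ih, e2, e5]
        rw [← mul_prod_erase I _ hlI, ← mul_prod_erase I (fun j => gauss (a j) (t j)) hlI, if_pos rfl]
        have e3 : ∏ x ∈ I.erase l, gauss (a x) (if x = l then t0 else t x) =
            ∏ x ∈ I.erase l, gauss (a x) (t x) :=
          prod_congr rfl fun x hx => by rw [if_neg (ne_of_mem_erase hx)]
        have e4 := gauss_succ_right (a l) t0
        rw [e3, ht0, ← add_assoc, pow_add, pow_add _ (∑ x ∈ I, _)]
        linear_combination -(∏ x ∈ I.erase l, gauss (a x) (t x)) * (vK ^ 2) ^ (∑ k ∈ I with k < l, a k)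
          * (vK ^ 2) ^ a l * (vK ^ 2) ^
            (∑ l' ∈ I, ∑ k ∈ I with k < l', (if l' = l then t0 else t l') * a k) * e4
    rw [claim1, claim2, qnum_add]
    ring

theorem gauss_comm (a t : ℕ) : gauss a t = gauss t a := by
  rw [gauss, gauss, add_comm, mul_comm (qfact a)]

/-- The generating function for the opposite order, obtained by passing to complements. -/
theorem sum_powerset_inversions' (I : Finset ℤ) (f : ℤ → ℤ) (P : Finset ℤ) (hf : MonotoneOn f P)
    (hfI : ∀ p ∈ P, f p ∈ I) (a t : ℤ → ℕ) (h : ∀ j ∈ I, #{p ∈ P | f p = j} = a j + t j) :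
    (∑ S ∈ P.powerset, if ∀ j ∈ I, #{p ∈ S | f p = j} = t j then
      (vK ^ 2) ^ #{z ∈ S ×ˢ (P \ S) | z.1 < z.2} else 0) =
    (vK ^ 2) ^ (∑ l ∈ I, ∑ k ∈ I with k < l, a l * t k) * ∏ l ∈ I, gauss (a l) (t l) := by
  have key := sum_powerset_inversions I f P hf hfI t a (fun j hj => by rw [h j hj, add_comm])
  simp only [gauss_comm (t _)] at key
  rw [← key]
  refine sum_nbij' (P \ ·) (P \ ·) ?_ ?_ ?_ ?_ ?_
  · intro S _; exact mem_powerset.2 sdiff_subset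
  · intro S _; exact mem_powerset.2 sdiff_subset
  · intro S hS; exact Finset.sdiff_sdiff_eq_self (mem_powerset.1 hS)
  · intro S hS; exact Finset.sdiff_sdiff_eq_self (mem_powerset.1 hS)
  · intro S hS
    rw [mem_powerset] at hS
    have hcond : (∀ j ∈ I, #{p ∈ S | f p = j} = t j) ↔ ∀ j ∈ I, #{p ∈ P \ S | f p = j} = a j := by
      refine forall₂_congr fun j hj => ?_
      have h1 := h j hj
      have h2 : {p ∈ P \ S | f p = j} = {p ∈ P | f p = j} \ {p ∈ S | f p = j} := by
        ext p; simp only [mem_filter, mem_sdiff]; tauto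
      have h3 := card_sdiff_add_card_eq_card (filter_subset_filter (f · = j) hS)
      rw [h2]
      omega
    simp only [hcond]
    congr 2
    rw [Finset.sdiff_sdiff_eq_self hS]
    refine card_nbij' Prod.swap Prod.swap ?_ ?_ ?_ ?_
    · rintro ⟨x, y⟩ hz
      simp only [coe_filter, mem_product, Set.mem_ofPred_eq, Prod.swap] at hz ⊢
      tauto
    · rintro ⟨x, y⟩ hz
      simp only [coe_filter, mem_product, Set.mem_ofPred_eq, Prod.swap] at hz ⊢
      tauto
    · intro z _; exact Prod.swap_swap z
    · intro z _; exact Prod.swap_swap z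

/-! ### The generating function of the isotropic subsets of a symmetric interval -/

/-- The weight of an isotropic subset of `[-N, N]`; it is `q_w` for the corresponding representative
`w` of the symmetric block. -/
noncomputable def isoWeight (N : ℕ) (S : Finset ℤ) : LaurK :=
  (uK ^ 2) ^ #{p ∈ S | p < 0} * (vK ^ 2) ^ #(isoInversions (Icc (-N : ℤ) N) S)

/-- The interval `[-N, N]` without `0` and `±S` has `2 (N - |S|)` elements. -/
theorem card_isotropic_compl {N : ℕ} {S : Finset ℤ} (hS : S ⊆ Icc (-N : ℤ) N)
    (hi : ∀ p ∈ S, -p ∉ S) :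
    #{p ∈ Icc (-N : ℤ) N \ S | p ≠ 0 ∧ -p ∉ S} + 2 * #S = 2 * N := by
  have h0 : (0 : ℤ) ∉ S := fun h => hi 0 h (by simpa using h)
  set T := {p ∈ Icc (-N : ℤ) N \ S | p ≠ 0 ∧ -p ∉ S} with hT
  have e : Icc (-N : ℤ) N = insert 0 (T ∪ (S ∪ S.image Neg.neg)) := by
    ext p
    have : p ∈ S.image Neg.neg ↔ -p ∈ S := by
      rw [mem_image]
      exact ⟨by rintro ⟨q, hq, rfl⟩; rwa [neg_neg], fun h => ⟨-p, h, neg_neg p⟩⟩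
    rw [mem_insert, mem_union, mem_union, this, hT, mem_filter, mem_sdiff]
    constructor
    · tauto
    · rintro (rfl | h | h | h)
      · simp
      · exact h.1.1
      · exact hS h
      · have := hS h
        rw [mem_Icc] at this ⊢
        omega
  have h1 := congrArg card e
  rw [Int.card_Icc, card_insert_of_notMem, card_union_of_disjoint, card_union_of_disjoint,
    card_image_of_injective _ neg_injective] at h1
  · omega
  · rw [disjoint_left]
    intro p hp hp'
    obtain ⟨q, hq, rfl⟩ := mem_image.1 hp'
    exact hi q hq hp
  · rw [disjoint_left]
    intro p hp hp'
    rw [hT, mem_filter, mem_sdiff] at hp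
    rcases mem_union.1 hp' with h | h
    · exact hp.1.2 h
    · obtain ⟨q, hq, rfl⟩ := mem_image.1 h
      rw [neg_neg] at hp
      exact hp.2.2 hq
  · rw [mem_union, mem_union, mem_image, hT, mem_filter]
    rintro (h | h | ⟨q, hq, h⟩)
    · exact h.2.1 rfl
    · exact h0 h
    · rw [neg_eq_zero] at h
      exact h0 (h ▸ hq)

theorem card_isoInversions {P S : Finset ℤ} : #(isoInversions P S) =
    ∑ x ∈ S, #{y ∈ P \ S | y ≠ 0 ∧ x < y ∧ (-y ∈ S → -y < x)} := by
  rw [isoInversions]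
  exact card_filter_product (R := fun x y => y ≠ 0 ∧ x < y ∧ (-y ∈ S → -y < x)) _ _

theorem Icc_succ_eq (N : ℕ) : Icc (-((N + 1 : ℕ) : ℤ)) ((N + 1 : ℕ) : ℤ) =
    insert ((N + 1 : ℕ) : ℤ) (insert (-((N + 1 : ℕ) : ℤ)) (Icc (-N : ℤ) N)) := by
  ext p; simp only [mem_Icc, mem_insert]; push_cast; omega

/-- If `±(N + 1) ∉ S`, then `N + 1` forms an inversion with each element of `S`, and `-(N + 1)` with
none. -/
theorem isoWeight_of_subset {N : ℕ} {S : Finset ℤ} (hS : S ⊆ Icc (-N : ℤ) N) :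
    isoWeight (N + 1) S = (vK ^ 2) ^ #S * isoWeight N S := by
  have hb : ∀ p ∈ S, -(N : ℤ) ≤ p ∧ p ≤ N := fun p hp => mem_Icc.1 (hS hp)
  rw [isoWeight, isoWeight]
  have : #(isoInversions (Icc (-((N + 1 : ℕ) : ℤ)) ((N + 1 : ℕ) : ℤ)) S) =
      #S + #(isoInversions (Icc (-N : ℤ) N) S) := by
    rw [card_isoInversions, card_isoInversions, card_eq_sum_ones, ← sum_add_distrib]
    refine sum_congr rfl fun x hx => ?_
    have hx' := hb x hx
    have : {y ∈ Icc (-((N + 1 : ℕ) : ℤ)) ((N + 1 : ℕ) : ℤ) \ S | y ≠ 0 ∧ x < y ∧ (-y ∈ S → -y < x)} =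
        insert ((N + 1 : ℕ) : ℤ) {y ∈ Icc (-N : ℤ) N \ S | y ≠ 0 ∧ x < y ∧ (-y ∈ S → -y < x)} := by
      ext y
      rw [Icc_succ_eq]
      simp only [mem_filter, mem_sdiff, mem_insert]
      constructor
      · rintro ⟨⟨h1 | h1 | h1, h2⟩, h3⟩
        · exact Or.inl h1
        · push_cast at h1; omega
        · exact Or.inr ⟨⟨h1, h2⟩, h3⟩
      · rintro (rfl | ⟨⟨h1, h2⟩, h3⟩)
        · refine ⟨⟨Or.inl rfl, fun h => ?_⟩, by omega, by push_cast; omega, fun h => ?_⟩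
          · have := hb _ h; push_cast at this; omega
          · have := hb _ h; push_cast at this; omega
        · exact ⟨⟨Or.inr (Or.inr h1), h2⟩, h3⟩
    rw [this, card_insert_of_notMem, add_comm]
    simp only [mem_filter, mem_sdiff, mem_Icc]
    push_cast
    omega
  rw [this]
  ring

theorem isoWeight_insert_pos {N : ℕ} {S : Finset ℤ} (hS : S ⊆ Icc (-N : ℤ) N) :
    isoWeight (N + 1) (insert ((N + 1 : ℕ) : ℤ) S) = isoWeight N S := by
  have hb : ∀ p ∈ S, -(N : ℤ) ≤ p ∧ p ≤ N := fun p hp => mem_Icc.1 (hS hp)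
  rw [isoWeight, isoWeight, filter_insert, if_neg (by omega)]
  congr 3
  ext ⟨x, y⟩
  rw [Icc_succ_eq]
  simp only [isoInversions, mem_filter, mem_product, mem_sdiff, mem_insert, mem_Icc]
  constructor
  · rintro ⟨⟨h1, h2, h3⟩, h4, h5, h6⟩
    have hx : x ∈ S := by
      refine h1.resolve_left fun h => ?_
      subst h
      push_cast at *
      omega
    have := hb x hx
    push_cast at *
    refine ⟨⟨hx, by omega, by tauto⟩, h4, h5, fun h => h6 (Or.inr h)⟩
  · rintro ⟨⟨h1, h2, h3⟩, h4, h5, h6⟩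
    push_cast at *
    refine ⟨⟨Or.inr h1, Or.inr (Or.inr h2), ?_⟩, h4, h5, fun h => h6 (h.resolve_left (by omega))⟩
    rintro (h | h)
    · omega
    · exact h3 h

/-- The element `-(N + 1)` of the subset forms inversions with the `2 (N - |S|)` elements outside
`±S ∪ {0}`, and `N + 1` forms one with each element of `S`; in total these are `2 N - |S|`. -/
theorem isoWeight_insert_neg {N : ℕ} {S : Finset ℤ} (hS : S ⊆ Icc (-N : ℤ) N)
    (hi : ∀ p ∈ S, -p ∉ S) :
    isoWeight (N + 1) (insert (-((N + 1 : ℕ) : ℤ)) S) =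
      uK ^ 2 * (vK ^ 2) ^ (2 * N - #S) * isoWeight N S := by
  have hb : ∀ p ∈ S, -(N : ℤ) ≤ p ∧ p ≤ N := fun p hp => mem_Icc.1 (hS hp)
  have hM : -((N + 1 : ℕ) : ℤ) ∉ S := fun h => by have := hb _ h; push_cast at this; omega
  have hM' : ((N + 1 : ℕ) : ℤ) ∉ S := fun h => by have := hb _ h; push_cast at this; omega
  rw [isoWeight, isoWeight, filter_insert, if_pos (by push_cast; omega),
    card_insert_of_notMem (fun h => hM (mem_of_mem_filter _ h))]
  have hd : ∀ y, y ∈ Icc (-((N + 1 : ℕ) : ℤ)) ((N + 1 : ℕ) : ℤ) \ insert (-((N + 1 : ℕ) : ℤ)) S ↔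
      y = ((N + 1 : ℕ) : ℤ) ∨ y ∈ Icc (-N : ℤ) N \ S := by
    intro y
    rw [Icc_succ_eq]
    simp only [mem_sdiff, mem_insert, mem_Icc, not_or]
    constructor
    · tauto
    · rintro (rfl | ⟨h1, h2⟩)
      · exact ⟨Or.inl rfl, by omega, hM'⟩
      · exact ⟨Or.inr (Or.inr h1), by push_cast; omega, h2⟩
  have : #(isoInversions (Icc (-((N + 1 : ℕ) : ℤ)) ((N + 1 : ℕ) : ℤ))
      (insert (-((N + 1 : ℕ) : ℤ)) S)) = 2 * N - #S + #(isoInversions (Icc (-N : ℤ) N) S) := by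
    rw [card_isoInversions, card_isoInversions, sum_insert hM]
    have e1 : {y ∈ Icc (-((N + 1 : ℕ) : ℤ)) ((N + 1 : ℕ) : ℤ) \ insert (-((N + 1 : ℕ) : ℤ)) S |
        y ≠ 0 ∧ -((N + 1 : ℕ) : ℤ) < y ∧ (-y ∈ insert (-((N + 1 : ℕ) : ℤ)) S →
          -y < -((N + 1 : ℕ) : ℤ))} = {p ∈ Icc (-N : ℤ) N \ S | p ≠ 0 ∧ -p ∉ S} := by
      ext y
      rw [mem_filter, mem_filter, hd, mem_insert]
      constructor
      · rintro ⟨h1, h2, h3, h4⟩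
        have hy : y ≠ ((N + 1 : ℕ) : ℤ) := fun h => by
          have := h4 (Or.inl (by rw [h]))
          omega
        refine ⟨h1.resolve_left hy, h2, fun h => ?_⟩
        have := h4 (Or.inr h)
        have := hb _ h
        push_cast at *
        omega
      · rintro ⟨h1, h2, h3⟩
        have h1' := mem_Icc.1 (mem_sdiff.1 h1).1
        refine ⟨Or.inr h1, h2, by push_cast; omega, ?_⟩
        rintro (h | h)
        · push_cast at h; omega
        · exact absurd h h3
    have e2 : ∀ x ∈ S, #{y ∈ Icc (-((N + 1 : ℕ) : ℤ)) ((N + 1 : ℕ) : ℤ) \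
        insert (-((N + 1 : ℕ) : ℤ)) S | y ≠ 0 ∧ x < y ∧ (-y ∈ insert (-((N + 1 : ℕ) : ℤ)) S →
          -y < x)} = 1 + #{y ∈ Icc (-N : ℤ) N \ S | y ≠ 0 ∧ x < y ∧ (-y ∈ S → -y < x)} := by
      intro x hx
      have hx' := hb x hx
      have : {y ∈ Icc (-((N + 1 : ℕ) : ℤ)) ((N + 1 : ℕ) : ℤ) \
          insert (-((N + 1 : ℕ) : ℤ)) S | y ≠ 0 ∧ x < y ∧ (-y ∈ insert (-((N + 1 : ℕ) : ℤ)) S →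
          -y < x)} = insert ((N + 1 : ℕ) : ℤ)
            {y ∈ Icc (-N : ℤ) N \ S | y ≠ 0 ∧ x < y ∧ (-y ∈ S → -y < x)} := by
        ext y
        rw [mem_filter, hd, mem_insert (s := S), mem_insert, mem_filter]
        constructor
        · rintro ⟨h1 | h1, h2, h3, h4⟩
          · exact Or.inl h1
          · exact Or.inr ⟨h1, h2, h3, fun h => h4 (Or.inr h)⟩
        · rintro (rfl | ⟨h1, h2, h3, h4⟩)
          · refine ⟨Or.inl rfl, by omega, by push_cast; omega, fun _ => by push_cast; omega⟩
          · refine ⟨Or.inr h1, h2, h3, fun h => h4 (h.resolve_left ?_)⟩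
            have := mem_Icc.1 (mem_sdiff.1 h1).1
            push_cast
            omega
      rw [this, card_insert_of_notMem, add_comm]
      simp only [mem_filter, mem_sdiff, mem_Icc]
      push_cast
      omega
    rw [e1, sum_congr rfl e2, sum_add_distrib, ← card_eq_sum_ones]
    have := card_isotropic_compl hS hi
    omega
  rw [this]
  ring

/-- The recursion that removes the pair `±(N + 1)`. -/
theorem sum_isoWeight_succ (N : ℕ) (c : Finset ℤ → Prop) [DecidablePred c] :
    (∑ S ∈ (Icc (-((N + 1 : ℕ) : ℤ)) ((N + 1 : ℕ) : ℤ)).powerset,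
      if (∀ p ∈ S, -p ∉ S) ∧ c S then isoWeight (N + 1) S else 0) =
    (∑ S ∈ (Icc (-N : ℤ) N).powerset,
      if (∀ p ∈ S, -p ∉ S) ∧ c S then (vK ^ 2) ^ #S * isoWeight N S else 0) +
    (∑ S ∈ (Icc (-N : ℤ) N).powerset,
      if (∀ p ∈ S, -p ∉ S) ∧ c (insert ((N + 1 : ℕ) : ℤ) S) then isoWeight N S else 0) +
    ∑ S ∈ (Icc (-N : ℤ) N).powerset, if (∀ p ∈ S, -p ∉ S) ∧ c (insert (-((N + 1 : ℕ) : ℤ)) S) then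
      uK ^ 2 * (vK ^ 2) ^ (2 * N - #S) * isoWeight N S else 0 := by
  set M : ℤ := ((N + 1 : ℕ) : ℤ) with hM
  have hMN : M = N + 1 := by rw [hM]; push_cast; ring
  have h1 : -M ∉ Icc (-N : ℤ) N := by rw [mem_Icc]; omega
  have h2 : M ∉ insert (-M) (Icc (-N : ℤ) N) := by rw [mem_insert, mem_Icc]; omega
  rw [Icc_succ_eq, ← hM, sum_powerset_insert h2, sum_powerset_insert h1, sum_powerset_insert h1]
  have z : ∑ S ∈ (Icc (-N : ℤ) N).powerset,
      (if (∀ p ∈ insert M (insert (-M) S), -p ∉ insert M (insert (-M) S)) ∧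
        c (insert M (insert (-M) S)) then isoWeight (N + 1) (insert M (insert (-M) S)) else 0) = 0 :=
    sum_eq_zero fun S _ => if_neg fun h => h.1 M (by simp) (by simp)
  have iso : ∀ S ∈ (Icc (-N : ℤ) N).powerset, ∀ m, m = M ∨ m = -M →
      ((∀ p ∈ insert m S, -p ∉ insert m S) ↔ ∀ p ∈ S, -p ∉ S) := by
    intro S hS m hm
    have hb : ∀ p ∈ S, -(N : ℤ) ≤ p ∧ p ≤ N := fun p hp => mem_Icc.1 (mem_powerset.1 hS hp)
    constructor
    · intro h p hp hp'
      exact h p (mem_insert_of_mem hp) (mem_insert_of_mem hp')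
    · intro h p hp hp'
      rw [mem_insert] at hp hp'
      rcases hp with rfl | hp <;> rcases hp' with hp' | hp'
      · omega
      · have := hb _ hp'; omega
      · have := hb _ hp; omega
      · exact h p hp hp'
  rw [z, add_zero, add_right_comm]
  congr 1
  · congr 1
    · refine sum_congr rfl fun S hS => ?_
      rw [isoWeight_of_subset (mem_powerset.1 hS)]
    · refine sum_congr rfl fun S hS => ?_
      rw [isoWeight_insert_pos (mem_powerset.1 hS)]
      simp only [iso S hS M (Or.inl rfl)]
  · refine sum_congr rfl fun S hS => ?_
    simp only [iso S hS (-M) (Or.inr rfl)]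
    split_ifs with h
    · rw [isoWeight_insert_neg (mem_powerset.1 hS) h.1]
    · rfl

theorem cnum_ratio (k : ℕ) : qnum ((k + 1 : ℕ) : ℤ) * (uK ^ 2 * (vK ^ 2) ^ k + 1) ≠ 0 :=
  mul_ne_zero (qnum_ne_zero (by omega)) (uK_sq_mul_add_one_ne_zero k)

/-- The type B analogue `[a + t]_𝔠^! / ([a]_𝔠^! [t]!)` of the quantum binomial coefficient. -/
noncomputable def cgauss (a t : ℕ) : LaurK := cfact (a + t) / (cfact a * qfact t)

theorem cgauss_zero_right (a : ℕ) : cgauss a 0 = 1 := by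
  rw [cgauss, add_zero, qfact_zero, mul_one, div_self (cfact_ne_zero a)]

theorem cgauss_succ_left (a t : ℕ) :
    cgauss (a + 1) t * (qnum ((a + 1 : ℕ) : ℤ) * (uK ^ 2 * (vK ^ 2) ^ a + 1)) =
      cgauss a t * (qnum ((a + t + 1 : ℕ) : ℤ) * (uK ^ 2 * (vK ^ 2) ^ (a + t) + 1)) := by
  have h1 := cfact_ne_zero a
  have h2 := qfact_ne_zero t
  have h3 := cnum_ratio a
  rw [cgauss, cgauss, show a + 1 + t = a + t + 1 by ring, cfact_succ, cfact_succ,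
    div_mul_eq_mul_div, div_mul_eq_mul_div,
    div_eq_div_iff (mul_ne_zero (mul_ne_zero h1 h3) h2) (mul_ne_zero h1 h2)]
  ring

theorem cgauss_succ_right (a t : ℕ) :
    cgauss a (t + 1) * qnum ((t + 1 : ℕ) : ℤ) =
      cgauss a t * (qnum ((a + t + 1 : ℕ) : ℤ) * (uK ^ 2 * (vK ^ 2) ^ (a + t) + 1)) := by
  have h1 := cfact_ne_zero a
  have h2 := qfact_ne_zero t
  have h3 : qnum ((t + 1 : ℕ) : ℤ) ≠ 0 := qnum_ne_zero (by omega)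
  rw [cgauss, cgauss, ← add_assoc, cfact_succ, qfact_succ, div_mul_eq_mul_div, div_mul_eq_mul_div,
    div_eq_div_iff (mul_ne_zero h1 (mul_ne_zero h2 h3)) (mul_ne_zero h1 h2)]
  ring

/-- The recursion of `cgauss`, in a form that covers the boundary cases `a = 0` and `t = 0`. -/
theorem cgauss_rec {a t : ℕ} (h : a + t ≠ 0) : cgauss a t =
    (if a = 0 then 0 else (vK ^ 2) ^ t * cgauss (a - 1) t) +
      if t = 0 then 0 else (1 + uK ^ 2 * (vK ^ 2) ^ (2 * a + t - 1)) * cgauss a (t - 1) := by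
  have h1 : qnum ((a + t : ℕ) : ℤ) * (uK ^ 2 * (vK ^ 2) ^ (a + t - 1) + 1) ≠ 0 := by
    obtain ⟨k, hk⟩ : ∃ k, a + t = k + 1 := ⟨a + t - 1, by omega⟩
    rw [hk]
    exact cnum_ratio k
  apply mul_right_cancel₀ h1
  have e1 : (if a = 0 then 0 else (vK ^ 2) ^ t * cgauss (a - 1) t) *
      (qnum ((a + t : ℕ) : ℤ) * (uK ^ 2 * (vK ^ 2) ^ (a + t - 1) + 1)) =
      (vK ^ 2) ^ t * cgauss a t * qnum (a : ℤ) * (uK ^ 2 * (vK ^ 2) ^ (a - 1) + 1) := by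
    rcases a with _ | a
    · simp [qnum_zero]
    · have := cgauss_succ_left a t
      rw [if_neg (by omega), Nat.add_sub_cancel, show a + 1 + t = a + t + 1 by ring,
        Nat.add_sub_cancel]
      linear_combination -(vK ^ 2) ^ t * this
  have e2 : (if t = 0 then 0 else (1 + uK ^ 2 * (vK ^ 2) ^ (2 * a + t - 1)) * cgauss a (t - 1)) *
      (qnum ((a + t : ℕ) : ℤ) * (uK ^ 2 * (vK ^ 2) ^ (a + t - 1) + 1)) =
      (1 + uK ^ 2 * (vK ^ 2) ^ (2 * a + t - 1)) * cgauss a t * qnum (t : ℤ) := by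
    rcases t with _ | t
    · simp [qnum_zero]
    · have := cgauss_succ_right a t
      rw [if_neg (by omega), Nat.add_sub_cancel, ← add_assoc, ← add_assoc, Nat.add_sub_cancel,
        Nat.add_sub_cancel]
      linear_combination -(1 + uK ^ 2 * (vK ^ 2) ^ (2 * a + t)) * this
  rw [add_mul, e1, e2]
  have e3 : qnum ((a + t : ℕ) : ℤ) = qnum (t : ℤ) + (vK ^ 2) ^ t * qnum (a : ℤ) := by
    rw [add_comm, qnum_add]
  have e4 : qnum ((a + t : ℕ) : ℤ) = qnum (a : ℤ) + (vK ^ 2) ^ a * qnum (t : ℤ) := qnum_add a t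
  have e5 : qnum (a : ℤ) * (vK ^ 2) ^ t * (vK ^ 2) ^ (a - 1) = qnum (a : ℤ) * (vK ^ 2) ^ (a + t - 1) := by
    rcases a with _ | a
    · simp [qnum_zero]
    · rw [mul_assoc, ← pow_add]; congr 2; omega
  have e6 : qnum (t : ℤ) * (vK ^ 2) ^ (2 * a + t - 1) =
      qnum (t : ℤ) * (vK ^ 2) ^ a * (vK ^ 2) ^ (a + t - 1) := by
    rcases t with _ | t
    · simp [qnum_zero]
    · rw [mul_assoc _ _ ((vK ^ 2) ^ (a + _ - 1)), ← pow_add]; congr 2; omega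
  linear_combination cgauss a t * e3 + cgauss a t * uK ^ 2 * (vK ^ 2) ^ (a + t - 1) * e4
    - cgauss a t * uK ^ 2 * e5 - cgauss a t * uK ^ 2 * e6

/-- The generating function of the isotropic subsets of `[-N, N]` with `t` elements. -/
theorem sum_isoWeight (N : ℕ) : ∀ a t : ℕ, a + t = N →
    (∑ S ∈ (Icc (-N : ℤ) N).powerset, if (∀ p ∈ S, -p ∉ S) ∧ #S = t then isoWeight N S else 0) =
      cgauss a t := by
  induction N with
  | zero =>
    intro a t h
    obtain ⟨rfl, rfl⟩ : a = 0 ∧ t = 0 := by omega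
    rw [cgauss_zero_right, sum_eq_single_of_mem ∅ (by simp)]
    · simp [isoWeight, isoInversions]
    · intro S _ hS
      rw [if_neg]
      rintro ⟨_, h⟩
      exact hS (card_eq_zero.1 h)
  | succ N ih =>
    intro a t h
    rw [sum_isoWeight_succ, cgauss_rec (by omega)]
    have hM : ∀ S ∈ (Icc (-N : ℤ) N).powerset,
        ((N + 1 : ℕ) : ℤ) ∉ S ∧ -((N + 1 : ℕ) : ℤ) ∉ S := fun S hS => by
      rw [mem_powerset] at hS
      refine ⟨fun h => ?_, fun h => ?_⟩ <;>
      · have := mem_Icc.1 (hS h); push_cast at this; omega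
    have c1 : (∑ S ∈ (Icc (-N : ℤ) N).powerset, if (∀ p ∈ S, -p ∉ S) ∧ #S = t then
        (vK ^ 2) ^ #S * isoWeight N S else 0) =
        if a = 0 then 0 else (vK ^ 2) ^ t * cgauss (a - 1) t := by
      split_ifs with ha
      · refine sum_eq_zero fun S hS => if_neg ?_
        rintro ⟨h1, h2⟩
        have := card_isotropic_compl (mem_powerset.1 hS) h1
        omega
      · rw [← ih (a - 1) t (by omega), mul_sum]
        refine sum_congr rfl fun S _ => ?_
        split_ifs with h1
        · rw [h1.2]
        · rw [mul_zero]
    have c2 : (∑ S ∈ (Icc (-N : ℤ) N).powerset,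
        if (∀ p ∈ S, -p ∉ S) ∧ #(insert ((N + 1 : ℕ) : ℤ) S) = t then isoWeight N S else 0) =
        if t = 0 then 0 else cgauss a (t - 1) := by
      split_ifs with ht
      · refine sum_eq_zero fun S hS => if_neg ?_
        rintro ⟨h1, h2⟩
        rw [card_insert_of_notMem (hM S hS).1] at h2
        omega
      · rw [← ih a (t - 1) (by omega)]
        refine sum_congr rfl fun S hS => ?_
        rw [card_insert_of_notMem (hM S hS).1]
        simp only [show #S + 1 = t ↔ #S = t - 1 by omega]
    have c3 : (∑ S ∈ (Icc (-N : ℤ) N).powerset,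
        if (∀ p ∈ S, -p ∉ S) ∧ #(insert (-((N + 1 : ℕ) : ℤ)) S) = t then
          uK ^ 2 * (vK ^ 2) ^ (2 * N - #S) * isoWeight N S else 0) =
        if t = 0 then 0 else uK ^ 2 * (vK ^ 2) ^ (2 * a + t - 1) * cgauss a (t - 1) := by
      split_ifs with ht
      · refine sum_eq_zero fun S hS => if_neg ?_
        rintro ⟨h1, h2⟩
        rw [card_insert_of_notMem (hM S hS).2] at h2
        omega
      · rw [← ih a (t - 1) (by omega), mul_sum]
        refine sum_congr rfl fun S hS => ?_
        rw [card_insert_of_notMem (hM S hS).2]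
        simp only [show #S + 1 = t ↔ #S = t - 1 by omega]
        split_ifs with h1
        · rw [h1.2]
          congr 3
          omega
        · rw [mul_zero]
    rw [c1, c2, c3]
    split_ifs <;> ring

/-- The quantum trinomial coefficient `[a + t + s]! / ([a]! [t]! [s]!)`. -/
noncomputable def trinom (a t s : ℕ) : LaurK :=
  qfact (a + t + s) / (qfact a * qfact t * qfact s)

theorem trinom_zero : trinom 0 0 0 = 1 := by simp [trinom, qfact_zero]

theorem trinom_succ_left (a t s : ℕ) :
    trinom (a + 1) t s * qnum ((a + 1 : ℕ) : ℤ) =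
      trinom a t s * qnum ((a + t + s + 1 : ℕ) : ℤ) := by
  have h1 := qfact_ne_zero a
  have h2 := qfact_ne_zero t
  have h3 := qfact_ne_zero s
  have h4 : qnum ((a + 1 : ℕ) : ℤ) ≠ 0 := qnum_ne_zero (by omega)
  rw [trinom, trinom, show a + 1 + t + s = a + t + s + 1 by ring, qfact_succ, qfact_succ]
  field_simp

theorem trinom_succ_mid (a t s : ℕ) :
    trinom a (t + 1) s * qnum ((t + 1 : ℕ) : ℤ) =
      trinom a t s * qnum ((a + t + s + 1 : ℕ) : ℤ) := by
  have h1 := qfact_ne_zero a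
  have h2 := qfact_ne_zero t
  have h3 := qfact_ne_zero s
  have h4 : qnum ((t + 1 : ℕ) : ℤ) ≠ 0 := qnum_ne_zero (by omega)
  rw [trinom, trinom, show a + (t + 1) + s = a + t + s + 1 by ring, qfact_succ, qfact_succ]
  field_simp

theorem trinom_succ_right (a t s : ℕ) :
    trinom a t (s + 1) * qnum ((s + 1 : ℕ) : ℤ) =
      trinom a t s * qnum ((a + t + s + 1 : ℕ) : ℤ) := by
  have h1 := qfact_ne_zero a
  have h2 := qfact_ne_zero t
  have h3 := qfact_ne_zero s
  have h4 : qnum ((s + 1 : ℕ) : ℤ) ≠ 0 := qnum_ne_zero (by omega)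
  rw [trinom, trinom, ← add_assoc, qfact_succ, qfact_succ]
  field_simp

/-- The exponent of `v²` in the monomial factor of the generating function `isoGen` of the isotropic
subsets `S` with `t_j` elements in the fibre over `j`; here `a_j` is the number of elements of this
fibre that are neither `0` nor in `±S`. -/
noncomputable def isoExp (n : ℕ) (a t : ℤ → ℕ) : ℕ :=
  (∑ j ∈ Icc (-n : ℤ) n, ∑ k ∈ Icc (-n : ℤ) n with j < k, t j * a k) +
    (∑ j ∈ Icc (-n : ℤ) n, ∑ k ∈ Icc (-n : ℤ) n with j < k ∧ j + k < 0, t j * t k) +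
    ∑ j ∈ Icc (-n : ℤ) n with j < 0, (t j).choose 2

/-- The closed form of the generating function of the isotropic subsets with given fibres, where
`a_0 = 2 a0` for the fibre over `0`. -/
noncomputable def isoGen (n a0 : ℕ) (a t : ℤ → ℕ) : LaurK :=
  (uK ^ 2) ^ (∑ k ∈ Icc (-n : ℤ) n with k < 0, t k) * (vK ^ 2) ^ isoExp n a t *
    (cgauss a0 (t 0) * ∏ l ∈ Icc (1 : ℤ) n, trinom (a l) (t l) (t (-l)))

theorem isoExp_eq (n : ℕ) (a t : ℤ → ℕ) : isoExp n a t =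
    (∑ j ∈ Icc (-n : ℤ) n, ∑ k ∈ Icc (-n : ℤ) n, if j < k then t j * a k else 0) +
    (∑ j ∈ Icc (-n : ℤ) n, ∑ k ∈ Icc (-n : ℤ) n, if j < k ∧ j + k < 0 then t j * t k else 0) +
    ∑ j ∈ Icc (-n : ℤ) n, if j < 0 then (t j).choose 2 else 0 := by
  simp only [isoExp, sum_filter]

theorem sum_sum_ite_add_single {I : Finset ℤ} {m : ℤ} (hm : m ∈ I) (c : ℤ → ℤ → Prop)
    [∀ j k, Decidable (c j k)] (t : ℤ → ℕ) :
    (∑ j ∈ I, ∑ k ∈ I, if c j k then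
      (t j + if j = m then 1 else 0) * (t k + if k = m then 1 else 0) else 0) =
    (∑ j ∈ I, ∑ k ∈ I, if c j k then t j * t k else 0) + (∑ k ∈ I, if c m k then t k else 0) +
      (∑ j ∈ I, if c j m then t j else 0) + if c m m then 1 else 0 := by
  have e : ∀ j k, (if c j k then
      (t j + if j = m then 1 else 0) * (t k + if k = m then 1 else 0) else 0) =
      (if c j k then t j * t k else 0) + (if j = m then (if c m k then t k else 0) else 0) +
      (if k = m then (if c j m then t j else 0) else 0) +
      if j = m then (if k = m then (if c m m then 1 else 0) else 0) else 0 := by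
    intro j k
    by_cases hj : j = m <;> by_cases hk : k = m
    · subst hj; subst hk; simp only [if_true]; split_ifs <;> ring
    · subst hj; simp only [if_true, if_neg hk]; split_ifs <;> ring
    · subst hk; simp only [if_true, if_neg hj]; split_ifs <;> ring
    · simp only [if_neg hj, if_neg hk]; split_ifs <;> ring
  have e2 : ∀ j, (∑ k ∈ I, if j = m then (if c m k then t k else 0) else 0) =
      if j = m then (∑ k ∈ I, if c m k then t k else 0) else 0 := by
    intro j; split_ifs <;> simp
  have e3 : ∀ j, (∑ k ∈ I, if j = m then (if k = m then (if c m m then 1 else 0) else 0) else 0) =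
      if j = m then (if c m m then 1 else 0) else 0 := by
    intro j
    split_ifs with h1 h2
    · rw [sum_ite_eq' I m, if_pos hm]
    · simp
    · simp
  simp only [e, sum_add_distrib, e2, e3, sum_ite_eq', if_pos hm]

section

variable {n : ℕ} {l : ℤ} (hl : 1 ≤ l) (hln : l ≤ n)

include hl hln

/-- The change of `isoExp` when the pair `±N` in the fibres over `±l` lies outside the subset; here `l`
is the largest index of a nonempty fibre. -/
theorem isoExp_add_left (a t : ℤ → ℕ) (ht : ∀ j ∈ Icc (-n : ℤ) n, l < |j| → t j = 0) :
    isoExp n (fun j => a j + ((if j = l then 1 else 0) + if j = -l then 1 else 0)) t + t l =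
      isoExp n a t + ∑ j ∈ Icc (-n : ℤ) n, t j := by
  have h1 : l ∈ Icc (-n : ℤ) n := mem_Icc.2 (by omega)
  have h2 : -l ∈ Icc (-n : ℤ) n := mem_Icc.2 (by omega)
  have e : ∀ j ∈ Icc (-n : ℤ) n, (∑ k ∈ Icc (-n : ℤ) n, if j < k then
      t j * (a k + ((if k = l then 1 else 0) + if k = -l then 1 else 0)) else 0) =
      (∑ k ∈ Icc (-n : ℤ) n, if j < k then t j * a k else 0) + if j = l then 0 else t j := by
    intro j hj
    have : ∀ k, (if j < k then
        t j * (a k + ((if k = l then 1 else 0) + if k = -l then 1 else 0)) else 0) =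
        (if j < k then t j * a k else 0) + ((if k = l then (if j < l then t j else 0) else 0) +
          if k = -l then (if j < -l then t j else 0) else 0) := by
      intro k
      by_cases hk : k = l
      · rw [if_pos hk, if_pos hk, if_neg (show ¬k = -l by omega),
          if_neg (show ¬k = -l by omega), hk]
        split_ifs <;> ring
      · by_cases hk' : k = -l
        · rw [if_neg hk, if_neg hk, if_pos hk', if_pos hk', hk']
          split_ifs <;> ring
        · rw [if_neg hk, if_neg hk, if_neg hk', if_neg hk']
          split_ifs <;> ring
    simp only [this, sum_add_distrib, sum_ite_eq', if_pos h1, if_pos h2]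
    have := ht j hj
    rw [lt_abs] at this
    split_ifs <;> omega
  have e' : ∑ j ∈ Icc (-n : ℤ) n, t j = (∑ j ∈ Icc (-n : ℤ) n, if j = l then 0 else t j) + t l := by
    rw [← add_sum_erase _ _ h1, ← add_sum_erase _ (fun j => if j = l then 0 else t j) h1, if_pos rfl,
      zero_add, add_comm]
    congr 1
    exact sum_congr rfl fun x hx => (if_neg (ne_of_mem_erase hx)).symm
  rw [isoExp_eq, isoExp_eq, sum_congr rfl e, sum_add_distrib, e']
  ring

/-- The change of `isoExp` when `N` belongs to the subset. -/
theorem isoExp_add_mid (a t : ℤ → ℕ) (ha : ∀ j ∈ Icc (-n : ℤ) n, l < |j| → a j = 0)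
    (ht : ∀ j ∈ Icc (-n : ℤ) n, l < |j| → t j = 0) :
    isoExp n a (fun j => t j + if j = l then 1 else 0) = isoExp n a t := by
  have h1 : l ∈ Icc (-n : ℤ) n := mem_Icc.2 (by omega)
  rw [isoExp_eq, isoExp_eq, sum_sum_ite_add_single h1 (fun j k => j < k ∧ j + k < 0)]
  have e1 : ∀ j ∈ Icc (-n : ℤ) n, (∑ k ∈ Icc (-n : ℤ) n,
      if j < k then (t j + if j = l then 1 else 0) * a k else 0) =
      ∑ k ∈ Icc (-n : ℤ) n, if j < k then t j * a k else 0 := by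
    intro j hj
    refine sum_congr rfl fun k hk => ?_
    by_cases hjl : j = l
    · split_ifs with h
      · rw [ha k hk (by rw [lt_abs]; omega), mul_zero, mul_zero]
      · rfl
    · rw [if_neg hjl, add_zero]
  have e2 : (∑ k ∈ Icc (-n : ℤ) n, if l < k ∧ l + k < 0 then t k else 0) = 0 :=
    sum_eq_zero fun k _ => if_neg (by omega)
  have e3 : (∑ j ∈ Icc (-n : ℤ) n, if j < l ∧ j + l < 0 then t j else 0) = 0 := by
    refine sum_eq_zero fun j hj => ?_
    split_ifs with h
    · exact ht j hj (by rw [lt_abs]; omega)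
    · rfl
  have e4 : ∀ j, (if j < 0 then (t j + if j = l then 1 else 0).choose 2 else 0) =
      if j < 0 then (t j).choose 2 else 0 := by
    intro j
    split_ifs <;> first | rfl | omega
  rw [sum_congr rfl e1, e2, e3, if_neg (by omega)]
  simp only [e4, add_zero]

/-- The change of `isoExp` when `-N` belongs to the subset. -/
theorem isoExp_add_right (a t : ℤ → ℕ) (ha : ∀ j ∈ Icc (-n : ℤ) n, l < |j| → a j = 0)
    (hs : a (-l) = a l) (ht : ∀ j ∈ Icc (-n : ℤ) n, l < |j| → t j = 0) :
    isoExp n a (fun j => t j + if j = -l then 1 else 0) + (a l + t l) =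
      isoExp n a t + ∑ j ∈ Icc (-n : ℤ) n, (a j + t j) := by
  have h1 : l ∈ Icc (-n : ℤ) n := mem_Icc.2 (by omega)
  have h2 : -l ∈ Icc (-n : ℤ) n := mem_Icc.2 (by omega)
  rw [isoExp_eq, isoExp_eq, sum_sum_ite_add_single h2 (fun j k => j < k ∧ j + k < 0)]
  have split1 : ∀ g : ℤ → ℕ, ∑ j ∈ Icc (-n : ℤ) n, g j =
      (∑ j ∈ Icc (-n : ℤ) n, if j = -l then 0 else g j) + g (-l) := by
    intro g
    rw [← add_sum_erase _ _ h2, ← add_sum_erase _ (fun j => if j = -l then 0 else g j) h2, if_pos rfl,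
      zero_add, add_comm]
    congr 1
    exact sum_congr rfl fun x hx => (if_neg (ne_of_mem_erase hx)).symm
  have split2 : ∀ g : ℤ → ℕ, (∑ j ∈ Icc (-n : ℤ) n, if j = -l then 0 else g j) =
      (∑ j ∈ Icc (-n : ℤ) n, if j = -l then 0 else if j = l then 0 else g j) + g l := by
    intro g
    rw [← add_sum_erase _ _ h1, ← add_sum_erase _
      (fun j => if j = -l then 0 else if j = l then 0 else g j) h1, if_pos rfl,
      if_neg (by omega), if_neg (by omega), zero_add, add_comm]
    congr 1
    refine sum_congr rfl fun x hx => ?_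
    rw [if_neg (ne_of_mem_erase hx)]
  have e1 : ∀ j ∈ Icc (-n : ℤ) n, (∑ k ∈ Icc (-n : ℤ) n,
      if j < k then (t j + if j = -l then 1 else 0) * a k else 0) =
      (∑ k ∈ Icc (-n : ℤ) n, if j < k then t j * a k else 0) +
        if j = -l then (∑ k ∈ Icc (-n : ℤ) n, if k = -l then 0 else a k) else 0 := by
    intro j hj
    by_cases hjl : j = -l
    · subst hjl
      rw [if_pos rfl, if_pos rfl, ← sum_add_distrib]
      refine sum_congr rfl fun k hk => ?_
      have := ha k hk
      rw [lt_abs] at this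
      rcases lt_trichotomy k (-l) with h | h | h
      · rw [if_neg (by omega), if_neg (by omega), if_neg (by omega), this (by omega)]
      · rw [if_neg (by omega), if_neg (by omega), if_pos h]
      · rw [if_pos h, if_pos h, if_neg (by omega)]; ring
    · simp only [if_neg hjl, add_zero]
  have e2 : (∑ k ∈ Icc (-n : ℤ) n, if -l < k ∧ -l + k < 0 then t k else 0) =
      ∑ j ∈ Icc (-n : ℤ) n, if j = -l then 0 else if j = l then 0 else t j := by
    refine sum_congr rfl fun k hk => ?_
    have := ht k hk
    rw [lt_abs] at this
    split_ifs <;> omega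
  have e3 : (∑ j ∈ Icc (-n : ℤ) n, if j < -l ∧ j + -l < 0 then t j else 0) = 0 := by
    refine sum_eq_zero fun j hj => ?_
    split_ifs with h
    · exact ht j hj (by rw [lt_abs]; omega)
    · rfl
  have e4 : ∀ j, (if j < 0 then (t j + if j = -l then 1 else 0).choose 2 else 0) =
      (if j < 0 then (t j).choose 2 else 0) + if j = -l then t (-l) else 0 := by
    intro j
    by_cases hjl : j = -l
    · subst hjl
      rw [if_pos (by omega), if_pos rfl, if_pos (by omega), if_pos rfl,
        Nat.choose_succ_succ' _ 1, Nat.choose_one_right, add_comm]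
    · rw [if_neg hjl, if_neg hjl, add_zero, add_zero]
  rw [sum_congr rfl e1, e2, e3, if_neg (by omega)]
  simp only [e4, sum_add_distrib, sum_ite_eq', if_pos h2]
  rw [split1 a, split1 t, split2 t, hs]
  ring

end

/-- The generating function of the isotropic subsets of `[-N, N]` with prescribed numbers of
elements in the fibres of an odd monotone map `f`. The induction removes the pair `±N` until `f`
vanishes, where `sum_isoWeight` applies. -/
theorem sum_isotropic (n : ℕ) (f : ℤ → ℤ) (N : ℕ) : MonotoneOn f (Icc (-N : ℤ) N) →
    (∀ p ∈ Icc (-N : ℤ) N, f (-p) = -f p) → (∀ p ∈ Icc (-N : ℤ) N, f p ∈ Icc (-n : ℤ) n) →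
    ∀ (a0 : ℕ) (a t : ℤ → ℕ), (∀ j, a (-j) = a j) → a 0 = 2 * a0 →
    (∀ j ∈ Icc (-n : ℤ) n, #{p ∈ Icc (-N : ℤ) N | f p = j} =
      a j + t j + t (-j) + if j = 0 then 1 else 0) →
    (∑ S ∈ (Icc (-N : ℤ) N).powerset,
      if (∀ p ∈ S, -p ∉ S) ∧ ∀ j ∈ Icc (-n : ℤ) n, #{p ∈ S | f p = j} = t j then
        isoWeight N S else 0) = isoGen n a0 a t := by
  -- the case where `f` vanishes
  have base : ∀ N : ℕ, (∀ p ∈ Icc (-N : ℤ) N, f p = 0) →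
      ∀ (a0 : ℕ) (a t : ℤ → ℕ), a 0 = 2 * a0 →
      (∀ j ∈ Icc (-n : ℤ) n, #{p ∈ Icc (-N : ℤ) N | f p = j} =
        a j + t j + t (-j) + if j = 0 then 1 else 0) →
      (∑ S ∈ (Icc (-N : ℤ) N).powerset,
        if (∀ p ∈ S, -p ∉ S) ∧ ∀ j ∈ Icc (-n : ℤ) n, #{p ∈ S | f p = j} = t j then
          isoWeight N S else 0) = isoGen n a0 a t := by
    intro N hf a0 a t ha0 h
    have h0I : (0 : ℤ) ∈ Icc (-n : ℤ) n := mem_Icc.2 (by omega)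
    have hz : ∀ j ∈ Icc (-n : ℤ) n, j ≠ 0 → a j = 0 ∧ t j = 0 := by
      intro j hj hj0
      have h1 := h j hj
      rw [if_neg hj0, filter_false_of_mem fun p hp => by rw [hf p hp]; exact hj0.symm,
        card_empty] at h1
      omega
    have hN : a0 + t 0 = N := by
      have h1 := h 0 h0I
      rw [if_pos rfl, filter_true_of_mem hf, Int.card_Icc, neg_zero, ha0] at h1
      omega
    have e1 : ∑ k ∈ Icc (-n : ℤ) n with k < 0, t k = 0 := sum_eq_zero fun k hk => by
      rw [mem_filter] at hk
      exact (hz k hk.1 hk.2.ne).2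
    have e2 : isoExp n a t = 0 := by
      rw [isoExp]
      have z1 : ∑ j ∈ Icc (-n : ℤ) n, ∑ k ∈ Icc (-n : ℤ) n with j < k, t j * a k = 0 :=
        sum_eq_zero fun j hj => sum_eq_zero fun k hk => by
          rw [mem_filter] at hk
          by_cases hj0 : j = 0
          · rw [(hz k hk.1 (by omega)).1, mul_zero]
          · rw [(hz j hj hj0).2, zero_mul]
      have z2 : ∑ j ∈ Icc (-n : ℤ) n, ∑ k ∈ Icc (-n : ℤ) n with j < k ∧ j + k < 0, t j * t k = 0 :=
        sum_eq_zero fun j hj => sum_eq_zero fun k hk => by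
          rw [mem_filter] at hk
          rw [(hz j hj (by omega)).2, zero_mul]
      have z3 : ∑ j ∈ Icc (-n : ℤ) n with j < 0, (t j).choose 2 = 0 :=
        sum_eq_zero fun j hj => by
          rw [mem_filter] at hj
          rw [(hz j hj.1 hj.2.ne).2]; rfl
      rw [z1, z2, z3]
    have e3 : ∏ l ∈ Icc (1 : ℤ) n, trinom (a l) (t l) (t (-l)) = 1 := prod_eq_one fun l hl => by
      rw [mem_Icc] at hl
      rw [(hz l (mem_Icc.2 (by omega)) (by omega)).1, (hz l (mem_Icc.2 (by omega)) (by omega)).2,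
        (hz (-l) (mem_Icc.2 (by omega)) (by omega)).2, trinom_zero]
    rw [isoGen, e1, e2, e3, pow_zero, pow_zero, one_mul, one_mul, mul_one, ← sum_isoWeight N _ _ hN]
    refine sum_congr rfl fun S hS => ?_
    rw [mem_powerset] at hS
    have : (∀ j ∈ Icc (-n : ℤ) n, #{p ∈ S | f p = j} = t j) ↔ #S = t 0 := by
      constructor
      · intro h1
        have := h1 0 h0I
        rwa [filter_true_of_mem fun p hp => hf p (hS hp)] at this
      · intro h1 j hj
        by_cases hj0 : j = 0
        · rw [hj0, filter_true_of_mem fun p hp => hf p (hS hp), h1]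
        · rw [(hz j hj hj0).2, filter_false_of_mem fun p hp => by
            rw [hf p (hS hp)]; exact fun h => hj0 h.symm, card_empty]
    simp only [this]
  induction N with
  | zero =>
    intro _ hodd _ a0 a t _ ha0 h
    refine base 0 (fun p hp => ?_) a0 a t ha0 h
    obtain rfl : p = 0 := by simpa using hp
    have := hodd 0 hp
    rw [neg_zero] at this
    omega
  | succ N ih =>
    intro hf hodd hfI a0 a t hs ha0 h
    set M : ℤ := ((N + 1 : ℕ) : ℤ) with hM
    have hMN : M = N + 1 := by rw [hM]; push_cast; ring
    have hsub : Icc (-N : ℤ) N ⊆ Icc (-M) M := fun p hp => by rw [mem_Icc] at hp ⊢; omega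
    have hMm : M ∈ Icc (-M) M := mem_Icc.2 (by omega)
    have hf0 : f 0 = 0 := by
      have := hodd 0 (mem_Icc.2 (by omega))
      rw [neg_zero] at this
      omega
    have hle : ∀ p ∈ Icc (-M) M, f p ≤ f M := fun p hp =>
      hf (by exact_mod_cast hp) (by exact_mod_cast hMm) (mem_Icc.1 hp).2
    have hle' : ∀ p ∈ Icc (-M) M, -f M ≤ f p := fun p hp => by
      have hp' : -p ∈ Icc (-M) M := by rw [mem_Icc] at hp ⊢; omega
      have := hle (-p) hp'
      rw [hodd p hp] at this
      omega
    by_cases hl0 : f M = 0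
    · refine base (N + 1) (fun p hp => ?_) a0 a t ha0 h
      have := hle p hp
      have := hle' p hp
      omega
    set l := f M with hl
    have hl1 : 1 ≤ l := by
      have := hle 0 (mem_Icc.2 (by omega))
      omega
    have hln : l ≤ n := (mem_Icc.1 (hfI M hMm)).2
    have hlI : l ∈ Icc (-n : ℤ) n := mem_Icc.2 (by omega)
    have hlI' : -l ∈ Icc (-n : ℤ) n := mem_Icc.2 (by omega)
    have hfM : f (-M) = -l := hodd M hMm
    have hM1 : -M ∉ Icc (-N : ℤ) N := by rw [mem_Icc]; omega
    have hM2 : M ∉ insert (-M) (Icc (-N : ℤ) N) := by rw [mem_insert, mem_Icc]; omega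
    have hc : ∀ j ∈ Icc (-n : ℤ) n, #{p ∈ Icc (-N : ℤ) N | f p = j} +
        ((if j = l then 1 else 0) + if j = -l then 1 else 0) =
        a j + t j + t (-j) + if j = 0 then 1 else 0 := fun j hj => by
      rw [← h j hj, hM, Icc_succ_eq, ← hM, card_filter_insert_eq hM2, card_filter_insert_eq hM1,
        hfM]
      ring
    have hmax : ∀ j ∈ Icc (-n : ℤ) n, l < |j| → a j = 0 ∧ t j = 0 := by
      intro j hj hlj
      have h1 := h j hj
      rw [lt_abs] at hlj
      rw [if_neg (by omega), filter_false_of_mem fun p hp => by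
        have := hle p hp
        have := hle' p hp
        omega, card_empty] at h1
      omega
    have hmem : ∀ S ∈ (Icc (-N : ℤ) N).powerset, M ∉ S ∧ -M ∉ S := fun S hS => by
      rw [mem_powerset] at hS
      exact ⟨fun h => hM2 (mem_insert_of_mem (hS h)), fun h => hM1 (hS h)⟩
    have hnl : a l + t l + t (-l) ≠ 0 := by
      have := hc l hlI
      rw [if_pos rfl, if_neg (by omega), if_neg (by omega)] at this
      omega
    have ih := ih (hf.mono (by exact_mod_cast hsub)) (fun p hp => hodd p (hsub hp))
      (fun p hp => hfI p (hsub hp)) a0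
    have hq : qnum ((a l + t l + t (-l) : ℕ) : ℤ) ≠ 0 := qnum_ne_zero hnl
    have hcard : ∀ S ∈ (Icc (-N : ℤ) N).powerset,
        #S = ∑ j ∈ Icc (-n : ℤ) n, #{p ∈ S | f p = j} := fun S hS =>
      card_eq_sum_content fun p hp => hfI p (hsub (mem_powerset.1 hS hp))
    have hlP : l ∈ Icc (1 : ℤ) n := mem_Icc.2 ⟨hl1, hln⟩
    have hfib : ∀ S ∈ (Icc (-N : ℤ) N).powerset, (∀ p ∈ S, -p ∉ S) →
        #{p ∈ S | f p = l} + #{p ∈ S | f p = -l} ≤ #{p ∈ Icc (-N : ℤ) N | f p = l} := by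
      intro S hS hi
      rw [mem_powerset] at hS
      rw [← card_image_of_injective {p ∈ S | f p = -l} neg_injective, ← card_union_of_disjoint]
      · refine card_le_card fun p hp => ?_
        rcases mem_union.1 hp with hp | hp
        · exact filter_subset_filter _ hS hp
        · obtain ⟨q, hq, rfl⟩ := mem_image.1 hp
          rw [mem_filter] at hq ⊢
          have := mem_Icc.1 (hS hq.1)
          exact ⟨mem_Icc.2 (by omega), by rw [hodd q (hsub (hS hq.1)), hq.2, neg_neg]⟩
      · rw [disjoint_left]
        intro p hp hp'
        obtain ⟨q, hq, rfl⟩ := mem_image.1 hp'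
        exact hi q (mem_filter.1 hq).1 (mem_filter.1 hp).1
    -- `N + 1` and `-(N + 1)` both outside the subset
    have claim1 : (∑ S ∈ (Icc (-N : ℤ) N).powerset,
        if (∀ p ∈ S, -p ∉ S) ∧ ∀ j ∈ Icc (-n : ℤ) n, #{p ∈ S | f p = j} = t j then
          (vK ^ 2) ^ #S * isoWeight N S else 0) * qnum ((a l + t l + t (-l) : ℕ) : ℤ) =
        isoGen n a0 a t * ((vK ^ 2) ^ t l * qnum (a l : ℤ)) := by
      rcases Nat.eq_zero_or_pos (a l) with ha | ha
      · rw [ha, Nat.cast_zero, qnum_zero, mul_zero, mul_zero, sum_eq_zero, zero_mul]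
        intro S hS
        rw [if_neg]
        rintro ⟨h1, h2⟩
        have h3 := hfib S hS h1
        have h4 := hc l hlI
        rw [h2 l hlI, h2 (-l) hlI'] at h3
        rw [if_pos rfl, if_neg (by omega), if_neg (by omega)] at h4
        omega
      · obtain ⟨a', rfl⟩ : ∃ a' : ℤ → ℕ,
            a = fun j => a' j + ((if j = l then 1 else 0) + if j = -l then 1 else 0) := by
          refine ⟨fun j => a j - ((if j = l then 1 else 0) + if j = -l then 1 else 0), ?_⟩
          funext j
          have := hs l
          dsimp only
          by_cases h1 : j = l
          · subst h1; rw [if_pos rfl, if_neg (by omega)]; omega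
          · by_cases h2 : j = -l
            · subst h2; rw [if_neg h1, if_pos rfl]; omega
            · rw [if_neg h1, if_neg h2]; omega
        have e0 : ∀ j, a' (-j) = a' j := by
          intro j
          have := hs j
          dsimp only at this
          split_ifs at this <;> omega
        have ih := ih a' t e0 (by
          have := ha0
          dsimp only at this
          split_ifs at this <;> omega) (fun j hj => by
          have := hc j hj
          dsimp only at this
          omega)
        have e1 : (∑ S ∈ (Icc (-N : ℤ) N).powerset,
            if (∀ p ∈ S, -p ∉ S) ∧ ∀ j ∈ Icc (-n : ℤ) n, #{p ∈ S | f p = j} = t j then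
              (vK ^ 2) ^ #S * isoWeight N S else 0) =
            (vK ^ 2) ^ (∑ j ∈ Icc (-n : ℤ) n, t j) * isoGen n a0 a' t := by
          rw [← ih, mul_sum]
          refine sum_congr rfl fun S hS => ?_
          split_ifs with h1
          · rw [hcard S hS, sum_congr rfl h1.2]
          · rw [mul_zero]
        have e2 := isoExp_add_left hl1 hln a' t fun j hj hlj => (hmax j hj hlj).2
        have e3 : ∏ x ∈ (Icc (1 : ℤ) n).erase l,
            trinom (a' x + ((if x = l then 1 else 0) + if x = -l then 1 else 0)) (t x) (t (-x)) =
            ∏ x ∈ (Icc (1 : ℤ) n).erase l, trinom (a' x) (t x) (t (-x)) :=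
          prod_congr rfl fun x hx => by
            have := mem_Icc.1 (mem_of_mem_erase hx)
            rw [if_neg (ne_of_mem_erase hx), if_neg (by omega)]
            rfl
        have e4 := trinom_succ_left (a' l) (t l) (t (-l))
        have e5 := congrArg ((vK ^ 2) ^ ·) e2
        simp only [pow_add] at e5
        rw [e1, isoGen, isoGen, ← mul_prod_erase _ _ hlP,
          ← mul_prod_erase _ (fun l => trinom _ (t l) (t (-l))) hlP, e3]
        beta_reduce
        rw [if_pos rfl, if_neg (by omega), add_zero, show a' l + 1 + t l + t (-l) = a' l + t l + t (-l) + 1 by ring]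
        linear_combination (uK ^ 2) ^ (∑ k ∈ Icc (-n : ℤ) n with k < 0, t k) * cgauss a0 (t 0) *
          (∏ x ∈ (Icc (1 : ℤ) n).erase l, trinom (a' x) (t x) (t (-x))) *
          (-trinom (a' l + 1) (t l) (t (-l)) * qnum ((a' l + 1 : ℕ) : ℤ) * e5 -
            (vK ^ 2) ^ isoExp n a' t * (vK ^ 2) ^ (∑ j ∈ Icc (-n : ℤ) n, t j) * e4)
    -- `N + 1` in the subset
    have claim2 : (∑ S ∈ (Icc (-N : ℤ) N).powerset,
        if (∀ p ∈ S, -p ∉ S) ∧ ∀ j ∈ Icc (-n : ℤ) n, #{p ∈ insert M S | f p = j} = t j then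
          isoWeight N S else 0) * qnum ((a l + t l + t (-l) : ℕ) : ℤ) =
        isoGen n a0 a t * qnum (t l : ℤ) := by
      rcases Nat.eq_zero_or_pos (t l) with ht | ht
      · rw [ht, Nat.cast_zero, qnum_zero, mul_zero, sum_eq_zero, zero_mul]
        intro S hS
        rw [if_neg]
        rintro ⟨h1, h2⟩
        have h3 := h2 l hlI
        rw [card_filter_insert_eq (hmem S hS).1, if_pos rfl] at h3
        omega
      · obtain ⟨t', rfl⟩ : ∃ t' : ℤ → ℕ, t = fun j => t' j + if j = l then 1 else 0 := by
          refine ⟨fun j => t j - if j = l then 1 else 0, ?_⟩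
          funext j
          dsimp only
          split_ifs with h1
          · subst h1; omega
          · rfl
        have ih := ih a t' hs ha0 (fun j hj => by
          have := hc j hj
          dsimp only at this
          simp only [show -j = l ↔ j = -l by omega] at this
          omega)
        have e1 : (∑ S ∈ (Icc (-N : ℤ) N).powerset,
            if (∀ p ∈ S, -p ∉ S) ∧ ∀ j ∈ Icc (-n : ℤ) n, #{p ∈ insert M S | f p = j} =
              t' j + (if j = l then 1 else 0) then isoWeight N S else 0) = isoGen n a0 a t' := by
          rw [← ih]
          refine sum_congr rfl fun S hS => ?_
          simp only [card_filter_insert_eq (hmem S hS).1, ← hl, add_left_inj]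
        have e2 := isoExp_add_mid hl1 hln a t' (fun j hj hlj => (hmax j hj hlj).1)
          fun j hj hlj => Nat.eq_zero_of_add_eq_zero_right (hmax j hj hlj).2
        have e3 : ∏ x ∈ (Icc (1 : ℤ) n).erase l,
            trinom (a x) (t' x + if x = l then 1 else 0) (t' (-x) + if -x = l then 1 else 0) =
            ∏ x ∈ (Icc (1 : ℤ) n).erase l, trinom (a x) (t' x) (t' (-x)) :=
          prod_congr rfl fun x hx => by
            have := mem_Icc.1 (mem_of_mem_erase hx)
            rw [if_neg (ne_of_mem_erase hx), if_neg (by omega)]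
            rfl
        have e4 := trinom_succ_mid (a l) (t' l) (t' (-l))
        have e5 : ∑ k ∈ Icc (-n : ℤ) n with k < 0, (t' k + if k = l then 1 else 0) =
            ∑ k ∈ Icc (-n : ℤ) n with k < 0, t' k := sum_congr rfl fun k hk => by
          rw [mem_filter] at hk
          rw [if_neg (by omega), add_zero]
        rw [e1, isoGen, isoGen, ← mul_prod_erase _ _ hlP,
          ← mul_prod_erase _ (fun l => trinom _ (t' l + _) (t' (-l) + _)) hlP, e3, e2, e5]
        beta_reduce
        rw [if_pos rfl, if_neg (by omega), if_neg (by omega), add_zero, add_zero,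
          show a l + (t' l + 1) + t' (-l) = a l + t' l + t' (-l) + 1 by ring]
        linear_combination -(uK ^ 2) ^ (∑ k ∈ Icc (-n : ℤ) n with k < 0, t' k) * cgauss a0 (t' 0) *
          (∏ x ∈ (Icc (1 : ℤ) n).erase l, trinom (a x) (t' x) (t' (-x))) *
          (vK ^ 2) ^ isoExp n a t' * e4
    -- `-(N + 1)` in the subset
    have claim3 : (∑ S ∈ (Icc (-N : ℤ) N).powerset,
        if (∀ p ∈ S, -p ∉ S) ∧ ∀ j ∈ Icc (-n : ℤ) n, #{p ∈ insert (-M) S | f p = j} = t j then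
          uK ^ 2 * (vK ^ 2) ^ (2 * N - #S) * isoWeight N S else 0) *
          qnum ((a l + t l + t (-l) : ℕ) : ℤ) =
        isoGen n a0 a t * ((vK ^ 2) ^ (a l + t l) * qnum (t (-l) : ℤ)) := by
      rcases Nat.eq_zero_or_pos (t (-l)) with ht | ht
      · rw [ht, Nat.cast_zero, qnum_zero, mul_zero, mul_zero, sum_eq_zero, zero_mul]
        intro S hS
        rw [if_neg]
        rintro ⟨h1, h2⟩
        have h3 := h2 (-l) hlI'
        rw [card_filter_insert_eq (hmem S hS).2, hfM, if_pos rfl] at h3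
        omega
      · obtain ⟨t', rfl⟩ : ∃ t' : ℤ → ℕ, t = fun j => t' j + if j = -l then 1 else 0 := by
          refine ⟨fun j => t j - if j = -l then 1 else 0, ?_⟩
          funext j
          dsimp only
          split_ifs with h1
          · subst h1; omega
          · rfl
        have hc' : ∀ j ∈ Icc (-n : ℤ) n, #{p ∈ Icc (-N : ℤ) N | f p = j} =
            a j + t' j + t' (-j) + if j = 0 then 1 else 0 := fun j hj => by
          have := hc j hj
          dsimp only at this
          simp only [show -j = -l ↔ j = l by omega] at this
          omega
        have ih := ih a t' hs ha0 hc'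
        have e0 : 2 * N = ∑ j ∈ Icc (-n : ℤ) n, (a j + t' j) + ∑ j ∈ Icc (-n : ℤ) n, t' j := by
          have h1 := hcard (Icc (-N : ℤ) N) (mem_powerset_self _)
          rw [sum_congr rfl hc', sum_add_distrib, sum_add_distrib, sum_ite_eq',
            if_pos (mem_Icc.2 (by omega)), Int.card_Icc] at h1
          have h2 : ∑ j ∈ Icc (-n : ℤ) n, t' (-j) = ∑ j ∈ Icc (-n : ℤ) n, t' j :=
            sum_nbij' Neg.neg Neg.neg (fun j hj => by rw [mem_Icc] at hj ⊢; omega)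
              (fun j hj => by rw [mem_Icc] at hj ⊢; omega) (fun j _ => neg_neg j)
              (fun j _ => neg_neg j) fun j _ => rfl
          omega
        have e1 : (∑ S ∈ (Icc (-N : ℤ) N).powerset,
            if (∀ p ∈ S, -p ∉ S) ∧ ∀ j ∈ Icc (-n : ℤ) n, #{p ∈ insert (-M) S | f p = j} =
              t' j + (if j = -l then 1 else 0) then
              uK ^ 2 * (vK ^ 2) ^ (2 * N - #S) * isoWeight N S else 0) =
            uK ^ 2 * (vK ^ 2) ^ (∑ j ∈ Icc (-n : ℤ) n, (a j + t' j)) * isoGen n a0 a t' := by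
          rw [← ih, mul_sum]
          refine sum_congr rfl fun S hS => ?_
          simp only [card_filter_insert_eq (hmem S hS).2, hfM, add_left_inj]
          split_ifs with h1
          · rw [hcard S hS, sum_congr rfl h1.2, e0, Nat.add_sub_cancel]
          · rw [mul_zero]
        have e2 := isoExp_add_right hl1 hln a t' (fun j hj hlj => (hmax j hj hlj).1) (hs l)
          fun j hj hlj => Nat.eq_zero_of_add_eq_zero_right (hmax j hj hlj).2
        have e3 : ∏ x ∈ (Icc (1 : ℤ) n).erase l,
            trinom (a x) (t' x + if x = -l then 1 else 0) (t' (-x) + if -x = -l then 1 else 0) =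
            ∏ x ∈ (Icc (1 : ℤ) n).erase l, trinom (a x) (t' x) (t' (-x)) :=
          prod_congr rfl fun x hx => by
            have := mem_Icc.1 (mem_of_mem_erase hx)
            have := ne_of_mem_erase hx
            rw [if_neg (by omega), if_neg (by omega)]
            rfl
        have e4 := trinom_succ_right (a l) (t' l) (t' (-l))
        have e5 : ∑ k ∈ Icc (-n : ℤ) n with k < 0, (t' k + if k = -l then 1 else 0) =
            ∑ k ∈ Icc (-n : ℤ) n with k < 0, t' k + 1 := by
          rw [sum_add_distrib, sum_ite_eq', if_pos (mem_filter.2 ⟨hlI', by omega⟩)]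
        have e6 := congrArg ((vK ^ 2) ^ ·) e2
        simp only [pow_add _ (isoExp _ _ _)] at e6
        rw [e1, isoGen, isoGen, ← mul_prod_erase _ _ hlP,
          ← mul_prod_erase _ (fun l => trinom _ (t' l + _) (t' (-l) + _)) hlP, e3, e5]
        beta_reduce
        rw [if_pos rfl, if_neg (by omega), if_neg (by omega), add_zero, add_zero, pow_succ,
          show a l + t' l + (t' (-l) + 1) = a l + t' l + t' (-l) + 1 by ring]
        linear_combination (uK ^ 2) ^ (∑ k ∈ Icc (-n : ℤ) n with k < 0, t' k) * uK ^ 2 *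
          cgauss a0 (t' 0) *
          (∏ x ∈ (Icc (1 : ℤ) n).erase l, trinom (a x) (t' x) (t' (-x))) *
          (-trinom (a l) (t' l) (t' (-l) + 1) * qnum ((t' (-l) + 1 : ℕ) : ℤ) * e6 -
            (vK ^ 2) ^ isoExp n a t' * (vK ^ 2) ^ (∑ j ∈ Icc (-n : ℤ) n, (a j + t' j)) * e4)
    apply mul_right_cancel₀ hq
    rw [hM, sum_isoWeight_succ N (fun S => ∀ j ∈ Icc (-n : ℤ) n, #{p ∈ S | f p = j} = t j), ← hM,
      add_mul, add_mul, claim1, claim2, claim3, add_comm (a l), add_assoc, qnum_add, qnum_add]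
    ring

/-! ### Contents of subsets and the product with a double coset sum -/

theorem Ld.notMem_R {n d : ℕ} (l : Ld n d) {i p : ℤ} (hi : i ∉ Icc (-n : ℤ) n) : p ∉ l.R i :=
  fun hp => hi (mem_Icc.2 (abs_le.1 (l.R_empty hp)))

/-- The content of `S` with respect to the sets `x R_j`: the function `j ↦ |S ∩ x R_j|`. -/
noncomputable def content {n d : ℕ} (m : Ld n d) (x : W d) (S : Finset ℤ) : ℤ →₀ ℕ :=
  Finsupp.onFinset (Icc (-n : ℤ) n) (fun j => #{s ∈ S | (x⁻¹).1 s ∈ m.R j}) fun j hj => by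
    by_contra h
    exact hj (card_eq_zero.2 (filter_false_of_mem fun s _ => m.notMem_R h))

theorem content_apply {n d : ℕ} (m : Ld n d) (x : W d) (S : Finset ℤ) (j : ℤ) :
    content m x S j = #{s ∈ S | (x⁻¹).1 s ∈ m.R j} := rfl

theorem content_mem {n d : ℕ} (m : Ld n d) (x : W d) {S : Finset ℤ} (hS : ∀ s ∈ S, |s| ≤ d) :
    content m x S ∈ (Icc (-n : ℤ) n).finsuppAntidiag #S := by
  rw [mem_finsuppAntidiag]
  refine ⟨?_, Finsupp.support_onFinset_subset⟩
  have hex : ∀ s ∈ S, ∃ j, (x⁻¹).1 s ∈ m.R j := fun s hs => m.R_cover (W_abs _ (hS s hs))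
  choose! f hf using hex
  rw [card_eq_sum_content (I := Icc (-n : ℤ) n) (f := f) fun s hs =>
    mem_Icc.2 (abs_le.1 (m.R_empty (hf s hs)))]
  refine sum_congr rfl fun j _ => ?_
  rw [content_apply]
  congr 1
  refine filter_congr fun s hs => ?_
  exact ⟨fun h => m.R_disj (hf s hs) h, fun h => h ▸ hf s hs⟩

/-- Multiplying by `w⁻¹` on the left changes the matrix `κ` in the rows `±h` and `±(h - 1)` only.
The sign `ε` tells whether the strip `E` moves up or down. -/
theorem kappa_inv_mul {n d : ℕ} {l l' : Ld n d} {E : Finset ℤ} {h ε : ℤ}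
    (hE : ∀ (G : ℤ → Prop) [DecidablePred G] (i : ℤ), (#{p ∈ l.R i | G p} : ℤ) =
      #{p ∈ l'.R i | G p} + ε * ((if i = h - 1 then (#{p ∈ E | G p} : ℤ) else 0)
        - (if i = h then (#{p ∈ E | G p} : ℤ) else 0)
        + (if -i = h - 1 then (#{p ∈ E | G (-p)} : ℤ) else 0)
        - (if -i = h then (#{p ∈ E | G (-p)} : ℤ) else 0)))
    (m : Ld n d) {w : W d} (hw : w ∈ l'.par) (x : W d) (i j : ℤ) :
    (kappa l (w⁻¹ * x) m i j : ℤ) = kappa l' x m i j -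
      ε * (rowE n h (content m x (E.image w.1)) i j - rowE n (h - 1) (content m x (E.image w.1)) i j) := by
  have hx : ((w⁻¹ * x)⁻¹) = x⁻¹ * w := by group
  have h1 := hE (fun p => (x⁻¹).1 (w.1 p) ∈ m.R j) i
  have h2 : #{p ∈ l'.R i | (x⁻¹).1 (w.1 p) ∈ m.R j} = kappa l' x m i j := by
    have := kappa_mul (m := m) (l'.par.inv_mem hw) m.par.one_mem x
    rw [mul_one] at this
    rw [← this, kappa_eq, hx]
    rfl
  have h3 : ∀ j', #{p ∈ E | (x⁻¹).1 (w.1 p) ∈ m.R j'} = content m x (E.image w.1) j' := by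
    intro j'
    rw [content_apply, filter_image, card_image_of_injective _ w.1.injective]
  have h4 : #{p ∈ E | (x⁻¹).1 (w.1 (-p)) ∈ m.R j} = content m x (E.image w.1) (-j) := by
    rw [← h3]
    congr 1
    refine filter_congr fun p _ => ?_
    rw [W_neg, W_neg, m.R_neg]
  rw [h2, h3, h4] at h1
  rw [kappa_eq, hx]
  refine Eq.trans ?_ (h1.trans ?_)
  · rfl
  · rw [rowE_eq, rowE_eq]
    by_cases hj : j ∈ Icc (-n : ℤ) n
    · rw [if_pos hj, if_pos hj]
      simp only [show i = -h ↔ -i = h by omega, show i = -(h - 1) ↔ -i = h - 1 by omega]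
      ring
    · have e1 : content m x (E.image w.1) j = 0 :=
        card_eq_zero.2 (filter_false_of_mem fun s _ => m.notMem_R hj)
      have e2 : content m x (E.image w.1) (-j) = 0 :=
        card_eq_zero.2 (filter_false_of_mem fun s _ => m.notMem_R fun h => hj (by
          rw [mem_Icc] at h ⊢; omega))
      rw [if_neg hj, if_neg hj, e1, e2]
      simp

theorem rowE_sub_apply {n : ℕ} {h : ℤ} (h1 : 1 ≤ h) (t : ℤ →₀ ℕ) {j : ℤ} (hj : j ∈ Icc (-n : ℤ) n) :
    rowE n h t h j - rowE n (h - 1) t h j = t j := by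
  rw [rowE_eq, rowE_eq, if_pos hj, if_pos hj, if_pos rfl, if_neg (by omega), if_neg (by omega),
    if_neg (by omega)]
  ring

/-- The product of the sum over `reps` with a double coset sum, up to the generating functions of
the subsets `S` of `R_r` with given content. -/
theorem IsStrip.mul_TX_coset {n d : ℕ} {A B : Xi n d} {E : Finset ℤ} {r s h ε : ℤ}
    (hS : IsStrip B.co B.ro E r s) (hBA : B.co = A.ro)
    (hTX : TX B.coset = (∑ w ∈ reps B.co B.ro, heckeT d w) * B.co.x)
    (h1 : 1 ≤ h) (hε : ε ≠ 0)
    (hE : ∀ (G : ℤ → Prop) [DecidablePred G] (i : ℤ), (#{p ∈ B.co.R i | G p} : ℤ) =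
      #{p ∈ B.ro.R i | G p} + ε * ((if i = h - 1 then (#{p ∈ E | G p} : ℤ) else 0)
        - (if i = h then (#{p ∈ E | G p} : ℤ) else 0)
        + (if -i = h - 1 then (#{p ∈ E | G (-p)} : ℤ) else 0)
        - (if -i = h then (#{p ∈ E | G (-p)} : ℤ) else 0)))
    {T : Finset (ℤ →₀ ℕ)} (A' : T → Xi n d)
    (hA' : ∀ t i j, ((A' t).a i j : ℤ) = A.a i j + ε * (rowE n h t.1 i j - rowE n (h - 1) t.1 i j))
    (hT : ∀ t, t ∈ T ↔ t ∈ (Icc (-n : ℤ) n).finsuppAntidiag #E ∧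
      ∀ i j, 0 ≤ (A.a i j : ℤ) + ε * (rowE n h t i j - rowE n (h - 1) t i j))
    (hro : ∀ t, (A' t).ro = B.ro) (hco : ∀ t, (A' t).co = A.co)
    (c : T → Laur) (wt : Finset ℤ → Laur)
    (hw : ∀ w ∈ reps B.co B.ro, weight w = wt (E.image w.1))
    (hc : ∀ t x, B.ro.basc x⁻¹ → (∀ i j, kappa B.ro x A.co i j = (A' t).a i j) →
      (∑ S ∈ isotropic (B.ro.R r) #E, if content A.co x S = t.1 then wt S else 0) = c t) :
    (∑ w ∈ reps B.co B.ro, heckeT d w) * TX A.coset = ∑ t, c t • TX (A' t).coset := by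
  classical
  obtain ⟨z, hz⟩ := TX_left A.ro A.coset fun x hx w hw => by
    rw [A.mem_coset] at hw ⊢
    have := kappa_mul (m := A.co) hx A.co.par.one_mem w
    rw [mul_one] at this
    rw [this, hw]
  -- both sides are eigenvectors of `W_{λ'}` for the index character
  apply eq_of_repr_eq (l := B.ro)
  · intro i hi
    have : (∑ w ∈ reps B.co B.ro, heckeT d w) * TX A.coset = TX B.coset * z := by
      rw [hz, hTX, ← hBA, mul_assoc]
    rw [this, ← mul_assoc, TX_coset_left B hi, smul_mul_assoc]
  · intro i hi
    rw [mul_sum, smul_sum]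
    refine sum_congr rfl fun t _ => ?_
    rw [mul_smul_comm, TX_coset_left (A' t) (by rw [hro]; exact hi), smul_comm]
  · intro x hx
    have hxD : x ∈ B.ro.D := Ld.mem_D hx
    have hl : (heckeT d).repr ((∑ w ∈ reps B.co B.ro, heckeT d w) * TX A.coset) x =
        ∑ w ∈ reps B.co B.ro, weight w * if w⁻¹ * x ∈ A.coset then 1 else 0 := by
      rw [sum_mul, map_sum, Finsupp.finsetSum_apply]
      refine sum_congr rfl fun w hw => ?_
      rw [repr_heckeT_mul, repr_TX]
      have := hxD w⁻¹ (B.ro.par.inv_mem (mem_reps.1 hw).1)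
      rwa [len_inv] at this
    have hr : (heckeT d).repr (∑ t, c t • TX (A' t).coset) x =
        ∑ t, c t * if x ∈ (A' t).coset then 1 else 0 := by
      rw [map_sum, Finsupp.finsetSum_apply]
      refine sum_congr rfl fun t _ => ?_
      rw [map_smul, Finsupp.smul_apply, repr_TX, smul_eq_mul]
    have hmem : ∀ w ∈ reps B.co B.ro, (w⁻¹ * x ∈ A.coset ↔ ∀ i j, (kappa B.ro x A.co i j : ℤ) =
        A.a i j + ε * (rowE n h (content A.co x (E.image w.1)) i j
          - rowE n (h - 1) (content A.co x (E.image w.1)) i j)) := by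
      intro w hw
      have := kappa_inv_mul hE A.co (mem_reps.1 hw).1 x
      rw [A.mem_coset, ← hBA]
      constructor
      · intro e i j
        have := this i j
        rw [e] at this
        omega
      · intro e
        funext i j
        have := this i j
        rw [e i j] at this
        zify
        rw [this]
        ring
    have hl2 : ∑ w ∈ reps B.co B.ro, (weight w * if w⁻¹ * x ∈ A.coset then 1 else 0) =
        ∑ S ∈ isotropic (B.ro.R r) #E, if ∀ i j, (kappa B.ro x A.co i j : ℤ) =
          A.a i j + ε * (rowE n h (content A.co x S) i j - rowE n (h - 1) (content A.co x S) i j)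
          then wt S else 0 := by
      rw [← hS.sum_reps fun S => if ∀ i j, (kappa B.ro x A.co i j : ℤ) =
          A.a i j + ε * (rowE n h (content A.co x S) i j - rowE n (h - 1) (content A.co x S) i j)
          then wt S else 0]
      refine sum_congr rfl fun w hw' => ?_
      rw [hw w hw', mul_ite, mul_one, mul_zero]
      exact if_congr (hmem w hw') rfl rfl
    have hmem' : ∀ t, x ∈ (A' t).coset ↔ ∀ i j, kappa B.ro x A.co i j = (A' t).a i j := by
      intro t
      rw [(A' t).mem_coset, hro, hco]
      exact ⟨fun e i j => by rw [e], fun e => funext fun i => funext fun j => e i j⟩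
    -- the row `h` of the matrix determines the content
    have huniq : ∀ t t' : ℤ →₀ ℕ, (t.support ⊆ Icc (-n : ℤ) n) → (t'.support ⊆ Icc (-n : ℤ) n) →
        (∀ i j, (A.a i j : ℤ) + ε * (rowE n h t i j - rowE n (h - 1) t i j) =
          A.a i j + ε * (rowE n h t' i j - rowE n (h - 1) t' i j)) → t = t' := by
      intro t t' ht ht' e
      ext j
      by_cases hj : j ∈ Icc (-n : ℤ) n
      · have := e h j
        rw [rowE_sub_apply h1 t hj, rowE_sub_apply h1 t' hj] at this
        have := mul_left_cancel₀ hε (add_left_cancel this)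
        exact_mod_cast this
      · rw [Finsupp.notMem_support_iff.1 fun h => hj (ht h),
          Finsupp.notMem_support_iff.1 fun h => hj (ht' h)]
    have hcont : ∀ S ∈ isotropic (B.ro.R r) #E,
        content A.co x S ∈ (Icc (-n : ℤ) n).finsuppAntidiag #E := by
      intro S hS
      have hS := (mem_isotropic.1 hS).1
      rw [← hS.2]
      exact content_mem _ _ fun p hp => B.ro.R_abs (hS.1 hp)
    have hsupp : ∀ t : T, t.1.support ⊆ Icc (-n : ℤ) n := fun t =>
      (mem_finsuppAntidiag.1 ((hT t.1).1 t.2).1).2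
    rw [hl, hr, hl2]
    -- at most one summand on the right contains `x`, namely the one with the matrix of `x`
    by_cases hex : ∃ t0 : T, ∀ i j, kappa B.ro x A.co i j = (A' t0).a i j
    · obtain ⟨t0, ht0⟩ := hex
      rw [sum_eq_single_of_mem t0 (mem_univ _), if_pos ((hmem' t0).2 ht0), mul_one, ← hc t0 x hx ht0]
      · refine sum_congr rfl fun S hS => if_congr ?_ rfl rfl
        constructor
        · intro e
          refine huniq _ _ (mem_finsuppAntidiag.1 (hcont S hS)).2 (hsupp t0) fun i j => ?_
          rw [← e i j, ht0 i j, hA']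
        · intro e i j
          rw [e, ht0 i j, hA']
      · intro t _ ht
        rw [if_neg, mul_zero]
        rw [hmem']
        intro e
        refine ht (Subtype.ext (huniq _ _ (hsupp t) (hsupp t0) fun i j => ?_))
        rw [← hA', ← hA', ← e i j, ht0 i j]
    · rw [sum_eq_zero, sum_eq_zero]
      · intro t _
        rw [if_neg fun e => hex ⟨t, (hmem' t).1 e⟩, mul_zero]
      · intro S hS
        rw [if_neg]
        intro e
        refine hex ⟨⟨content A.co x S, (hT _).2 ⟨hcont S hS, fun i j => ?_⟩⟩, fun i j => ?_⟩
        · rw [← e i j]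
          positivity
        · zify
          rw [hA', ← e i j]

/-! ### Matrices with one off-diagonal pair of entries -/

/-- `(h, ε, k, m)` is `(h, 1, h, h - 1)` or `(h, -1, h - 1, h)`: the factor on the left has its
off-diagonal entry at `(k, m)`, and multiplication moves entries from row `m` to row `k`. -/
structure IsStep (n : ℕ) (h ε k m : ℤ) : Prop where
  one_le : 1 ≤ h
  le : h ≤ n
  cases : (ε = 1 ∧ k = h ∧ m = h - 1) ∨ (ε = -1 ∧ k = h - 1 ∧ m = h)

theorem Ld.ext_val {n d : ℕ} {l m : Ld n d} (h : ∀ i, l.val i = m.val i) : l = m := by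
  cases l; cases m
  congr
  exact funext h

theorem sum_rowE_left {n : ℕ} {h : ℤ} (hh : |h| ≤ n) (t : ℤ →₀ ℕ) (j : ℤ) :
    ∑ i ∈ Icc (-n : ℤ) n, rowE n h t i j =
      if j ∈ Icc (-n : ℤ) n then (t j : ℤ) + t (-j) else 0 := by
  have hh := abs_le.1 hh
  simp only [rowE_eq]
  split_ifs
  · rw [sum_add_distrib, sum_ite_eq', sum_ite_eq', if_pos (mem_Icc.2 (by omega)),
      if_pos (mem_Icc.2 (by omega))]
  · simp

theorem sum_rowE_right {n b : ℕ} (h : ℤ) {t : ℤ →₀ ℕ} (ht : t ∈ (Icc (-n : ℤ) n).finsuppAntidiag b)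
    (i : ℤ) : ∑ j ∈ Icc (-n : ℤ) n, rowE n h t i j =
      b * ((if i = h then 1 else 0) + if i = -h then 1 else 0) := by
  have h1 : ∑ j ∈ Icc (-n : ℤ) n, (t j : ℤ) = b := by
    have := (mem_finsuppAntidiag.1 ht).1
    exact_mod_cast this
  have h2 : ∑ j ∈ Icc (-n : ℤ) n, (t (-j) : ℤ) = b := by
    rw [← h1]
    exact_mod_cast sum_neg n t
  have h3 : ∀ j ∈ Icc (-n : ℤ) n, rowE n h t i j =
      (if i = h then (t j : ℤ) else 0) + if i = -h then (t (-j) : ℤ) else 0 := fun j hj => by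
    rw [rowE_eq, if_pos hj]
  rw [sum_congr rfl h3, sum_add_distrib]
  split_ifs <;> simp [h1, h2]; ring

theorem kappa_one {n d : ℕ} (l : Ld n d) (i j : ℤ) :
    kappa l 1 l i j = if i = j then l.val j else 0 := by
  rw [kappa_eq, inv_one]
  split_ifs with h
  · subst h
    rw [← l.card_R i]
    exact congrArg card (filter_true_of_mem fun _ h => h)
  · exact card_eq_zero.2 (filter_false_of_mem fun p hp hp' => h (l.R_disj hp hp'))

section

variable {n d : ℕ} {B : Xi n d} {h ε k m : ℤ} {b : ℕ}

theorem IsStep.abs_k (hs : IsStep n h ε k m) : |k| ≤ n := by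
  have := hs.one_le
  have := hs.le
  rw [abs_le]
  rcases hs.cases with ⟨_, _, _⟩ | ⟨_, _, _⟩ <;> omega

theorem IsStep.abs_m (hs : IsStep n h ε k m) : |m| ≤ n := by
  have := hs.one_le
  have := hs.le
  rw [abs_le]
  rcases hs.cases with ⟨_, _, _⟩ | ⟨_, _, _⟩ <;> omega

theorem IsStep.ne (hs : IsStep n h ε k m) : k ≠ m := by
  rcases hs.cases with ⟨_, _, _⟩ | ⟨_, _, _⟩ <;> omega

/-- The diagonal entries are determined by the column sums. -/
theorem IsStep.entry (hs : IsStep n h ε k m) (hB : IsDiag fun i j => (B.a i j : ℤ) - b * Eth k m i j)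
    (i j : ℤ) : (B.a i j : ℤ) =
      (if i = j then (B.co.val j : ℤ) else 0) + b * (Eth k m i j - Eth m m i j) := by
  have hne := hs.ne
  have hk := abs_le.1 hs.abs_k
  have hm := abs_le.1 hs.abs_m
  by_cases hij : i = j
  · subst hij
    rw [if_pos rfl]
    by_cases hi : i ∈ Icc (-n : ℤ) n
    · have h1 : ∑ x ∈ Icc (-n : ℤ) n, ((B.a x i : ℤ) - b * Eth k m x i) = B.a i i - b * Eth k m i i :=
        sum_eq_single_of_mem i hi fun x _ hx => hB x i hx
      have h2 : ∑ x ∈ Icc (-n : ℤ) n, Eth k m x i =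
          (if i = m then 1 else 0) + if i = -m then 1 else 0 := by
        simp only [Eth, ite_and, sum_add_distrib]
        rw [sum_ite_eq', sum_ite_eq', if_pos (mem_Icc.2 (by omega)), if_pos (mem_Icc.2 (by omega))]
      have h3 : ∑ x ∈ Icc (-n : ℤ) n, (B.a x i : ℤ) = B.co.val i := by
        rw [← Nat.cast_sum]; rfl
      have h4 : Eth m m i i = (if i = m then 1 else 0) + if i = -m then 1 else 0 := by
        simp only [Eth, and_self]
      rw [sum_sub_distrib, ← mul_sum, h2, h3] at h1
      rw [h4]
      linarith
    · have hi' : (n : ℤ) < |i| := by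
        rw [← not_le, abs_le]
        exact fun h => hi (mem_Icc.2 h)
      rw [mem_Icc] at hi
      rw [B.supp i i (Or.inl hi'), B.co.supp i hi', Eth, Eth, if_neg (by omega), if_neg (by omega),
        if_neg (by omega), if_neg (by omega)]
      simp
  · have h1 := hB i j hij
    have h2 : Eth m m i j = 0 := by rw [Eth, if_neg (by omega), if_neg (by omega), add_zero]
    rw [if_neg hij, h2]
    linarith

theorem IsStep.ro_val (hs : IsStep n h ε k m)
    (hB : IsDiag fun i j => (B.a i j : ℤ) - b * Eth k m i j) (i : ℤ) :
    (B.ro.val i : ℤ) = B.co.val i + b * ((if i = k then 1 else 0) + (if i = -k then 1 else 0)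
      - (if i = m then 1 else 0) - if i = -m then 1 else 0) := by
  have hm := abs_le.1 hs.abs_m
  have h1 : ∀ a : ℤ, ∑ j ∈ Icc (-n : ℤ) n, Eth a m i j =
      (if i = a then 1 else 0) + if i = -a then 1 else 0 := by
    intro a
    simp only [Eth, sum_add_distrib, and_comm (a := i = _), ite_and]
    rw [sum_ite_eq', sum_ite_eq', if_pos (mem_Icc.2 (by omega)), if_pos (mem_Icc.2 (by omega))]
  have h2 : (∑ j ∈ Icc (-n : ℤ) n, if i = j then (B.co.val j : ℤ) else 0) = B.co.val i := by
    rw [sum_ite_eq]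
    split_ifs with hi
    · rfl
    · rw [B.co.supp i]
      · rfl
      · rw [← not_le, abs_le]
        exact fun h => hi (mem_Icc.2 h)
  change ((∑ j ∈ Icc (-n : ℤ) n, B.a i j : ℕ) : ℤ) = _
  push_cast
  rw [sum_congr rfl fun j _ => hs.entry hB i j, sum_add_distrib, h2, ← mul_sum, sum_sub_distrib,
    h1, h1]
  ring

/-- The strip of elements that change their block. -/
theorem IsStep.exists_strip (hs : IsStep n h ε k m)
    (hB : IsDiag fun i j => (B.a i j : ℤ) - b * Eth k m i j) :
    ∃ E, IsStrip B.co B.ro E k m ∧ #E = b ∧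
      ∀ (G : ℤ → Prop) [DecidablePred G] (i : ℤ), (#{p ∈ B.co.R i | G p} : ℤ) =
        #{p ∈ B.ro.R i | G p} + ε * ((if i = h - 1 then (#{p ∈ E | G p} : ℤ) else 0)
        - (if i = h then (#{p ∈ E | G p} : ℤ) else 0)
        + (if -i = h - 1 then (#{p ∈ E | G (-p)} : ℤ) else 0)
        - (if -i = h then (#{p ∈ E | G (-p)} : ℤ) else 0)) := by
  have h1 := hs.one_le
  rcases hs.cases with ⟨rfl, rfl, rfl⟩ | ⟨rfl, rfl, rfl⟩
  · have hc : Cut B.co B.ro k b := by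
      refine cut_of_val h1 fun i hi => ?_
      rw [hs.ro_val hB]
      split_ifs <;> omega
    refine ⟨_, hc.isStrip h1, hc.card_strip h1, fun G _ i => ?_⟩
    rw [hc.card_filter h1 G i]
    ring
  · have hc : Cut B.ro B.co m b := by
      refine cut_of_val h1 fun i hi => ?_
      rw [hs.ro_val hB]
      split_ifs <;> omega
    refine ⟨_, hc.isStrip' h1, hc.card_strip h1, fun G _ i => ?_⟩
    have := hc.card_filter h1 G i
    linarith

/-- The nonzero entries of `B` in the columns `j ≥ 0` descend weakly to the right. -/
theorem IsStep.staircase (hs : IsStep n h ε k m)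
    (hB : IsDiag fun i j => (B.a i j : ℤ) - b * Eth k m i j) {i i' j j' : ℤ} (hj : 0 ≤ j)
    (hjj : j < j') (h1 : 0 < B.a i j) (h2 : 0 < B.a i' j') : i ≤ i' := by
  have ho := hs.one_le
  have key : ∀ x y, 0 < B.a x y → x = y ∨ (x = k ∧ y = m) ∨ (x = -k ∧ y = -m) := by
    intro x y hxy
    by_contra hc
    have := hB x y (by tauto)
    simp only [Eth] at this
    rw [if_neg (by tauto), if_neg (by tauto)] at this
    simp at this
    omega
  have k1 := key _ _ h1
  have k2 := key _ _ h2
  rcases hs.cases with ⟨_, _, _⟩ | ⟨_, _, _⟩ <;> omega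

/-- The identity is the shortest element of the double coset of `B`. -/
theorem IsStep.kappa_one (hs : IsStep n h ε k m)
    (hB : IsDiag fun i j => (B.a i j : ℤ) - b * Eth k m i j) {E : Finset ℤ}
    (hS : IsStrip B.co B.ro E k m) (hb : #E = b)
    (hE : ∀ (G : ℤ → Prop) [DecidablePred G] (i : ℤ), (#{p ∈ B.co.R i | G p} : ℤ) =
        #{p ∈ B.ro.R i | G p} + ε * ((if i = h - 1 then (#{p ∈ E | G p} : ℤ) else 0)
        - (if i = h then (#{p ∈ E | G p} : ℤ) else 0)
        + (if -i = h - 1 then (#{p ∈ E | G (-p)} : ℤ) else 0)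
        - (if -i = h then (#{p ∈ E | G (-p)} : ℤ) else 0))) :
    kappa B.ro 1 B.co = B.a := by
  have hm := abs_le.1 hs.abs_m
  funext i j
  have h1 := kappa_inv_mul hE B.co B.ro.par.one_mem 1 i j
  rw [inv_one, one_mul, SchurBC.kappa_one] at h1
  have hc : ∀ j, content B.co 1 (E.image (1 : W d).1) j = if j = m then b else 0 := by
    intro j
    have : E.image (1 : W d).1 = E := image_id
    rw [content_apply, this, inv_one]
    split_ifs with hj
    · rw [filter_true_of_mem fun p hp => hj ▸ ((hS.mem p).1 hp).2, hb]
    · exact card_eq_zero.2 (filter_false_of_mem fun p hp hp' =>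
        hj (B.co.R_disj hp' ((hS.mem p).1 hp).2))
  have hr : ∀ a, rowE n a (content B.co 1 (E.image (1 : W d).1)) i j = b * Eth a m i j := by
    intro a
    rw [rowE, sum_eq_single_of_mem m (mem_Icc.2 hm), hc, if_pos rfl]
    intro x _ hx
    rw [hc, if_neg hx, Nat.cast_zero, zero_mul]
  rw [hr, hr] at h1
  have h2 := hs.entry hB i j
  zify
  rw [h2]
  push_cast at h1
  rw [h1]
  rcases hs.cases with ⟨rfl, rfl, rfl⟩ | ⟨rfl, rfl, rfl⟩ <;> ring

theorem IsStep.ro_eq (hs : IsStep n h ε k m)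
    (hB : IsDiag fun i j => (B.a i j : ℤ) - b * Eth k m i j) {A A' : Xi n d} (hBA : B.co = A.ro)
    {t : ℤ →₀ ℕ} (ht : t ∈ (Icc (-n : ℤ) n).finsuppAntidiag b)
    (hA' : ∀ i j, (A'.a i j : ℤ) = A.a i j + ε * (rowE n h t i j - rowE n (h - 1) t i j)) :
    A'.ro = B.ro := by
  refine Ld.ext_val fun i => ?_
  have h1 := hs.ro_val hB i
  have h2 : (A'.ro.val i : ℤ) = ∑ j ∈ Icc (-n : ℤ) n, (A'.a i j : ℤ) := by rw [← Nat.cast_sum]; rfl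
  have h3 : (A.ro.val i : ℤ) = ∑ j ∈ Icc (-n : ℤ) n, (A.a i j : ℤ) := by rw [← Nat.cast_sum]; rfl
  rw [sum_congr rfl fun j _ => hA' i j, sum_add_distrib, ← h3, ← mul_sum, sum_sub_distrib,
    sum_rowE_right h ht, sum_rowE_right (h - 1) ht] at h2
  zify
  rw [h1, h2, hBA]
  rcases hs.cases with ⟨rfl, rfl, rfl⟩ | ⟨rfl, rfl, rfl⟩ <;> ring

theorem IsStep.co_eq (hs : IsStep n h ε k m) {A A' : Xi n d} {t : ℤ →₀ ℕ}
    (hA' : ∀ i j, (A'.a i j : ℤ) = A.a i j + ε * (rowE n h t i j - rowE n (h - 1) t i j)) :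
    A'.co = A.co := by
  refine Ld.ext_val fun j => ?_
  have h2 : (A'.co.val j : ℤ) = ∑ i ∈ Icc (-n : ℤ) n, (A'.a i j : ℤ) := by rw [← Nat.cast_sum]; rfl
  have h3 : (A.co.val j : ℤ) = ∑ i ∈ Icc (-n : ℤ) n, (A.a i j : ℤ) := by rw [← Nat.cast_sum]; rfl
  have ho := hs.one_le
  have hl := hs.le
  rw [sum_congr rfl fun i _ => hA' i j, sum_add_distrib, ← h3, ← mul_sum, sum_sub_distrib,
    sum_rowE_left (abs_le.2 (by omega)), sum_rowE_left (abs_le.2 (by omega)), sub_self, mul_zero,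
    add_zero] at h2
  exact_mod_cast h2

/-- The product of the standard basis elements `[B]` and `[A]`, up to the generating functions of
the subsets `S` of the block `k` with given content. -/
theorem IsStep.std_mul_std (hs : IsStep n h ε k m)
    (hB : IsDiag fun i j => (B.a i j : ℤ) - b * Eth k m i j) {A : Xi n d} (hBA : B.co = A.ro)
    {T : Finset (ℤ →₀ ℕ)} (A' : T → Xi n d)
    (hA' : ∀ t i j, ((A' t).a i j : ℤ) = A.a i j + ε * (rowE n h t.1 i j - rowE n (h - 1) t.1 i j))
    (hT : ∀ t, t ∈ T ↔ t ∈ (Icc (-n : ℤ) n).finsuppAntidiag b ∧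
      ∀ i j, 0 ≤ (A.a i j : ℤ) + ε * (rowE n h t i j - rowE n (h - 1) t i j))
    (wt : Finset ℤ → Laur) (γ : T → Laur)
    (hw : ∀ E : Finset ℤ, IsStrip B.co B.ro E k m → ∀ w ∈ reps B.co B.ro,
      weight w = wt (E.image w.1))
    (hγ : ∀ t x, B.ro.basc x⁻¹ → (∀ i j, kappa B.ro x A.co i j = (A' t).a i j) →
      uv (-B.lhatc) (-B.lhata) * uv (-A.lhatc) (-A.lhata) *
        (∑ S ∈ isotropic (B.ro.R k) b, if content A.co x S = t.1 then wt S else 0) =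
      γ t * uv (-(A' t).lhatc) (-(A' t).lhata)) :
    B.std * A.std = ∑ t, γ t • (A' t).std := by
  obtain ⟨E, hS, hb, hE⟩ := hs.exists_strip hB
  have hTX := hS.TX_coset (hs.kappa_one hB hS hb hE) fun i i' k k' => hs.staircase hB
  have hε : ε ≠ 0 := by rcases hs.cases with ⟨rfl, _⟩ | ⟨rfl, _⟩ <;> decide
  have hro : ∀ t, (A' t).ro = B.ro := fun t => hs.ro_eq hB hBA ((hT t.1).1 t.2).1 (hA' t)
  have hco : ∀ t, (A' t).co = A.co := fun t => hs.co_eq (hA' t)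
  have e1 : uv (A.lhatc + B.lhatc) (A.lhata + B.lhata) *
      (uv (-B.lhatc) (-B.lhata) * uv (-A.lhatc) (-A.lhata)) = 1 := by
    rw [uv_mul, uv_mul, ← uv_zero]
    congr 1 <;> ring
  refine Xi.std_mul_std hBA A' hro hco _ (by rw [hTX, hBA])
    (fun t => γ t * uv (-(A' t).lhatc) (-(A' t).lhata) *
      uv (A.lhatc + B.lhatc) (A.lhata + B.lhata)) γ
    (hS.mul_TX_coset hBA hTX hs.one_le hε hE A' hA' (by rwa [hb]) hro hco _ wt (hw E hS)
      fun t x hx hk => ?_) fun t => ?_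
  · rw [hb]
    rw [← hγ t x hx hk]
    linear_combination -(∑ S ∈ isotropic (B.ro.R k) b,
      if content A.co x S = t.1 then wt S else 0) * e1
  · linear_combination -γ t * uv (-(A' t).lhatc) (-(A' t).lhata) * e1

end

/-! ### The generating functions of a block -/

/-- If `x⁻¹` has ascents in the block `R_r` of `l`, the map that sends `p` to the index of the block
of `m` that contains `x⁻¹ p` is monotone on `R_r`, and it turns contents into cardinalities of
fibres. -/
theorem exists_blockIndex {n d : ℕ} (l m : Ld n d) {x : W d} (hx : l.basc x⁻¹) (r : ℤ) :
    ∃ f : ℤ → ℤ, MonotoneOn f (l.R r) ∧ (∀ p ∈ l.R r, f p ∈ Icc (-n : ℤ) n) ∧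
      (∀ p ∈ l.R r, -p ∈ l.R r → f (-p) = -f p) ∧
      (∀ j, #{p ∈ l.R r | f p = j} = kappa l x m r j) ∧
      ∀ S ⊆ l.R r, ∀ j, content m x S j = #{p ∈ S | f p = j} := by
  have hex : ∀ p ∈ l.R r, ∃ j, (x⁻¹).1 p ∈ m.R j := fun p hp => m.R_cover (W_abs _ (l.R_abs hp))
  choose! f hf using hex
  have hfj : ∀ p ∈ l.R r, ∀ j, f p = j ↔ (x⁻¹).1 p ∈ m.R j := fun p hp j =>
    ⟨fun h => h ▸ hf p hp, fun h => m.R_disj (hf p hp) h⟩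
  refine ⟨f, fun p hp q hq hpq => ?_, fun p hp => mem_Icc.2 (abs_le.1 (m.R_empty (hf p hp))),
    fun p hp hp' => ?_, fun j => ?_, fun S hS j => ?_⟩
  · rcases hpq.eq_or_lt with rfl | h
    · exact le_rfl
    · exact m.idx_le (Ld.basc_lt hx hp hq h).le (hf p hp) (hf q hq)
  · rw [hfj _ hp', W_neg, m.R_neg, neg_neg]
    exact hf p hp
  · rw [kappa_eq]
    exact congrArg card (filter_congr fun p hp => hfj p hp j)
  · rw [content_apply]
    exact congrArg card (filter_congr fun p hp => (hfj p (hS hp) j).symm)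

theorem sum_isotropic_content {n d : ℕ} {l m : Ld n d} {x : W d} {r : ℤ} {f : ℤ → ℤ}
    (hfI : ∀ p ∈ l.R r, f p ∈ Icc (-n : ℤ) n)
    (hcont : ∀ S ⊆ l.R r, ∀ j, content m x S j = #{p ∈ S | f p = j})
    {b : ℕ} {t : ℤ →₀ ℕ} (ht : t ∈ (Icc (-n : ℤ) n).finsuppAntidiag b) {M : Type*} [AddCommMonoid M]
    (F : Finset ℤ → M) :
    (∑ S ∈ isotropic (l.R r) b, if content m x S = t then F S else 0) =
      ∑ S ∈ (l.R r).powerset,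
        if (∀ p ∈ S, -p ∉ S) ∧ ∀ j ∈ Icc (-n : ℤ) n, #{p ∈ S | f p = j} = t j then F S else 0 := by
  rw [mem_finsuppAntidiag] at ht
  rw [← sum_filter, ← sum_filter]
  refine sum_congr (Finset.ext fun S => ?_) fun _ _ => rfl
  rw [mem_filter, mem_filter, mem_isotropic, mem_powerset]
  constructor
  · rintro ⟨⟨⟨h1, h2⟩, h3⟩, h4⟩
    exact ⟨h1, h3, fun j _ => by rw [← hcont S h1, h4]⟩
  · rintro ⟨h1, h2, h3⟩
    refine ⟨⟨⟨h1, ?_⟩, h2⟩, Finsupp.ext fun j => ?_⟩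
    · rw [card_eq_sum_content (I := Icc (-n : ℤ) n) (f := f) fun p hp => hfI p (h1 hp),
        sum_congr rfl h3, ht.1]
    · rw [hcont S h1]
      by_cases hj : j ∈ Icc (-n : ℤ) n
      · exact h3 j hj
      · rw [Finsupp.notMem_support_iff.1 fun h => hj (ht.2 h)]
        exact card_eq_zero.2 (filter_false_of_mem fun p hp h => hj (h ▸ hfI p (h1 hp)))

theorem notMem_neg_of_pos {n d : ℕ} {l : Ld n d} {r : ℤ} (hr : 0 < r) {S : Finset ℤ}
    (hS : S ⊆ l.R r) : ∀ p ∈ S, -p ∉ S := fun p hp hp' => by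
  have h1 := (l.R_sign (hS hp)).1 hr
  have h2 := (l.R_sign (hS hp')).1 hr
  omega

theorem algebraMap_sum_ite {P : Finset ℤ} (q : Finset ℤ → Prop) [DecidablePred q]
    (F : Finset ℤ → Laur) : algebraMap Laur LaurK (∑ S ∈ P.powerset, if q S then F S else 0) =
      ∑ S ∈ P.powerset, if q S then algebraMap Laur LaurK (F S) else 0 := by
  rw [map_sum]
  refine sum_congr rfl fun S _ => ?_
  rw [apply_ite (algebraMap Laur LaurK), map_zero]

theorem algebraMap_uv_nat (a b : ℕ) :
    algebraMap Laur LaurK (uv (2 * a) (2 * b)) = (uK ^ 2) ^ a * (vK ^ 2) ^ b := by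
  rw [algebraMap_uv, ← pow_mul, ← pow_mul]
  norm_cast

section

variable {n d : ℕ} {l m : Ld n d} {x : W d} (hx : l.basc x⁻¹) {r : ℤ} {b : ℕ} {t : ℤ →₀ ℕ}
  (ht : t ∈ (Icc (-n : ℤ) n).finsuppAntidiag b) {a : ℤ → ℕ}

include hx ht

/-- The coefficients for `B` with entry at `(h, h - 1)`. -/
theorem gen_lt (hr : 0 < r) (ha : ∀ j ∈ Icc (-n : ℤ) n, kappa l x m r j = a j + t j) :
    algebraMap Laur LaurK (∑ S ∈ isotropic (l.R r) b, if content m x S = t then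
      uv 0 (2 * #{z ∈ S ×ˢ (l.R r \ S) | z.2 < z.1}) else 0) =
    (vK ^ 2) ^ (∑ j ∈ Icc (-n : ℤ) n, ∑ k ∈ Icc (-n : ℤ) n with k < j, t j * a k) *
      ∏ j ∈ Icc (-n : ℤ) n, gauss (a j) (t j) := by
  obtain ⟨f, hf, hfI, -, hk, hc⟩ := exists_blockIndex l m hx r
  rw [sum_isotropic_content hfI hc ht, algebraMap_sum_ite,
    ← sum_powerset_inversions _ f _ hf hfI a t fun j hj => by rw [hk, ha j hj]]
  refine sum_congr rfl fun S hS => if_congr ?_ ?_ rfl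
  · rw [and_iff_right (notMem_neg_of_pos hr (mem_powerset.1 hS))]
  · have := algebraMap_uv_nat 0 #{z ∈ S ×ˢ (l.R r \ S) | z.2 < z.1}
    simpa using this

/-- The coefficients for `C` with entry at `(h - 1, h)`, where `h > 1`. -/
theorem gen_gt (hr : 0 < r) (ha : ∀ j ∈ Icc (-n : ℤ) n, kappa l x m r j = a j + t j) :
    algebraMap Laur LaurK (∑ S ∈ isotropic (l.R r) b, if content m x S = t then
      uv 0 (2 * #{z ∈ S ×ˢ (l.R r \ S) | z.1 < z.2}) else 0) =
    (vK ^ 2) ^ (∑ j ∈ Icc (-n : ℤ) n, ∑ k ∈ Icc (-n : ℤ) n with k < j, a j * t k) *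
      ∏ j ∈ Icc (-n : ℤ) n, gauss (a j) (t j) := by
  obtain ⟨f, hf, hfI, -, hk, hc⟩ := exists_blockIndex l m hx r
  rw [sum_isotropic_content hfI hc ht, algebraMap_sum_ite,
    ← sum_powerset_inversions' _ f _ hf hfI a t fun j hj => by rw [hk, ha j hj]]
  refine sum_congr rfl fun S hS => if_congr ?_ ?_ rfl
  · rw [and_iff_right (notMem_neg_of_pos hr (mem_powerset.1 hS))]
  · have := algebraMap_uv_nat 0 #{z ∈ S ×ˢ (l.R r \ S) | z.1 < z.2}
    simpa using this

/-- The coefficients for `C` with entry at `(0, 1)`. -/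
theorem gen_zero {a0 : ℕ} (has : ∀ j, a (-j) = a j) (ha0 : a 0 = 2 * a0)
    (ha : ∀ j ∈ Icc (-n : ℤ) n, kappa l x m 0 j = a j + t j + t (-j) + if j = 0 then 1 else 0) :
    algebraMap Laur LaurK (∑ S ∈ isotropic (l.R 0) b, if content m x S = t then
      uv (2 * #{p ∈ S | p < 0}) (2 * #(isoInversions (l.R 0) S)) else 0) =
    isoGen n a0 a t := by
  obtain ⟨f, hf, hfI, hodd, hk, hc⟩ := exists_blockIndex l m hx 0
  rw [sum_isotropic_content hfI hc ht, algebraMap_sum_ite]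
  have hR : l.R 0 = Icc (-((l.cum 0).toNat : ℤ)) ((l.cum 0).toNat : ℤ) := by
    ext p
    have := l.cum_nonneg 0
    rw [l.mem_R_zero, mem_Icc]
    omega
  have hk' : ∀ j ∈ Icc (-n : ℤ) n, #{p ∈ l.R 0 | f p = j} =
      a j + t j + t (-j) + if j = 0 then 1 else 0 := fun j hj => by rw [hk, ha j hj]
  have hodd' : ∀ p ∈ l.R 0, f (-p) = -f p := fun p hp => hodd p hp (by
    have := l.R_neg 0 p
    rw [neg_zero] at this
    exact this.1 hp)
  rw [hR] at hf hfI hk' hodd' ⊢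
  rw [← sum_isotropic n f _ hf hodd' hfI a0 a t has ha0 hk']
  refine sum_congr rfl fun S _ => if_congr Iff.rfl ?_ rfl
  rw [isoWeight, ← algebraMap_uv_nat]

end

/-! ### The exponents as values of a bilinear form -/

/-- The sum of the entries of `Y` weakly above row `i` and strictly to the right of column `j`. -/
noncomputable def corner (n : ℕ) (Y : ℤ → ℤ → ℤ) (i j : ℤ) : ℤ :=
  ∑ x ∈ Icc (-n : ℤ) n, ∑ y ∈ Icc (-n : ℤ) n, if x ≤ i ∧ j < y then Y x y else 0

/-- The bilinear form `∑ X_{ij} Y_{xy}`, where the sum is over `x ≤ i` and `j < y`. -/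
noncomputable def pairing (n : ℕ) (X Y : ℤ → ℤ → ℤ) : ℤ :=
  ∑ i ∈ Icc (-n : ℤ) n, ∑ j ∈ Icc (-n : ℤ) n, X i j * corner n Y i j

theorem corner_add (n : ℕ) (X Y : ℤ → ℤ → ℤ) (c i j : ℤ) :
    corner n (fun i j => X i j + c * Y i j) i j = corner n X i j + c * corner n Y i j := by
  simp only [corner, mul_sum, ← sum_add_distrib]
  refine sum_congr rfl fun x _ => sum_congr rfl fun y _ => ?_
  split_ifs <;> ring

theorem pairing_add (n : ℕ) (X Y : ℤ → ℤ → ℤ) (c : ℤ) :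
    pairing n (fun i j => X i j + c * Y i j) (fun i j => X i j + c * Y i j) =
      pairing n X X + c * (pairing n X Y + pairing n Y X) + c ^ 2 * pairing n Y Y := by
  simp only [pairing, corner_add, mul_add, mul_sum, ← sum_add_distrib]
  refine sum_congr rfl fun x _ => sum_congr rfl fun y _ => ?_
  ring

theorem sum_Icc_neg (n : ℕ) (f : ℤ → ℤ) :
    ∑ i ∈ Icc (-n : ℤ) n, f (-i) = ∑ i ∈ Icc (-n : ℤ) n, f i :=
  sum_nbij' Neg.neg Neg.neg (by simp; omega) (by simp; omega) (by simp) (by simp) (by simp)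

theorem sum_sum_neg (n : ℕ) (f : ℤ → ℤ → ℤ) :
    ∑ i ∈ Icc (-n : ℤ) n, ∑ j ∈ Icc (-n : ℤ) n, f (-i) (-j) =
      ∑ i ∈ Icc (-n : ℤ) n, ∑ j ∈ Icc (-n : ℤ) n, f i j := by
  rw [← sum_Icc_neg n fun i => ∑ j ∈ Icc (-n : ℤ) n, f i j]
  exact sum_congr rfl fun i _ => sum_Icc_neg n (f (-i))

/-- Reflection of the corner of a centrally symmetric matrix. -/
theorem corner_neg {n : ℕ} {Y : ℤ → ℤ → ℤ} (hY : ∀ i j, Y (-i) (-j) = Y i j) (i j : ℤ) :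
    corner n Y (-i) (-j) =
      ∑ x ∈ Icc (-n : ℤ) n, ∑ y ∈ Icc (-n : ℤ) n, if i ≤ x ∧ y < j then Y x y else 0 := by
  rw [corner, ← sum_sum_neg]
  refine sum_congr rfl fun x _ => sum_congr rfl fun y _ => ?_
  rw [hY]
  simp only [neg_le_neg_iff, neg_lt_neg_iff]

/-- The reflection `(i, j) ↦ (-i, -j)` exchanges the two arguments of the form. -/
theorem pairing_comm {n : ℕ} {X Y : ℤ → ℤ → ℤ} (hX : ∀ i j, X (-i) (-j) = X i j)
    (hY : ∀ i j, Y (-i) (-j) = Y i j) : pairing n X Y = pairing n Y X := by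
  rw [pairing, ← sum_sum_neg]
  simp only [hX, corner_neg hY]
  simp only [pairing, corner, mul_sum, mul_ite, mul_zero, ← sum_product']
  refine sum_nbij' (fun p => (p.2.2.1, p.2.2.2, p.1, p.2.1))
    (fun p => (p.2.2.1, p.2.2.2, p.1, p.2.1)) ?_ ?_ (fun _ _ => rfl) (fun _ _ => rfl) fun p _ => ?_
  · intro p hp
    simp only [mem_product] at hp ⊢
    tauto
  · intro p hp
    simp only [mem_product] at hp ⊢
    tauto
  · rw [mul_comm]

theorem sum_symm_parity {α : Type*} [DecidableEq α] (s : Finset α) (F : α → α → ℤ)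
    (hF : ∀ p q, F p q = F q p) : ∃ c, ∑ p ∈ s, ∑ q ∈ s, F p q = ∑ p ∈ s, F p p + 2 * c := by
  induction s using Finset.induction_on with
  | empty => exact ⟨0, by simp⟩
  | insert a s ha ih =>
    obtain ⟨c, hc⟩ := ih
    refine ⟨c + ∑ q ∈ s, F a q, ?_⟩
    simp only [sum_insert ha, sum_add_distrib, hc, hF _ a]
    ring

/-- By central symmetry, all but the diagonal terms of `pairing n X X` come in pairs. -/
theorem pairing_parity {n : ℕ} {X : ℤ → ℤ → ℤ} (hX : ∀ i j, X (-i) (-j) = X i j) :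
    ∃ c, pairing n X X = corner n X 0 0 + 2 * c := by
  classical
  obtain ⟨c, hc⟩ := sum_symm_parity (Icc (-n : ℤ) n ×ˢ Icc (-n : ℤ) n)
    (fun p q => if 0 ≤ p.1 + q.1 ∧ p.2 + q.2 < 0 then X p.1 p.2 * X q.1 q.2 else 0)
    fun p q => by rw [add_comm p.1, add_comm p.2, mul_comm]
  have h1 : pairing n X X = ∑ p ∈ Icc (-n : ℤ) n ×ˢ Icc (-n : ℤ) n,
      ∑ q ∈ Icc (-n : ℤ) n ×ˢ Icc (-n : ℤ) n,
      if 0 ≤ p.1 + q.1 ∧ p.2 + q.2 < 0 then X p.1 p.2 * X q.1 q.2 else 0 := by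
    rw [pairing, sum_product]
    refine sum_congr rfl fun i _ => sum_congr rfl fun j _ => ?_
    rw [sum_product, corner, ← sum_sum_neg]
    simp only [mul_sum, hX]
    refine sum_congr rfl fun x _ => sum_congr rfl fun y _ => ?_
    simp only [show -x ≤ i ↔ 0 ≤ i + x by omega, show j < -y ↔ j + y < 0 by omega]
    split_ifs <;> ring
  have h2 : ∀ p ∈ Icc (-n : ℤ) n ×ˢ Icc (-n : ℤ) n,
      (if 0 ≤ p.1 + p.1 ∧ p.2 + p.2 < 0 then X p.1 p.2 * X p.1 p.2 else 0) =
      (if 0 ≤ p.1 ∧ p.2 < 0 then X p.1 p.2 else 0) +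
        2 * if 0 ≤ p.1 ∧ p.2 < 0 then X p.1 p.2 * (X p.1 p.2 - 1) / 2 else 0 := by
    intro p _
    simp only [show 0 ≤ p.1 + p.1 ↔ 0 ≤ p.1 by omega, show p.2 + p.2 < 0 ↔ p.2 < 0 by omega]
    split_ifs
    · rw [Int.mul_ediv_cancel' (Int.even_mul_pred_self _).two_dvd]
      ring
    · ring
  have h3 : corner n X 0 0 = ∑ p ∈ Icc (-n : ℤ) n ×ˢ Icc (-n : ℤ) n,
      if 0 ≤ p.1 ∧ p.2 < 0 then X p.1 p.2 else 0 := by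
    have := corner_neg (n := n) hX 0 0
    rw [neg_zero] at this
    rw [this, sum_product]
  rw [h1, hc, sum_congr rfl h2, sum_add_distrib, ← h3, ← mul_sum]
  exact ⟨_, by rw [add_assoc, ← mul_add]⟩

/-- Sums over all index pairs in terms of the half `I_𝔠`. -/
theorem sum_sum_eq_Ic (n : ℕ) {f : ℤ → ℤ → ℤ} (hf : ∀ i j, f (-i) (-j) = f i j) :
    ∑ i ∈ Icc (-n : ℤ) n, ∑ j ∈ Icc (-n : ℤ) n, f i j + f 0 0 = 2 * ∑ p ∈ Ic n, f p.1 p.2 := by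
  set C := ({0} ×ˢ Icc (1 : ℤ) n) ∪ (Icc (1 : ℤ) n ×ˢ Icc (-n : ℤ) n) with hC
  have hmem : ∀ p : ℤ × ℤ, p ∈ C ↔ (p.1 = 0 ∧ 1 ≤ p.2 ∧ p.2 ≤ n) ∨
      ((1 ≤ p.1 ∧ p.1 ≤ n) ∧ -n ≤ p.2 ∧ p.2 ≤ n) := fun p => by
    simp only [hC, mem_union, mem_product, mem_singleton, mem_Icc]
  have hneg : ∀ p : ℤ × ℤ, p ∈ C.image (fun p => (-p.1, -p.2)) ↔ (-p.1, -p.2) ∈ C := fun p => by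
    rw [mem_image]
    constructor
    · rintro ⟨q, hq, rfl⟩
      simpa using hq
    · intro h
      exact ⟨_, h, by simp⟩
  have h1 : Ic n = insert (0, 0) C := by
    ext p
    simp only [Ic, hC, mem_union, mem_insert, mem_singleton]
    tauto
  have h2 : Icc (-n : ℤ) n ×ˢ Icc (-n : ℤ) n =
      insert (0, 0) (C ∪ C.image fun p => (-p.1, -p.2)) := by
    ext ⟨i, j⟩
    rw [mem_insert, mem_union, hneg, hmem, hmem, mem_product, mem_Icc, mem_Icc, Prod.mk.injEq]
    omega
  have h0 : ((0 : ℤ), (0 : ℤ)) ∉ C := by rw [hmem]; omega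
  rw [← sum_product', h2, h1, sum_insert h0, sum_insert, sum_union, sum_image]
  · simp only [hf]
    ring
  · rintro ⟨a, b⟩ _ ⟨a', b'⟩ _ h
    simp only [Prod.mk.injEq, neg_inj] at h
    exact Prod.ext h.1 h.2
  · rw [disjoint_left]
    intro p hp hp'
    rw [hneg, hmem] at hp'
    rw [hmem] at hp
    omega
  · rw [mem_union, hneg, hmem, hmem]
    omega

section

variable {n d : ℕ}

theorem Xi.symm_int (A : Xi n d) (i j : ℤ) : (A.a (-i) (-j) : ℤ) = A.a i j := by rw [A.symm]

theorem Xi.a_zero_zero (A : Xi n d) : A.a 0 0 = 2 * A.nat 0 0 + 1 := by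
  obtain ⟨k, hk⟩ := A.odd
  rw [Xi.nat, if_pos ⟨rfl, rfl⟩]
  omega

theorem Xi.lhatc_eq (A : Xi n d) : A.lhatc = corner n (fun i j => A.a i j) 0 0 := by
  have h := corner_neg (n := n) (Y := fun i j => (A.a i j : ℤ)) A.symm_int 0 0
  rw [neg_zero] at h
  have h1 : corner n (fun i j => (A.a i j : ℤ)) 0 0 = ((∑ x ∈ Icc (-n : ℤ) n,
      ∑ y ∈ Icc (-n : ℤ) n, if x ≤ 0 ∧ 0 < y then A.a x y else 0 : ℕ) : ℤ) := by
    rw [corner]; push_cast; rfl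
  have h2 : corner n (fun i j => (A.a i j : ℤ)) 0 0 = ((∑ x ∈ Icc (-n : ℤ) n,
      ∑ y ∈ Icc (-n : ℤ) n, if 0 ≤ x ∧ y < 0 then A.a x y else 0 : ℕ) : ℤ) := by
    rw [h]; push_cast; rfl
  rw [lhatc, Nat.cast_add, ← h1, ← h2]
  omega

/-- The sum over `I_𝔠` is half of the sum over all index pairs, up to the term at `(0, 0)`. The
division by `2` in `ℓ̂` is exact by `pairing_parity`. -/
theorem Xi.lhat_eq (A : Xi n d) : 2 * A.lhat =
    pairing n (fun i j => A.a i j) (fun i j => A.a i j) - corner n (fun i j => A.a i j) 0 0 := by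
  set X : ℤ → ℤ → ℤ := fun i j => A.a i j with hX
  have hs : ∀ i j, X (-i) (-j) = X i j := A.symm_int
  set G : ℤ → ℤ → ℤ := fun i j => corner n X i j + corner n X (-i) (-j) with hG
  have hGs : ∀ i j, G (-i) (-j) = G i j := fun i j => by
    simp only [hG, neg_neg]; ring
  have h1 := sum_sum_eq_Ic n (f := fun i j => X i j * G i j) fun i j => by rw [hs, hGs]
  have h2 : ∑ i ∈ Icc (-n : ℤ) n, ∑ j ∈ Icc (-n : ℤ) n, X i j * G i j = 2 * pairing n X X := by
    have : ∑ i ∈ Icc (-n : ℤ) n, ∑ j ∈ Icc (-n : ℤ) n, X i j * corner n X (-i) (-j) =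
        pairing n X X := by
      rw [pairing, ← sum_sum_neg]
      simp only [hs, neg_neg]
    simp only [hG, mul_add, sum_add_distrib, this]
    rw [pairing, two_mul]
  have h3 : ∀ p ∈ Ic n, (((∑ x ∈ Icc (-n : ℤ) n, ∑ y ∈ Icc (-n : ℤ) n,
        if x ≤ p.1 ∧ p.2 < y then A.nat p.1 p.2 * A.a x y else 0) +
      ∑ x ∈ Icc (-n : ℤ) n, ∑ y ∈ Icc (-n : ℤ) n,
        if p.1 ≤ x ∧ y < p.2 then A.nat p.1 p.2 * A.a x y else 0 : ℕ) : ℤ) =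
      (A.nat p.1 p.2 : ℤ) * G p.1 p.2 := by
    intro p _
    have e := corner_neg (n := n) hs p.1 p.2
    simp only [hG, e]
    simp only [corner, mul_add, mul_sum, mul_ite, mul_zero]
    push_cast
    rfl
  have h4 : ∀ p ∈ Ic n, X p.1 p.2 * G p.1 p.2 = (A.nat p.1 p.2 : ℤ) * G p.1 p.2 +
      (if p = (0, 0) then (A.nat 0 0 + 1) * G 0 0 else 0) := by
    intro p _
    by_cases hp : p = (0, 0)
    · subst hp
      rw [if_pos rfl, hX]
      dsimp only
      rw [A.a_zero_zero]
      push_cast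
      ring
    · rw [if_neg hp, add_zero, Xi.nat, if_neg fun h => hp (Prod.ext h.1 h.2)]
  have h5 : ((0 : ℤ), (0 : ℤ)) ∈ Ic n := by simp [Ic]
  have h6 : G 0 0 = 2 * corner n X 0 0 := by simp only [hG, neg_zero]; ring
  have h7 : A.lhat = (∑ p ∈ Ic n, (A.nat p.1 p.2 : ℤ) * G p.1 p.2) / 2 := by
    rw [lhat, Nat.cast_sum, sum_congr rfl h3]
  have h8 : X 0 0 = 2 * A.nat 0 0 + 1 := by
    simp only [hX, A.a_zero_zero]
    push_cast
    rfl
  obtain ⟨c, hc⟩ := pairing_parity hs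
  rw [sum_congr rfl h4, sum_add_distrib, sum_ite_eq', if_pos h5, h2, h6, h8] at h1
  have h9 : ∑ p ∈ Ic n, (A.nat p.1 p.2 : ℤ) * G p.1 p.2 = pairing n X X - corner n X 0 0 := by
    linarith
  rw [h7, h9, hc]
  omega

/-- Twice the exponent of `v⁻¹` in the standard basis element. -/
theorem Xi.lhata_eq (A : Xi n d) : 2 * A.lhata =
    pairing n (fun i j => A.a i j) (fun i j => A.a i j) -
      3 * corner n (fun i j => A.a i j) 0 0 := by
  have h1 := A.lhat_eq
  have h2 := A.lhatc_eq
  rw [lhata]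
  linarith

/-! ### The exponents of a product -/

/-- The change `∑ t_l E_{hl}^θ - ∑ t_l E_{h-1,l}^θ` of a matrix. -/
noncomputable def stepE (n : ℕ) (h : ℤ) (t : ℤ →₀ ℕ) : ℤ → ℤ → ℤ :=
  fun i j => rowE n h t i j - rowE n (h - 1) t i j

theorem stepE_symm (n : ℕ) (h : ℤ) (t : ℤ →₀ ℕ) (i j : ℤ) :
    stepE n h t (-i) (-j) = stepE n h t i j := by
  rw [stepE, stepE, rowE_symm, rowE_symm]

theorem sum_rowE_mul {n : ℕ} {h : ℤ} (hh : |h| ≤ n) (t : ℤ →₀ ℕ) (G : ℤ → ℤ → ℤ) :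
    ∑ i ∈ Icc (-n : ℤ) n, ∑ j ∈ Icc (-n : ℤ) n, rowE n h t i j * G i j =
      ∑ l ∈ Icc (-n : ℤ) n, (t l : ℤ) * (G h l + G (-h) (-l)) := by
  have hh := abs_le.1 hh
  have h1 : ∀ k l, k ∈ Icc (-n : ℤ) n → l ∈ Icc (-n : ℤ) n →
      (∑ i ∈ Icc (-n : ℤ) n, ∑ j ∈ Icc (-n : ℤ) n, if i = k ∧ j = l then G i j else 0) =
        G k l := by
    intro k l hk hl
    rw [sum_eq_single_of_mem k hk, sum_eq_single_of_mem l hl, if_pos ⟨rfl, rfl⟩]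
    · intro j _ hj
      rw [if_neg fun h => hj h.2]
    · intro i _ hi
      exact sum_eq_zero fun j _ => if_neg fun h => hi h.1
  have h2 : ∀ i j, rowE n h t i j * G i j = ∑ l ∈ Icc (-n : ℤ) n, (t l : ℤ) *
      ((if i = h ∧ j = l then G i j else 0) + if i = -h ∧ j = -l then G i j else 0) := by
    intro i j
    rw [rowE, sum_mul]
    refine sum_congr rfl fun l _ => ?_
    rw [Eth]
    split_ifs <;> ring
  simp only [h2]
  rw [sum_congr rfl fun i _ => sum_comm, sum_comm]
  refine sum_congr rfl fun l hl => ?_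
  simp only [← mul_sum, sum_add_distrib]
  rw [mem_Icc] at hl
  rw [h1 _ _ (mem_Icc.2 hh) (mem_Icc.2 hl),
    h1 _ _ (mem_Icc.2 (by omega)) (mem_Icc.2 (by omega))]

theorem corner_sub_corner {n : ℕ} (Y : ℤ → ℤ → ℤ) {i : ℤ} (hi : i ∈ Icc (-n : ℤ) n) (j : ℤ) :
    corner n Y i j - corner n Y (i - 1) j =
      ∑ y ∈ Icc (-n : ℤ) n, if j < y then Y i y else 0 := by
  rw [corner, corner, ← sum_sub_distrib, sum_eq_single_of_mem i hi]
  · rw [← sum_sub_distrib]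
    refine sum_congr rfl fun y _ => ?_
    rw [if_neg (show ¬(i ≤ i - 1 ∧ j < y) by omega), sub_zero]
    simp only [le_refl, true_and]
  · intro x _ hx
    rw [← sum_sub_distrib]
    refine sum_eq_zero fun y _ => ?_
    simp only [show x ≤ i - 1 ↔ x ≤ i by omega, sub_self]

section

variable {h : ℤ} (h1 : 1 ≤ h) (hn : h ≤ n) (t : ℤ →₀ ℕ)

include h1 hn

theorem pairing_stepE {Y : ℤ → ℤ → ℤ} (hY : ∀ i j, Y (-i) (-j) = Y i j) :
    pairing n (stepE n h t) Y =
      (∑ l ∈ Icc (-n : ℤ) n, ∑ k ∈ Icc (-n : ℤ) n, if l < k then (t l : ℤ) * Y h k else 0) -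
      ∑ l ∈ Icc (-n : ℤ) n, ∑ k ∈ Icc (-n : ℤ) n, if k < l then (t l : ℤ) * Y (h - 1) k else 0 := by
  rw [pairing]
  simp only [stepE, sub_mul, sum_sub_distrib]
  rw [sum_rowE_mul (abs_le.2 (by omega)), sum_rowE_mul (abs_le.2 (by omega)), ← sum_sub_distrib,
    ← sum_sub_distrib]
  refine sum_congr rfl fun l _ => ?_
  have e1 := corner_sub_corner (n := n) Y (i := h) (mem_Icc.2 (by omega)) l
  have e2 := corner_sub_corner (n := n) Y (i := -(h - 1)) (mem_Icc.2 (by omega)) (-l)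
  rw [← sum_Icc_neg] at e2
  simp only [hY, neg_lt_neg_iff, show -(h - 1) - 1 = -h by ring] at e2
  simp only [← mul_ite_zero, ← mul_sum]
  rw [← e1, ← e2, show -(h - 1) = 1 - h by ring]
  ring

theorem corner_stepE : corner n (stepE n h t) 0 0 =
    -if h = 1 then ∑ l ∈ Icc (-n : ℤ) n with 0 < l, (t l : ℤ) else 0 := by
  have e : corner n (stepE n h t) 0 0 = ∑ x ∈ Icc (-n : ℤ) n, ∑ y ∈ Icc (-n : ℤ) n,
      (rowE n h t x y * (if x ≤ 0 ∧ 0 < y then 1 else 0) -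
        rowE n (h - 1) t x y * if x ≤ 0 ∧ 0 < y then 1 else 0) := by
    rw [corner]
    refine sum_congr rfl fun x _ => sum_congr rfl fun y _ => ?_
    rw [stepE]
    split_ifs <;> ring
  rw [e]
  simp only [sum_sub_distrib]
  rw [sum_rowE_mul (G := fun x y => if x ≤ 0 ∧ 0 < y then 1 else 0) (abs_le.2 (by omega)),
    sum_rowE_mul (G := fun x y => if x ≤ 0 ∧ 0 < y then 1 else 0) (abs_le.2 (by omega)),
    ← sum_sub_distrib]
  by_cases hh : h = 1
  · rw [if_pos hh, sum_filter, ← sum_neg_distrib]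
    refine sum_congr rfl fun l _ => ?_
    split_ifs <;> omega
  · rw [if_neg hh, neg_zero]
    refine sum_eq_zero fun l _ => ?_
    split_ifs <;> omega

/-- The value of the quadratic form at `stepE`. -/
theorem pairing_stepE_self : pairing n (stepE n h t) (stepE n h t) =
    ∑ l ∈ Icc (-n : ℤ) n, ∑ k ∈ Icc (-n : ℤ) n, (t l : ℤ) * t k *
      ((if l < k then 1 else 0) + (if k < l then 1 else 0) + if h = 1 ∧ 0 < l + k then 1 else 0) := by
  rw [pairing_stepE h1 hn t (stepE_symm n h t)]
  have e1 : ∀ k ∈ Icc (-n : ℤ) n, stepE n h t h k = t k := fun k hk => rowE_sub_apply h1 t hk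
  have e2 : ∀ k ∈ Icc (-n : ℤ) n, stepE n h t (h - 1) k = -t k - if h = 1 then (t (-k) : ℤ) else 0 := by
    intro k hk
    rw [stepE, rowE_eq, rowE_eq, if_pos hk, if_pos hk, if_neg (by omega), if_neg (by omega),
      if_pos rfl]
    simp only [show h - 1 = -(h - 1) ↔ h = 1 by omega]
    ring
  rw [← sum_sub_distrib]
  refine sum_congr rfl fun l _ => ?_
  have e3 : (∑ k ∈ Icc (-n : ℤ) n, if k < l then (t l : ℤ) * stepE n h t (h - 1) k else 0) =
      -(∑ k ∈ Icc (-n : ℤ) n, if k < l then (t l : ℤ) * t k else 0) -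
      ∑ k ∈ Icc (-n : ℤ) n, if h = 1 ∧ 0 < l + k then (t l : ℤ) * t k else 0 := by
    rw [← sum_Icc_neg n fun k => if h = 1 ∧ 0 < l + k then (t l : ℤ) * t k else 0,
      ← sum_neg_distrib, ← sum_sub_distrib]
    refine sum_congr rfl fun k hk => ?_
    rw [e2 k hk]
    split_ifs <;> first | omega | ring
  rw [e3, sum_congr rfl fun k hk => by rw [e1 k hk]]
  rw [sub_sub_eq_add_sub, sub_neg_eq_add, ← sum_add_distrib, ← sum_add_distrib]
  refine sum_congr rfl fun k _ => ?_
  split_ifs <;> ring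

end

end

section

variable {n d : ℕ} {A A' B : Xi n d} {h ε k m : ℤ} {b : ℕ} {t : ℤ →₀ ℕ}

theorem sum_single_mul {n : ℕ} {m : ℤ} (hm : m ∈ Icc (-n : ℤ) n) (b : ℕ) (G : ℤ → ℤ) :
    ∑ l ∈ Icc (-n : ℤ) n, ((Finsupp.single m b l : ℕ) : ℤ) * G l = b * G m := by
  rw [sum_eq_single_of_mem m hm, Finsupp.single_eq_same]
  intro x _ hx
  rw [Finsupp.single_eq_of_ne hx, Nat.cast_zero, zero_mul]

theorem rowE_single {n : ℕ} {m : ℤ} (hm : m ∈ Icc (-n : ℤ) n) (a : ℤ) (b : ℕ) (i j : ℤ) :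
    rowE n a (Finsupp.single m b) i j = b * Eth a m i j :=
  sum_single_mul hm b fun l => Eth a l i j

/-- The matrix `B` is a diagonal matrix plus a step. -/
theorem IsStep.eq_diag_add (hs : IsStep n h ε k m)
    (hB : IsDiag fun i j => (B.a i j : ℤ) - b * Eth k m i j) :
    (fun i j => (B.a i j : ℤ)) = fun i j => (if i = j then (B.co.val j : ℤ) else 0) +
      ε * stepE n h (Finsupp.single m b) i j := by
  have hm := mem_Icc.2 (abs_le.1 hs.abs_m)
  funext i j
  rw [hs.entry hB, stepE, rowE_single hm, rowE_single hm]
  rcases hs.cases with ⟨rfl, rfl, rfl⟩ | ⟨rfl, rfl, rfl⟩ <;> ring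

theorem corner_diag (n : ℕ) (v : ℤ → ℤ) (i : ℤ) :
    corner n (fun i j => if i = j then v j else 0) i i = 0 :=
  sum_eq_zero fun x _ => sum_eq_zero fun y _ => by
    dsimp only
    split_ifs <;> omega

theorem pairing_diag (n : ℕ) (v : ℤ → ℤ) : pairing n (fun i j => if i = j then v j else 0)
    (fun i j => if i = j then v j else 0) = 0 :=
  sum_eq_zero fun i _ => sum_eq_zero fun j _ => by
    by_cases hij : i = j
    · rw [hij, corner_diag, mul_zero]
    · dsimp only
      rw [if_neg hij, zero_mul]

theorem IsStep.sq (hs : IsStep n h ε k m) : ε ^ 2 = 1 := by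
  rcases hs.cases with ⟨rfl, _⟩ | ⟨rfl, _⟩ <;> rfl

theorem IsStep.corner_left (hs : IsStep n h ε k m)
    (hB : IsDiag fun i j => (B.a i j : ℤ) - b * Eth k m i j) :
    corner n (fun i j => (B.a i j : ℤ)) 0 0 = -(ε * if h = 1 ∧ 0 < m then (b : ℤ) else 0) := by
  have hm := mem_Icc.2 (abs_le.1 hs.abs_m)
  rw [hs.eq_diag_add hB, corner_add, corner_diag, corner_stepE hs.one_le hs.le, sum_filter]
  have := sum_single_mul hm b fun l => if 0 < l then 1 else 0
  simp only [mul_ite, mul_one, mul_zero] at this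
  rw [this]
  split_ifs <;> first | omega | simp_all

theorem IsStep.pairing_left (hs : IsStep n h ε k m)
    (hB : IsDiag fun i j => (B.a i j : ℤ) - b * Eth k m i j) :
    pairing n (fun i j => (B.a i j : ℤ)) (fun i j => B.a i j) =
      2 * b * B.co.val k + if h = 1 ∧ 0 < m then (b : ℤ) ^ 2 else 0 := by
  have hm := mem_Icc.2 (abs_le.1 hs.abs_m)
  have ho := hs.one_le
  have hn := hs.le
  have hD : ∀ i j : ℤ, (if -i = -j then (B.co.val (-j) : ℤ) else 0) =
      if i = j then (B.co.val j : ℤ) else 0 := fun i j => by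
    rw [B.co.symm]; simp only [neg_inj]
  rw [hs.eq_diag_add hB, pairing_add, hs.sq, pairing_diag,
    pairing_comm (X := fun i j => if i = j then (B.co.val j : ℤ) else 0) hD
      (stepE_symm n h _), pairing_stepE ho hn _ hD, pairing_stepE_self ho hn]
  have e1 : (∑ l ∈ Icc (-n : ℤ) n, ∑ k ∈ Icc (-n : ℤ) n, ((Finsupp.single m b l : ℕ) : ℤ) *
      (Finsupp.single m b k : ℕ) * ((if l < k then 1 else 0) + (if k < l then 1 else 0) +
        if h = 1 ∧ 0 < l + k then 1 else 0)) = if h = 1 ∧ 0 < m then (b : ℤ) ^ 2 else 0 := by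
    simp only [mul_assoc, ← mul_sum]
    rw [sum_single_mul hm b fun l => ∑ k ∈ Icc (-n : ℤ) n, ((Finsupp.single m b k : ℕ) : ℤ) *
      ((if l < k then 1 else 0) + (if k < l then 1 else 0) +
        if h = 1 ∧ 0 < l + k then 1 else 0), sum_single_mul hm b]
    rw [if_neg (lt_irrefl m)]
    simp only [show 0 < m + m ↔ 0 < m by omega]
    split_ifs <;> ring
  have e2 : ∀ (c : ℤ → ℤ → Prop) [∀ i j, Decidable (c i j)] (i : ℤ), i ∈ Icc (-n : ℤ) n →
      (∑ l ∈ Icc (-n : ℤ) n, ∑ k ∈ Icc (-n : ℤ) n, if c l k then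
        ((Finsupp.single m b l : ℕ) : ℤ) * (if i = k then (B.co.val k : ℤ) else 0) else 0) =
      if c m i then (b : ℤ) * B.co.val i else 0 := by
    intro c _ i hi
    simp only [← mul_ite_zero, ← mul_sum]
    rw [sum_single_mul hm b fun l => ∑ k ∈ Icc (-n : ℤ) n,
      if c l k then (if i = k then (B.co.val k : ℤ) else 0) else 0, sum_eq_single_of_mem i hi,
      if_pos rfl, mul_ite_zero]
    intro k _ hk
    rw [if_neg (Ne.symm hk), ite_self]
  rw [e1, e2 (fun l k => l < k) h (mem_Icc.2 (by omega)),
    e2 (fun l k => k < l) (h - 1) (mem_Icc.2 (by omega))]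
  rcases hs.cases with ⟨rfl, rfl, rfl⟩ | ⟨rfl, rfl, rfl⟩
  · rw [if_pos (show k - 1 < k by omega), if_neg (show ¬ k - 1 < k - 1 by omega)]
    ring
  · rw [if_neg (show ¬ m < m by omega), if_pos (show m - 1 < m by omega)]
    ring

theorem step_eq (hA' : ∀ i j, (A'.a i j : ℤ) = A.a i j +
    ε * (rowE n h t i j - rowE n (h - 1) t i j)) :
    (fun i j => (A'.a i j : ℤ)) = fun i j => (A.a i j : ℤ) + ε * stepE n h t i j :=
  funext fun i => funext fun j => hA' i j

theorem IsStep.lhatc_sub (hs : IsStep n h ε k m)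
    (hB : IsDiag fun i j => (B.a i j : ℤ) - b * Eth k m i j)
    (hA' : ∀ i j, (A'.a i j : ℤ) = A.a i j + ε * (rowE n h t i j - rowE n (h - 1) t i j)) :
    A'.lhatc - A.lhatc - B.lhatc =
      ε * ((if h = 1 ∧ 0 < m then (b : ℤ) else 0) -
        if h = 1 then ∑ l ∈ Icc (-n : ℤ) n with 0 < l, (t l : ℤ) else 0) := by
  rw [A'.lhatc_eq, A.lhatc_eq, B.lhatc_eq, step_eq hA', corner_add, hs.corner_left hB,
    corner_stepE hs.one_le hs.le]
  ring

/-- The exponents of `v` in `[B]`, `[A]` and a summand `[A']` of the product, as a quadratic polynomial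
in `t`; the mixed terms come from the bilinear form, and `∑ t_l a_{k,j}` from the diagonal of `B`. -/
theorem IsStep.lhata_sub (hs : IsStep n h ε k m)
    (hB : IsDiag fun i j => (B.a i j : ℤ) - b * Eth k m i j) (hBA : B.co = A.ro)
    (ht : t ∈ (Icc (-n : ℤ) n).finsuppAntidiag b)
    (hA' : ∀ i j, (A'.a i j : ℤ) = A.a i j + ε * (rowE n h t i j - rowE n (h - 1) t i j)) :
    2 * (A'.lhata - A.lhata - B.lhata) =
      2 * ε * ((∑ l ∈ Icc (-n : ℤ) n, ∑ j ∈ Icc (-n : ℤ) n,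
          if l < j then (t l : ℤ) * A.a h j else 0) -
        ∑ l ∈ Icc (-n : ℤ) n, ∑ j ∈ Icc (-n : ℤ) n,
          if j < l then (t l : ℤ) * A.a (h - 1) j else 0) +
      (∑ l ∈ Icc (-n : ℤ) n, ∑ j ∈ Icc (-n : ℤ) n, (t l : ℤ) * t j *
        ((if l < j then 1 else 0) + (if j < l then 1 else 0) +
          if h = 1 ∧ 0 < l + j then 1 else 0)) -
      2 * (∑ l ∈ Icc (-n : ℤ) n, ∑ j ∈ Icc (-n : ℤ) n, (t l : ℤ) * A.a k j) -
      (if h = 1 ∧ 0 < m then (b : ℤ) ^ 2 else 0) - 3 * (A'.lhatc - A.lhatc - B.lhatc) := by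
  have e1 : (∑ l ∈ Icc (-n : ℤ) n, ∑ j ∈ Icc (-n : ℤ) n, (t l : ℤ) * A.a k j) =
      b * B.co.val k := by
    rw [← sum_mul_sum, hBA]
    have h1 : ∑ l ∈ Icc (-n : ℤ) n, (t l : ℤ) = b := by exact_mod_cast (mem_finsuppAntidiag.1 ht).1
    rw [h1, ← Nat.cast_sum]
    rfl
  have h1 := A'.lhata_eq
  have h2 := A.lhata_eq
  have h3 := B.lhata_eq
  rw [step_eq hA', pairing_add, hs.sq, pairing_comm (X := fun i j => (A.a i j : ℤ)) A.symm_int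
    (stepE_symm n h t), pairing_stepE hs.one_le hs.le t A.symm_int,
    pairing_stepE_self hs.one_le hs.le, ← step_eq hA'] at h1
  rw [hs.pairing_left hB] at h3
  rw [A'.lhatc_eq, A.lhatc_eq, B.lhatc_eq, e1]
  linarith

end

/-! ### The bar involution and integrality -/

theorem bar_qnum (k : ℕ) : bar (qnum k) * (vK ^ 2) ^ k = vK ^ 2 * qnum k := by
  have h0 := vK_sq_sub_one
  have h1 := vK_ne_zero
  have h2 : (vK⁻¹ : LaurK) ^ 2 - 1 ≠ 0 := by
    have e : (vK⁻¹ : LaurK) ^ 2 - 1 = -(vK ^ 2 - 1) / vK ^ 2 := by field_simp; ring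
    rw [e]
    exact div_ne_zero (neg_ne_zero.2 h0) (pow_ne_zero 2 h1)
  have h3 : ((vK⁻¹ : LaurK) ^ 2) ^ k * (vK ^ 2) ^ k = 1 := by
    rw [← mul_pow, ← mul_pow, inv_mul_cancel₀ h1, one_pow, one_pow]
  have h4 : (vK⁻¹ : LaurK) ^ 2 * vK ^ 2 = 1 := by
    rw [← mul_pow, inv_mul_cancel₀ h1, one_pow]
  rw [qnum_nat, map_div₀, map_sub, map_sub, map_pow, map_pow, bar_vK, map_one, div_mul_eq_mul_div,
    mul_div_assoc', div_eq_div_iff h2 h0]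
  linear_combination (vK ^ 2 - 1) * h3 - ((vK ^ 2) ^ k - 1) * h4

theorem bar_qfact (k : ℕ) : bar (qfact k) * vK ^ (k ^ 2) = vK ^ k * qfact k := by
  induction k with
  | zero => simp [qfact_zero]
  | succ k ih =>
    have h := bar_qnum (k + 1)
    have h1 := pow_ne_zero 1 vK_ne_zero
    rw [qfact_succ, map_mul]
    apply mul_right_cancel₀ h1
    calc bar (qfact k) * bar (qnum ((k + 1 : ℕ) : ℤ)) * vK ^ ((k + 1) ^ 2) * vK ^ 1
        = (bar (qfact k) * vK ^ (k ^ 2)) *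
          (bar (qnum ((k + 1 : ℕ) : ℤ)) * (vK ^ 2) ^ (k + 1)) := by ring
      _ = _ := by rw [ih, h]; ring

theorem bar_cfact (k : ℕ) :
    bar (cfact k) * (uK ^ (2 * k) * vK ^ (2 * k ^ 2)) = vK ^ (2 * k) * cfact k := by
  induction k with
  | zero => simp [cfact_zero]
  | succ k ih =>
    have h := bar_qnum (k + 1)
    have h1 := uK_ne_zero
    have h2 := vK_ne_zero
    have h3 : bar (uK ^ 2 * (vK ^ 2) ^ k + 1) * (uK ^ 2 * (vK ^ 2) ^ k) =
        uK ^ 2 * (vK ^ 2) ^ k + 1 := by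
      have e : (uK⁻¹ ^ 2 * (vK⁻¹ ^ 2) ^ k) * (uK ^ 2 * (vK ^ 2) ^ k) = 1 := by
        simp only [inv_pow]
        exact inv_mul_cancel₀ (mul_ne_zero (pow_ne_zero _ h1)
          (pow_ne_zero _ (pow_ne_zero _ h2))) ▸ by rw [mul_inv]
      rw [map_add, map_mul, map_pow, map_pow, map_pow, bar_uK, bar_vK, map_one]
      linear_combination e
    rw [cfact_succ, map_mul, map_mul]
    calc bar (cfact k) * (bar (qnum ((k + 1 : ℕ) : ℤ)) * bar (uK ^ 2 * (vK ^ 2) ^ k + 1)) *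
          (uK ^ (2 * (k + 1)) * vK ^ (2 * (k + 1) ^ 2))
        = (bar (cfact k) * (uK ^ (2 * k) * vK ^ (2 * k ^ 2))) *
          (bar (qnum ((k + 1 : ℕ) : ℤ)) * (vK ^ 2) ^ (k + 1)) *
          (bar (uK ^ 2 * (vK ^ 2) ^ k + 1) * (uK ^ 2 * (vK ^ 2) ^ k)) := by ring
      _ = _ := by rw [ih, h, h3]; ring

theorem gauss_eq_bar (a t : ℕ) : gauss a t = vK ^ (2 * (a * t)) * bar (gauss a t) := by
  have ha := qfact_ne_zero a
  have ht := qfact_ne_zero t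
  have e : gauss a t * (qfact a * qfact t) = qfact (a + t) :=
    div_mul_cancel₀ _ (mul_ne_zero ha ht)
  have e' := congrArg bar e
  rw [map_mul, map_mul] at e'
  have h0 := vK_ne_zero
  apply mul_right_cancel₀ (mul_ne_zero (mul_ne_zero ha ht) (pow_ne_zero (a + t) h0))
  calc gauss a t * (qfact a * qfact t * vK ^ (a + t))
      = vK ^ (a + t) * (gauss a t * (qfact a * qfact t)) := by ring
    _ = bar (qfact (a + t)) * vK ^ ((a + t) ^ 2) := by rw [e, ← bar_qfact]
    _ = vK ^ (2 * (a * t)) * bar (gauss a t) *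
        ((bar (qfact a) * vK ^ (a ^ 2)) * (bar (qfact t) * vK ^ (t ^ 2))) := by rw [← e']; ring
    _ = _ := by rw [bar_qfact, bar_qfact]; ring

theorem trinom_eq (a t s : ℕ) : trinom a t s = gauss a t * gauss (a + t) s := by
  have h1 := qfact_ne_zero a
  have h2 := qfact_ne_zero t
  have h3 := qfact_ne_zero s
  have h4 := qfact_ne_zero (a + t)
  rw [trinom, gauss, gauss]
  field_simp

theorem trinom_eq_bar (a t s : ℕ) :
    trinom a t s = vK ^ (2 * (a * t + a * s + t * s)) * bar (trinom a t s) := by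
  rw [trinom_eq, map_mul]
  nth_rewrite 1 [gauss_eq_bar a t, gauss_eq_bar (a + t) s]
  ring

theorem cgauss_eq_bar (a t : ℕ) : cgauss a t * vK ^ t =
    uK ^ (2 * t) * vK ^ (4 * (a * t) + t ^ 2) * bar (cgauss a t) := by
  have ha := cfact_ne_zero a
  have ht := qfact_ne_zero t
  have e : cgauss a t * (cfact a * qfact t) = cfact (a + t) :=
    div_mul_cancel₀ _ (mul_ne_zero ha ht)
  have e' := congrArg bar e
  rw [map_mul, map_mul] at e'
  have h0 := vK_ne_zero
  have h1 := uK_ne_zero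
  apply mul_right_cancel₀ (mul_ne_zero (mul_ne_zero ha ht) (pow_ne_zero (2 * a + t) h0))
  apply mul_right_cancel₀ (pow_ne_zero (2 * a) h1)
  calc cgauss a t * vK ^ t * (cfact a * qfact t * vK ^ (2 * a + t)) * uK ^ (2 * a)
      = uK ^ (2 * a) * (vK ^ (2 * (a + t)) * (cgauss a t * (cfact a * qfact t))) := by ring
    _ = uK ^ (2 * a) * (bar (cfact (a + t)) * (uK ^ (2 * (a + t)) * vK ^ (2 * (a + t) ^ 2))) := by
        rw [e, bar_cfact]
    _ = uK ^ (2 * a) * (uK ^ (2 * t) * vK ^ (4 * (a * t) + t ^ 2) * bar (cgauss a t) *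
        ((bar (cfact a) * (uK ^ (2 * a) * vK ^ (2 * a ^ 2))) *
          (bar (qfact t) * vK ^ (t ^ 2)))) := by rw [← e']; ring
    _ = _ := by rw [bar_cfact, bar_qfact]; ring

/-- The image of `𝔸` in its fraction field, as a subring. -/
noncomputable def integral : Subring LaurK := (algebraMap Laur LaurK).range

theorem uK_zpow_mem (a : ℤ) : uK ^ a ∈ integral := ⟨_, (uK_zpow a).symm⟩

theorem vK_zpow_mem (a : ℤ) : vK ^ a ∈ integral := ⟨_, (vK_zpow a).symm⟩

theorem bar_mem {x : LaurK} (hx : x ∈ integral) : bar x ∈ integral := by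
  obtain ⟨y, rfl⟩ := hx
  exact ⟨barA y, (bar_algebraMap y).symm⟩

theorem uK_mem : uK ∈ integral := ⟨_, rfl⟩

theorem vK_mem : vK ∈ integral := ⟨_, rfl⟩

theorem gauss_mem (a t : ℕ) : gauss a t ∈ integral := by
  induction a generalizing t with
  | zero => rw [gauss_zero_left]; exact integral.one_mem
  | succ a iha =>
    induction t with
    | zero => rw [gauss_zero_right]; exact integral.one_mem
    | succ t iht =>
      rw [gauss_succ_succ]
      exact integral.add_mem (iha _)
        (integral.mul_mem (pow_mem (pow_mem vK_mem _) _) iht)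

theorem trinom_mem (a t s : ℕ) : trinom a t s ∈ integral := by
  rw [trinom_eq]
  exact integral.mul_mem (gauss_mem _ _) (gauss_mem _ _)

theorem cgauss_mem (a t : ℕ) : cgauss a t ∈ integral := by
  induction a generalizing t with
  | zero =>
    induction t with
    | zero => rw [cgauss_zero_right]; exact integral.one_mem
    | succ t iht =>
      rw [cgauss_rec (by omega), if_pos rfl, zero_add, if_neg (by omega)]
      exact integral.mul_mem (integral.add_mem integral.one_mem (integral.mul_mem
        (pow_mem uK_mem _) (pow_mem (pow_mem vK_mem _) _))) iht
  | succ a iha =>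
    induction t with
    | zero => rw [cgauss_zero_right]; exact integral.one_mem
    | succ t iht =>
      rw [cgauss_rec (by omega), if_neg (by omega), if_neg (by omega)]
      exact integral.add_mem (integral.mul_mem (pow_mem (pow_mem vK_mem _) _) (iha _))
        (integral.mul_mem (integral.add_mem integral.one_mem (integral.mul_mem
          (pow_mem uK_mem _) (pow_mem (pow_mem vK_mem _) _))) iht)

/-- The generating function of the isotropic subsets in terms of the barred coefficients. -/
theorem isoGen_eq_bar (n a0 : ℕ) (a t : ℤ → ℕ) : isoGen n a0 a t =
    uK ^ (2 * (∑ k ∈ Icc (-n : ℤ) n with k < 0, (t k : ℤ)) + 2 * t 0) *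
      vK ^ (2 * (isoExp n a t : ℤ) + (4 * (a0 * t 0) + (t 0 : ℤ) ^ 2 - t 0) +
        2 * ∑ l ∈ Icc (1 : ℤ) n, ((a l : ℤ) * t l + a l * t (-l) + t l * t (-l))) *
      bar (cgauss a0 (t 0) * ∏ l ∈ Icc (1 : ℤ) n, trinom (a l) (t l) (t (-l))) := by
  have hu := uK_ne_zero
  have hv := vK_ne_zero
  have h1 : cgauss a0 (t 0) = uK ^ (2 * (t 0 : ℤ)) *
      vK ^ (4 * (a0 * t 0 : ℤ) + (t 0 : ℤ) ^ 2 - t 0) * bar (cgauss a0 (t 0)) := by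
    rw [zpow_sub₀ hv, zpow_natCast, mul_div_assoc', div_mul_eq_mul_div,
      eq_div_iff (pow_ne_zero _ hv), cgauss_eq_bar]
    norm_cast
  have h2 : ∏ l ∈ Icc (1 : ℤ) n, trinom (a l) (t l) (t (-l)) =
      vK ^ (2 * ∑ l ∈ Icc (1 : ℤ) n, ((a l : ℤ) * t l + a l * t (-l) + t l * t (-l))) *
        bar (∏ l ∈ Icc (1 : ℤ) n, trinom (a l) (t l) (t (-l))) := by
    rw [map_prod, show (2 * ∑ l ∈ Icc (1 : ℤ) n, ((a l : ℤ) * t l + a l * t (-l) + t l * t (-l))) =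
      ((∑ l ∈ Icc (1 : ℤ) n, 2 * (a l * t l + a l * t (-l) + t l * t (-l)) : ℕ) : ℤ) by
        push_cast; rw [mul_sum], zpow_natCast, ← prod_pow_eq_pow_sum, ← prod_mul_distrib]
    exact prod_congr rfl fun l _ => trinom_eq_bar _ _ _
  have h3 : (uK ^ 2) ^ (∑ k ∈ Icc (-n : ℤ) n with k < 0, t k) =
      uK ^ (2 * (∑ k ∈ Icc (-n : ℤ) n with k < 0, (t k : ℤ))) := by
    rw [← pow_mul, ← zpow_natCast]
    push_cast
    rfl
  have h4 : (vK ^ 2) ^ isoExp n a t = vK ^ (2 * (isoExp n a t : ℤ)) := by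
    rw [← pow_mul, ← zpow_natCast]
    push_cast
    rfl
  rw [isoGen, h3, h4, map_mul, zpow_add₀ hu, zpow_add₀ hv, zpow_add₀ hv]
  nth_rewrite 1 [h1, h2]
  ring

/-- Comparison of the coefficients of the basis elements `e_A` and of the standard basis. -/
theorem coeff_eq {lA lB lA' mA mB mA' p q U V : ℤ} {γ G : Laur} {P : LaurK}
    (hG : algebraMap Laur LaurK G = uK ^ p * vK ^ q * P)
    (hγ : algebraMap Laur LaurK γ = uK ^ U * vK ^ V * P)
    (hU : U = lA' - lA - lB + p) (hV : V = mA' - mA - mB + q) :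
    uv (-lB) (-mB) * uv (-lA) (-mA) * G = γ * uv (-lA') (-mA') := by
  apply IsFractionRing.injective Laur LaurK
  have hu := uK_ne_zero
  have hv := vK_ne_zero
  rw [uv_mul, map_mul, map_mul, algebraMap_uv, algebraMap_uv, hG, hγ, hU, hV]
  calc uK ^ (-lB + -lA) * vK ^ (-mB + -mA) * (uK ^ p * vK ^ q * P)
      = uK ^ (-lB + -lA + p) * vK ^ (-mB + -mA + q) * P := by
        rw [zpow_add₀ hu _ p, zpow_add₀ hv _ q]; ring
    _ = (uK ^ (lA' - lA - lB + p) * uK ^ (-lA')) * (vK ^ (mA' - mA - mB + q) * vK ^ (-mA')) * P := by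
        rw [← zpow_add₀ hu, ← zpow_add₀ hv]
        congr 3 <;> ring
    _ = _ := by ring

/-! ### Comparison of the exponents -/

/-- A quadratic form is determined by the symmetric part of its coefficients. -/
theorem sum_sum_quadratic {I : Finset ℤ} (t : ℤ → ℤ) {c c' : ℤ → ℤ → ℤ}
    (h : ∀ l ∈ I, ∀ k ∈ I, c l k + c k l = c' l k + c' k l) :
    ∑ l ∈ I, ∑ k ∈ I, t l * t k * c l k = ∑ l ∈ I, ∑ k ∈ I, t l * t k * c' l k := by
  have sw : ∀ f : ℤ → ℤ → ℤ, 2 * ∑ l ∈ I, ∑ k ∈ I, t l * t k * f l k =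
      ∑ l ∈ I, ∑ k ∈ I, t l * t k * (f l k + f k l) := fun f => by
    simp only [mul_add, sum_add_distrib, two_mul]
    congr 1
    rw [sum_comm]
    exact sum_congr rfl fun l _ => sum_congr rfl fun k _ => by ring
  have := (sw c).trans ((sum_congr rfl fun l hl => sum_congr rfl fun k hk => by
    rw [h l hl k hk]).trans (sw c').symm)
  omega

theorem sum_filter_eq_sum_sum {I : Finset ℤ} (p : ℤ → Prop) [DecidablePred p] (f : ℤ → ℤ)
    (g : ℤ → ℤ) (hg : ∀ l ∈ I, g l ∈ I) (t : ℤ → ℤ) :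
    ∑ l ∈ I with p l, f l * t (g l) =
      ∑ l ∈ I, ∑ k ∈ I, f l * t k * if k = g l ∧ p l then 1 else 0 := by
  rw [sum_filter]
  refine sum_congr rfl fun l hl => ?_
  split_ifs with h
  · simp [h, hg l hl]
  · simp [h]

theorem two_mul_sum_half {I : Finset ℤ} (t : ℤ → ℤ) {r : ℤ} (hr : Odd r) (p : ℤ → Prop)
    [DecidablePred p] : 2 * ∑ l ∈ I with p l, t l * (t l + r) / 2 =
      (∑ l ∈ I with p l, t l * t l) + r * ∑ l ∈ I with p l, t l := by
  rw [mul_sum, mul_sum, ← sum_add_distrib]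
  refine sum_congr rfl fun l _ => ?_
  have : Even (t l * (t l + r)) := by
    rcases Int.even_or_odd (t l) with h | h
    · exact h.mul_right _
    · exact (h.add_odd hr).mul_left _
  rw [Int.mul_ediv_cancel' this.two_dvd]
  ring

theorem sum_sum_sub_mul {I : Finset ℤ} (a t : ℤ → ℤ) (p : ℤ → ℤ → Prop) [DecidableRel p] :
    ∑ l ∈ I, ∑ k ∈ I with p l k, t l * (a k - t k) =
      (∑ l ∈ I, ∑ k ∈ I with p l k, t l * a k) - ∑ l ∈ I, ∑ k ∈ I with p l k, t l * t k := by
  simp only [mul_sub, sum_sub_distrib]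

theorem sum_sum_filter_eq {I : Finset ℤ} (a t : ℤ → ℤ) (p : ℤ → ℤ → Prop) [DecidableRel p] :
    ∑ l ∈ I, ∑ k ∈ I with p l k, t l * a k =
      ∑ l ∈ I, ∑ k ∈ I, t l * a k * if p l k then 1 else 0 := by
  simp only [sum_filter, mul_ite, mul_one, mul_zero]

section

variable {n d : ℕ} {A A' B : Xi n d} {h : ℤ} {b : ℕ} {t : ℤ →₀ ℕ}

/-- The exponent `β` is the difference of the exponents of the basis elements plus the exponent of
`v` in the generating function `gen_lt`, after the binomial coefficients are barred. -/
theorem beta_eq (hs : IsStep n h 1 h (h - 1))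
    (hB : IsDiag fun i j => (B.a i j : ℤ) - b * Eth h (h - 1) i j) (hBA : B.co = A.ro)
    (ht : t ∈ (Icc (-n : ℤ) n).finsuppAntidiag b)
    (hA' : ∀ i j, (A'.a i j : ℤ) = A.a i j + 1 * (rowE n h t i j - rowE n (h - 1) t i j)) :
    A.beta h t = A'.lhata - A.lhata - B.lhata +
      (2 * (∑ j ∈ Icc (-n : ℤ) n, ∑ k ∈ Icc (-n : ℤ) n with k < j, (t j : ℤ) * A.a h k) +
        2 * ∑ j ∈ Icc (-n : ℤ) n, (A.a h j : ℤ) * t j) := by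
  have h1 := hs.lhata_sub hB hBA ht hA'
  rw [hs.lhatc_sub hB hA', if_neg (show ¬ (h = 1 ∧ 0 < h - 1) by omega),
    if_neg (show ¬ (h = 1 ∧ 0 < h - 1) by omega)] at h1
  simp only [Xi.beta]
  set I := Icc (-n : ℤ) n
  have e1 : ∑ j ∈ I, (A.a h j : ℤ) * t j =
      ∑ l ∈ I, ∑ k ∈ I, (t l : ℤ) * A.a h k * if k = l then 1 else 0 := by
    refine sum_congr rfl fun l hl => ?_
    simp [hl, mul_comm]
  have L : 2 * (∑ l ∈ I, ∑ k ∈ I with k ≤ l, (t l : ℤ) * A.a h k) =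
      2 * (∑ l ∈ I, ∑ k ∈ I, if l < k then (t l : ℤ) * A.a h k else 0) -
      2 * (∑ l ∈ I, ∑ k ∈ I, (t l : ℤ) * A.a h k) +
      4 * (∑ j ∈ I, ∑ k ∈ I with k < j, (t j : ℤ) * A.a h k) +
      4 * ∑ j ∈ I, (A.a h j : ℤ) * t j := by
    rw [e1]
    simp only [sum_filter, mul_sum, ← sum_sub_distrib, ← sum_add_distrib]
    refine sum_congr rfl fun l _ => sum_congr rfl fun k _ => ?_
    split_ifs <;> omega
  have L' : (∑ l ∈ I, ∑ k ∈ I with k < l, (t l : ℤ) * A.a (h - 1) k) =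
      ∑ l ∈ I, ∑ k ∈ I, if k < l then (t l : ℤ) * A.a (h - 1) k else 0 := by
    simp only [sum_filter]
  have Q : 2 * (∑ l ∈ I, ∑ k ∈ I with k < l, (t l : ℤ) * t k) + (if h = 1 then
        2 * (∑ l ∈ I, ∑ k ∈ I with -l < k ∧ k < l, (t l : ℤ) * t k) +
          ∑ l ∈ I with 0 < l, (t l : ℤ) * t l else 0) =
      ∑ l ∈ I, ∑ j ∈ I, (t l : ℤ) * t j *
        ((if l < j then 1 else 0) + (if j < l then 1 else 0) + if h = 1 ∧ 0 < l + j then 1 else 0) := by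
    have e2 := sum_filter_eq_sum_sum (I := I) (fun l => 0 < l) (fun l => (t l : ℤ)) id
      (fun l hl => hl) fun l => (t l : ℤ)
    simp only [id] at e2
    rw [e2, sum_sum_filter_eq (fun l => (t l : ℤ)) fun l => (t l : ℤ),
      sum_sum_filter_eq (fun l => (t l : ℤ)) fun l => (t l : ℤ)]
    have e3 : ∀ X : ℤ, (if h = 1 then X else 0) = (if h = 1 then 1 else 0) * X := fun X => by
      split_ifs <;> ring
    rw [e3]
    trans ∑ l ∈ I, ∑ k ∈ I, (t l : ℤ) * t k * (2 * (if k < l then 1 else 0) +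
      (if h = 1 then 1 else 0) * (2 * (if -l < k ∧ k < l then 1 else 0) +
        if k = l ∧ 0 < l then 1 else 0))
    · simp only [mul_sum, ← sum_add_distrib]
      exact sum_congr rfl fun l _ => sum_congr rfl fun k _ => by ring
    · refine sum_sum_quadratic _ fun l _ k _ => ?_
      split_ifs <;> omega
  have H := two_mul_sum_half (I := I) (fun l => (t l : ℤ)) (r := 3) (by decide) fun l => 0 < l
  rw [sum_sum_sub_mul (fun k => (A.a (h - 1) k : ℤ)) fun k => (t k : ℤ)]
  clear_value I
  split_ifs at h1 Q ⊢ <;> linarith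

/-- The exponent `β'`, in the same way, from the generating function `gen_gt`. -/
theorem beta'_eq (hs : IsStep n h (-1) (h - 1) h)
    (hB : IsDiag fun i j => (B.a i j : ℤ) - b * Eth (h - 1) h i j) (hBA : B.co = A.ro)
    (ht : t ∈ (Icc (-n : ℤ) n).finsuppAntidiag b)
    (hA' : ∀ i j, (A'.a i j : ℤ) = A.a i j + -1 * (rowE n h t i j - rowE n (h - 1) t i j))
    (h1 : h ≠ 1) :
    A.beta' h t = A'.lhata - A.lhata - B.lhata +
      (2 * (∑ j ∈ Icc (-n : ℤ) n, ∑ k ∈ Icc (-n : ℤ) n with k < j, (A.a (h - 1) j : ℤ) * t k) +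
        2 * ∑ j ∈ Icc (-n : ℤ) n, (A.a (h - 1) j : ℤ) * t j) := by
  have e0 := hs.lhata_sub hB hBA ht hA'
  rw [hs.lhatc_sub hB hA'] at e0
  simp only [h1, false_and, if_false, sub_zero, mul_zero] at e0
  simp only [Xi.beta']
  set I := Icc (-n : ℤ) n
  have e1 : ∑ j ∈ I, (A.a (h - 1) j : ℤ) * t j =
      ∑ l ∈ I, ∑ k ∈ I, (t l : ℤ) * A.a (h - 1) k * if k = l then 1 else 0 := by
    refine sum_congr rfl fun l hl => ?_
    simp [hl, mul_comm]
  have e2 : (∑ j ∈ I, ∑ k ∈ I with k < j, (A.a (h - 1) j : ℤ) * t k) =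
      ∑ l ∈ I, ∑ k ∈ I, if l < k then (t l : ℤ) * A.a (h - 1) k else 0 := by
    simp only [sum_filter]
    rw [sum_comm]
    exact sum_congr rfl fun l _ => sum_congr rfl fun k _ => by rw [mul_comm]
  have L : 2 * (∑ l ∈ I, ∑ k ∈ I with l ≤ k, (t l : ℤ) * A.a (h - 1) k) =
      2 * (∑ l ∈ I, ∑ k ∈ I, if k < l then (t l : ℤ) * A.a (h - 1) k else 0) -
      2 * (∑ l ∈ I, ∑ k ∈ I, (t l : ℤ) * A.a (h - 1) k) +
      4 * (∑ j ∈ I, ∑ k ∈ I with k < j, (A.a (h - 1) j : ℤ) * t k) +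
      4 * ∑ j ∈ I, (A.a (h - 1) j : ℤ) * t j := by
    rw [e1, e2]
    simp only [sum_filter, mul_sum, ← sum_sub_distrib, ← sum_add_distrib]
    refine sum_congr rfl fun l _ => sum_congr rfl fun k _ => ?_
    split_ifs <;> omega
  have L' : (∑ l ∈ I, ∑ k ∈ I with l < k, (t l : ℤ) * A.a h k) =
      ∑ l ∈ I, ∑ k ∈ I, if l < k then (t l : ℤ) * A.a h k else 0 := by
    simp only [sum_filter]
  have Q : 2 * (∑ l ∈ I, ∑ k ∈ I with l < k, (t l : ℤ) * t k) =
      ∑ l ∈ I, ∑ j ∈ I, (t l : ℤ) * t j *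
        ((if l < j then 1 else 0) + (if j < l then 1 else 0) + 0) := by
    rw [sum_sum_filter_eq (fun l => (t l : ℤ)) fun l => (t l : ℤ)]
    trans ∑ l ∈ I, ∑ k ∈ I, (t l : ℤ) * t k * (2 * (if l < k then 1 else 0))
    · simp only [mul_sum]
      exact sum_congr rfl fun l _ => sum_congr rfl fun k _ => by ring
    · refine sum_sum_quadratic _ fun l _ k _ => ?_
      split_ifs <;> omega
  rw [sum_sum_sub_mul (fun k => (A.a h k : ℤ)) fun k => (t k : ℤ)]
  clear_value I
  linarith

theorem two_mul_cast_choose_two (k : ℕ) : 2 * ((k.choose 2 : ℕ) : ℤ) = k * k - k := by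
  induction k with
  | zero => simp
  | succ k ih =>
    rw [Nat.choose_succ_succ' k 1, Nat.choose_one_right]
    push_cast at ih ⊢
    linarith

theorem sum_Icc_one_eq_filter (n : ℕ) (f : ℤ → ℤ) :
    ∑ l ∈ Icc (1 : ℤ) n, f l = ∑ l ∈ Icc (-n : ℤ) n with 0 < l, f l :=
  sum_congr (by ext l; simp only [mem_Icc, mem_filter]; omega) fun _ _ => rfl

theorem sum_eq_add_sum_Icc_one (n : ℕ) (f : ℤ → ℤ) :
    ∑ l ∈ Icc (-n : ℤ) n, f l = f 0 + ∑ l ∈ Icc (1 : ℤ) n, (f l + f (-l)) := by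
  have e : Icc (-n : ℤ) n = insert 0 (Icc (1 : ℤ) n ∪ (Icc (1 : ℤ) n).image Neg.neg) := by
    ext x
    simp only [mem_Icc, mem_insert, mem_union, mem_image]
    constructor
    · intro h
      rcases lt_trichotomy x 0 with h' | h' | h'
      · exact Or.inr (Or.inr ⟨-x, by omega, by omega⟩)
      · exact Or.inl h'
      · exact Or.inr (Or.inl (by omega))
    · rintro (h | h | ⟨y, h, rfl⟩) <;> omega
  rw [e, sum_insert, sum_union, sum_image neg_injective.injOn, sum_add_distrib]
  · rw [disjoint_left]
    intro x hx hx'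
    simp at hx hx'
    omega
  · simp

theorem sum_filter_nonpos (n : ℕ) (t : ℤ →₀ ℕ) :
    (∑ l ∈ Icc (-n : ℤ) n with l ≤ 0, (t l : ℤ)) =
      (∑ l ∈ Icc (-n : ℤ) n with l < 0, (t l : ℤ)) + t 0 := by
  have : ∑ l ∈ Icc (-n : ℤ) n, (if l = 0 then (t l : ℤ) else 0) = t 0 := by
    rw [sum_ite_eq' _ _ _, if_pos (by simp)]
  rw [← this, sum_filter, sum_filter, ← sum_add_distrib]
  exact sum_congr rfl fun l _ => by split_ifs <;> omega

theorem sum_filter_pos (ht : t ∈ (Icc (-n : ℤ) n).finsuppAntidiag b) :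
    (b : ℤ) = (∑ l ∈ Icc (-n : ℤ) n with l ≤ 0, (t l : ℤ)) +
      ∑ l ∈ Icc (-n : ℤ) n with 0 < l, (t l : ℤ) := by
  have hb : ∑ l ∈ Icc (-n : ℤ) n, (t l : ℤ) = b := by
    exact_mod_cast (mem_finsuppAntidiag.1 ht).1
  rw [← hb, sum_filter, sum_filter, ← sum_add_distrib]
  exact sum_congr rfl fun l _ => by split_ifs <;> omega

/-- The symmetrized coefficients of `t_l t_k` in the identity for the exponent `β''`. -/
theorem isotropic_coeff_symm (l k : ℤ) : (2 * (if l < k then 1 else 0) + 2 * (if l < k ∧ k ≤ -l then 1 else 0) +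
        if k = l ∧ l ≤ 0 then 1 else 0) + (2 * (if k < l then 1 else 0) + 2 * (if k < l ∧ l ≤ -k then 1 else 0) +
        if l = k ∧ k ≤ 0 then 1 else 0) = (((if l < k then 1 else 0) + (if k < l then 1 else 0) +
        if 0 < l + k then 1 else 0) - 1 + 4 * (if l < k ∧ l + k < 0 then 1 else 0) +
        2 * (if k = l ∧ l < 0 then 1 else 0) + 2 * (if k = l ∧ l = 0 then 1 else 0) +
        4 * if k = -l ∧ 0 < l then 1 else 0 : ℤ) + (((if k < l then 1 else 0) + (if l < k then 1 else 0) +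
        if 0 < k + l then 1 else 0) - 1 + 4 * (if k < l ∧ k + l < 0 then 1 else 0) +
        2 * (if l = k ∧ k < 0 then 1 else 0) + 2 * (if l = k ∧ k = 0 then 1 else 0) +
        4 * if l = -k ∧ 0 < k then 1 else 0) := by
  rcases lt_trichotomy l k with h | h | h <;> rcases lt_trichotomy (l + k) 0 with h' | h' | h' <;>
  · repeat first | rw [if_pos (by omega)] | rw [if_neg (by omega)]
    norm_num

/-- The exponent `β''`, in the same way, from `isoGen`. -/
theorem beta''_eq (hs : IsStep n 1 (-1) 0 1)
    (hB : IsDiag fun i j => (B.a i j : ℤ) - b * Eth 0 1 i j) (hBA : B.co = A.ro)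
    (ht : t ∈ (Icc (-n : ℤ) n).finsuppAntidiag b)
    (hA' : ∀ i j, (A'.a i j : ℤ) = A.a i j + -1 * (rowE n 1 t i j - rowE n (1 - 1) t i j))
    {a : ℤ → ℕ} {a0 : ℕ} (ha : ∀ j, A.a 0 j = a j + if j = 0 then 1 else 0)
    (has : ∀ j, a (-j) = a j) (ha0 : a 0 = 2 * a0) :
    A.beta'' t = A'.lhata - A.lhata - B.lhata +
      (2 * (isoExp n a t : ℤ) + (4 * (a0 * t 0) + (t 0 : ℤ) ^ 2 - t 0) +
        2 * ∑ l ∈ Icc (1 : ℤ) n, ((a l : ℤ) * t l + a l * t (-l) + t l * t (-l))) := by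
  have e0 := hs.lhata_sub hB hBA ht hA'
  rw [hs.lhatc_sub hB hA'] at e0
  have hb : ∑ l ∈ Icc (-n : ℤ) n, (t l : ℤ) = b := by
    exact_mod_cast (mem_finsuppAntidiag.1 ht).1
  have h0 : (0 : ℤ) ∈ Icc (-n : ℤ) n := by simp
  have hneg : ∀ l ∈ Icc (-n : ℤ) n, -l ∈ Icc (-n : ℤ) n := fun l hl => by
    rw [mem_Icc] at *; omega
  have ha' : ∀ j, (A.a 0 j : ℤ) = a j + if j = 0 then 1 else 0 := fun j => by
    rw [ha]; push_cast; rfl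
  -- the terms with both `a` and `t` on the diagonal
  have e1 : 4 * (∑ l ∈ Icc (-n : ℤ) n, ∑ k ∈ Icc (-n : ℤ) n,
      (t l : ℤ) * a k * if k = l then 1 else 0) =
      8 * (a0 * t 0) + 4 * ∑ l ∈ Icc (1 : ℤ) n, ((a l : ℤ) * t l + a l * t (-l)) := by
    have : (∑ l ∈ Icc (-n : ℤ) n, ∑ k ∈ Icc (-n : ℤ) n,
      (t l : ℤ) * a k * if k = l then 1 else 0) = ∑ l ∈ Icc (-n : ℤ) n, (t l : ℤ) * a l := by
      refine sum_congr rfl fun l hl => ?_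
      rw [sum_eq_single_of_mem l hl fun k _ hk => by rw [if_neg hk, mul_zero], if_pos rfl, mul_one]
    rw [this, sum_eq_add_sum_Icc_one, ha0, mul_add]
    congr 1
    · push_cast; ring
    · congr 1
      exact sum_congr rfl fun l _ => by rw [has]; ring
  have e2 : ∑ l ∈ Icc (1 : ℤ) n, (t l : ℤ) * t (-l) = ∑ l ∈ Icc (-n : ℤ) n,
      ∑ k ∈ Icc (-n : ℤ) n, (t l : ℤ) * t k * if k = -l ∧ 0 < l then 1 else 0 := by
    rw [sum_Icc_one_eq_filter]
    exact sum_filter_eq_sum_sum (fun l => 0 < l) (fun l => (t l : ℤ)) Neg.neg hneg fun l => (t l : ℤ)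
  have e3 : (t 0 : ℤ) ^ 2 = ∑ l ∈ Icc (-n : ℤ) n,
      ∑ k ∈ Icc (-n : ℤ) n, (t l : ℤ) * t k * if k = l ∧ l = 0 then 1 else 0 := by
    have := sum_filter_eq_sum_sum (I := Icc (-n : ℤ) n) (fun l => l = 0) (fun l => (t l : ℤ)) id
      (fun _ hl => hl) fun l => (t l : ℤ)
    simp only [id] at this
    rw [← this, sum_filter, sum_ite_eq' _ _ _, if_pos h0, sq]
  have e4 : ∑ l ∈ Icc (-n : ℤ) n with l ≤ 0, (t l : ℤ) * t l = ∑ l ∈ Icc (-n : ℤ) n,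
      ∑ k ∈ Icc (-n : ℤ) n, (t l : ℤ) * t k * if k = l ∧ l ≤ 0 then 1 else 0 :=
    sum_filter_eq_sum_sum (fun l => l ≤ 0) (fun l => (t l : ℤ)) id (fun _ hl => hl)
      fun l => (t l : ℤ)
  have e5 : ∑ l ∈ Icc (-n : ℤ) n with l < 0, (t l : ℤ) * t l = ∑ l ∈ Icc (-n : ℤ) n,
      ∑ k ∈ Icc (-n : ℤ) n, (t l : ℤ) * t k * if k = l ∧ l < 0 then 1 else 0 :=
    sum_filter_eq_sum_sum (fun l => l < 0) (fun l => (t l : ℤ)) id (fun _ hl => hl)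
      fun l => (t l : ℤ)
  have e6 : (b : ℤ) ^ 2 = ∑ l ∈ Icc (-n : ℤ) n, ∑ k ∈ Icc (-n : ℤ) n, (t l : ℤ) * t k := by
    rw [← sum_mul_sum, hb, sq]
  have e7 : 2 * (isoExp n a t : ℤ) =
      2 * (∑ l ∈ Icc (-n : ℤ) n, ∑ k ∈ Icc (-n : ℤ) n,
        (t l : ℤ) * a k * if l < k then 1 else 0) +
      2 * (∑ l ∈ Icc (-n : ℤ) n, ∑ k ∈ Icc (-n : ℤ) n,
        (t l : ℤ) * t k * if l < k ∧ l + k < 0 then 1 else 0) +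
      ((∑ l ∈ Icc (-n : ℤ) n with l < 0, (t l : ℤ) * t l) -
        ∑ l ∈ Icc (-n : ℤ) n with l < 0, (t l : ℤ)) := by
    rw [isoExp]
    push_cast
    rw [sum_sum_filter_eq (fun k => (a k : ℤ)) fun k => (t k : ℤ),
      sum_sum_filter_eq (fun k => (t k : ℤ)) fun k => (t k : ℤ), mul_add, mul_add,
      ← sum_sub_distrib]
    congr 1
    rw [mul_sum]
    simp only [two_mul_cast_choose_two]
  have e8 := sum_filter_nonpos n t
  have e9 := sum_filter_pos ht
  have H := two_mul_sum_half (I := Icc (-n : ℤ) n) (fun l => (t l : ℤ)) (r := -3) (by decide)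
    fun l => l ≤ 0
  -- the terms that involve the row `0` of `A`
  have L : 2 * (∑ l ∈ Icc (-n : ℤ) n, ∑ k ∈ Icc (-n : ℤ) n with l ≤ k, (t l : ℤ) * A.a 0 k) =
      2 * (∑ l ∈ Icc (-n : ℤ) n, ∑ k ∈ Icc (-n : ℤ) n,
        if k < l then (t l : ℤ) * A.a 0 k else 0) -
      2 * (∑ l ∈ Icc (-n : ℤ) n, ∑ k ∈ Icc (-n : ℤ) n, (t l : ℤ) * A.a 0 k) +
      4 * (∑ l ∈ Icc (-n : ℤ) n, ∑ k ∈ Icc (-n : ℤ) n,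
        (t l : ℤ) * a k * if l < k then 1 else 0) +
      4 * (∑ l ∈ Icc (-n : ℤ) n, ∑ k ∈ Icc (-n : ℤ) n,
        (t l : ℤ) * a k * if k = l then 1 else 0) +
      4 * ∑ l ∈ Icc (-n : ℤ) n with l ≤ 0, (t l : ℤ) := by
    have : ∑ l ∈ Icc (-n : ℤ) n with l ≤ 0, (t l : ℤ) = ∑ l ∈ Icc (-n : ℤ) n,
        ∑ k ∈ Icc (-n : ℤ) n, if k = 0 then (if l ≤ 0 then (t l : ℤ) else 0) else 0 := by
      rw [sum_filter]
      exact sum_congr rfl fun l _ => by rw [sum_ite_eq' _ _ _, if_pos h0]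
    rw [this]
    simp only [ha', sum_filter, mul_sum, ← sum_sub_distrib, ← sum_add_distrib]
    refine sum_congr rfl fun l _ => sum_congr rfl fun k _ => ?_
    split_ifs <;> first | omega | ring
  have L' : (∑ l ∈ Icc (-n : ℤ) n, ∑ k ∈ Icc (-n : ℤ) n with l < k, (t l : ℤ) * A.a 1 k) =
      ∑ l ∈ Icc (-n : ℤ) n, ∑ k ∈ Icc (-n : ℤ) n,
        if l < k then (t l : ℤ) * A.a 1 k else 0 := by
    simp only [sum_filter]
  have Q : 2 * (∑ l ∈ Icc (-n : ℤ) n, ∑ k ∈ Icc (-n : ℤ) n,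
        (t l : ℤ) * t k * if l < k then 1 else 0) +
      2 * (∑ l ∈ Icc (-n : ℤ) n, ∑ k ∈ Icc (-n : ℤ) n,
        (t l : ℤ) * t k * if l < k ∧ k ≤ -l then 1 else 0) +
      (∑ l ∈ Icc (-n : ℤ) n, ∑ k ∈ Icc (-n : ℤ) n,
        (t l : ℤ) * t k * if k = l ∧ l ≤ 0 then 1 else 0) =
      (∑ l ∈ Icc (-n : ℤ) n, ∑ j ∈ Icc (-n : ℤ) n, (t l : ℤ) * t j *
        ((if l < j then 1 else 0) + (if j < l then 1 else 0) + if 0 < l + j then 1 else 0)) -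
      (∑ l ∈ Icc (-n : ℤ) n, ∑ k ∈ Icc (-n : ℤ) n, (t l : ℤ) * t k) +
      4 * (∑ l ∈ Icc (-n : ℤ) n, ∑ k ∈ Icc (-n : ℤ) n,
        (t l : ℤ) * t k * if l < k ∧ l + k < 0 then 1 else 0) +
      2 * (∑ l ∈ Icc (-n : ℤ) n, ∑ k ∈ Icc (-n : ℤ) n,
        (t l : ℤ) * t k * if k = l ∧ l < 0 then 1 else 0) +
      2 * (∑ l ∈ Icc (-n : ℤ) n, ∑ k ∈ Icc (-n : ℤ) n,
        (t l : ℤ) * t k * if k = l ∧ l = 0 then 1 else 0) +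
      4 * ∑ l ∈ Icc (-n : ℤ) n, ∑ k ∈ Icc (-n : ℤ) n,
        (t l : ℤ) * t k * if k = -l ∧ 0 < l then 1 else 0 := by
    have key := sum_sum_quadratic (I := Icc (-n : ℤ) n) (fun l => (t l : ℤ))
      (c := fun l k => 2 * (if l < k then 1 else 0) + 2 * (if l < k ∧ k ≤ -l then 1 else 0) +
        if k = l ∧ l ≤ 0 then 1 else 0)
      (c' := fun l k => ((if l < k then 1 else 0) + (if k < l then 1 else 0) +
        if 0 < l + k then 1 else 0) - 1 + 4 * (if l < k ∧ l + k < 0 then 1 else 0) +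
        2 * (if k = l ∧ l < 0 then 1 else 0) + 2 * (if k = l ∧ l = 0 then 1 else 0) +
        4 * if k = -l ∧ 0 < l then 1 else 0)
      fun l _ k _ => isotropic_coeff_symm l k
    trans
    · refine Eq.trans ?_ key
      simp only [mul_sum, ← sum_add_distrib]
      exact sum_congr rfl fun l _ => sum_congr rfl fun k _ => by ring
    · simp only [mul_sum, ← sum_add_distrib, ← sum_sub_distrib]
      exact sum_congr rfl fun l _ => sum_congr rfl fun k _ => by ring
  simp only [true_and, zero_lt_one, and_true, if_true, sub_self] at e0
  simp only [Xi.beta'']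
  rw [sum_sum_sub_mul (fun k => (A.a 1 k : ℤ)) fun k => (t k : ℤ),
    sum_sum_filter_eq (fun k => (t k : ℤ)) fun k => (t k : ℤ),
    sum_sum_filter_eq (fun k => (t k : ℤ)) fun k => (t k : ℤ)]
  have H' : 2 * ∑ l ∈ Icc (-n : ℤ) n with l ≤ 0, (t l : ℤ) * ((t l : ℤ) - 3) / 2 =
      (∑ l ∈ Icc (-n : ℤ) n with l ≤ 0, (t l : ℤ) * t l) +
        -3 * ∑ l ∈ Icc (-n : ℤ) n with l ≤ 0, (t l : ℤ) := H
  rw [sum_add_distrib (f := fun l => (a l : ℤ) * t l + a l * t (-l))]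
  linarith

end

/-! ### The multiplication formulas -/

theorem prod_gauss_eq_bar {I : Finset ℤ} (E : ℕ) (a t : ℤ → ℕ) :
    (vK ^ 2) ^ E * ∏ j ∈ I, gauss (a j) (t j) =
      uK ^ (0 : ℤ) * vK ^ (2 * (E : ℤ) + 2 * ∑ j ∈ I, (a j : ℤ) * t j) *
        ∏ j ∈ I, bar (qbinom ((a j : ℤ) + t j) (t j)) := by
  have h1 : ∏ j ∈ I, gauss (a j) (t j) = vK ^ (2 * ∑ j ∈ I, (a j : ℤ) * t j) *
      ∏ j ∈ I, bar (qbinom ((a j : ℤ) + t j) (t j)) := by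
    rw [show (2 * ∑ j ∈ I, (a j : ℤ) * t j) = ((∑ j ∈ I, 2 * (a j * t j) : ℕ) : ℤ) by
      push_cast; rw [mul_sum], zpow_natCast, ← prod_pow_eq_pow_sum, ← prod_mul_distrib]
    exact prod_congr rfl fun j _ => by rw [qbinom_eq, ← gauss_eq_bar]
  have h2 : (vK ^ 2) ^ E = vK ^ (2 * (E : ℤ)) := by
    rw [← pow_mul, ← zpow_natCast]
    push_cast
    rfl
  rw [h1, h2, zpow_add₀ vK_ne_zero, zpow_zero, one_mul, mul_assoc]

theorem prod_bar_qbinom_mem {I : Finset ℤ} (a t : ℤ → ℕ) :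
    ∏ j ∈ I, bar (qbinom ((a j : ℤ) + t j) (t j)) ∈ integral :=
  prod_mem fun j _ => by rw [qbinom_eq]; exact bar_mem (gauss_mem _ _)

section

variable {n d : ℕ} {A B : Xi n d} {h : ℤ} {b : ℕ}

theorem Xi.check_apply (h1 : 1 ≤ h) (hn : h ≤ n) (t : A.checkSet h b) (i j : ℤ) :
    ((A.check h1 hn t).a i j : ℤ) =
      A.a i j + 1 * (rowE n h t.1 i j - rowE n (h - 1) t.1 i j) := by
  have := Int.toNat_of_nonneg (A.check_nonneg h1 t.2 i j)
  change (((_ : ℤ).toNat : ℕ) : ℤ) = _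
  rw [this]
  ring

theorem Xi.hat_apply (h1 : 1 ≤ h) (hn : h ≤ n) (t : A.hatSet h b) (i j : ℤ) :
    ((A.hat h1 hn t).a i j : ℤ) =
      A.a i j + -1 * (rowE n h t.1 i j - rowE n (h - 1) t.1 i j) := by
  have := Int.toNat_of_nonneg (A.hat_nonneg h1 t.2 i j)
  change (((_ : ℤ).toNat : ℕ) : ℤ) = _
  rw [this]
  ring

theorem Xi.mem_checkSet_iff (h1 : 1 ≤ h) (t : ℤ →₀ ℕ) :
    t ∈ A.checkSet h b ↔ t ∈ (Icc (-n : ℤ) n).finsuppAntidiag b ∧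
      ∀ i j, 0 ≤ (A.a i j : ℤ) + 1 * (rowE n h t i j - rowE n (h - 1) t i j) := by
  refine ⟨fun ht => ⟨(mem_filter.1 ht).1, fun i j => ?_⟩, fun ht => mem_filter.2 ⟨ht.1, ?_⟩⟩
  · have := A.check_nonneg h1 ht i j
    linarith
  · intro j hj
    have := ht.2 (h - 1) j
    rw [rowE_eq, rowE_eq, if_pos hj, if_pos hj, if_neg (by omega), if_neg (by omega),
      if_pos rfl] at this
    split_ifs at this ⊢ <;> omega

theorem Xi.mem_hatSet_iff (h1 : 1 ≤ h) (t : ℤ →₀ ℕ) :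
    t ∈ A.hatSet h b ↔ t ∈ (Icc (-n : ℤ) n).finsuppAntidiag b ∧
      ∀ i j, 0 ≤ (A.a i j : ℤ) + -1 * (rowE n h t i j - rowE n (h - 1) t i j) := by
  refine ⟨fun ht => ⟨(mem_filter.1 ht).1, fun i j => ?_⟩, fun ht => mem_filter.2 ⟨ht.1, ?_⟩⟩
  · have := A.hat_nonneg h1 ht i j
    linarith
  · intro j hj
    have := ht.2 h j
    rw [rowE_eq, rowE_eq, if_pos hj, if_pos hj, if_pos rfl, if_neg (by omega), if_neg (by omega)]
      at this
    split_ifs at this <;> omega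

theorem std_mul_std_check (h1 : 1 ≤ h) (hn : h ≤ n)
    (hB : IsDiag fun i j => (B.a i j : ℤ) - b * Eth h (h - 1) i j) (hBA : B.co = A.ro) :
    ∃ γ : A.checkSet h b → Laur,
      (∀ t, algebraMap Laur LaurK (γ t) =
        uK ^ (-(if h = 1 then ∑ l ∈ Icc (-n : ℤ) n with 0 < l, (t.1 l : ℤ) else 0)) *
          vK ^ A.beta h t.1 *
          ∏ l ∈ Icc (-n : ℤ) n, bar (qbinom ((A.a h l : ℤ) + t.1 l) (t.1 l))) ∧
      B.std * A.std = ∑ t, γ t • (A.check h1 hn t).std := by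
  have hs : IsStep n h 1 h (h - 1) := ⟨h1, hn, Or.inl ⟨rfl, rfl, rfl⟩⟩
  have hint := fun t : A.checkSet h b => integral.mul_mem (integral.mul_mem (uK_zpow_mem
    (-(if h = 1 then ∑ l ∈ Icc (-n : ℤ) n with 0 < l, (t.1 l : ℤ) else 0)))
    (vK_zpow_mem (A.beta h t.1))) (prod_bar_qbinom_mem (I := Icc (-n : ℤ) n) (A.a h) t.1)
  choose γ hγ using hint
  refine ⟨γ, hγ, hs.std_mul_std hB hBA (A.check h1 hn) (Xi.check_apply h1 hn)
    (Xi.mem_checkSet_iff h1)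
    (fun S => uv 0 (2 * #{z ∈ S ×ˢ (B.ro.R h \ S) | z.2 < z.1})) γ
    (fun E hE w hw => hE.weight_lt (by omega) (by omega) hw)
    fun t x hx hk => ?_⟩
  have ht := ((Xi.mem_checkSet_iff h1 t.1).1 t.2).1
  have hA' := Xi.check_apply (A := A) h1 hn t
  have hrow : ∀ j ∈ Icc (-n : ℤ) n, kappa B.ro x A.co h j = A.a h j + t.1 j := fun j hj => by
    have := hA' h j
    rw [rowE_eq, rowE_eq, if_pos hj, if_pos hj, if_pos rfl, if_neg (by omega), if_neg (by omega),
      if_neg (by omega)] at this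
    rw [hk]
    omega
  refine coeff_eq ((gen_lt hx ht (by omega) hrow).trans (prod_gauss_eq_bar _ _ _)) (hγ t) ?_ ?_
  · rw [hs.lhatc_sub hB hA', if_neg (show ¬ (h = 1 ∧ 0 < h - 1) by omega)]
    ring
  · rw [beta_eq hs hB hBA ht hA']
    push_cast
    rfl

theorem std_mul_std_hat (h1 : 1 ≤ h) (hn : h ≤ n)
    (hB : IsDiag fun i j => (B.a i j : ℤ) - b * Eth (h - 1) h i j) (hBA : B.co = A.ro)
    (hh : h ≠ 1) :
    ∃ γ : A.hatSet h b → Laur,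
      (∀ t, algebraMap Laur LaurK (γ t) =
        vK ^ A.beta' h t.1 *
          ∏ l ∈ Icc (-n : ℤ) n, bar (qbinom ((A.a (h - 1) l : ℤ) + t.1 l) (t.1 l))) ∧
      B.std * A.std = ∑ t, γ t • (A.hat h1 hn t).std := by
  have hs : IsStep n h (-1) (h - 1) h := ⟨h1, hn, Or.inr ⟨rfl, rfl, rfl⟩⟩
  have hint := fun t : A.hatSet h b => integral.mul_mem
    (vK_zpow_mem (A.beta' h t.1)) (prod_bar_qbinom_mem (I := Icc (-n : ℤ) n) (A.a (h - 1)) t.1)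
  choose γ hγ using hint
  refine ⟨γ, hγ, hs.std_mul_std hB hBA (A.hat h1 hn) (Xi.hat_apply h1 hn)
    (Xi.mem_hatSet_iff h1)
    (fun S => uv 0 (2 * #{z ∈ S ×ˢ (B.ro.R (h - 1) \ S) | z.1 < z.2})) γ
    (fun E hE w hw => hE.weight_gt (by omega) (by omega) hw)
    fun t x hx hk => ?_⟩
  have ht := ((Xi.mem_hatSet_iff h1 t.1).1 t.2).1
  have hA' := Xi.hat_apply (A := A) h1 hn t
  have hrow : ∀ j ∈ Icc (-n : ℤ) n, kappa B.ro x A.co (h - 1) j = A.a (h - 1) j + t.1 j :=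
    fun j hj => by
      have := hA' (h - 1) j
      rw [rowE_eq, rowE_eq, if_pos hj, if_pos hj, if_pos rfl, if_neg (by omega), if_neg (by omega),
        if_neg (by omega)] at this
      rw [hk]
      omega
  refine coeff_eq (U := 0) ((gen_gt hx ht (by omega) hrow).trans (prod_gauss_eq_bar _ _ _))
    (by rw [hγ t, zpow_zero, one_mul]) ?_ ?_
  · rw [hs.lhatc_sub hB hA']
    simp [hh]
  · rw [beta'_eq hs hB hBA ht hA' hh]
    push_cast
    rfl

theorem std_mul_std_hat_one (hn : (1 : ℤ) ≤ n)
    (hB : IsDiag fun i j => (B.a i j : ℤ) - b * Eth 0 1 i j) (hBA : B.co = A.ro) :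
    ∃ γ : A.hatSet 1 b → Laur,
      (∀ t, algebraMap Laur LaurK (γ t) =
        uK ^ (∑ l ∈ Icc (-n : ℤ) n with l ≤ 0, (t.1 l : ℤ)) * vK ^ A.beta'' t.1 *
          bar (cgauss (A.nat 0 0) (t.1 0) *
            ∏ l ∈ Icc (1 : ℤ) n, trinom (A.a 0 l) (t.1 l) (t.1 (-l)))) ∧
      B.std * A.std = ∑ t, γ t • (A.hat le_rfl hn t).std := by
  have hs : IsStep n 1 (-1) 0 1 := ⟨le_rfl, hn, Or.inr ⟨rfl, rfl, rfl⟩⟩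
  have hint := fun t : A.hatSet 1 b => integral.mul_mem (integral.mul_mem
    (uK_zpow_mem (∑ l ∈ Icc (-n : ℤ) n with l ≤ 0, (t.1 l : ℤ))) (vK_zpow_mem (A.beta'' t.1)))
    (bar_mem (integral.mul_mem (cgauss_mem (A.nat 0 0) (t.1 0)) (prod_mem (t := Icc (1 : ℤ) n)
      fun l _ => trinom_mem (A.a 0 l) (t.1 l) (t.1 (-l)))))
  choose γ hγ using hint
  refine ⟨γ, hγ, hs.std_mul_std hB hBA (A.hat le_rfl hn) (Xi.hat_apply le_rfl hn)
    (Xi.mem_hatSet_iff le_rfl)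
    (fun S => uv (2 * #{p ∈ S | p < 0}) (2 * #(isoInversions (B.ro.R 0) S))) γ
    (fun E hE w hw => hE.weight_zero one_pos hw)
    fun t x hx hk => ?_⟩
  have ht := ((Xi.mem_hatSet_iff le_rfl t.1).1 t.2).1
  have hA' := Xi.hat_apply (A := A) le_rfl hn t
  -- the row `0` of `A` without the fixed point `0`
  set a : ℤ → ℕ := fun j => if j = 0 then 2 * A.nat 0 0 else A.a 0 j
  have ha : ∀ j, A.a 0 j = a j + if j = 0 then 1 else 0 := fun j => by
    by_cases hj : j = 0
    · simp only [a, hj, if_true, A.a_zero_zero]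
    · simp only [a, hj, if_false, add_zero]
  have has : ∀ j, a (-j) = a j := fun j => by
    have := A.symm 0 j
    rw [neg_zero] at this
    simp only [a, neg_eq_zero, this]
  have hrow : ∀ j ∈ Icc (-n : ℤ) n, kappa B.ro x A.co 0 j =
      a j + t.1 j + t.1 (-j) + if j = 0 then 1 else 0 := fun j hj => by
    have := hA' 0 j
    rw [rowE_eq, rowE_eq, if_pos hj, if_pos hj, if_neg (by omega), if_neg (by omega),
      if_pos (by omega), if_pos (by omega), ha] at this
    rw [hk]
    omega
  have hP : ∏ l ∈ Icc (1 : ℤ) n, trinom (a l) (t.1 l) (t.1 (-l)) =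
      ∏ l ∈ Icc (1 : ℤ) n, trinom (A.a 0 l) (t.1 l) (t.1 (-l)) := prod_congr rfl fun l hl => by
    have : l ≠ 0 := by rw [mem_Icc] at hl; omega
    simp only [a, this, if_false]
  refine coeff_eq ((gen_zero hx ht has rfl hrow).trans (isoGen_eq_bar _ _ _ _))
    ((hγ t).trans (by rw [hP])) ?_ (beta''_eq hs hB hBA ht hA' ha has rfl)
  have e1 : (∑ l ∈ Icc (-n : ℤ) n with l ≤ 0, (t.1 l : ℤ)) =
      (∑ l ∈ Icc (-n : ℤ) n with l < 0, (t.1 l : ℤ)) + t.1 0 := sum_filter_nonpos n t.1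
  have e2 := sum_filter_pos ht
  rw [hs.lhatc_sub hB hA']
  simp only [true_and, one_pos, if_true]
  linarith

end

end SchurBC

theorem theorem4p6 (n d : ℕ) (h : ℤ) (h1 : 1 ≤ h) (hn : h ≤ n) (A B C : Xi n d) (b c : ℕ) :
    (IsDiag (fun i j => (B.a i j : ℤ) - b * Eth h (h - 1) i j) → B.co = A.ro →
      ∃ γ : A.checkSet h b → Laur,
        (∀ t, algebraMap Laur LaurK (γ t) =
          uK ^ (-(if h = 1 then ∑ l ∈ Finset.Icc (-n : ℤ) n with 0 < l, (t.1 l : ℤ) else 0)) *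
            vK ^ A.beta h t.1 *
            ∏ l ∈ Finset.Icc (-n : ℤ) n, bar (qbinom ((A.a h l : ℤ) + t.1 l) (t.1 l))) ∧
        B.std * A.std = ∑ t, γ t • (A.check h1 hn t).std) ∧
    (IsDiag (fun i j => (C.a i j : ℤ) - c * Eth (h - 1) h i j) → C.co = A.ro →
      (h ≠ 1 → ∃ γ : A.hatSet h c → Laur,
        (∀ t, algebraMap Laur LaurK (γ t) =
          vK ^ A.beta' h t.1 *
            ∏ l ∈ Finset.Icc (-n : ℤ) n,
              bar (qbinom ((A.a (h - 1) l : ℤ) + t.1 l) (t.1 l))) ∧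
        C.std * A.std = ∑ t, γ t • (A.hat h1 hn t).std) ∧
      (h = 1 → ∃ γ : A.hatSet h c → Laur,
        (∀ t, algebraMap Laur LaurK (γ t) =
          uK ^ (∑ l ∈ Finset.Icc (-n : ℤ) n with l ≤ 0, (t.1 l : ℤ)) *
            vK ^ A.beta'' t.1 *
            bar (cfact (A.nat 0 0 + t.1 0) / (cfact (A.nat 0 0) * qfact (t.1 0)) *
              ∏ l ∈ Finset.Icc (1 : ℤ) n,
                qfact (A.a 0 l + t.1 l + t.1 (-l)) /
                  (qfact (A.a 0 l) * qfact (t.1 l) * qfact (t.1 (-l))))) ∧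
        C.std * A.std = ∑ t, γ t • (A.hat h1 hn t).std)) := by
  refine ⟨std_mul_std_check h1 hn, fun hC hCA => ⟨std_mul_std_hat h1 hn hC hCA, ?_⟩⟩
  rintro rfl
  exact std_mul_std_hat_one hn hC hCA
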